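/- **Setting.** Let $\Sigma$ be the union of $\mathbb R_-=(-\infty,0]$, oriented towards the origin, and of finitely many distinct rays $\varpi_j=e^{i\theta_j}\mathbb R_+$, $\theta_j\in(-\pi,\pi)$, each oriented either towards infinity or towards the origin; $F_+$, $F_-$ denote the boundary values of $F$ from the left and from the right of $\Sigma$. All roots and powers are principal, $\sigma_1,\sigma_2,\sigma_3$ are the Pauli matrices, $\sigma_+=\begin{bmatrix}0&1\\0&0\end{bmatrix}$, $\sigma_-=\sigma_+^{\mathrm T}$. For $\mathbf t$ in an open set $T\subset\mathbb C^d$ let $M(\lambda;\mathbf t)$, $\lambda\in\Sigma\setminus\{0\}$, be equal to $i\sigma_2$ on $\mathbb R_-$ and to $\mathbf 1+f_j(\lambda;\mathbf t)\sigma_+$ or $\mathbf 1+f_j(\lambda;\mathbf t)\sigma_-$ on $\varpi_j$ (the choice depends only on $j$). Locally in $\mathbf t$ and for $\lambda$ in an open sector around $\varpi_j$ (not meeting $\mathbb R_-$), $f_j$ is assumed to be jointly holomorphic, to be $O(|\lambda|^{-N})$ at infinity for every $N$ and bounded, uniformly in $\mathbf t$, and to satisfy $|f_j(\lambda;\mathbf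 t)-c_j|\le C|\lambda|^{\alpha}$ for some $\alpha>0$ and a constant $c_j$ independent of $\mathbf t$. A *solution of the Riemann–Hilbert problem* with jump matrix $M$ is a $2\times2$ matrix $\Gamma$, analytic in $\mathbb C\setminus\Sigma$, locally bounded in $\mathbb C$, with continuous boundary values on each open ray satisfying $\Gamma_+=\Gamma_-M$, and with an asymptotic expansion in powers of $\lambda^{-1/2}$, the same in all of $\mathbb C\setminus\Sigma$, of the form $$\Gamma(\lambda)=\lambda^{-\sigma_3/4}\,\frac{\mathbf 1+i\sigma_1}{\sqrt2}\left(\mathbf 1+\frac{a}{\sqrt\lambda}\,\sigma_3+\mathcal O(\lambda^{-1})\right),\qquad \lambda\to\infty .$$ Let $\Gamma_0(\lambda;\mathbf t)$, $\mathbf t\in T$, be a family of such solutions with jump matrices $M(\lambda;\mathbf t)$ that is jointly analytic in $(\lambda,\mathbf t)$, with the local bounds and the expansion locally uniform in $\mathbf t$. Let $\vec\lambda=(\lambda_1,\dots,\lambda_{n_2})$, $\vec\mu=(\mu_1,\dots,\mu_{n_1})$ be $n=n_1+n_2$ pairwise distinct points of $\mathbb C\setminus\Sigma$, and put $$D(\lambda)=\begin{bmatrix}\prod_{j\le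 n_2}(\sqrt{\lambda_j}+\sqrt\lambda)\prod_{j\le n_1}(\sqrt{\mu_j}-\sqrt\lambda)&0\\0&\prod_{j\le n_2}(\sqrt{\lambda_j}-\sqrt\lambda)\prod_{j\le n_1}(\sqrt{\mu_j}+\sqrt\lambda)\end{bmatrix},\qquad M_n:=D_-^{-1}MD_+ .$$ Let $\Gamma_n$ solve the Riemann–Hilbert problem with jump matrix $M_n$ at the given parameters $(\mathbf t,\vec\lambda,\vec\mu)$. For any derivative $\partial$ with respect to $(\mathbf t,\vec\lambda,\vec\mu)$ at this point put $$\Omega(\partial;[M])=\int_\Sigma\mathrm{Tr}\left(\Gamma_{0-}^{-1}\Gamma_{0-}'\,\partial M\,M^{-1}\right)\frac{d\lambda}{2\pi i},\qquad \Omega(\partial;[M_n])=\int_\Sigma\mathrm{Tr}\left(\Gamma_{n-}^{-1}\Gamma_{n-}'\,\partial M_n\,M_n^{-1}\right)\frac{d\lambda}{2\pi i},$$ where $'$ is the derivative in $\lambda$ along $\Sigma$. Put $$\Delta(\vec\lambda,\vec\mu)=\frac{\prod_{j\le n_2}\lambda_j^{1/4}\prod_{j\le n_1}\mu_j^{1/4}}{\prod_{j<k\le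 n_2}(\sqrt{\lambda_j}-\sqrt{\lambda_k})\prod_{j<k\le n_1}(\sqrt{\mu_j}-\sqrt{\mu_k})\prod_{j\le n_2,\,k\le n_1}(\sqrt{\lambda_j}+\sqrt{\mu_k})},$$ $$G_\infty(\lambda)=\Gamma_0(\lambda)D(\lambda)\frac{\mathbf 1-i\sigma_1}{\sqrt2}\,\lambda^{\sigma_3/4}\begin{bmatrix}\lambda^{-\lfloor (n+1)/2\rfloor}&0\\0&\lambda^{-\lfloor n/2\rfloor}\end{bmatrix},$$ and let $\mathbb G$ be the $n\times n$ matrix with entries $$\mathbb G_{k,\ell}=\begin{cases}\displaystyle\mathop{\mathrm{res}}_{\lambda=\infty}\frac{\lambda^{\lfloor(\ell-1)/2\rfloor}\,\mathbf e_2^{\mathrm T}\Gamma_0^{-1}(\lambda_k)G_\infty(\lambda)\mathbf e_{((\ell-1)\bmod 2)+1}}{\lambda-\lambda_k},&1\le k\le n_2,\\[10pt]\displaystyle\mathop{\mathrm{res}}_{\lambda=\infty}\frac{\lambda^{\lfloor(\ell-1)/2\rfloor}\,\mathbf e_1^{\mathrm T}\Gamma_0^{-1}(\mu_{k-n_2})G_\infty(\lambda)\mathbf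 e_{((\ell-1)\bmod 2)+1}}{\lambda-\mu_{k-n_2}},&n_2<k\le n,\end{cases}$$ where $\mathop{\mathrm{res}}_{\lambda=\infty}g=-c$ if $g(\lambda)=p(\lambda)+c\lambda^{-1}+o(\lambda^{-1})$ as $\lambda\to\infty$ in $\mathbb C\setminus\Sigma$ with a polynomial $p$. **Theorem 3.1.** The residues defining $\mathbb G$ exist, both integrals $\Omega$ converge absolutely, $\Delta(\vec\lambda,\vec\mu)\det\mathbb G$ is nonzero and is differentiable in $(\mathbf t,\vec\lambda,\vec\mu)$ at the given parameters, and for every derivative $\partial$ with respect to $\mathbf t,\vec\lambda,\vec\mu$ $$\Omega(\partial;[M_n])-\Omega(\partial;[M])=\partial\ln\big(\Delta(\vec\lambda,\vec\mu)\det\mathbb G\big).$$ -/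

import Mathlib

open Filter Topology

noncomputable section

namespace Dressing

/-- Complex `2 × 2` matrices. -/
abbrev Mat : Type := Matrix (Fin 2) (Fin 2) ℂ

/-- `m` distinct open rays `e^{iθ_j} ℝ_+`, `θ_j ∈ (-π, π)`, each with an orientation: `1` for
"from the origin to infinity", `-1` for "from infinity to the origin". -/
structure RayContour (m : ℕ) where
  angle : Fin m → ℝ
  angle_mem : ∀ j, angle j ∈ Set.Ioo (-Real.pi) Real.pi
  angle_injective : Function.Injective angle
  orientation : Fin m → ℤˣ

namespace RayContour

variable {m : ℕ} (S : RayContour m)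

/-- The pieces of the contour are the rays `some j` and the negative half line `none`;
this is the angle of a piece. -/
def arg : Option (Fin m) → ℝ
  | none => Real.pi
  | some j => S.angle j

/-- Orientation of a piece; the negative half line is oriented towards the origin. -/
def sgn : Option (Fin m) → ℤˣ
  | none => -1
  | some j => S.orientation j

/-- The point at distance `r` from the origin on the piece `p`. -/
def point (p : Option (Fin m)) (r : ℝ) : ℂ :=
  (r : ℂ) * Complex.exp ((S.arg p : ℂ) * Complex.I)

/-- The contour `Σ`: the union of all the rays and of the negative half line, with the origin. -/
def carrier : Set ℂ := {z | ∃ p r, 0 ≤ r ∧ z = S.point p r}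

/-- The points off the contour that lie on one side of the line through the piece `p`: for `s = 1`
the side on the left of the ray when it is traversed from the origin outwards, for `s = -1` the
side on its right. -/
def side (p : Option (Fin m)) (s : ℤˣ) : Set ℂ :=
  {z | z ∉ S.carrier ∧
    0 < ((s : ℤ) : ℝ) * (z * Complex.exp (-((S.arg p : ℂ) * Complex.I))).im}

/-- The boundary value of `F` at the point at distance `r` on the piece `p`, from the side `s`. -/
def boundaryValue (F : ℂ → Mat) (p : Option (Fin m)) (s : ℤˣ) (r : ℝ) : Mat :=
  limUnder (𝓝[S.side p s] (S.point p r)) F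

/-- `F_+`: the boundary value from the left of the oriented contour. -/
def plus (F : ℂ → Mat) (p : Option (Fin m)) (r : ℝ) : Mat :=
  S.boundaryValue F p (S.sgn p) r

/-- `F_-`: the boundary value from the right of the oriented contour. -/
def minus (F : ℂ → Mat) (p : Option (Fin m)) (r : ℝ) : Mat :=
  S.boundaryValue F p (-S.sgn p) r

/-- The open sector of half-opening `δ` about the ray `j`, within the plane slit along the
negative half line. -/
def sector (j : Fin m) (δ : ℝ) : Set ℂ :=
  {z | z ∈ Complex.slitPlane ∧ |Complex.arg z - S.angle j| < δ}

end RayContour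

/-- The principal square root. -/
def csqrt (z : ℂ) : ℂ := z ^ (1 / 2 : ℂ)

/-- `(1 + i σ₁) / √2`. -/
def eMat : Mat := ((Real.sqrt 2 : ℝ) : ℂ)⁻¹ • !![1, Complex.I; Complex.I, 1]

/-- `(1 - i σ₁) / √2`. -/
def eMatInv : Mat := ((Real.sqrt 2 : ℝ) : ℂ)⁻¹ • !![1, -Complex.I; -Complex.I, 1]

/-- `λ^{σ₃ / 4}`, principal branch. -/
def quarterPow (z : ℂ) : Mat := !![z ^ (1 / 4 : ℂ), 0; 0, (z ^ (1 / 4 : ℂ))⁻¹]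

/-- `λ^{-σ₃ / 4}`, principal branch. -/
def quarterPowNeg (z : ℂ) : Mat := !![(z ^ (1 / 4 : ℂ))⁻¹, 0; 0, z ^ (1 / 4 : ℂ)]

/-- `σ₃`. -/
def sigma3 : Mat := !![1, 0; 0, -1]

/-- `σ_+` (if `b`) or `σ_-` (if not). -/
def nilp (b : Bool) : Mat := if b then !![0, 1; 0, 0] else !![0, 0; 1, 0]

/-- Off the contour and for `‖z‖ ≥ ρ`, the function `Γ` is
`z^{-σ₃/4} ((1 + i σ₁)/√2) (∑_{k<N} Y_k z^{-k/2} + r(z))` with a remainder `r(z)` whose entries are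
bounded by `C ‖z‖^{-N/2}`. -/
def RemainderBound {m : ℕ} (S : RayContour m) (Γ : ℂ → Mat) (Y : ℕ → Mat) (N : ℕ) (C ρ : ℝ) :
    Prop :=
  ∀ z : ℂ, z ∉ S.carrier → ρ ≤ ‖z‖ → ∀ i j : Fin 2,
    ‖((quarterPowNeg z * eMat)⁻¹ * Γ z
        - ∑ k ∈ Finset.range N, ((csqrt z)⁻¹ ^ k) • Y k) i j‖ ≤ C * ‖z‖ ^ (-(N : ℝ) / 2)

/-- `Γ` solves the Riemann-Hilbert problem on the contour `S` with jump matrices `M p r`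
(`p` a piece of the contour, `r > 0` the distance from the origin) and the normalization
`Γ = λ^{-σ₃/4} ((1 + i σ₁)/√2) (1 + a σ₃ λ^{-1/2} + O(λ^{-1}))` at infinity, where the right-hand
side begins a full asymptotic expansion in powers of `λ^{-1/2}`, the same in all sectors. -/
structure IsRHPSolution {m : ℕ} (S : RayContour m) (M : Option (Fin m) → ℝ → Mat)
    (Γ : ℂ → Mat) : Prop where
  analytic : ∀ i j, DifferentiableOn ℂ (fun z => Γ z i j) S.carrierᶜ
  locally_bounded : ∀ z₀ : ℂ, ∃ C : ℝ, ∀ᶠ z in 𝓝[S.carrierᶜ] z₀, ∀ i j, ‖Γ z i j‖ ≤ C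
  boundary_tendsto : ∀ p s, ∀ r : ℝ, 0 < r →
    Tendsto Γ (𝓝[S.side p s] (S.point p r)) (𝓝 (S.boundaryValue Γ p s r))
  boundary_continuous : ∀ p s, ContinuousOn (S.boundaryValue Γ p s) (Set.Ioi 0)
  jump : ∀ p, ∀ r : ℝ, 0 < r → S.plus Γ p r = S.minus Γ p r * M p r
  expansion : ∃ (Y : ℕ → Mat) (a : ℂ), Y 0 = 1 ∧ Y 1 = a • sigma3 ∧
    ∀ N : ℕ, ∃ C ρ : ℝ, RemainderBound S Γ Y N C ρ

/-- The jump matrices `M(λ; t)`: `i σ₂` on the negative half line, and on the ray `j` the unipotent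
matrix `1 + f_j(λ; t) σ_±`, upper triangular if `upper j` and lower triangular otherwise. -/
def jumpMatrix {m d : ℕ} (S : RayContour m) (upper : Fin m → Bool)
    (f : Fin m → (Fin d → ℂ) → ℂ → ℂ) (t : Fin d → ℂ) : Option (Fin m) → ℝ → Mat
  | none, _ => !![0, 1; -1, 0]
  | some j, r => 1 + f j t (S.point (some j) r) • nilp (upper j)

/-- Regularity of the scalar functions `f_j(λ; t)` in the jump matrices. Locally in `t ∈ T` and for
`λ` in a sector about the ray `j`, they are jointly holomorphic, decay faster than any power of `λ`
at infinity uniformly in `t`, and tend to a constant `c_j` (the Stokes parameter, independent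
of `t`) at the origin at a Hölder rate. -/
def IsAdmissible {m d : ℕ} (S : RayContour m) (T : Set (Fin d → ℂ))
    (f : Fin m → (Fin d → ℂ) → ℂ → ℂ) : Prop :=
  ∀ j, ∃ c : ℂ, ∀ t₀ ∈ T, ∃ δ : ℝ, 0 < δ ∧ ∃ U : Set (Fin d → ℂ), IsOpen U ∧ t₀ ∈ U ∧
    DifferentiableOn ℂ (fun w : (Fin d → ℂ) × ℂ => f j w.1 w.2) (U ×ˢ S.sector j δ) ∧
    (∀ N : ℕ, ∃ C : ℝ, ∀ t ∈ U, ∀ z ∈ S.sector j δ, ‖f j t z‖ * (1 + ‖z‖) ^ N ≤ C) ∧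
    (∃ α C : ℝ, 0 < α ∧ ∀ t ∈ U, ∀ z ∈ S.sector j δ, ‖f j t z - c‖ ≤ C * ‖z‖ ^ α)

/-- `Γ(λ; t)`, `t ∈ T`, is an analytic family of solutions of the Riemann-Hilbert problems with
jump matrices `M t`: it is jointly analytic in `(t, λ)`, and the local bounds and the
asymptotic expansion at infinity hold locally uniformly in `t`. -/
structure IsAnalyticRHPFamily {m d : ℕ} (S : RayContour m) (T : Set (Fin d → ℂ))
    (M : (Fin d → ℂ) → Option (Fin m) → ℝ → Mat) (Γ : (Fin d → ℂ) → ℂ → Mat) : Prop where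
  solution : ∀ t ∈ T, IsRHPSolution S (M t) (Γ t)
  analytic : ∀ i j, DifferentiableOn ℂ (fun w : (Fin d → ℂ) × ℂ => Γ w.1 w.2 i j)
    (T ×ˢ S.carrierᶜ)
  locally_bounded : ∀ t₀ ∈ T, ∀ z₀ : ℂ, ∃ C : ℝ,
    ∀ᶠ w in 𝓝[T ×ˢ S.carrierᶜ] (t₀, z₀), ∀ i j, ‖Γ w.1 w.2 i j‖ ≤ C
  expansion : ∃ Y : (Fin d → ℂ) → ℕ → Mat, ∀ t₀ ∈ T, ∀ N : ℕ, ∃ C ρ : ℝ,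
    ∀ᶠ t in 𝓝 t₀, RemainderBound S (Γ t) (Y t) N C ρ

/-- The deformation parameters `(t, λ⃗, μ⃗)`, with `n₂` points `λ_k` and `n₁` points `μ_k`. -/
abbrev Params (d n₁ n₂ : ℕ) : Type := (Fin d → ℂ) × (Fin n₂ → ℂ) × (Fin n₁ → ℂ)

/-- The diagonal dressing factor
`D(z) = diag (∏ (√λ_j + √z) ∏ (√μ_j - √z), ∏ (√λ_j - √z) ∏ (√μ_j + √z))`. -/
def dressD {n₁ n₂ : ℕ} (lam : Fin n₂ → ℂ) (mu : Fin n₁ → ℂ) (z : ℂ) : Mat :=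
  !![(∏ j, (csqrt (lam j) + csqrt z)) * ∏ j, (csqrt (mu j) - csqrt z), 0;
     0, (∏ j, (csqrt (lam j) - csqrt z)) * ∏ j, (csqrt (mu j) + csqrt z)]

/-- The dressed jump matrices `M_n = D_-^{-1} M D_+`. -/
def dressedJump {m d n₁ n₂ : ℕ} (S : RayContour m)
    (M : (Fin d → ℂ) → Option (Fin m) → ℝ → Mat) (q : Params d n₁ n₂)
    (p : Option (Fin m)) (r : ℝ) : Mat :=
  (S.minus (dressD q.2.1 q.2.2) p r)⁻¹ * M q.1 p r * S.plus (dressD q.2.1 q.2.2) p r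

/-- `Tr (Γ_-^{-1} Γ_-' ∂M M^{-1}) / (2πi) · dλ/dr` at the point `λ` at distance `r` on the piece `p`;
`Γ_-' dλ/dr` is the derivative of the boundary value along the ray, and `∂M` is the derivative of
`M` with respect to the parameters at `q` in the direction `v`. -/
def omegaIntegrand {m : ℕ} {E : Type*} [AddCommGroup E] [Module ℂ E] (S : RayContour m)
    (Γ : ℂ → Mat) (M : E → Option (Fin m) → ℝ → Mat) (q v : E)
    (p : Option (Fin m)) (r : ℝ) : ℂ :=
  Matrix.trace ((S.minus Γ p r)⁻¹
      * Matrix.of (fun i j => deriv (fun x : ℝ => S.minus Γ p x i j) r)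
      * Matrix.of (fun i j => lineDeriv ℂ (fun q' => M q' p r i j) q v)
      * (M q p r)⁻¹) / (2 * Real.pi * Complex.I)

/-- The one-form `Ω(∂; [M])` at `q`, for `∂` the derivative in the direction `v`: the integral over
the oriented contour, piece by piece. -/
def Omega {m : ℕ} {E : Type*} [AddCommGroup E] [Module ℂ E] (S : RayContour m)
    (Γ : ℂ → Mat) (M : E → Option (Fin m) → ℝ → Mat) (q v : E) : ℂ :=
  ∑ p, ((S.sgn p : ℤ) : ℂ) * ∫ r in Set.Ioi (0 : ℝ), omegaIntegrand S Γ M q v p r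

/-- `g`, defined off the contour, has the asymptotic form `p(λ) + c λ^{-1} + o(λ^{-1})` at infinity
with a polynomial `p`, and its (formal) residue at infinity `-c` is `ρ`. -/
def HasResidueAtInfty {m : ℕ} (S : RayContour m) (g : ℂ → ℂ) (ρ : ℂ) : Prop :=
  ∃ p : Polynomial ℂ,
    Tendsto (fun z => z * (g z - p.eval z))
      (Bornology.cobounded ℂ ⊓ 𝓟 S.carrierᶜ) (𝓝 (-ρ))

open Classical in
/-- The residue at infinity, in the sense of `HasResidueAtInfty`. -/
def residueAtInfty {m : ℕ} (S : RayContour m) (g : ℂ → ℂ) : ℂ :=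
  if h : ∃ ρ, HasResidueAtInfty S g ρ then h.choose else 0

/-- `G_∞(λ) = Γ₀(λ) D(λ) ((1 - i σ₁)/√2) λ^{σ₃/4} diag (λ^{-⌊(n+1)/2⌋}, λ^{-⌊n/2⌋})`,
`n = n₁ + n₂`; the last factor is `λ^{-k}` for `n = 2k` and `diag (λ^{-k-1}, λ^{-k})` for
`n = 2k + 1`. -/
def gInfty {n₁ n₂ : ℕ} (Γ₀ : ℂ → Mat) (lam : Fin n₂ → ℂ) (mu : Fin n₁ → ℂ) (z : ℂ) : Mat :=
  Γ₀ z * dressD lam mu z * eMatInv * quarterPow z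
    * !![(z ^ ((n₂ + n₁ + 1) / 2))⁻¹, 0; 0, (z ^ ((n₂ + n₁) / 2))⁻¹]

/-- The function of `z` whose residue at infinity is the entry `(k, l)` of `𝔾`. The indices are
counted from `0`; the rows `k < n₂` belong to the `λ_k`, the others to the `μ_k`. -/
def gIntegrand {n₁ n₂ : ℕ} (Γ₀ : ℂ → Mat) (lam : Fin n₂ → ℂ) (mu : Fin n₁ → ℂ)
    (k l : Fin (n₂ + n₁)) (z : ℂ) : ℂ :=
  Fin.addCases (motive := fun _ => ℂ)
    (fun k' => z ^ ((l : ℕ) / 2)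
      * ((Γ₀ (lam k'))⁻¹ * gInfty Γ₀ lam mu z) 1 (Fin.ofNat 2 l) / (z - lam k'))
    (fun k' => z ^ ((l : ℕ) / 2)
      * ((Γ₀ (mu k'))⁻¹ * gInfty Γ₀ lam mu z) 0 (Fin.ofNat 2 l) / (z - mu k'))
    k

/-- The `n × n` matrix `𝔾`. -/
def bigG {m n₁ n₂ : ℕ} (S : RayContour m) (Γ₀ : ℂ → Mat) (lam : Fin n₂ → ℂ) (mu : Fin n₁ → ℂ) :
    Matrix (Fin (n₂ + n₁)) (Fin (n₂ + n₁)) ℂ :=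
  Matrix.of fun k l => residueAtInfty S (gIntegrand Γ₀ lam mu k l)

/-- `Δ(λ⃗, μ⃗)`. -/
def bigDelta {n₁ n₂ : ℕ} (lam : Fin n₂ → ℂ) (mu : Fin n₁ → ℂ) : ℂ :=
  ((∏ j, lam j ^ (1 / 4 : ℂ)) * ∏ j, mu j ^ (1 / 4 : ℂ)) /
    ((∏ j, ∏ k ∈ Finset.Ioi j, (csqrt (lam j) - csqrt (lam k)))
      * (∏ j, ∏ k ∈ Finset.Ioi j, (csqrt (mu j) - csqrt (mu k)))
      * ∏ j, ∏ k, (csqrt (lam j) + csqrt (mu k)))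

/-- `Δ(λ⃗, μ⃗) det 𝔾` as a function of all the parameters `(t, λ⃗, μ⃗)`. -/
def deltaDetG {m d n₁ n₂ : ℕ} (S : RayContour m) (Γ₀ : (Fin d → ℂ) → ℂ → Mat)
    (q : Params d n₁ n₂) : ℂ :=
  bigDelta q.2.1 q.2.2 * (bigG S (Γ₀ q.1) q.2.1 q.2.2).det

end Dressing

end

/-! Write a_k for the points λ_j and μ_j together, x_k for the signed roots √λ_j and −√μ_j, and e_k
for the row in which D vanishes at a_k. The jump matrices are unimodular, so Γ₀ and Γn have
determinant one. Since Γ₀ D has the jump matrix D_-⁻¹ M D_+ of Γn, the quotient P = Γ₀ D Γn⁻¹ has no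
jump; it is bounded at the origin and of power growth at infinity, hence a matrix of polynomials,
and det P = ∏ (a_k − z) (`exists_isDressing`). Both sides of the theorem are computed from P, and
each turns out to be the sum over k of `pointTerm`.

The determinant. The polynomial parts of the columns of G_∞ exist because G_∞ has no jump on the
negative half line, so no odd power of √z survives (`IsRHPSolution.gInfty_no_jump`). Their
coefficients form a triangular matrix with a constant diagonal, whence det 𝔾 is a nonzero constant
times the determinant of `rowMat`, whose k-th row is row e_k of Γ₀⁻¹(a_k) times powers of a_k
(`IsRHPSolution.residues`). An inverse of this matrix can be written down: the vectors W_k(z) = P(z)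
Γn(a_k) e / (z − a_k), suitably normalized, are polynomial, and Γ₀⁻¹ W_k = D Γn⁻¹ Γn(a_k) e / (z −
a_k) vanishes in row e_l at a_l for l ≠ k (`rowMat_mul_dressInv`). This shows that det 𝔾 is nonzero,
and Jacobi's formula turns its logarithmic derivative into a sum over the points. The part of the
sum that comes from D alone is cancelled by Δ (`logDeriv_bigDelta_line`, `logDeriv_deltaDetG`).

The integrals. Let a dot denote ∂ and put H = −Tr(P′ P⁻¹ Γ̇₀ Γ₀⁻¹) + Tr(Γn⁻¹ Γn′ D⁻¹ Ḋ). This is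
`formH`: Γn⁻¹ Γn′ is traceless and D diagonal, so the second trace is its upper left entry times the
difference of the logarithmic derivatives of the entries of D. Up to the factor 2πi, the jumps of H
are the difference of the two integrands (`formH_jump`); its poles at the a_k are simple with
residues `pointTerm` (`formNum_pts`); and z H(z) tends to 0 at the origin and at infinity. A Cauchy
theorem for the contour, proved in the coordinate log z (`RayContour.sum_integral_jump`), then gives
the difference of the Ω as the sum of the residues (`Omega_sub_eq_sum_pointTerm`).

The analytic input is an estimate Γ₀′ = O(Γ₀ / z) up to the contour, from Cauchy's estimate for the
analytic continuations of Γ₀ through the rays (`IsRHPSolution.exists_deriv_bound`), and Cauchy's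
estimate in the parameters. The function Γn is never estimated by itself: everything about Γn⁻¹ Γn′
is deduced from Γ₀, P and D by differentiating P Γn = Γ₀ D (`IsDressing.logMat_eq`). -/

noncomputable section

namespace Dressing

/-! ### Complex analysis and determinants: general tools. -/

section

/-- A continuous function that is holomorphic off the real axis is holomorphic. -/
lemma differentiableOn_of_continuousOn_off_real {f : ℂ → ℂ} {U : Set ℂ} (hU : IsOpen U)
    (hc : ContinuousOn f U) (hd : ∀ z ∈ U, z.im ≠ 0 → DifferentiableAt ℂ f z) :
    DifferentiableOn ℂ f U := by
  -- Morera's theorem: it is enough that integrals over boundaries of rectangles vanish. If the real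
  -- axis misses the interior, this is Cauchy's theorem with continuity up to the boundary; any
  -- other rectangle is cut along the axis into two such halves.
  have half : ∀ z w : ℂ, Complex.Rectangle z w ⊆ U → (0 ∉ Set.Ioo (min z.im w.im) (max z.im w.im)) →
      Complex.wedgeIntegral z w f + Complex.wedgeIntegral w z f = 0 := by
    intro z w hzw h0
    rw [Complex.wedgeIntegral_add_wedgeIntegral_eq]
    refine Complex.integral_boundary_rect_eq_zero_of_continuousOn_of_differentiableOn f z w
      (hc.mono hzw) fun u hu => (hd u (hzw ?_) ?_).differentiableWithinAt
    · exact ⟨Set.Ioo_subset_Icc_self hu.1, Set.Ioo_subset_Icc_self hu.2⟩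
    · intro h
      exact h0 (h ▸ hu.2)
  rw [← Complex.isConservativeOn_and_continuousOn_iff_isDifferentiableOn hU]
  refine ⟨fun z w hzw => ?_, hc⟩
  rw [← add_eq_zero_iff_eq_neg]
  by_cases h0 : 0 ∈ Set.Ioo (min z.im w.im) (max z.im w.im)
  swap
  · exact half z w hzw h0
  have h0' : (0 : ℝ) ∈ Set.uIcc z.im w.im := Set.Ioo_subset_Icc_self h0
  have h1 : Complex.Rectangle z (⟨w.re, 0⟩ : ℂ) ⊆ U := fun u hu =>
    hzw ⟨hu.1, Set.uIcc_subset_uIcc_left h0' hu.2⟩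
  have h2 : Complex.Rectangle (⟨z.re, 0⟩ : ℂ) w ⊆ U := fun u hu =>
    hzw ⟨hu.1, Set.uIcc_subset_uIcc_right h0' hu.2⟩
  have e1 := half _ _ h1 (by
    simp only [Set.mem_Ioo, not_and, not_lt]
    intro h
    rcases min_lt_iff.1 h with h | h
    · simp [h.le]
    · exact absurd h (by simp))
  have e2 := half _ _ h2 (by
    simp only [Set.mem_Ioo, not_and, not_lt]
    intro h
    rcases min_lt_iff.1 h with h | h
    · exact absurd h (by simp)
    · simp [h.le])
  rw [Complex.wedgeIntegral_add_wedgeIntegral_eq] at e1 e2 ⊢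
  have hi : ∀ x ∈ Set.uIcc z.re w.re, ∀ a ∈ Set.uIcc z.im w.im, ∀ b ∈ Set.uIcc z.im w.im,
      IntervalIntegrable (fun y : ℝ => f (x + y * Complex.I)) MeasureTheory.volume a b := by
    intro x hx a ha b hb
    apply ContinuousOn.intervalIntegrable
    refine hc.comp (by fun_prop) fun y hy => hzw ⟨by simpa using hx, ?_⟩
    simpa using Set.uIcc_subset_uIcc ha hb hy
  have a1 := intervalIntegral.integral_add_adjacent_intervals
    (hi w.re (by simp) z.im (by simp) 0 h0') (hi w.re (by simp) 0 h0' w.im (by simp))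
  have a2 := intervalIntegral.integral_add_adjacent_intervals
    (hi z.re (by simp) z.im (by simp) 0 h0') (hi z.re (by simp) 0 h0' w.im (by simp))
  simp only [smul_eq_mul] at e1 e2 ⊢
  rw [← a1, ← a2]
  linear_combination e1 + e2

/-- An entire function of polynomial growth is a polynomial. -/
lemma exists_polynomial_of_growth {f : ℂ → ℂ} (hf : Differentiable ℂ f) {C ρ e : ℝ} {N : ℕ}
    (heN : e < N) (hb : ∀ z : ℂ, ρ ≤ ‖z‖ → ‖f z‖ ≤ C * ‖z‖ ^ e) :
    ∃ p : Polynomial ℂ, p.degree < N ∧ ∀ z, f z = p.eval z := by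
  -- Cauchy's estimate on the circle of radius R gives O(R^(e − n)), and n ≥ N > e. The exponent e
  -- may be negative: for N = 0 the function vanishes.
  have hz : ∀ n : ℕ, N ≤ n → iteratedDeriv n f 0 = 0 := by
    intro n hn
    have h1 : ∀ᶠ R : ℝ in atTop, ‖iteratedDeriv n f 0‖ ≤ (n.factorial : ℝ) * C * R ^ (-((n : ℝ) - e)) := by
      filter_upwards [eventually_ge_atTop (max ρ 1)] with R hR
      have hR0 : 0 < R := lt_of_lt_of_le one_pos ((le_max_right _ _).trans hR)
      have := Complex.norm_iteratedDeriv_le_of_forall_mem_sphere_norm_le (f := f) (c := 0) n hR0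
        hf.diffContOnCl (C := C * R ^ e) (fun z hz => by
          have : ‖z‖ = R := by simpa using hz
          rw [← this]
          exact hb z (this ▸ (le_max_left _ _).trans hR))
      refine this.trans (le_of_eq ?_)
      rw [neg_sub, Real.rpow_sub hR0, Real.rpow_natCast]
      ring
    have h2 : Tendsto (fun R : ℝ => (n.factorial : ℝ) * C * R ^ (-((n : ℝ) - e))) atTop
        (𝓝 ((n.factorial : ℝ) * C * 0)) := by
      refine (tendsto_rpow_neg_atTop ?_).const_mul _
      have : (N : ℝ) ≤ n := by exact_mod_cast hn
      linarith
    rw [mul_zero] at h2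
    exact norm_le_zero_iff.1 (ge_of_tendsto h2 h1)
  refine ⟨∑ n ∈ Finset.range N,
    Polynomial.C ((n.factorial : ℂ)⁻¹ * iteratedDeriv n f 0) * Polynomial.X ^ n, ?_, fun z => ?_⟩
  · rw [← Polynomial.mem_degreeLT]
    refine Submodule.sum_mem _ fun n hn => ?_
    rw [Polynomial.mem_degreeLT]
    refine lt_of_le_of_lt (Polynomial.degree_C_mul_X_pow_le _ _) ?_
    exact_mod_cast Finset.mem_range.1 hn
  · have h := Complex.taylorSeries_eq_of_entire' 0 z hf
    rw [← h, tsum_eq_sum (s := Finset.range N) (fun n hn => by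
      rw [hz n (by simpa using hn)]; simp), Polynomial.eval_finsetSum]
    simp

/-- A holomorphic function with prescribed zeros can be divided by the nodal polynomial. -/
lemma exists_eq_prod_mul {ι : Type*} {U : Set ℂ} (hU : IsOpen U) (s : Finset ι) (a : ι → ℂ)
    (ha : ∀ i ∈ s, a i ∈ U) (hinj : Set.InjOn a s) {g : ℂ → ℂ} (hg : DifferentiableOn ℂ g U)
    (h0 : ∀ i ∈ s, g (a i) = 0) :
    ∃ h : ℂ → ℂ, DifferentiableOn ℂ h U ∧ ∀ z, g z = (∏ i ∈ s, (z - a i)) * h z := by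
  classical
  induction s using Finset.induction_on generalizing g with
  | empty => exact ⟨g, hg, by simp⟩
  | insert i s hi ih =>
    have hd : DifferentiableOn ℂ (dslope g (a i)) U :=
      (Complex.differentiableOn_dslope (hU.mem_nhds (ha i (by simp)))).2 hg
    have e : ∀ z, g z = (z - a i) * dslope g (a i) z := fun z => by
      have := sub_smul_dslope g (a i) z
      rw [h0 i (by simp), sub_zero, smul_eq_mul] at this
      exact this.symm
    obtain ⟨h, hh, he⟩ := ih (fun j hj => ha j (by simp [hj]))
      (hinj.mono (by simp)) hd (fun j hj => by
        have h1 := e (a j)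
        rw [h0 j (by simp [hj])] at h1
        refine (mul_eq_zero.1 h1.symm).resolve_left (sub_ne_zero.2 fun h => hi ?_)
        exact hinj (by simp [hj]) (by simp) h ▸ hj)
    refine ⟨h, hh, fun z => ?_⟩
    rw [e z, he z, Finset.prod_insert hi, mul_assoc]

/-- Partial fractions for a quotient of a holomorphic function by a nodal polynomial. -/
lemma exists_partial_fractions {ι : Type*} [DecidableEq ι] {U : Set ℂ} (hU : IsOpen U)
    (s : Finset ι) (a : ι → ℂ) (ha : ∀ i ∈ s, a i ∈ U) (hinj : Set.InjOn a s) {g : ℂ → ℂ}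
    (hg : DifferentiableOn ℂ g U) :
    ∃ h : ℂ → ℂ, DifferentiableOn ℂ h U ∧ ∀ z, (∀ i ∈ s, z ≠ a i) →
      g z / ∏ i ∈ s, (z - a i) = h z +
        ∑ i ∈ s, g (a i) / (∏ j ∈ s.erase i, (a i - a j)) / (z - a i) := by
  -- After subtraction of the Lagrange interpolant the function is divisible by the nodal
  -- polynomial; the interpolant divided by the nodal polynomial is the sum of the principal parts.
  obtain ⟨h, hh, he⟩ := exists_eq_prod_mul hU s a ha hinj
    (g := fun z => g z - (Lagrange.interpolate s a (fun i => g (a i))).eval z)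
    (hg.sub (Polynomial.differentiable _).differentiableOn) (fun i hi => by
      simp only [Lagrange.eval_interpolate_at_node _ hinj hi, sub_self])
  refine ⟨h, hh, fun z hz => ?_⟩
  have h0 : ∏ i ∈ s, (z - a i) ≠ 0 := Finset.prod_ne_zero_iff.2 fun i hi => sub_ne_zero.2 (hz i hi)
  have h1 := he z
  rw [Lagrange.eval_interpolate_not_at_node _ hz, Lagrange.eval_nodal] at h1
  rw [div_eq_iff h0, eq_add_of_sub_eq h1, add_mul, mul_comm (h z)]
  congr 1
  rw [mul_comm]
  congr 1
  refine Finset.sum_congr rfl fun i _ => ?_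
  rw [Lagrange.nodalWeight, Finset.prod_inv_distrib]
  ring

/-- Parameter derivatives of a bounded holomorphic family converge when the family does; the limit
is given by Cauchy's formula. -/
lemma tendsto_deriv_of_bounded {α : Type*} {l : Filter α} [l.IsCountablyGenerated]
    {g : ℂ → α → ℂ} {g₀ : ℂ → ℂ} {ρ C : ℝ} (hρ : 0 < ρ)
    (hd : ∀ᶠ z in l, DifferentiableOn ℂ (fun s => g s z) (Metric.ball 0 ρ))
    (hb : ∀ᶠ z in l, ∀ s ∈ Metric.ball (0 : ℂ) ρ, ‖g s z‖ ≤ C)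
    (hl : ∀ s ∈ Metric.ball (0 : ℂ) ρ, Tendsto (g s) l (𝓝 (g₀ s))) :
    Tendsto (fun z => deriv (fun s => g s z) 0) l (𝓝 (Complex.cderiv (ρ / 2) g₀ 0)) := by
  have hsub : Metric.closedBall (0 : ℂ) (ρ / 2) ⊆ Metric.ball 0 ρ :=
    Metric.closedBall_subset_ball (by linarith)
  have hr : (0 : ℝ) ≤ ρ / 2 := by linarith
  have hmem : ∀ θ : ℝ, circleMap 0 (ρ / 2) θ ∈ Metric.ball (0 : ℂ) ρ := fun θ =>
    hsub (circleMap_mem_closedBall 0 hr θ)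
  -- The derivative at 0 is a Cauchy integral over the circle of radius ρ/2, where the uniform bound
  -- permits dominated convergence. This is where the filter has to be countably generated.
  have key : Tendsto (fun z => Complex.cderiv (ρ / 2) (fun s => g s z) 0) l
      (𝓝 (Complex.cderiv (ρ / 2) g₀ 0)) := by
    unfold Complex.cderiv
    refine Tendsto.const_smul ?_ _
    unfold circleIntegral
    refine intervalIntegral.tendsto_integral_filter_of_dominated_convergence
      (fun _ => (ρ / 2) * ((((ρ / 2) ^ 2)⁻¹) * C)) ?_ ?_ (by simp) ?_
    · filter_upwards [hd] with z hz
      apply ContinuousOn.aestronglyMeasurable _ measurableSet_uIoc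
      apply Continuous.continuousOn
      have h1 : Continuous fun θ : ℝ => g (circleMap 0 (ρ / 2) θ) z :=
        hz.continuousOn.comp_continuous (continuous_circleMap 0 _) hmem
      have h2 : Continuous fun θ : ℝ => ((circleMap 0 (ρ / 2) θ - 0) ^ 2)⁻¹ := by
        refine Continuous.inv₀ (by fun_prop) fun θ => ?_
        simp [hρ.ne']
      simp only [deriv_circleMap]
      exact Continuous.smul ((continuous_circleMap 0 _).mul continuous_const) (h2.smul h1)
    · filter_upwards [hb] with z hz
      refine MeasureTheory.ae_of_all _ fun θ _ => ?_
      rw [norm_smul, norm_smul, deriv_circleMap]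
      simp only [circleMap_zero, sub_zero, norm_mul, norm_inv, norm_pow, Complex.norm_I, mul_one]
      simp only [Complex.norm_exp_ofReal_mul_I, Complex.norm_real, Real.norm_eq_abs, mul_one,
        abs_of_nonneg hr]
      gcongr
      have := hz _ (hmem θ)
      rwa [circleMap_zero] at this
    · exact MeasureTheory.ae_of_all _ fun θ _ => ((hl _ (hmem θ)).const_smul _).const_smul _
  refine key.congr' ?_
  filter_upwards [hd] with z hz
  exact Complex.cderiv_eq_deriv Metric.isOpen_ball hz (by linarith) hsub

/-- Schwarz's lemma, applied first to f and then to its difference quotient. The bound depends on f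
only through C, so that difference quotients of a bounded family converge uniformly. -/
lemma norm_dslope_sub_le {f : ℂ → ℂ} {r C : ℝ} (hr : 0 < r) (hC : 0 < C)
    (hd : DifferentiableOn ℂ f (Metric.ball 0 r)) (hb : ∀ z ∈ Metric.ball (0 : ℂ) r, ‖f z‖ ≤ C)
    {z : ℂ} (hz : z ∈ Metric.ball (0 : ℂ) r) :
    ‖dslope f 0 z - deriv f 0‖ ≤ 9 * C / r ^ 2 * ‖z‖ := by
  have h0 : (0 : ℂ) ∈ Metric.ball (0 : ℂ) r := by simpa using hr
  have h1 : ∀ w ∈ Metric.ball (0 : ℂ) r, ‖dslope f 0 w‖ ≤ 3 * C / r := fun w hw => by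
    refine Complex.norm_dslope_le_div_of_mapsTo_ball hd (fun u hu => ?_) hw
    rw [Metric.mem_closedBall, dist_eq_norm]
    calc ‖f u - f 0‖ ≤ ‖f u‖ + ‖f 0‖ := norm_sub_le _ _
      _ ≤ 3 * C := by linarith [hb u hu, hb 0 h0]
  have hd' : DifferentiableOn ℂ (dslope f 0) (Metric.ball 0 r) :=
    (Complex.differentiableOn_dslope (Metric.isOpen_ball.mem_nhds h0)).2 hd
  have hp : 0 < C / r := by positivity
  have h2 : ‖dslope (dslope f 0) 0 z‖ ≤ (9 * C / r) / r := by
    refine Complex.norm_dslope_le_div_of_mapsTo_ball hd' (fun u hu => ?_) hz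
    rw [Metric.mem_closedBall, dist_eq_norm]
    calc ‖dslope f 0 u - dslope f 0 0‖ ≤ ‖dslope f 0 u‖ + ‖dslope f 0 0‖ := norm_sub_le _ _
      _ ≤ 3 * C / r + 3 * C / r := add_le_add (h1 u hu) (h1 0 h0)
      _ ≤ 9 * C / r := by
        have : 3 * C / r + 3 * C / r = 6 * (C / r) := by ring
        rw [this, mul_div_assoc]; linarith
  have h3 := sub_smul_dslope (dslope f 0) 0 z
  rw [← dslope_same f 0, ← h3, norm_smul, sub_zero, mul_comm]
  refine mul_le_mul_of_nonneg_right (h2.trans (le_of_eq ?_)) (norm_nonneg _)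
  field_simp

/-- The parameter derivative of a jointly holomorphic function is holomorphic. -/
lemma differentiableOn_deriv_param {V : Set (ℂ × ℂ)} (hV : IsOpen V) {W : Set ℂ}
    (hW : ∀ z ∈ W, ((0 : ℂ), z) ∈ V) {g : ℂ × ℂ → ℂ} (hg : DifferentiableOn ℂ g V) :
    DifferentiableOn ℂ (fun z => deriv (fun s => g (s, z)) 0) W := by
  intro z₀ hz₀
  obtain ⟨ε, hε, hsub⟩ := Metric.isOpen_iff.1 hV _ (hW z₀ hz₀)
  set r := ε / 2 with hr
  have hr0 : 0 < r := by positivity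
  have hmem : ∀ s ∈ Metric.closedBall (0 : ℂ) r, ∀ z ∈ Metric.closedBall z₀ r, (s, z) ∈ V := by
    intro s hs z hz
    apply hsub
    rw [← ball_prod_same]
    exact ⟨Metric.closedBall_subset_ball (by linarith) hs,
      Metric.closedBall_subset_ball (by linarith) hz⟩
  obtain ⟨C, hC⟩ := ((isCompact_closedBall (0 : ℂ) r).prod
    (isCompact_closedBall z₀ r)).exists_bound_of_continuousOn
    (hg.continuousOn.mono fun p hp => hmem p.1 hp.1 p.2 hp.2)
  have hC' : ∀ s ∈ Metric.ball (0 : ℂ) r, ∀ z ∈ Metric.ball z₀ r, ‖g (s, z)‖ ≤ |C| + 1 :=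
    fun s hs z hz => (hC (s, z) ⟨Metric.ball_subset_closedBall hs,
      Metric.ball_subset_closedBall hz⟩).trans ((le_abs_self C).trans (by linarith))
  have hds : ∀ z ∈ Metric.ball z₀ r, DifferentiableOn ℂ (fun s => g (s, z)) (Metric.ball 0 r) :=
    fun z hz => hg.comp (by fun_prop) fun s hs =>
      hmem s (Metric.ball_subset_closedBall hs) z (Metric.ball_subset_closedBall hz)
  have hdz : ∀ s ∈ Metric.ball (0 : ℂ) r, DifferentiableOn ℂ (fun z => g (s, z)) (Metric.ball z₀ r) :=
    fun s hs => hg.comp (by fun_prop) fun z hz =>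
      hmem s (Metric.ball_subset_closedBall hs) z (Metric.ball_subset_closedBall hz)
  -- The difference quotients in s are holomorphic in z and converge uniformly near z₀, so that
  -- their limit is holomorphic.
  have hu : TendstoUniformlyOn (fun (s : ℂ) z => dslope (fun s => g (s, z)) 0 s)
      (fun z => deriv (fun s => g (s, z)) 0) (𝓝[≠] 0) (Metric.ball z₀ r) := by
    rw [Metric.tendstoUniformlyOn_iff]
    intro δ hδ
    have h1 : Tendsto (fun s : ℂ => 9 * (|C| + 1) / r ^ 2 * ‖s‖) (𝓝[≠] 0) (𝓝 0) := by
      have : Tendsto (fun s : ℂ => 9 * (|C| + 1) / r ^ 2 * ‖s‖) (𝓝 0)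
          (𝓝 (9 * (|C| + 1) / r ^ 2 * ‖(0 : ℂ)‖)) := Continuous.tendsto (by fun_prop) 0
      rw [norm_zero, mul_zero] at this
      exact this.mono_left nhdsWithin_le_nhds
    filter_upwards [h1.eventually (gt_mem_nhds hδ),
      mem_nhdsWithin_of_mem_nhds (Metric.ball_mem_nhds (0 : ℂ) hr0)] with s hs hs' z hz
    rw [dist_comm, dist_eq_norm]
    exact (norm_dslope_sub_le hr0 (by positivity) (hds z hz)
      (fun s hs => hC' s hs z hz) hs').trans_lt hs
  have hD := hu.tendstoLocallyUniformlyOn.differentiableOn (by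
    filter_upwards [self_mem_nhdsWithin,
      mem_nhdsWithin_of_mem_nhds (Metric.ball_mem_nhds (0 : ℂ) hr0)] with s hs hs'
    have hs0 : s ≠ 0 := hs
    simp only [dslope_of_ne _ hs0, slope_fun_def, sub_zero, vsub_eq_sub, smul_eq_mul]
    exact ((hdz s hs').sub (hdz 0 (by simpa using hr0))).const_mul _) Metric.isOpen_ball
  exact (hD.differentiableAt (Metric.ball_mem_nhds z₀ hr0)).differentiableWithinAt

/-- Jacobi's formula at an invertible matrix. -/
lemma hasDerivAt_det {n : Type*} [Fintype n] [DecidableEq n] {A : ℂ → Matrix n n ℂ}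
    {A' B : Matrix n n ℂ} {s : ℂ} (hA : ∀ i j, HasDerivAt (fun x => A x i j) (A' i j) s)
    (hB : A s * B = 1) :
    HasDerivAt (fun x => (A x).det) ((A s).det * (A' * B).trace) s := by
  have hdet : (A s).det * B.det = 1 := by rw [← Matrix.det_mul, hB, Matrix.det_one]
  have hC : ∀ i j, HasDerivAt (fun x => (A x * B) i j) ((A' * B) i j) s := fun i j => by
    simp only [Matrix.mul_apply]
    exact HasDerivAt.fun_sum fun k _ => (hA i k).mul_const _
  -- At s the matrix A B is the identity. A permutation other than 1 moves at least two indices, so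
  -- each term of the product rule keeps a vanishing off-diagonal factor; only the trace remains.
  have h1 : HasDerivAt (fun x => (A x * B).det) (A' * B).trace s := by
    simp only [Matrix.det_apply']
    have h2 : ∀ σ : Equiv.Perm n, HasDerivAt
        (fun x => ((Equiv.Perm.sign σ : ℤ) : ℂ) * ∏ i, (A x * B) (σ i) i)
        (if σ = 1 then (A' * B).trace else 0) s := by
      intro σ
      have h3 := (HasDerivAt.fun_finsetProd (u := Finset.univ)
        (fun i _ => hC (σ i) i)).const_mul ((Equiv.Perm.sign σ : ℤ) : ℂ)
      refine h3.congr_deriv ?_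
      split_ifs with hσ
      · subst hσ
        simp [hB, Matrix.trace]
      · have : ∀ i, ∏ j ∈ Finset.univ.erase i, (A s * B) (σ j) j = 0 := by
          intro i
          obtain ⟨j, hj⟩ : ∃ j, σ j ≠ j := by
            by_contra! h
            exact hσ (Equiv.ext h)
          have : ∃ j ≠ i, σ j ≠ j := by
            by_cases hji : j = i
            · refine ⟨σ j, fun h => hj (h.trans hji.symm), fun h => hj (σ.injective h)⟩
            · exact ⟨j, hji, hj⟩
          obtain ⟨k, hk, hk'⟩ := this
          exact Finset.prod_eq_zero (i := k) (by simp [hk]) (by rw [hB, Matrix.one_apply_ne hk'])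
        simp [this]
    have h4 := HasDerivAt.fun_sum (u := Finset.univ) fun σ _ => h2 σ
    simpa using h4
  have h5 := h1.const_mul (A s).det
  refine h5.congr_of_eventuallyEq (Eventually.of_forall fun x => ?_)
  simp only [Matrix.det_mul]
  linear_combination -(A x).det * hdet

end

/-! ### Geometry of the contour; extension and continuation across it. -/

section

namespace RayContour

variable {m : ℕ} (S : RayContour m)

/-- The unit vector in the direction of a piece of the contour. -/
def rot (p : Option (Fin m)) : ℂ := Complex.exp ((S.arg p : ℂ) * Complex.I)

lemma rot_ne_zero (p : Option (Fin m)) : S.rot p ≠ 0 := Complex.exp_ne_zero _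

lemma norm_rot (p : Option (Fin m)) : ‖S.rot p‖ = 1 := Complex.norm_exp_ofReal_mul_I _

lemma point_eq (p : Option (Fin m)) (r : ℝ) : S.point p r = r * S.rot p := rfl

lemma rot_none : S.rot none = -1 := by simp [rot, arg, Complex.exp_pi_mul_I]

lemma norm_point (p : Option (Fin m)) {r : ℝ} (hr : 0 ≤ r) : ‖S.point p r‖ = r := by
  rw [point_eq, norm_mul, norm_rot, mul_one, Complex.norm_real, Real.norm_eq_abs, abs_of_nonneg hr]

lemma point_ne_zero (p : Option (Fin m)) {r : ℝ} (hr : 0 < r) : S.point p r ≠ 0 := by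
  rw [← norm_ne_zero_iff, norm_point _ _ hr.le]
  exact hr.ne'

lemma mem_side {p : Option (Fin m)} {s : ℤˣ} {z : ℂ} :
    z ∈ S.side p s ↔ z ∉ S.carrier ∧ 0 < ((s : ℤ) : ℝ) * (z * (S.rot p)⁻¹).im := by
  rw [rot, ← Complex.exp_neg]
  rfl

lemma side_subset (p : Option (Fin m)) (s : ℤˣ) : S.side p s ⊆ S.carrierᶜ := fun _ h => h.1

lemma point_mem_carrier (p : Option (Fin m)) {r : ℝ} (hr : 0 ≤ r) : S.point p r ∈ S.carrier :=
  ⟨p, r, hr, rfl⟩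

lemma zero_mem_carrier : (0 : ℂ) ∈ S.carrier := ⟨none, 0, le_rfl, by simp [point_eq]⟩

lemma ne_zero_of_notMem {z : ℂ} (hz : z ∉ S.carrier) : z ≠ 0 := fun h =>
  hz (h ▸ S.zero_mem_carrier)

lemma compl_carrier_subset_slitPlane : S.carrierᶜ ⊆ Complex.slitPlane := by
  intro z hz
  by_contra h
  rw [Complex.mem_slitPlane_iff, not_or, not_lt, not_not] at h
  refine hz ⟨none, -z.re, by linarith, ?_⟩
  rw [point_eq, rot_none]
  exact Complex.ext (by simp) (by simp [h.2])

/-- One closed condition for each piece, in the coordinate rotated so that the piece becomes the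
positive half line. -/
lemma carrier_eq : S.carrier =
    ⋃ p, {z | (z * (S.rot p)⁻¹).im = 0 ∧ 0 ≤ (z * (S.rot p)⁻¹).re} := by
  ext z
  simp only [Set.mem_iUnion, Set.mem_ofPred_eq]
  constructor
  · rintro ⟨p, r, hr, rfl⟩
    refine ⟨p, ?_⟩
    rw [point_eq, mul_assoc, mul_inv_cancel₀ (S.rot_ne_zero p), mul_one]
    simpa using hr
  · rintro ⟨p, h1, h2⟩
    refine ⟨p, _, h2, ?_⟩
    have : ((z * (S.rot p)⁻¹).re : ℂ) = z * (S.rot p)⁻¹ := Complex.ext (by simp) (by simp [h1])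
    rw [point_eq, this, mul_assoc, inv_mul_cancel₀ (S.rot_ne_zero p), mul_one]

lemma isClosed_carrier : IsClosed S.carrier := by
  rw [carrier_eq]
  refine isClosed_iUnion_of_finite fun p => IsClosed.inter ?_ ?_
  · exact isClosed_eq (Complex.continuous_im.comp (by fun_prop)) continuous_const
  · exact isClosed_le continuous_const (Complex.continuous_re.comp (by fun_prop))

lemma isOpen_compl : IsOpen S.carrierᶜ := S.isClosed_carrier.isOpen_compl

end RayContour

/-- The open cone about the positive half line. -/
def cone (c : ℝ) : Set ℂ := {u | 0 < u.re ∧ |u.im| < c * u.re}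

lemma isOpen_cone (c : ℝ) : IsOpen (cone c) :=
  (isOpen_lt continuous_const Complex.continuous_re).inter
    (isOpen_lt (continuous_abs.comp Complex.continuous_im)
      (continuous_const.mul Complex.continuous_re))

lemma ofReal_mem_cone {c r : ℝ} (hc : 0 < c) (hr : 0 < r) : (r : ℂ) ∈ cone c := by
  simp [cone, hr, hc]

lemma cone_mono {c c' : ℝ} (h : c ≤ c') : cone c ⊆ cone c' := fun _ hu =>
  ⟨hu.1, hu.2.trans_le (mul_le_mul_of_nonneg_right h hu.1.le)⟩

lemma ne_zero_of_mem_cone {c : ℝ} {u : ℂ} (hu : u ∈ cone c) : u ≠ 0 := by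
  rintro rfl
  exact lt_irrefl _ hu.1

/-- Division by the real part moves a thin cone into a small neighbourhood of 1, where the argument
is continuous and small. -/
lemma eventually_abs_arg_lt {ε : ℝ} (hε : 0 < ε) :
    ∀ᶠ c in 𝓝[>] (0 : ℝ), ∀ u ∈ cone c, |Complex.arg u| < ε := by
  have h1 : ∀ᶠ w in 𝓝 (1 : ℂ), |Complex.arg w| < ε := by
    have : ContinuousAt (fun w => |Complex.arg w|) 1 :=
      (Complex.continuousAt_arg Complex.one_mem_slitPlane).abs
    exact this.eventually (gt_mem_nhds (by simpa using hε))
  obtain ⟨η, hη, hsub⟩ := Metric.eventually_nhds_iff.1 h1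
  filter_upwards [Ioo_mem_nhdsGT hη] with c hc u hu
  have h2 : u = (u.re : ℂ) * (1 + (u.im / u.re : ℝ) * Complex.I) := by
    have : (u.re : ℂ) ≠ 0 := by exact_mod_cast hu.1.ne'
    push_cast
    field_simp
    exact (Complex.re_add_im u).symm
  rw [h2, Complex.arg_real_mul _ hu.1]
  apply hsub
  rw [dist_eq_norm, add_sub_cancel_left, norm_mul, Complex.norm_I, mul_one, Complex.norm_real,
    Real.norm_eq_abs, abs_div, abs_of_pos hu.1, div_lt_iff₀ hu.1]
  exact hu.2.trans (mul_lt_mul_of_pos_right hc.2 hu.1)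

namespace RayContour

variable {m : ℕ} (S : RayContour m)

lemma arg_mem (p : Option (Fin m)) : S.arg p ∈ Set.Ioc (-Real.pi) Real.pi := by
  cases p with
  | none => exact ⟨by simp [arg, Real.pi_pos], le_rfl⟩
  | some j => exact ⟨(S.angle_mem j).1, (S.angle_mem j).2.le⟩

lemma arg_injective : Function.Injective S.arg := by
  intro p p' h
  cases p <;> cases p'
  · rfl
  · exact absurd h (S.angle_mem _).2.ne'
  · exact absurd h (S.angle_mem _).2.ne
  · exact congrArg some (S.angle_injective h)

lemma arg_rot (p : Option (Fin m)) : Complex.arg (S.rot p) = S.arg p := by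
  rw [rot, Complex.arg_exp_mul_I, toIocMod_eq_self]
  convert S.arg_mem p using 1
  ring_nf

lemma rot_injective : Function.Injective S.rot := fun p p' h =>
  S.arg_injective (by rw [← S.arg_rot p, ← S.arg_rot p', h])

/-- A thin cone about a piece of the contour meets the contour in that piece only. -/
lemma eventually_cone_good : ∀ᶠ c in 𝓝[>] (0 : ℝ), ∀ p, ∀ u ∈ cone c, u.im ≠ 0 →
    u * S.rot p ∉ S.carrier := by
  -- The quotient of the directions of two different pieces has modulus one and differs from 1, so
  -- it lies outside every sufficiently thin cone.
  have h1 : ∀ p p' : Option (Fin m), p ≠ p' → ∀ᶠ c in 𝓝[>] (0 : ℝ),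
      S.rot p' * (S.rot p)⁻¹ ∉ cone c := by
    intro p p' hp
    set w := S.rot p' * (S.rot p)⁻¹ with hw
    have hn : ‖w‖ = 1 := by rw [hw, norm_mul, norm_inv, norm_rot, norm_rot]; simp
    have hw1 : w ≠ 1 := fun h => hp (S.rot_injective (by
      rw [hw, ← div_eq_mul_inv, div_eq_one_iff_eq (S.rot_ne_zero p)] at h
      exact h.symm))
    by_cases hre : 0 < w.re
    · have him : 0 < |w.im| := by
        rw [abs_pos]
        intro him
        apply hw1
        have h2 : w = w.re := Complex.ext (by simp) (by simp [him])
        have h3 : ‖w‖ = w.re := by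
          conv_lhs => rw [h2]
          rw [Complex.norm_real, Real.norm_eq_abs, abs_of_pos hre]
        rw [h2, ← h3, hn]
        simp
      filter_upwards [Ioo_mem_nhdsGT (div_pos him hre)] with c hc hmem
      have := hc.2
      rw [lt_div_iff₀ hre] at this
      exact lt_asymm this hmem.2
    · exact Eventually.of_forall fun c h => hre h.1
  have h2 : ∀ᶠ c in 𝓝[>] (0 : ℝ), ∀ p p' : Option (Fin m), p ≠ p' →
      S.rot p' * (S.rot p)⁻¹ ∉ cone c := by
    refine eventually_all.2 fun p => eventually_all.2 fun p' => ?_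
    by_cases hp : p = p'
    · exact Eventually.of_forall fun _ h => absurd hp h
    · exact (h1 p p' hp).mono fun _ h _ => h
  filter_upwards [h2] with c hc p u hu him
  rintro ⟨p', r, hr, he⟩
  have he' : u = r * (S.rot p' * (S.rot p)⁻¹) := by
    rw [← mul_assoc, ← point_eq, ← he, mul_assoc, mul_inv_cancel₀ (S.rot_ne_zero p), mul_one]
  by_cases hp : p = p'
  · subst hp
    rw [mul_inv_cancel₀ (S.rot_ne_zero p), mul_one] at he'
    exact him (by simp [he'])
  · have hr0 : 0 < r := by
      refine lt_of_le_of_ne hr fun h => ?_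
      rw [← h, Complex.ofReal_zero, zero_mul] at he'
      exact ne_zero_of_mem_cone hu he'
    refine hc p p' hp ?_
    rw [he'] at hu
    obtain ⟨h3, h4⟩ := hu
    rw [Complex.re_ofReal_mul] at h3 h4
    rw [Complex.im_ofReal_mul, abs_mul, abs_of_pos hr0] at h4
    refine ⟨pos_of_mul_pos_right h3 hr0.le, ?_⟩
    nlinarith

/-- The angle of a ray has positive distance from ±π, so for a thin cone the arguments add without
wrapping around. Thus hypotheses on sectors become statements on cones. -/
lemma eventually_cone_sector (j : Fin m) {δ : ℝ} (hδ : 0 < δ) :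
    ∀ᶠ c in 𝓝[>] (0 : ℝ), ∀ u ∈ cone c, u * S.rot (some j) ∈ S.sector j δ := by
  have hj := S.angle_mem j
  have hε : 0 < min δ (min (Real.pi - S.angle j) (S.angle j + Real.pi)) :=
    lt_min hδ (lt_min (by linarith [hj.2]) (by linarith [hj.1]))
  filter_upwards [eventually_abs_arg_lt hε] with c hc u hu
  have h1 := hc u hu
  rw [lt_min_iff, lt_min_iff] at h1
  have h2 := abs_lt.1 h1.2.1
  have h3 := abs_lt.1 h1.2.2
  have hu0 := ne_zero_of_mem_cone hu
  have harg : Complex.arg (S.rot (some j)) = S.angle j := S.arg_rot _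
  have h4 : Complex.arg (u * S.rot (some j)) = Complex.arg u + S.angle j := by
    rw [← harg]
    refine (Complex.arg_mul_eq_add_arg_iff hu0 (S.rot_ne_zero _)).2 ?_
    rw [harg]
    constructor <;> linarith [h2.1, h2.2, h3.1, h3.2]
  refine ⟨?_, ?_⟩
  · rw [Complex.mem_slitPlane_iff_arg]
    refine ⟨?_, mul_ne_zero hu0 (S.rot_ne_zero _)⟩
    rw [h4]
    linarith [h2.2]
  · rw [h4, add_sub_cancel_right]
    exact h1.1

/-- A cone is good if it meets the contour in the central piece only. -/
def GoodCone (c : ℝ) : Prop := 0 < c ∧ ∀ p, ∀ u ∈ cone c, u.im ≠ 0 → u * S.rot p ∉ S.carrier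

lemma exists_goodCone : ∃ c, S.GoodCone c := by
  obtain ⟨c, h1, h2⟩ := (S.eventually_cone_good.and self_mem_nhdsWithin).exists
  exact ⟨c, h2, h1⟩

variable {S}

lemma GoodCone.mem_side {c : ℝ} (hc : S.GoodCone c) {p : Option (Fin m)} {s : ℤˣ} {u : ℂ}
    (hu : u ∈ cone c) (h : 0 < ((s : ℤ) : ℝ) * u.im) : u * S.rot p ∈ S.side p s := by
  rw [S.mem_side, mul_assoc, mul_inv_cancel₀ (S.rot_ne_zero p), mul_one]
  refine ⟨hc.2 p u hu fun h0 => ?_, h⟩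
  rw [h0, mul_zero] at h
  exact lt_irrefl _ h

variable (S)

lemma tendsto_mul_rot (p : Option (Fin m)) (r : ℝ) :
    Tendsto (fun u : ℂ => u * S.rot p) (𝓝 (r : ℂ)) (𝓝 (S.point p r)) :=
  Continuous.tendsto (by fun_prop : Continuous fun u : ℂ => u * S.rot p) _

lemma tendsto_mul_rot_inv (p : Option (Fin m)) (r : ℝ) :
    Tendsto (fun z : ℂ => z * (S.rot p)⁻¹) (𝓝 (S.point p r)) (𝓝 (r : ℂ)) := by
  have : Tendsto (fun z : ℂ => z * (S.rot p)⁻¹) (𝓝 (S.point p r))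
      (𝓝 (S.point p r * (S.rot p)⁻¹)) := Continuous.tendsto (by fun_prop) _
  rwa [point_eq, mul_assoc, mul_inv_cancel₀ (S.rot_ne_zero p), mul_one] at this

/-- In a good cone no other piece interferes, so a one-sided limit at the contour restricts to a
limit in a half plane after rotation. -/
lemma tendsto_mul_rot_side {c : ℝ} (hc : S.GoodCone c) (p : Option (Fin m)) (s : ℤˣ) {r : ℝ}
    (hr : 0 < r) : Tendsto (fun u : ℂ => u * S.rot p) (𝓝[{u | 0 < ((s : ℤ) : ℝ) * u.im}] (r : ℂ))
      (𝓝[S.side p s] (S.point p r)) := by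
  refine tendsto_nhdsWithin_iff.2 ⟨(S.tendsto_mul_rot p r).mono_left nhdsWithin_le_nhds, ?_⟩
  filter_upwards [self_mem_nhdsWithin, mem_nhdsWithin_of_mem_nhds
    ((isOpen_cone c).mem_nhds (ofReal_mem_cone hc.1 hr))] with u hu hu'
  exact hc.mem_side hu' hu

lemma neBot_half (s : ℤˣ) (r : ℝ) : (𝓝[{u : ℂ | 0 < ((s : ℤ) : ℝ) * u.im}] (r : ℂ)).NeBot := by
  rw [← mem_closure_iff_nhdsWithin_neBot]
  have h1 : Tendsto (fun ε : ℝ => (r : ℂ) + (((s : ℤ) : ℝ) : ℂ) * (ε : ℂ) * Complex.I) (𝓝[>] 0)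
      (𝓝 (r : ℂ)) := by
    have : Tendsto (fun ε : ℝ => (r : ℂ) + (((s : ℤ) : ℝ) : ℂ) * (ε : ℂ) * Complex.I) (𝓝 0)
        (𝓝 ((r : ℂ) + (((s : ℤ) : ℝ) : ℂ) * ((0 : ℝ) : ℂ) * Complex.I)) :=
      Continuous.tendsto (by fun_prop) 0
    simp only [Complex.ofReal_zero, mul_zero, zero_mul, add_zero] at this
    exact this.mono_left nhdsWithin_le_nhds
  refine mem_closure_of_tendsto h1 ?_
  filter_upwards [self_mem_nhdsWithin] with ε hε
  have hε : 0 < ε := hε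
  rcases Int.units_eq_one_or s with rfl | rfl <;> simpa using hε

lemma neBot_side (p : Option (Fin m)) (s : ℤˣ) (r : {r : ℝ // 0 < r}) :
    (𝓝[S.side p s] (S.point p r)).NeBot := by
  obtain ⟨c, hc⟩ := S.exists_goodCone
  have := neBot_half s (r : ℝ)
  exact (S.tendsto_mul_rot_side hc p s r.2).neBot

lemma nhdsWithin_side_neBot (p : Option (Fin m)) (s : ℤˣ) {r : ℝ} (hr : 0 < r) :
    (𝓝[S.side p s] (S.point p r)).NeBot := S.neBot_side p s ⟨r, hr⟩

lemma boundaryValue_eq {F : ℂ → Mat} {p : Option (Fin m)} {s : ℤˣ} {r : ℝ} {y : Mat} (hr : 0 < r)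
    (h : Tendsto F (𝓝[S.side p s] (S.point p r)) (𝓝 y)) : S.boundaryValue F p s r = y := by
  have := S.nhdsWithin_side_neBot p s hr
  exact h.limUnder_eq

/-- Off the contour the rotated coordinate of a nearby point has nonzero imaginary part, whose sign
decides the side. Hence equal limits from the two sides give a limit off the contour. -/
lemma nhdsWithin_compl_le (p : Option (Fin m)) {r : ℝ} (hr : 0 < r) :
    𝓝[S.carrierᶜ] (S.point p r) ≤ 𝓝[S.side p 1] (S.point p r) ⊔ 𝓝[S.side p (-1)] (S.point p r) := by
  rw [← nhdsWithin_union]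
  refine nhdsWithin_le_iff.2 ?_
  obtain ⟨c, hc⟩ := S.exists_goodCone
  filter_upwards [self_mem_nhdsWithin, mem_nhdsWithin_of_mem_nhds ((S.tendsto_mul_rot_inv p r)
    ((isOpen_cone c).mem_nhds (ofReal_mem_cone hc.1 hr)))] with z hz hz'
  rcases lt_trichotomy (z * (S.rot p)⁻¹).im 0 with h | h | h
  · right
    refine S.mem_side.2 ⟨hz, ?_⟩
    rw [Units.val_neg, Units.val_one, Int.cast_neg, Int.cast_one, neg_one_mul]
    exact neg_pos.2 h
  · exfalso
    refine hz ?_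
    rw [carrier_eq]
    exact Set.mem_iUnion.2 ⟨p, h, (show _ < _ from hz'.1).le⟩
  · left
    refine S.mem_side.2 ⟨hz, ?_⟩
    rw [Units.val_one, Int.cast_one, one_mul]
    exact h

lemma mem_carrier_cases {z : ℂ} (hz : z ∈ S.carrier) (h0 : z ≠ 0) :
    ∃ p r, 0 < r ∧ z = S.point p r := by
  obtain ⟨p, r, hr, rfl⟩ := hz
  refine ⟨p, r, lt_of_le_of_ne hr fun h => h0 ?_, rfl⟩
  simp [point_eq, ← h]

/-- Every point of a piece other than the origin is a limit of points on its sides, and the origin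
is a limit of points different from it. Identities and bounds off the contour therefore extend by
continuity. -/
lemma dense_compl : Dense S.carrierᶜ := by
  have h1 : ∀ z, z ≠ 0 → z ∈ closure S.carrierᶜ := by
    intro z hz
    by_cases hm : z ∈ S.carrier
    · obtain ⟨p, r, hr, rfl⟩ := S.mem_carrier_cases hm hz
      have := S.nhdsWithin_side_neBot p 1 hr
      exact closure_mono (S.side_subset p 1) (mem_closure_iff_nhdsWithin_neBot.2 this)
    · exact subset_closure hm
  intro z
  by_cases hz : z = 0
  · subst hz
    have : closure ({0}ᶜ : Set ℂ) ⊆ closure S.carrierᶜ := closure_minimal (fun z hz => h1 z hz)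
      isClosed_closure
    exact this ((dense_compl_singleton (0 : ℂ)) 0)
  · exact h1 z hz

/-- A function without jump, bounded near the origin, extends to an entire function. -/
lemma exists_entire {h : ℂ → ℂ} (hd : DifferentiableOn ℂ h S.carrierᶜ)
    (hb : ∃ C, ∀ᶠ z in 𝓝[S.carrierᶜ] 0, ‖h z‖ ≤ C)
    (hj : ∀ p r, 0 < r → ∃ y, ∀ s, Tendsto h (𝓝[S.side p s] (S.point p r)) (𝓝 y)) :
    ∃ g : ℂ → ℂ, Differentiable ℂ g ∧ ∀ z ∉ S.carrier, g z = h z := by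
  -- The extension by continuity is holomorphic across each open ray by the Morera argument in a
  -- rotated cone. The origin is then an isolated singularity, removable because h is bounded near
  -- it.
  set g := extendFrom S.carrierᶜ h with hg
  have hgh : ∀ z ∉ S.carrier, g z = h z := extendFrom_extends hd.continuousOn
  have hlim : ∀ z ≠ 0, ∃ y, Tendsto h (𝓝[S.carrierᶜ] z) (𝓝 y) := by
    intro z hz
    by_cases hm : z ∈ S.carrier
    · obtain ⟨p, r, hr, rfl⟩ := S.mem_carrier_cases hm hz
      obtain ⟨y, hy⟩ := hj p r hr
      exact ⟨y, ((hy 1).sup (hy (-1))).mono_left (S.nhdsWithin_compl_le p hr)⟩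
    · exact ⟨_, hd.continuousOn z hm⟩
  have hgl : ∀ z ≠ 0, Tendsto h (𝓝[S.carrierᶜ] z) (𝓝 (g z)) := fun z hz =>
    tendsto_extendFrom (hlim z hz)
  have hgc : ContinuousOn g {0}ᶜ :=
    continuousOn_extendFrom (fun z _ => S.dense_compl z) hlim
  have hgd0 : ∀ z ∉ S.carrier, DifferentiableAt ℂ g z := fun z hz =>
    (hd.differentiableAt (S.isOpen_compl.mem_nhds hz)).congr_of_eventuallyEq
      ((S.isOpen_compl.eventually_mem hz).mono hgh)
  obtain ⟨c, hc⟩ := S.exists_goodCone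
  have hgd : DifferentiableOn ℂ g {0}ᶜ := by
    intro z hz
    apply DifferentiableAt.differentiableWithinAt
    by_cases hm : z ∈ S.carrier
    · obtain ⟨p, r, hr, rfl⟩ := S.mem_carrier_cases hm hz
      have h1 : DifferentiableOn ℂ (fun u => g (u * S.rot p)) (cone c) := by
        refine differentiableOn_of_continuousOn_off_real (isOpen_cone c) ?_ fun u hu him => ?_
        · exact hgc.comp (by fun_prop) fun u hu =>
            mul_ne_zero (ne_zero_of_mem_cone hu) (S.rot_ne_zero p)
        · exact (hgd0 _ (hc.2 p u hu him)).comp u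
            (by fun_prop : DifferentiableAt ℂ (fun u => u * S.rot p) u)
      have h2 : DifferentiableAt ℂ (fun u => g (u * S.rot p)) (S.point p r * (S.rot p)⁻¹) := by
        rw [point_eq, mul_assoc, mul_inv_cancel₀ (S.rot_ne_zero p), mul_one]
        exact h1.differentiableAt ((isOpen_cone c).mem_nhds (ofReal_mem_cone hc.1 hr))
      have h3 := h2.comp (S.point p r) (by fun_prop : DifferentiableAt ℂ (fun z => z * (S.rot p)⁻¹) _)
      refine h3.congr_of_eventuallyEq (Eventually.of_forall fun z => ?_)
      simp [S.rot_ne_zero p]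
    · exact hgd0 z hm
  obtain ⟨C, hC⟩ := hb
  obtain ⟨ε, hε, hsub⟩ := Metric.mem_nhdsWithin_iff.1 hC
  have hbd : ∀ z ∈ Metric.ball (0 : ℂ) ε \ {0}, ‖g z‖ ≤ C := by
    intro z hz
    have := mem_closure_iff_nhdsWithin_neBot.1 (S.dense_compl z)
    refine le_of_tendsto (hgl z hz.2).norm ?_
    filter_upwards [self_mem_nhdsWithin, mem_nhdsWithin_of_mem_nhds
      (Metric.isOpen_ball.mem_nhds hz.1)] with w hw hw'
    exact hsub ⟨hw', hw⟩
  have h4 := Complex.differentiableOn_update_limUnder_of_bddAbove (f := g) (c := 0)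
    (s := Metric.ball (0 : ℂ) ε) (Metric.ball_mem_nhds 0 hε)
    (hgd.mono fun z hz => hz.2) ⟨C, by rintro _ ⟨z, hz, rfl⟩; exact hbd z hz⟩
  refine ⟨Function.update g 0 (limUnder (𝓝[≠] 0) g), fun z => ?_, fun z hz => ?_⟩
  · by_cases hz : z = 0
    · subst hz
      exact h4.differentiableAt (Metric.ball_mem_nhds 0 hε)
    · refine (hgd.differentiableAt (isOpen_compl_singleton.mem_nhds hz)).congr_of_eventuallyEq ?_
      filter_upwards [isOpen_compl_singleton.mem_nhds hz] with w hw
      exact Function.update_of_ne hw _ _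
  · rw [Function.update_of_ne (S.ne_zero_of_notMem hz), hgh z hz]

/-- Analytic continuation of a sectionally holomorphic matrix through a piece of the contour. -/
lemma exists_continuation {c : ℝ} (hc : S.GoodCone c) (p : Option (Fin m)) (s : ℤˣ) {Γ : ℂ → Mat}
    (hd : ∀ i j, DifferentiableOn ℂ (fun z => Γ z i j) S.carrierᶜ)
    (hb : ∀ s, ∀ r : ℝ, 0 < r →
      Tendsto Γ (𝓝[S.side p s] (S.point p r)) (𝓝 (S.boundaryValue Γ p s r)))
    (hbc : ContinuousOn (S.boundaryValue Γ p s) (Set.Ioi 0)) {N : ℂ → Mat}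
    (hN : ∀ i j, DifferentiableOn ℂ (fun u => N u i j) (cone c))
    (hj : ∀ r : ℝ, 0 < r → S.boundaryValue Γ p s r = S.boundaryValue Γ p (-s) r * N r) :
    ∃ G : ℂ → Mat, (∀ i j, DifferentiableOn ℂ (fun u => G u i j) (cone c)) ∧
      (∀ u ∈ cone c, 0 < ((s : ℤ) : ℝ) * u.im → G u = Γ (u * S.rot p)) ∧
      (∀ u ∈ cone c, ((s : ℤ) : ℝ) * u.im < 0 → G u = Γ (u * S.rot p) * N u) ∧
      ∀ r : ℝ, 0 < r → G r = S.boundaryValue Γ p s r := by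
  have hs : ((s : ℤ) : ℝ) ≠ 0 := by exact_mod_cast s.ne_zero
  -- On the side s this is Γ, on the opposite side Γ N; the jump relation is exactly the continuity
  -- of the result across the ray, and continuity suffices for holomorphy.
  set G : ℂ → Mat := fun u => if 0 < ((s : ℤ) : ℝ) * u.im then Γ (u * S.rot p)
    else if ((s : ℤ) : ℝ) * u.im < 0 then Γ (u * S.rot p) * N u
    else S.boundaryValue Γ p s u.re with hG
  have h1 : ∀ u, 0 < ((s : ℤ) : ℝ) * u.im → G u = Γ (u * S.rot p) := fun u h => if_pos h
  have h2 : ∀ u, ((s : ℤ) : ℝ) * u.im < 0 → G u = Γ (u * S.rot p) * N u := fun u h => by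
    simp only [hG, if_neg (lt_asymm h), if_pos h]
  have h3 : ∀ u, u.im = 0 → G u = S.boundaryValue Γ p s u.re := fun u h => by
    simp only [hG, h, mul_zero, lt_irrefl, if_false]
  have hNc : ContinuousOn N (cone c) :=
    continuousOn_pi.2 fun i => continuousOn_pi.2 fun j => (hN i j).continuousOn
  have hΓd : ∀ u ∈ cone c, u.im ≠ 0 → ∀ i j, DifferentiableAt ℂ (fun u => Γ (u * S.rot p) i j) u :=
    fun u hu him i j => by
      have := ((hd i j).differentiableAt (S.isOpen_compl.mem_nhds (hc.2 p u hu him)))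
      exact this.comp u (by fun_prop : DifferentiableAt ℂ (fun u => u * S.rot p) u)
  have hopen1 : IsOpen {u : ℂ | 0 < ((s : ℤ) : ℝ) * u.im} :=
    isOpen_lt continuous_const (continuous_const.mul Complex.continuous_im)
  have hopen2 : IsOpen {u : ℂ | ((s : ℤ) : ℝ) * u.im < 0} :=
    isOpen_lt (continuous_const.mul Complex.continuous_im) continuous_const
  have hGd : ∀ u ∈ cone c, u.im ≠ 0 → ∀ i j, DifferentiableAt ℂ (fun u => G u i j) u := by
    intro u hu him i j
    rcases lt_or_gt_of_ne (mul_ne_zero hs him) with h | h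
    · refine DifferentiableAt.congr_of_eventuallyEq (f₁ := fun u => G u i j)
        (f := fun u => (Γ (u * S.rot p) * N u) i j) ?_
        ((hopen2.eventually_mem h).mono fun w hw => by simp only [h2 w hw])
      simp only [Matrix.mul_apply]
      exact DifferentiableAt.fun_sum fun k _ => (hΓd u hu him i k).mul
        ((hN k j).differentiableAt ((isOpen_cone c).mem_nhds hu))
    · exact (hΓd u hu him i j).congr_of_eventuallyEq
        ((hopen1.eventually_mem h).mono fun w hw => by simp only [h1 w hw])
  have hGc : ContinuousOn G (cone c) := by
    intro u hu
    apply ContinuousAt.continuousWithinAt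
    by_cases him : u.im = 0
    · obtain ⟨r, rfl⟩ : ∃ r : ℝ, u = r := ⟨u.re, Complex.ext (by simp) (by simp [him])⟩
      have hr : 0 < r := by simpa using hu.1
      have e0 : G r = S.boundaryValue Γ p s r := by rw [h3 _ him, Complex.ofReal_re]
      have t1 : Tendsto G (𝓝[{u : ℂ | 0 < ((s : ℤ) : ℝ) * u.im}] (r : ℂ)) (𝓝 (G r)) := by
        rw [e0]
        refine ((hb s r hr).comp (S.tendsto_mul_rot_side hc p s hr)).congr' ?_
        filter_upwards [self_mem_nhdsWithin] with w hw
        exact (h1 w hw).symm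
      have t2 : Tendsto G (𝓝[{u : ℂ | 0 < (((-s : ℤˣ) : ℤ) : ℝ) * u.im}] (r : ℂ)) (𝓝 (G r)) := by
        rw [e0, hj r hr]
        refine (((hb (-s) r hr).comp (S.tendsto_mul_rot_side hc p (-s) hr)).mul
          ((hNc.continuousAt ((isOpen_cone c).mem_nhds hu)).tendsto.mono_left
            nhdsWithin_le_nhds)).congr' ?_
        filter_upwards [self_mem_nhdsWithin] with w hw
        exact (h2 w (by simpa using hw)).symm
      have t3 : Tendsto G (𝓝[{u : ℂ | u.im = 0}] (r : ℂ)) (𝓝 (G r)) := by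
        rw [e0]
        have h5 : Tendsto (S.boundaryValue Γ p s) (𝓝 r) (𝓝 (S.boundaryValue Γ p s r)) :=
          hbc.continuousAt (Ioi_mem_nhds hr)
        have h6 : Tendsto (fun u : ℂ => u.re) (𝓝[{u : ℂ | u.im = 0}] (r : ℂ)) (𝓝 r) :=
          (Complex.continuous_re.tendsto' (r : ℂ) r (by simp)).mono_left nhdsWithin_le_nhds
        refine (h5.comp h6).congr' ?_
        filter_upwards [self_mem_nhdsWithin] with w hw
        exact (h3 w hw).symm
      have hU : 𝓝 (r : ℂ) ≤ 𝓝[{u : ℂ | 0 < ((s : ℤ) : ℝ) * u.im}] (r : ℂ) ⊔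
          𝓝[{u : ℂ | 0 < (((-s : ℤˣ) : ℤ) : ℝ) * u.im}] (r : ℂ) ⊔
          𝓝[{u : ℂ | u.im = 0}] (r : ℂ) := by
        rw [← nhdsWithin_union, ← nhdsWithin_union, ← nhdsWithin_univ]
        refine nhdsWithin_mono _ fun w _ => ?_
        rcases lt_trichotomy (((s : ℤ) : ℝ) * w.im) 0 with h | h | h
        · left; right
          simpa using h
        · right
          exact (mul_eq_zero.1 h).resolve_left hs
        · left; left
          exact h
      exact ((t1.sup t2).sup t3).mono_left hU
    · exact continuousAt_pi.2 fun i => continuousAt_pi.2 fun j => (hGd u hu him i j).continuousAt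
  refine ⟨G, fun i j => ?_, fun u _ => h1 u, fun u _ => h2 u, fun r hr => by
    rw [h3 _ (by simp), Complex.ofReal_re]⟩
  refine differentiableOn_of_continuousOn_off_real (isOpen_cone c) ?_ fun u hu him =>
    hGd u hu him i j
  exact fun u hu => ((continuousWithinAt_pi.1 ((continuousWithinAt_pi.1 (hGc u hu)) i)) j)

end RayContour

end

/-! ### Behaviour of a solution at infinity; determinant and growth. -/

section

lemma norm_cpow_quarter (z : ℂ) : ‖z ^ (1 / 4 : ℂ)‖ = ‖z‖ ^ (1 / 4 : ℝ) := by
  have := Complex.norm_cpow_real z (1 / 4)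
  push_cast at this
  exact this

lemma csqrt_sq (z : ℂ) : csqrt z ^ 2 = z := by
  simp [csqrt]

lemma norm_csqrt (z : ℂ) : ‖csqrt z‖ = ‖z‖ ^ (1 / 2 : ℝ) := by
  simpa [csqrt] using Complex.norm_cpow_real z (1 / 2)

lemma csqrt_ne_zero {z : ℂ} (hz : z ≠ 0) : csqrt z ≠ 0 := fun h => hz (by
  rw [← csqrt_sq z, h]; simp)

lemma quarter_sq (z : ℂ) : (z ^ (1 / 4 : ℂ)) ^ 2 = csqrt z := by
  rw [← Complex.cpow_nat_mul, csqrt]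
  norm_num

lemma quarter_ne_zero {z : ℂ} (hz : z ≠ 0) : z ^ (1 / 4 : ℂ) ≠ 0 := fun h =>
  csqrt_ne_zero hz (by rw [← quarter_sq, h]; simp)

lemma sqrt_two_inv_sq : (((Real.sqrt 2 : ℝ) : ℂ)⁻¹) ^ 2 = 1 / 2 := by
  rw [inv_pow, ← Complex.ofReal_pow, Real.sq_sqrt (by norm_num)]
  norm_num

lemma det_eMat : eMat.det = 1 := by
  have h := sqrt_two_inv_sq
  simp only [eMat, Matrix.det_smul, Matrix.det_fin_two_of, Fintype.card_fin, h]
  simp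
  norm_num

lemma det_quarterPowNeg {z : ℂ} (hz : z ≠ 0) : (quarterPowNeg z).det = 1 := by
  rw [quarterPowNeg, Matrix.det_fin_two_of, inv_mul_cancel₀ (quarter_ne_zero hz)]
  simp

lemma det_frame {z : ℂ} (hz : z ≠ 0) : (quarterPowNeg z * eMat).det = 1 := by
  rw [Matrix.det_mul, det_quarterPowNeg hz, det_eMat, one_mul]

/-- The growth exponents of the rows of a solution at infinity. -/
def wt (i : Fin 2) : ℝ := ((i : ℕ) : ℝ) / 2 - 1 / 4

lemma wt_zero : wt 0 = -(1 / 4) := by norm_num [wt]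

lemma wt_one : wt 1 = 1 / 4 := by norm_num [wt]

lemma abs_wt (i : Fin 2) : |wt i| = 1 / 4 := by
  fin_cases i <;> norm_num [wt, abs_of_nonneg]

lemma norm_eMat_le (i j : Fin 2) : ‖eMat i j‖ ≤ 1 := by
  have h : |Real.sqrt 2|⁻¹ ≤ 1 := by
    rw [abs_of_nonneg (Real.sqrt_nonneg 2)]
    exact inv_le_one_of_one_le₀ (Real.one_le_sqrt.2 (by norm_num))
  fin_cases i <;> fin_cases j <;> simpa [eMat] using h

lemma norm_frame_le (z : ℂ) (i j : Fin 2) : ‖(quarterPowNeg z * eMat) i j‖ ≤ ‖z‖ ^ wt i := by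
  have h1 : (quarterPowNeg z * eMat) i j = quarterPowNeg z i i * eMat i j := by
    fin_cases i <;> simp [quarterPowNeg, Matrix.mul_apply, Fin.sum_univ_two]
  have h2 : ‖quarterPowNeg z i i‖ = ‖z‖ ^ wt i := by
    have h3 := norm_cpow_quarter z
    rw [one_div, one_div] at h3
    fin_cases i
    · simp [quarterPowNeg, wt_zero, Real.rpow_neg, h3]
    · simp [quarterPowNeg, wt_one, h3]
  rw [h1, norm_mul, h2]
  exact mul_le_of_le_one_right (by positivity) (norm_eMat_le i j)

/-- The solution in the frame of its leading behaviour at infinity. -/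
def frameCoord (F : ℂ → Mat) (z : ℂ) : Mat := (quarterPowNeg z * eMat)⁻¹ * F z

lemma frame_mul_frameCoord (F : ℂ → Mat) {z : ℂ} (hz : z ≠ 0) :
    quarterPowNeg z * eMat * frameCoord F z = F z := by
  rw [frameCoord, ← mul_assoc, Matrix.mul_nonsing_inv _ (by rw [det_frame hz]; exact isUnit_one),
    one_mul]

lemma norm_le_of_frameCoord {F : ℂ → Mat} {z : ℂ} (hz : z ≠ 0) {K : ℝ} {j : Fin 2}
    (h : ∀ k, ‖frameCoord F z k j‖ ≤ K) (i : Fin 2) : ‖F z i j‖ ≤ 2 * K * ‖z‖ ^ wt i := by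
  rw [← frame_mul_frameCoord F hz, Matrix.mul_apply, Fin.sum_univ_two]
  have h0 : 0 ≤ ‖z‖ ^ wt i := by positivity
  calc _ ≤ ‖(quarterPowNeg z * eMat) i 0‖ * ‖frameCoord F z 0 j‖ +
        ‖(quarterPowNeg z * eMat) i 1‖ * ‖frameCoord F z 1 j‖ := by
        rw [← norm_mul, ← norm_mul]; exact norm_add_le _ _
    _ ≤ ‖z‖ ^ wt i * K + ‖z‖ ^ wt i * K := by
        gcongr
        · exact norm_frame_le z i 0
        · exact h 0
        · exact norm_frame_le z i 1
        · exact h 1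
    _ = _ := by ring

namespace RayContour

variable {m : ℕ} (S : RayContour m)

/-- By density and continuity. The radius |ρ| + 1 makes z nonzero, so that the power is continuous
there, and leaves nearby points beyond ρ. -/
lemma le_of_forall_notMem {g : ℂ → ℂ} (hg : Continuous g) {C ρ e : ℝ}
    (h : ∀ z ∉ S.carrier, ρ ≤ ‖z‖ → ‖g z‖ ≤ C * ‖z‖ ^ e) {z : ℂ} (hz : |ρ| + 1 ≤ ‖z‖) :
    ‖g z‖ ≤ C * ‖z‖ ^ e := by
  have hz0 : 0 < ‖z‖ := by linarith [abs_nonneg ρ]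
  have := mem_closure_iff_nhdsWithin_neBot.1 (S.dense_compl z)
  have h1 : Tendsto (fun w => ‖g w‖) (𝓝[S.carrierᶜ] z) (𝓝 ‖g z‖) :=
    (hg.norm.tendsto z).mono_left nhdsWithin_le_nhds
  have h2 : Tendsto (fun w : ℂ => C * ‖w‖ ^ e) (𝓝[S.carrierᶜ] z) (𝓝 (C * ‖z‖ ^ e)) := by
    refine Tendsto.mono_left ?_ nhdsWithin_le_nhds
    exact ((continuous_norm.tendsto z).rpow_const (Or.inl hz0.ne')).const_mul C
  refine le_of_tendsto_of_tendsto h1 h2 ?_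
  have h3 : ∀ᶠ w in 𝓝 z, ρ < ‖w‖ := (continuous_norm.tendsto z).eventually_const_lt (by
    linarith [le_abs_self ρ])
  filter_upwards [self_mem_nhdsWithin, nhdsWithin_le_nhds h3] with w hw hw'
  exact h w hw hw'.le

/-- A function without jump and of polynomial growth is a polynomial. -/
lemma exists_polynomial {h : ℂ → ℂ} (hd : DifferentiableOn ℂ h S.carrierᶜ)
    (hb : ∃ C, ∀ᶠ z in 𝓝[S.carrierᶜ] 0, ‖h z‖ ≤ C)
    (hj : ∀ p r, 0 < r → ∃ y, ∀ s, Tendsto h (𝓝[S.side p s] (S.point p r)) (𝓝 y))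
    {C ρ e : ℝ} {N : ℕ} (heN : e < N) (hg : ∀ z ∉ S.carrier, ρ ≤ ‖z‖ → ‖h z‖ ≤ C * ‖z‖ ^ e) :
    ∃ p : Polynomial ℂ, p.degree < N ∧ ∀ z ∉ S.carrier, h z = p.eval z := by
  obtain ⟨g, hgd, hgh⟩ := S.exists_entire hd hb hj
  obtain ⟨p, hp, hp'⟩ := exists_polynomial_of_growth hgd (C := C) (ρ := |ρ| + 1) heN fun z hz =>
    S.le_of_forall_notMem hgd.continuous (fun w hw hw' => by rw [hgh w hw]; exact hg w hw hw') hz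
  exact ⟨p, hp, fun z hz => by rw [← hgh z hz, hp' z]⟩

lemma exists_notMem_large (R : ℝ) : ∃ z ∉ S.carrier, R ≤ ‖z‖ := by
  have h1 : IsOpen {z : ℂ | R < ‖z‖} := isOpen_lt continuous_const continuous_norm
  have h2 : ({z : ℂ | R < ‖z‖}).Nonempty := ⟨((|R| + 1 : ℝ) : ℂ), by
    simp only [Set.mem_ofPred_eq, Complex.norm_real, Real.norm_eq_abs]
    rw [abs_of_pos (by positivity)]
    linarith [le_abs_self R]⟩
  obtain ⟨z, hz, hz'⟩ := S.dense_compl.inter_open_nonempty _ h1 h2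
  exact ⟨z, hz', le_of_lt hz⟩

end RayContour

variable {m : ℕ} {S : RayContour m}

lemma remainderBound_one {Γ : ℂ → Mat} {Y : ℕ → Mat} {C ρ : ℝ} (h : RemainderBound S Γ Y 1 C ρ)
    {z : ℂ} (hz : z ∉ S.carrier) (hρ : ρ ≤ ‖z‖) (i j : Fin 2) :
    ‖(frameCoord Γ z - Y 0) i j‖ ≤ C * ‖z‖ ^ (-(1 / 2) : ℝ) := by
  have := h z hz hρ i j
  simp only [Finset.range_one, Finset.sum_singleton, pow_zero, one_smul, Nat.cast_one] at this
  rw [frameCoord]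
  convert this using 3
  norm_num

/-- Both coefficients are the limit of the solution in its frame. The locally uniform expansion of a
family comes with coefficients of its own, without a normalization; the comparison with the
expansion at fixed t shows that the first one is the identity. -/
lemma zeroth_coefficient_unique {Γ : ℂ → Mat} {Y Y' : ℕ → Mat} {C ρ C' ρ' : ℝ}
    (h : RemainderBound S Γ Y 1 C ρ) (h' : RemainderBound S Γ Y' 1 C' ρ') : Y 0 = Y' 0 := by
  ext i j
  rw [← sub_eq_zero, ← norm_le_zero_iff]
  have hb : ∀ R : ℝ, max (max ρ ρ') 1 ≤ R → ‖Y 0 i j - Y' 0 i j‖ ≤ (|C| + |C'|) * R ^ (-(1 / 2) : ℝ) := by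
    intro R hR
    obtain ⟨z, hz, hzR⟩ := S.exists_notMem_large R
    have h1 := remainderBound_one h hz ((le_max_left _ _).trans
      ((le_max_left _ _).trans (hR.trans hzR))) i j
    have h2 := remainderBound_one h' hz ((le_max_right _ _).trans
      ((le_max_left _ _).trans (hR.trans hzR))) i j
    have hR1 : (0 : ℝ) < R := lt_of_lt_of_le one_pos ((le_max_right _ _).trans hR)
    have h3 : ‖z‖ ^ (-(1 / 2) : ℝ) ≤ R ^ (-(1 / 2) : ℝ) :=
      Real.rpow_le_rpow_of_nonpos hR1 hzR (by norm_num)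
    have e : Y 0 i j - Y' 0 i j = (frameCoord Γ z - Y' 0) i j - (frameCoord Γ z - Y 0) i j := by
      simp only [Matrix.sub_apply]; ring
    rw [e]
    calc _ ≤ _ := norm_sub_le _ _
      _ ≤ |C'| * R ^ (-(1 / 2) : ℝ) + |C| * R ^ (-(1 / 2) : ℝ) := by
        refine add_le_add (h2.trans ?_) (h1.trans ?_)
        · exact mul_le_mul (le_abs_self _) h3 (by positivity) (abs_nonneg _)
        · exact mul_le_mul (le_abs_self _) h3 (by positivity) (abs_nonneg _)
      _ = _ := by ring
  have hl : Tendsto (fun R : ℝ => (|C| + |C'|) * R ^ (-(1 / 2) : ℝ)) atTop (𝓝 0) := by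
    have := (tendsto_rpow_neg_atTop (show (0 : ℝ) < 1 / 2 by norm_num)).const_mul (|C| + |C'|)
    rwa [mul_zero] at this
  exact ge_of_tendsto hl (eventually_atTop.2 ⟨_, hb⟩)

namespace IsRHPSolution

variable {M : Option (Fin m) → ℝ → Mat} {Γ : ℂ → Mat}

lemma exists_near_one (h : IsRHPSolution S M Γ) : ∃ C ρ : ℝ, 0 < C ∧ 1 ≤ ρ ∧
    ∀ z ∉ S.carrier, ρ ≤ ‖z‖ → ∀ i j, ‖(frameCoord Γ z - 1) i j‖ ≤ C * ‖z‖ ^ (-(1 / 2) : ℝ) := by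
  obtain ⟨Y, a, h0, -, h1⟩ := h.expansion
  obtain ⟨C, ρ, hC⟩ := h1 1
  refine ⟨|C| + 1, max ρ 1, by positivity, le_max_right _ _, fun z hz hρ i j => ?_⟩
  rw [← h0]
  refine (remainderBound_one hC hz ((le_max_left _ _).trans hρ) i j).trans ?_
  gcongr
  linarith [le_abs_self C]

lemma differentiableOn_det (h : IsRHPSolution S M Γ) :
    DifferentiableOn ℂ (fun z => (Γ z).det) S.carrierᶜ := by
  simp only [Matrix.det_fin_two]
  exact ((h.analytic 0 0).mul (h.analytic 1 1)).sub ((h.analytic 0 1).mul (h.analytic 1 0))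

/-- If the jump matrices are unimodular, so is the solution. -/
lemma det_eq_one (h : IsRHPSolution S M Γ) (hM : ∀ p r, 0 < r → (M p r).det = 1) {z : ℂ}
    (hz : z ∉ S.carrier) : (Γ z).det = 1 := by
  obtain ⟨C, ρ, hC0, hρ1, hC⟩ := h.exists_near_one
  -- The function det Γ − 1 has no jump, because the jump matrices are unimodular; it is bounded at
  -- the origin and O(|z|^(−1/2)) at infinity. Since −1/2 < 0, the case N = 0 of Liouville's theorem
  -- makes it vanish.
  obtain ⟨p, hp, hpe⟩ := S.exists_polynomial (h := fun z => (Γ z).det - 1)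
    (h.differentiableOn_det.sub_const 1) (by
      obtain ⟨K, hK⟩ := h.locally_bounded 0
      refine ⟨2 * K ^ 2 + 1, hK.mono fun z hz => ?_⟩
      rw [Matrix.det_fin_two]
      have hK0 : 0 ≤ K := (norm_nonneg _).trans (hz 0 0)
      calc _ ≤ ‖Γ z 0 0 * Γ z 1 1‖ + ‖Γ z 0 1 * Γ z 1 0‖ + ‖(1 : ℂ)‖ :=
            (norm_sub_le _ _).trans (add_le_add_left (norm_sub_le _ _) _)
        _ ≤ K * K + K * K + 1 := by
            rw [norm_mul, norm_mul, norm_one]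
            gcongr <;> exact hz _ _
        _ = _ := by ring)
    (fun p r hr => by
      refine ⟨(S.boundaryValue Γ p 1 r).det - 1, fun s => ?_⟩
      have hd : ∀ s, Tendsto (fun z => (Γ z).det - 1) (𝓝[S.side p s] (S.point p r))
          (𝓝 ((S.boundaryValue Γ p s r).det - 1)) := fun s =>
        ((Continuous.tendsto (by fun_prop : Continuous fun A : Mat => A.det) _).comp
          (h.boundary_tendsto p s r hr)).sub_const 1
      have hj := congrArg Matrix.det (h.jump p r hr)
      rw [Matrix.det_mul, hM p r hr, mul_one, RayContour.plus, RayContour.minus] at hj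
      have e : (S.boundaryValue Γ p s r).det = (S.boundaryValue Γ p 1 r).det := by
        rcases Int.units_eq_one_or (S.sgn p) with e | e <;>
          rcases Int.units_eq_one_or s with rfl | rfl <;> rw [e] at hj <;> simp_all
      rw [← e]
      exact hd s)
    (C := 2 * C ^ 2 + 2 * C) (ρ := ρ) (e := -(1 / 2)) (N := 0) (by norm_num) (by
      intro z hz hρ
      have hz1 : 1 ≤ ‖z‖ := hρ1.trans hρ
      have hB := hC z hz hρ
      set Y := frameCoord Γ z with hY
      have e1 : (Γ z).det = Y.det := by
        rw [hY, ← frame_mul_frameCoord Γ (S.ne_zero_of_notMem hz), Matrix.det_mul,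
          det_frame (S.ne_zero_of_notMem hz), one_mul]
      set η := ‖z‖ ^ (-(1 / 2) : ℝ) with hη
      have hη0 : 0 ≤ η := by positivity
      have hη1 : η ≤ 1 := Real.rpow_le_one_of_one_le_of_nonpos hz1 (by norm_num)
      have b00 := hB 0 0
      have b01 := hB 0 1
      have b10 := hB 1 0
      have b11 := hB 1 1
      simp only [Matrix.sub_apply, Matrix.one_apply, Fin.isValue, if_true, zero_ne_one, one_ne_zero,
        if_false, sub_zero] at b00 b01 b10 b11
      have e2 : Y.det - 1 = (Y 0 0 - 1) * (Y 1 1 - 1) + (Y 0 0 - 1) + (Y 1 1 - 1) - Y 0 1 * Y 1 0 := by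
        rw [Matrix.det_fin_two]; ring
      rw [e1, e2]
      calc _ ≤ ‖Y 0 0 - 1‖ * ‖Y 1 1 - 1‖ + ‖Y 0 0 - 1‖ + ‖Y 1 1 - 1‖ + ‖Y 0 1‖ * ‖Y 1 0‖ := by
            rw [← norm_mul, ← norm_mul]
            refine (norm_sub_le _ _).trans (add_le_add_left ?_ _)
            refine (norm_add_le _ _).trans (add_le_add_left ?_ _)
            exact norm_add_le _ _
        _ ≤ (C * η) * (C * η) + C * η + C * η + (C * η) * (C * η) := by gcongr
        _ = 2 * C ^ 2 * (η * η) + 2 * C * η := by ring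
        _ ≤ 2 * C ^ 2 * (η * 1) + 2 * C * η := by gcongr
        _ = _ := by ring)
  have hp0 : p = 0 := by
    by_contra h0
    rw [Polynomial.degree_eq_natDegree h0] at hp
    exact absurd hp (by simp)
  have := hpe z hz
  rw [hp0, Polynomial.eval_zero] at this
  exact sub_eq_zero.1 this

lemma exists_bound_closedBall (h : IsRHPSolution S M Γ) (R : ℝ) : ∃ C : ℝ, 0 ≤ C ∧
    ∀ z ∉ S.carrier, ‖z‖ ≤ R → ∀ i j, ‖Γ z i j‖ ≤ C := by
  have := (isCompact_closedBall (0 : ℂ) R).induction_on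
    (p := fun s => ∃ C : ℝ, 0 ≤ C ∧ ∀ z ∈ s, z ∉ S.carrier → ∀ i j, ‖Γ z i j‖ ≤ C)
    ⟨0, le_rfl, by simp⟩ (fun s t hst ⟨C, h0, hC⟩ => ⟨C, h0, fun z hz => hC z (hst hz)⟩)
    (fun s t ⟨C, h0, hC⟩ ⟨C', h0', hC'⟩ => ⟨max C C', le_max_of_le_left h0, fun z hz hz' i j => by
      rcases hz with hz | hz
      · exact (hC z hz hz' i j).trans (le_max_left _ _)
      · exact (hC' z hz hz' i j).trans (le_max_right _ _)⟩)
    (fun z _ => by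
      obtain ⟨C, hC⟩ := h.locally_bounded z
      rw [eventually_nhdsWithin_iff] at hC
      exact ⟨_, mem_nhdsWithin_of_mem_nhds hC, |C|, abs_nonneg C, fun w hw hw' i j =>
        (hw hw' i j).trans (le_abs_self C)⟩)
  obtain ⟨C, h0, hC⟩ := this
  exact ⟨C, h0, fun z hz hR => hC z (by simpa using hR) hz⟩

/-- Growth of the entries of a solution. -/
lemma exists_row_bound (h : IsRHPSolution S M Γ) : ∃ C : ℝ, 0 < C ∧
    ∀ z ∉ S.carrier, ∀ i j, ‖Γ z i j‖ ≤ C * (1 + ‖z‖) ^ wt i := by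
  obtain ⟨C, ρ, hC0, hρ1, hC⟩ := h.exists_near_one
  obtain ⟨K, hK0, hK⟩ := h.exists_bound_closedBall ρ
  -- The first summand serves for |z| ≤ ρ, where the weight is at least (1 + ρ)⁻¹; the second for
  -- |z| ≥ ρ, where one factor 2 comes from the two terms of the product with the frame and one from
  -- replacing |z| by 1 + |z|.
  refine ⟨K * (1 + ρ) + 4 * (C + 1), by positivity, fun z hz i j => ?_⟩
  have hp : 0 < (1 + ‖z‖) ^ wt i := by positivity
  rcases le_total ‖z‖ ρ with hzρ | hzρ
  · have h1 : 1 ≤ (1 + ρ) * (1 + ‖z‖) ^ wt i := by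
      have h2 : (1 + ‖z‖) ^ (-1 : ℝ) ≤ (1 + ‖z‖) ^ wt i :=
        Real.rpow_le_rpow_of_exponent_le (by linarith [norm_nonneg z])
          (by linarith [neg_abs_le (wt i), abs_wt i])
      rw [Real.rpow_neg_one] at h2
      calc 1 = (1 + ‖z‖) * (1 + ‖z‖)⁻¹ := by field_simp
        _ ≤ (1 + ρ) * (1 + ‖z‖) ^ wt i := by gcongr
    calc ‖Γ z i j‖ ≤ K * 1 := by rw [mul_one]; exact hK z hz hzρ i j
      _ ≤ K * ((1 + ρ) * (1 + ‖z‖) ^ wt i) := by gcongr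
      _ ≤ _ := by rw [← mul_assoc, add_mul]; linarith [mul_pos (by positivity : 0 < 4 * (C + 1)) hp]
  · have hz1 : 1 ≤ ‖z‖ := hρ1.trans hzρ
    have h1 : ∀ k, ‖frameCoord Γ z k j‖ ≤ C + 1 := fun k => by
      have h2 := hC z hz hzρ k j
      have h3 : ‖(1 : Mat) k j‖ ≤ 1 := by
        rw [Matrix.one_apply]; split_ifs <;> simp
      have h4 : ‖z‖ ^ (-(1 / 2) : ℝ) ≤ 1 := Real.rpow_le_one_of_one_le_of_nonpos hz1 (by norm_num)
      calc _ = ‖(frameCoord Γ z - 1) k j + (1 : Mat) k j‖ := by simp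
        _ ≤ C * ‖z‖ ^ (-(1 / 2) : ℝ) + 1 := (norm_add_le _ _).trans (add_le_add h2 h3)
        _ ≤ C * 1 + 1 := by gcongr
        _ = _ := by ring
    have h2 := norm_le_of_frameCoord (S.ne_zero_of_notMem hz) h1 i
    have h3 : ‖z‖ ^ wt i ≤ 2 * (1 + ‖z‖) ^ wt i := by
      fin_cases i
      · simp only [Fin.zero_eta, wt_zero]
        rw [Real.rpow_neg (norm_nonneg _), Real.rpow_neg (by positivity)]
        rw [← div_eq_mul_inv, inv_eq_one_div, div_le_div_iff₀ (by positivity) (by positivity), one_mul]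
        calc (1 + ‖z‖) ^ (1 / 4 : ℝ) ≤ (2 * ‖z‖) ^ (1 / 4 : ℝ) := by gcongr; linarith
          _ = 2 ^ (1 / 4 : ℝ) * ‖z‖ ^ (1 / 4 : ℝ) := Real.mul_rpow (by norm_num) (norm_nonneg _)
          _ ≤ 2 * ‖z‖ ^ (1 / 4 : ℝ) := by
            gcongr
            calc (2 : ℝ) ^ (1 / 4 : ℝ) ≤ 2 ^ (1 : ℝ) :=
                  Real.rpow_le_rpow_of_exponent_le (by norm_num) (by norm_num)
              _ = 2 := Real.rpow_one 2
      · simp only [Fin.mk_one, wt_one]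
        calc ‖z‖ ^ (1 / 4 : ℝ) ≤ (1 + ‖z‖) ^ (1 / 4 : ℝ) := by gcongr; linarith
          _ ≤ _ := by linarith [show 0 < (1 + ‖z‖) ^ (1 / 4 : ℝ) by positivity]
    calc ‖Γ z i j‖ ≤ 2 * (C + 1) * (2 * (1 + ‖z‖) ^ wt i) := h2.trans (by gcongr)
      _ ≤ _ := by
        have : 0 ≤ K * (1 + ρ) * (1 + ‖z‖) ^ wt i := by positivity
        linarith

end IsRHPSolution

end

/-! ### Analytic extension through the contour and bounds for derivatives. -/

section

namespace RayContour

variable {m : ℕ} (S : RayContour m)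

lemma isOpen_side (p : Option (Fin m)) (s : ℤˣ) : IsOpen (S.side p s) := by
  have : S.side p s = S.carrierᶜ ∩ {z | 0 < ((s : ℤ) : ℝ) * (z * (S.rot p)⁻¹).im} := by
    ext z; exact S.mem_side
  rw [this]
  exact S.isOpen_compl.inter (isOpen_lt continuous_const
    (continuous_const.mul (Complex.continuous_im.comp (by fun_prop))))

/-- `G` is an analytic extension of `F` from one side of the contour through one of its points. -/
structure HasExt (p : Option (Fin m)) (s : ℤˣ) (r : ℝ) (F G : ℂ → ℂ) : Prop where
  analyticAt : AnalyticAt ℂ G (S.point p r)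
  eventuallyEq : F =ᶠ[𝓝[S.side p s] (S.point p r)] G

namespace HasExt

variable {S} {p : Option (Fin m)} {s : ℤˣ} {r : ℝ} {F G F' G' : ℂ → ℂ}

lemma of_analyticAt (h : AnalyticAt ℂ F (S.point p r)) : S.HasExt p s r F F := ⟨h, EventuallyEq.rfl⟩

lemma add (h : S.HasExt p s r F G) (h' : S.HasExt p s r F' G') :
    S.HasExt p s r (fun z => F z + F' z) (fun z => G z + G' z) :=
  ⟨h.1.add h'.1, h.2.add h'.2⟩

lemma mul (h : S.HasExt p s r F G) (h' : S.HasExt p s r F' G') :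
    S.HasExt p s r (fun z => F z * F' z) (fun z => G z * G' z) :=
  ⟨h.1.mul h'.1, h.2.mul h'.2⟩

/-- The side is open: equality near the point on the side is equality in a neighbourhood of each
point of the side close to it, and may be differentiated. -/
lemma deriv (h : S.HasExt p s r F G) : S.HasExt p s r (deriv F) (deriv G) := by
  refine ⟨h.1.deriv, ?_⟩
  filter_upwards [eventually_eventually_nhdsWithin.2 h.2, self_mem_nhdsWithin] with z hz hz'
  refine EventuallyEq.deriv_eq ?_
  rwa [(S.isOpen_side p s).nhdsWithin_eq hz'] at hz

lemma tendsto (h : S.HasExt p s r F G) :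
    Tendsto F (𝓝[S.side p s] (S.point p r)) (𝓝 (G (S.point p r))) :=
  (h.1.continuousAt.tendsto.mono_left nhdsWithin_le_nhds).congr' h.2.symm

lemma congr (h : S.HasExt p s r F G) (hF : F' =ᶠ[𝓝[S.side p s] (S.point p r)] F) :
    S.HasExt p s r F' G := ⟨h.1, hF.trans h.2⟩

/-- The same G serves at the neighbouring points of the ray, so the boundary values are the
restriction of an analytic function and can be differentiated along the ray. -/
lemma eventually (h : S.HasExt p s r F G) : ∀ᶠ x in 𝓝 r, S.HasExt p s x F G := by
  have hc : Tendsto (fun x : ℝ => S.point p x) (𝓝 r) (𝓝 (S.point p r)) :=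
    Continuous.tendsto (by unfold point; fun_prop) r
  have h2 := eventually_eventually_nhdsWithin.2 h.2
  rw [eventually_nhdsWithin_iff] at h2
  have h3 : ∀ᶠ z in 𝓝 (S.point p r), F =ᶠ[𝓝[S.side p s] z] G := by
    have := eventually_eventually_nhds.2 (eventually_nhdsWithin_iff.1 h.2)
    filter_upwards [this] with z hz
    exact eventually_nhdsWithin_iff.2 hz
  filter_upwards [hc.eventually h3, hc.eventually h.1.eventually_analyticAt] with x h4 h5
  exact ⟨h5, h4⟩

end HasExt

/-- Entrywise analytic extension of matrices. -/
def MatExt (p : Option (Fin m)) (s : ℤˣ) (r : ℝ) (F G : ℂ → Mat) : Prop :=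
  ∀ i j, S.HasExt p s r (fun z => F z i j) (fun z => G z i j)

/-- The entrywise derivative of a matrix function. -/
def _root_.Dressing.derivMat (F : ℂ → Mat) (z : ℂ) : Mat :=
  Matrix.of fun i j => _root_.deriv (fun z => F z i j) z

namespace MatExt

variable {S} {p : Option (Fin m)} {s : ℤˣ} {r : ℝ} {F G F' G' : ℂ → Mat}

lemma mul (h : S.MatExt p s r F G) (h' : S.MatExt p s r F' G') :
    S.MatExt p s r (fun z => F z * F' z) (fun z => G z * G' z) := by
  intro i j
  simp only [Matrix.mul_apply, Fin.sum_univ_two]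
  exact ((h i 0).mul (h' 0 j)).add ((h i 1).mul (h' 1 j))

lemma derivMat (h : S.MatExt p s r F G) : S.MatExt p s r (derivMat F) (derivMat G) :=
  fun i j => (h i j).deriv

lemma tendsto (h : S.MatExt p s r F G) :
    Tendsto F (𝓝[S.side p s] (S.point p r)) (𝓝 (G (S.point p r))) :=
  tendsto_pi_nhds.2 fun i => tendsto_pi_nhds.2 fun j => (h i j).tendsto

lemma boundaryValue_eq (h : S.MatExt p s r F G) (hr : 0 < r) :
    S.boundaryValue F p s r = G (S.point p r) := S.boundaryValue_eq hr h.tendsto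

lemma eventually (h : S.MatExt p s r F G) : ∀ᶠ x in 𝓝 r, S.MatExt p s x F G :=
  eventually_all.2 fun i => eventually_all.2 fun j => (h i j).eventually

/-- The derivative of the boundary values along the contour. -/
lemma hasDerivAt_boundaryValue (h : S.MatExt p s r F G) (hr : 0 < r) (i j : Fin 2) :
    HasDerivAt (fun x : ℝ => S.boundaryValue F p s x i j)
      (Dressing.derivMat G (S.point p r) i j * S.rot p) r := by
  have h1 : HasDerivAt (fun z => G z i j) (Dressing.derivMat G (S.point p r) i j) (S.point p r) :=
    (h i j).analyticAt.differentiableAt.hasDerivAt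
  have h2 : HasDerivAt (fun x : ℝ => S.point p x) (S.rot p) r := by
    simpa [point_eq] using (Complex.ofRealCLM.hasDerivAt (x := r)).mul_const (S.rot p)
  refine (h1.comp r h2).congr_of_eventuallyEq ?_
  filter_upwards [h.eventually, lt_mem_nhds hr] with x hx hx0
  rw [hx.boundaryValue_eq hx0]
  rfl

end MatExt

end RayContour

variable {m d : ℕ} {S : RayContour m}

lemma det_one_add_smul_nilp (x : ℂ) (b : Bool) : (1 + x • nilp b : Mat).det = 1 := by
  cases b <;> simp [nilp, Matrix.det_fin_two]

lemma det_jumpMatrix (upper : Fin m → Bool) (f : Fin m → (Fin d → ℂ) → ℂ → ℂ) (t : Fin d → ℂ)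
    (p : Option (Fin m)) (r : ℝ) : (jumpMatrix S upper f t p r).det = 1 := by
  cases p
  · simp [jumpMatrix, Matrix.det_fin_two]
  · exact det_one_add_smul_nilp _ _

lemma inv_eq_adjugate {A : Mat} (h : A.det = 1) : A⁻¹ = A.adjugate := by
  rw [Matrix.inv_def, h, Ring.inverse_one, one_smul]

/-- Local uniformity of the hypotheses on the `f_j`, on a common cone. -/
lemma IsAdmissible.exists_cone {T : Set (Fin d → ℂ)} {f : Fin m → (Fin d → ℂ) → ℂ → ℂ}
    (hf : IsAdmissible S T f) {t₀ : Fin d → ℂ} (ht : t₀ ∈ T) :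
    ∃ c, S.GoodCone c ∧ ∃ U : Set (Fin d → ℂ), IsOpen U ∧ t₀ ∈ U ∧ ∀ j,
      DifferentiableOn ℂ (fun w : (Fin d → ℂ) × ℂ => f j w.1 (w.2 * S.rot (some j)))
        (U ×ˢ cone c) ∧
      (∀ N : ℕ, ∃ C : ℝ, ∀ t ∈ U, ∀ u ∈ cone c,
        ‖f j t (u * S.rot (some j))‖ * (1 + ‖u‖) ^ N ≤ C) ∧
      ∃ (c₀ : ℂ) (α C : ℝ), 0 < α ∧ ∀ t ∈ U, ∀ u ∈ cone c,
        ‖f j t (u * S.rot (some j)) - c₀‖ ≤ C * ‖u‖ ^ α := by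
  choose c₀ hc₀ using hf
  have h1 := fun j => hc₀ j t₀ ht
  choose δ hδ U hU htU hd hb hh using h1
  have h2 : ∀ᶠ c in 𝓝[>] (0 : ℝ), ∀ j, ∀ u ∈ cone c, u * S.rot (some j) ∈ S.sector j (δ j) :=
    eventually_all.2 fun j => S.eventually_cone_sector j (hδ j)
  obtain ⟨c, ⟨hc1, hc2⟩, hc3⟩ := ((S.eventually_cone_good.and self_mem_nhdsWithin).and h2).exists
  refine ⟨c, ⟨hc2, hc1⟩, ⋂ j, U j, isOpen_iInter_of_finite hU, Set.mem_iInter.2 htU, fun j => ?_⟩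
  have hn : ∀ u : ℂ, ‖u * S.rot (some j)‖ = ‖u‖ := fun u => by
    rw [norm_mul, S.norm_rot, mul_one]
  refine ⟨?_, fun N => ?_, ?_⟩
  · refine (hd j).comp (f := fun w : (Fin d → ℂ) × ℂ => (w.1, w.2 * S.rot (some j)))
      (by fun_prop) fun w hw => ⟨Set.mem_iInter.1 hw.1 j, hc3 j _ hw.2⟩
  · obtain ⟨C, hC⟩ := hb j N
    refine ⟨C, fun t ht u hu => ?_⟩
    have := hC t (Set.mem_iInter.1 ht j) _ (hc3 j u hu)
    rwa [hn] at this
  · obtain ⟨α, C, hα, hC⟩ := hh j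
    refine ⟨c₀ j, α, C, hα, fun t ht u hu => ?_⟩
    have := hC t (Set.mem_iInter.1 ht j) _ (hc3 j u hu)
    rwa [hn] at this

/-- Bounded analytic continuation of the jump matrices to cones about the pieces, in the direction
of either side. -/
structure JumpContinuation (S : RayContour m) (M : Option (Fin m) → ℝ → Mat) (c K : ℝ)
    (N : Option (Fin m) → ℤˣ → ℂ → Mat) : Prop where
  good : S.GoodCone c
  nonneg : 0 ≤ K
  diff : ∀ p s i j, DifferentiableOn ℂ (fun u => N p s u i j) (cone c)
  bound : ∀ p s, ∀ u ∈ cone c, ∀ i j, ‖N p s u i j‖ ≤ K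
  eq_jump : ∀ p, ∀ r : ℝ, 0 < r → N p (S.sgn p) r = M p r
  mul_jump : ∀ p, ∀ r : ℝ, 0 < r → M p r * N p (-S.sgn p) r = 1

/-- The matrix attached to a side expresses the boundary value from that side through the opposite
one: M on the plus side, M⁻¹ on the minus side. As det M = 1 the inverse is the adjugate, which has
the same bounds. -/
lemma IsAdmissible.exists_jumpContinuation {T : Set (Fin d → ℂ)}
    {f : Fin m → (Fin d → ℂ) → ℂ → ℂ} (hf : IsAdmissible S T f) (upper : Fin m → Bool)
    {t₀ : Fin d → ℂ} (ht : t₀ ∈ T) :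
    ∃ c K N, JumpContinuation S (jumpMatrix S upper f t₀) c K N := by
  obtain ⟨c, hc, U, hU, htU, hj⟩ := hf.exists_cone ht
  choose hd hb hh using hj
  have hb0 := fun j => hb j 0
  choose C hC using hb0
  set K := 1 + ∑ j, |C j| with hK
  have hfb : ∀ j, ∀ u ∈ cone c, ‖f j t₀ (u * S.rot (some j))‖ ≤ K := fun j u hu => by
    have h1 := hC j t₀ htU u hu
    rw [pow_zero, mul_one] at h1
    have h2 : |C j| ≤ ∑ j, |C j| :=
      Finset.single_le_sum (f := fun j => |C j|) (fun _ _ => abs_nonneg _) (Finset.mem_univ j)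
    linarith [le_abs_self (C j)]
  have hK1 : 1 ≤ K := by
    have : 0 ≤ ∑ j, |C j| := Finset.sum_nonneg fun _ _ => abs_nonneg _
    linarith
  have hfd : ∀ j, DifferentiableOn ℂ (fun u => f j t₀ (u * S.rot (some j))) (cone c) := fun j =>
    (hd j).comp (f := fun u : ℂ => (t₀, u)) (by fun_prop) fun u hu => ⟨htU, hu⟩
  set E : Option (Fin m) → ℂ → Mat := fun p u => match p with
    | none => !![0, 1; -1, 0]
    | some j => 1 + f j t₀ (u * S.rot (some j)) • nilp (upper j) with hE
  have hEM : ∀ p (r : ℝ), E p r = jumpMatrix S upper f t₀ p r := fun p r => by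
    cases p <;> rfl
  have hEd : ∀ p i j, DifferentiableOn ℂ (fun u => E p u i j) (cone c) := by
    intro p i j
    cases p with
    | none => exact differentiableOn_const _
    | some k =>
      simp only [hE, Matrix.add_apply, Matrix.smul_apply, smul_eq_mul]
      exact ((hfd k).mul_const _).const_add _
  have hEb : ∀ p, ∀ u ∈ cone c, ∀ i j, ‖E p u i j‖ ≤ K := by
    intro p u hu i j
    cases p with
    | none => fin_cases i <;> fin_cases j <;> simp [hE, hK1] <;> linarith
    | some k =>
      have := hfb k u hu
      rcases hb : upper k <;> fin_cases i <;> fin_cases j <;> simp [hE, hb, nilp, hK1, this] <;>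
        linarith
  refine ⟨c, K, fun p s u => if s = S.sgn p then E p u else (E p u).adjugate, hc, by linarith,
    fun p s i j => ?_, fun p s u hu i j => ?_, fun p r hr => ?_, fun p r hr => ?_⟩
  · split_ifs
    · exact hEd p i j
    · fin_cases i <;> fin_cases j <;> simp only [Matrix.adjugate_fin_two]
      · exact hEd p 1 1
      · exact (hEd p 0 1).neg
      · exact (hEd p 1 0).neg
      · exact hEd p 0 0
  · split_ifs
    · exact hEb p u hu i j
    · fin_cases i <;> fin_cases j <;> simp [Matrix.adjugate_fin_two, hEb p u hu]
  · simp only [if_true, hEM]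
  · have : ¬(-S.sgn p = S.sgn p) := by
      rcases Int.units_eq_one_or (S.sgn p) with e | e <;> rw [e] <;> decide
    simp only [if_neg this, hEM]
    rw [Matrix.mul_adjugate, det_jumpMatrix, one_smul]

/-- For exponents of modulus at most 1, comparable moduli give comparable weights, because 2^|e| ≤
2. It is applied to the points of a disc of radius proportional to the modulus of its centre. -/
lemma one_add_rpow_le {x y e : ℝ} (hx : 0 ≤ x) (hy : 0 ≤ y) (he : |e| ≤ 1)
    (h1 : 1 + y ≤ 2 * (1 + x)) (h2 : 1 + x ≤ 2 * (1 + y)) : (1 + y) ^ e ≤ 2 * (1 + x) ^ e := by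
  have two : ∀ a : ℝ, a ≤ 1 → (2 : ℝ) ^ a ≤ 2 := fun a ha =>
    (Real.rpow_le_rpow_of_exponent_le (by norm_num) ha).trans_eq (Real.rpow_one 2)
  rcases le_total 0 e with h0 | h0
  · calc (1 + y) ^ e ≤ (2 * (1 + x)) ^ e := Real.rpow_le_rpow (by positivity) h1 h0
      _ = 2 ^ e * (1 + x) ^ e := Real.mul_rpow (by norm_num) (by positivity)
      _ ≤ _ := by
        gcongr
        exact two e ((le_abs_self e).trans he)
  · have h3 : (2 * (1 + y)) ^ e ≤ (1 + x) ^ e :=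
      Real.rpow_le_rpow_of_nonpos (by positivity) h2 h0
    rw [Real.mul_rpow (by norm_num) (by positivity)] at h3
    have h4 : (2 : ℝ) * 2 ^ e ≥ 1 := by
      have := two (-e) ((neg_le_abs e).trans he)
      rw [Real.rpow_neg (by norm_num)] at this
      have h5 : (0 : ℝ) < 2 ^ e := by positivity
      rw [inv_le_comm₀ h5 (by norm_num)] at this
      linarith
    have h5 : 0 < (1 + y) ^ e := by positivity
    nlinarith

/-- Cauchy's estimate on a ball whose radius is proportional to the distance from the origin. -/
lemma norm_deriv_mul_norm_le {F : ℂ → ℂ} {z : ℂ} {κ C e : ℝ} (hκ : 0 < κ) (hκ1 : κ ≤ 1 / 2)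
    (hz : z ≠ 0) (he : |e| ≤ 1) (hC : 0 ≤ C)
    (hd : DifferentiableOn ℂ F (Metric.ball z (κ * ‖z‖)))
    (hb : ∀ w ∈ Metric.ball z (κ * ‖z‖), ‖F w‖ ≤ C * (1 + ‖w‖) ^ e) :
    ‖deriv F z‖ * ‖z‖ ≤ 4 * C / κ * (1 + ‖z‖) ^ e := by
  have hz0 : 0 < ‖z‖ := norm_pos_iff.2 hz
  have hR : 0 < κ * ‖z‖ / 2 := by positivity
  have hsub : Metric.closedBall z (κ * ‖z‖ / 2) ⊆ Metric.ball z (κ * ‖z‖) :=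
    Metric.closedBall_subset_ball (by linarith)
  have := Complex.norm_deriv_le_of_forall_mem_sphere_norm_le (f := F) (c := z)
    (C := 2 * C * (1 + ‖z‖) ^ e) hR
    ((hd.mono ((Metric.closure_ball_subset_closedBall).trans hsub)).diffContOnCl)
    (fun w hw => by
      have hw' : w ∈ Metric.ball z (κ * ‖z‖) := hsub (Metric.sphere_subset_closedBall hw)
      have h1 : ‖w - z‖ ≤ 1 / 2 * ‖z‖ := by
        rw [← dist_eq_norm]
        have := Metric.mem_ball.1 hw'
        nlinarith
      have h2 : ‖w‖ ≤ ‖z‖ + ‖w - z‖ := by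
        calc ‖w‖ = ‖z + (w - z)‖ := by ring_nf
          _ ≤ _ := norm_add_le _ _
      have h3 : ‖z‖ ≤ ‖w‖ + ‖w - z‖ := by
        calc ‖z‖ = ‖w - (w - z)‖ := by ring_nf
          _ ≤ _ := norm_sub_le _ _
      calc ‖F w‖ ≤ C * (1 + ‖w‖) ^ e := hb w hw'
        _ ≤ C * (2 * (1 + ‖z‖) ^ e) := by
          gcongr
          exact one_add_rpow_le (norm_nonneg _) (norm_nonneg _) he (by linarith) (by linarith)
        _ = _ := by ring)
  calc _ ≤ 2 * C * (1 + ‖z‖) ^ e / (κ * ‖z‖ / 2) * ‖z‖ := by gcongr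
    _ = _ := by field_simp; ring

/-- Cones are invariant under scaling, so a radius proportional to |u| is allowed; κ = c / (4 (1 +
c)²) meets the requirement. -/
lemma ball_subset_cone {c κ : ℝ} (hc : 0 < c) (hκ0 : 0 < κ) (hκ : κ * (4 * (1 + c) ^ 2) ≤ c) {u : ℂ}
    (hu : u ∈ cone (c / 2)) : Metric.ball u (κ * ‖u‖) ⊆ cone c := by
  intro w hw
  rw [Metric.mem_ball, dist_eq_norm] at hw
  obtain ⟨h1, h2⟩ := hu
  have h3 : ‖u‖ ≤ (1 + c / 2) * u.re := by
    have := Complex.norm_le_abs_re_add_abs_im u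
    rw [abs_of_pos h1] at this
    linarith
  have h4 := (Complex.abs_re_le_norm (w - u)).trans hw.le
  have h5 := (Complex.abs_im_le_norm (w - u)).trans hw.le
  rw [Complex.sub_re] at h4
  rw [Complex.sub_im] at h5
  have h6 : κ * ‖u‖ ≤ κ * ((1 + c / 2) * u.re) := by gcongr
  have h7 : κ * (1 + c / 2) * (1 + c) ≤ c / 4 := by nlinarith
  have h8 := abs_le.1 h4
  have h9 : |w.im| ≤ |u.im| + κ * ‖u‖ := by
    calc |w.im| = |u.im + (w.im - u.im)| := by ring_nf
      _ ≤ |u.im| + |w.im - u.im| := abs_add_le _ _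
      _ ≤ _ := by linarith
  have h10 : κ * (1 + c / 2) ≤ 1 / 4 := by
    by_contra! h
    nlinarith
  have hm : κ * (1 + c / 2) * (1 + c) * u.re ≤ c / 4 * u.re := by gcongr
  have hm2 : κ * (1 + c / 2) * u.re ≤ 1 / 4 * u.re := by gcongr
  refine ⟨by nlinarith, ?_⟩
  have h11 : u.re - κ * ((1 + c / 2) * u.re) ≤ w.re := by linarith [h8.1]
  have h12 : c * (u.re - κ * ((1 + c / 2) * u.re)) ≤ c * w.re := by gcongr
  nlinarith [mul_pos hc h1]

lemma IsRHPSolution.bv_eq {M : Option (Fin m) → ℝ → Mat} {Γ : ℂ → Mat} (h : IsRHPSolution S M Γ)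
    {c K : ℝ} {N : Option (Fin m) → ℤˣ → ℂ → Mat} (hN : JumpContinuation S M c K N)
    (p : Option (Fin m)) (s : ℤˣ) {r : ℝ} (hr : 0 < r) :
    S.boundaryValue Γ p s r = S.boundaryValue Γ p (-s) r * N p s r := by
  have hj := h.jump p r hr
  rw [RayContour.plus, RayContour.minus] at hj
  by_cases hs : s = S.sgn p
  · rw [hs, hN.eq_jump p r hr]
    exact hj
  · have hs' : s = -S.sgn p := by
      rcases Int.units_eq_one_or (S.sgn p) with e | e <;>
        rcases Int.units_eq_one_or s with rfl | rfl <;> simp_all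
    rw [hs', neg_neg, hj, mul_assoc, hN.mul_jump p r hr, mul_one]

/-- Solutions extend analytically through the contour. -/
lemma IsRHPSolution.exists_matExt {M : Option (Fin m) → ℝ → Mat} {Γ : ℂ → Mat}
    (h : IsRHPSolution S M Γ) {c K : ℝ} {N : Option (Fin m) → ℤˣ → ℂ → Mat}
    (hN : JumpContinuation S M c K N) (p : Option (Fin m)) (s : ℤˣ) {r : ℝ} (hr : 0 < r) :
    ∃ G, S.MatExt p s r Γ G := by
  obtain ⟨G, hG, hG1, -, -⟩ := S.exists_continuation hN.good p s h.analytic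
    (fun s r hr => h.boundary_tendsto p s r hr) (h.boundary_continuous p s) (hN.diff p s)
    (fun r hr => h.bv_eq hN p s hr)
  have hr' := ofReal_mem_cone hN.good.1 hr
  refine ⟨fun z => G (z * (S.rot p)⁻¹), fun i j => ⟨?_, ?_⟩⟩
  · have h1 : AnalyticAt ℂ (fun u => G u i j) (S.point p r * (S.rot p)⁻¹) := by
      rw [S.point_eq, mul_assoc, mul_inv_cancel₀ (S.rot_ne_zero p), mul_one]
      exact (hG i j).analyticAt ((isOpen_cone c).mem_nhds hr')
    exact h1.comp (f := fun z => z * (S.rot p)⁻¹) (by fun_prop)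
  · filter_upwards [self_mem_nhdsWithin, nhdsWithin_le_nhds ((S.tendsto_mul_rot_inv p r)
      ((isOpen_cone c).mem_nhds hr'))] with z hz hz'
    rw [hG1 _ hz' (S.mem_side.1 hz).2, mul_assoc, inv_mul_cancel₀ (S.rot_ne_zero p), mul_one]

/-- The derivative of a solution gains a factor `1 / z`, uniformly up to the contour. -/
lemma IsRHPSolution.exists_deriv_bound {M : Option (Fin m) → ℝ → Mat} {Γ : ℂ → Mat}
    (h : IsRHPSolution S M Γ) {c K : ℝ} {N : Option (Fin m) → ℤˣ → ℂ → Mat}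
    (hN : JumpContinuation S M c K N) : ∃ C : ℝ, 0 < C ∧
    ∀ z ∉ S.carrier, ∀ i j, ‖derivMat Γ z i j‖ * ‖z‖ ≤ C * (1 + ‖z‖) ^ wt i := by
  obtain ⟨C, hC0, hC⟩ := h.exists_row_bound
  have hc := hN.good.1
  have hK := hN.nonneg
  set κ := c / (4 * (1 + c) ^ 2) with hκ
  have hκ0 : 0 < κ := by positivity
  have hκ' : κ * (4 * (1 + c) ^ 2) ≤ c := by rw [hκ]; field_simp; exact le_rfl
  have hκ1 : κ ≤ 1 / 8 := by
    rw [hκ, div_le_div_iff₀ (by positivity) (by norm_num)]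
    nlinarith [sq_nonneg (1 - c)]
  have hw1 : ∀ i, |wt i| ≤ 1 := fun i => by rw [abs_wt]; norm_num
  set C' := C + 2 * C * K with hC'
  have hC'0 : 0 < C' := by positivity
  have hCC' : C ≤ C' := by rw [hC']; nlinarith [mul_nonneg hC0.le hK]
  refine ⟨4 * C' / κ, by positivity, fun z hz i j => ?_⟩
  have hz0 := S.ne_zero_of_notMem hz
  -- Close to a ray the disc for Cauchy's estimate may cross the contour. There Γ is replaced by its
  -- analytic continuation from the side of z, which beyond the ray is Γ N and is bounded by the
  -- same weight with the constant C + 2CK.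
  by_cases hp : ∃ p, z * (S.rot p)⁻¹ ∈ cone (c / 2)
  · obtain ⟨p, hp⟩ := hp
    set u := z * (S.rot p)⁻¹ with hu
    have hzu : z = u * S.rot p := by
      rw [hu, mul_assoc, inv_mul_cancel₀ (S.rot_ne_zero p), mul_one]
    have hnu : ‖u‖ = ‖z‖ := by rw [hu, norm_mul, norm_inv, S.norm_rot, inv_one, mul_one]
    have him : u.im ≠ 0 := fun him => hz (by
      rw [S.carrier_eq]
      exact Set.mem_iUnion.2 ⟨p, him, le_of_lt hp.1⟩)
    obtain ⟨s, hs⟩ : ∃ s : ℤˣ, 0 < ((s : ℤ) : ℝ) * u.im := by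
      rcases lt_or_gt_of_ne him with h | h
      · exact ⟨-1, by simpa using h⟩
      · exact ⟨1, by simpa using h⟩
    obtain ⟨G, hG, hG1, hG2, -⟩ := S.exists_continuation hN.good p s h.analytic
      (fun s r hr => h.boundary_tendsto p s r hr) (h.boundary_continuous p s) (hN.diff p s)
      (fun r hr => h.bv_eq hN p s hr)
    have hs0 : ((s : ℤ) : ℝ) ≠ 0 := by exact_mod_cast s.ne_zero
    have hb0 : ∀ w ∈ cone c, w.im ≠ 0 → ‖G w i j‖ ≤ C' * (1 + ‖w‖) ^ wt i := by
      intro w hw him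
      have hwz := hN.good.2 p w hw him
      have hnw : ‖w * S.rot p‖ = ‖w‖ := by rw [norm_mul, S.norm_rot, mul_one]
      have hCw := hC _ hwz i
      rw [hnw] at hCw
      have hq : 0 < (1 + ‖w‖) ^ wt i := by positivity
      rcases lt_or_gt_of_ne (mul_ne_zero hs0 him) with hlt | hgt
      · rw [hG2 w hw hlt, Matrix.mul_apply, Fin.sum_univ_two]
        calc _ ≤ ‖Γ (w * S.rot p) i 0‖ * ‖N p s w 0 j‖ + ‖Γ (w * S.rot p) i 1‖ * ‖N p s w 1 j‖ := by
              rw [← norm_mul, ← norm_mul]; exact norm_add_le _ _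
          _ ≤ C * (1 + ‖w‖) ^ wt i * K + C * (1 + ‖w‖) ^ wt i * K := by
              gcongr
              · exact hCw 0
              · exact hN.bound p s w hw 0 j
              · exact hCw 1
              · exact hN.bound p s w hw 1 j
          _ = 2 * C * K * (1 + ‖w‖) ^ wt i := by ring
          _ ≤ _ := by gcongr; linarith
      · rw [hG1 w hw hgt]
        exact (hCw j).trans (by gcongr)
    have hb : ∀ w ∈ cone c, ‖G w i j‖ ≤ C' * (1 + ‖w‖) ^ wt i := by
      intro w hw
      by_cases him : w.im = 0
      · obtain ⟨r, rfl⟩ : ∃ r : ℝ, w = r := ⟨w.re, Complex.ext (by simp) (by simp [him])⟩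
        have := RayContour.neBot_half 1 r
        have hGc : ContinuousAt (fun u => G u i j) (r : ℂ) :=
          ((hG i j).differentiableAt ((isOpen_cone c).mem_nhds hw)).continuousAt
        have hφ : ContinuousAt (fun w : ℂ => C' * (1 + ‖w‖) ^ wt i) (r : ℂ) := by
          refine ContinuousAt.mul continuousAt_const (ContinuousAt.rpow_const (by fun_prop) ?_)
          exact Or.inl (by positivity)
        refine le_of_tendsto_of_tendsto
          (b := 𝓝[{u : ℂ | 0 < (((1 : ℤˣ) : ℤ) : ℝ) * u.im}] (r : ℂ)) (hGc.norm.tendsto.mono_left nhdsWithin_le_nhds)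
          (hφ.tendsto.mono_left nhdsWithin_le_nhds) ?_
        filter_upwards [self_mem_nhdsWithin, mem_nhdsWithin_of_mem_nhds
          ((isOpen_cone c).mem_nhds hw)] with v hv hv'
        refine hb0 v hv' fun h0 => ?_
        have hv : 0 < (((1 : ℤˣ) : ℤ) : ℝ) * v.im := hv
        rw [h0, mul_zero] at hv
        exact lt_irrefl _ hv
      · exact hb0 w hw him
    have hsub := ball_subset_cone hc hκ0 hκ' hp
    have key := norm_deriv_mul_norm_le (F := fun u => G u i j) hκ0 (by linarith)
      (ne_zero_of_mem_cone hp) (hw1 i) hC'0.le ((hG i j).mono hsub) (fun w hw => hb w (hsub hw))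
    have hu' : u ∈ cone c := cone_mono (by linarith) hp
    have hder : HasDerivAt (fun z => Γ z i j) (deriv (fun u => G u i j) u * (S.rot p)⁻¹) z := by
      have h1 : HasDerivAt (fun u => G u i j) (deriv (fun u => G u i j) u) (z * (S.rot p)⁻¹) :=
        ((hG i j).differentiableAt ((isOpen_cone c).mem_nhds hu')).hasDerivAt
      have h2 : HasDerivAt (fun z => z * (S.rot p)⁻¹) ((S.rot p)⁻¹) z := by
        simpa using (hasDerivAt_id z).mul_const (S.rot p)⁻¹
      refine (h1.comp z h2).congr_of_eventuallyEq ?_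
      have h3 : ∀ᶠ w in 𝓝 z, w * (S.rot p)⁻¹ ∈ cone c :=
        (Continuous.tendsto (by fun_prop : Continuous fun w : ℂ => w * (S.rot p)⁻¹) z).eventually
          ((isOpen_cone c).mem_nhds hu')
      have h4 : ∀ᶠ w in 𝓝 z, 0 < ((s : ℤ) : ℝ) * (w * (S.rot p)⁻¹).im :=
        (Continuous.tendsto (continuous_const.mul (Complex.continuous_im.comp (by fun_prop)) :
          Continuous fun w : ℂ => ((s : ℤ) : ℝ) * (w * (S.rot p)⁻¹).im) z).eventually_const_lt hs
      filter_upwards [h3, h4] with w hw hw'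
      simp only [Function.comp]
      rw [hG1 _ hw hw', mul_assoc, inv_mul_cancel₀ (S.rot_ne_zero p), mul_one]
    have e1 : derivMat Γ z i j = deriv (fun u => G u i j) u * (S.rot p)⁻¹ := hder.deriv
    rw [e1, norm_mul, norm_inv, S.norm_rot, inv_one, mul_one, ← hnu]
    exact key
  -- Outside all the half-opening cones the disc avoids the contour: a contour point in it would put
  -- z into the cone about its piece. Cauchy's estimate then applies to Γ itself.
  · have hsub : Metric.ball z (κ * ‖z‖) ⊆ S.carrierᶜ := by
      rintro w hw ⟨p, r, hr, rfl⟩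
      refine hp ⟨p, ?_⟩
      have hn : ‖z * (S.rot p)⁻¹‖ = ‖z‖ := by rw [norm_mul, norm_inv, S.norm_rot, inv_one, mul_one]
      have h1 : ‖z * (S.rot p)⁻¹ - r‖ < κ * ‖z‖ := by
        have : z * (S.rot p)⁻¹ - r = (z - S.point p r) * (S.rot p)⁻¹ := by
          rw [S.point_eq, sub_mul, mul_assoc (r : ℂ), mul_inv_cancel₀ (S.rot_ne_zero p), mul_one]
        rw [this, norm_mul, norm_inv, S.norm_rot, inv_one, mul_one, ← dist_eq_norm, dist_comm]
        exact hw
      set u := z * (S.rot p)⁻¹ with hu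
      rw [← hn] at h1
      have hu0 : 0 < ‖u‖ := by rw [hn]; exact norm_pos_iff.2 hz0
      have h2 := (Complex.abs_re_le_norm _).trans h1.le
      have h3 := (Complex.abs_im_le_norm _).trans h1.le
      rw [Complex.sub_re, Complex.ofReal_re] at h2
      rw [Complex.sub_im, Complex.ofReal_im, sub_zero] at h3
      have h4 : ‖u‖ - κ * ‖u‖ ≤ r := by
        have h5 : ‖u‖ ≤ ‖u - r‖ + ‖(r : ℂ)‖ := by
          calc ‖u‖ = ‖(u - r) + r‖ := by ring_nf
            _ ≤ _ := norm_add_le _ _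
        rw [Complex.norm_real, Real.norm_eq_abs, abs_of_nonneg hr] at h5
        linarith
      have h6 : ‖u‖ - 2 * (κ * ‖u‖) ≤ u.re := by linarith [(abs_le.1 h2).1]
      have h7 : κ * ‖u‖ ≤ 1 / 8 * ‖u‖ := by gcongr
      have h8 : κ ≤ c / 4 := by
        rw [hκ]
        gcongr
        nlinarith
      refine ⟨by nlinarith, h3.trans_lt ?_⟩
      nlinarith
    exact norm_deriv_mul_norm_le hκ0 (by linarith) hz0 (hw1 i) hC'0.le ((h.analytic i j).mono hsub)
      fun w hw => (hC w (hsub hw) i j).trans (by gcongr)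

end

/-! ### Cauchy's theorem in logarithmic coordinates. -/

section

/-- A telescoping sum over angles that are not sorted. With the jumps at the θ_j ≤ x subtracted, the
value at x is locally constant from the right and from the left, hence constant on [a, b]. -/
lemma sum_jumps_eq {a b : ℝ} (hab : a < b) {m : ℕ} (θ : Fin m → ℝ) (hinj : Function.Injective θ)
    (hθ : ∀ j, θ j ∈ Set.Ioo a b) (R L : ℝ → ℂ)
    (hreg : ∀ x ∈ Set.Ioo a b, (∀ j, θ j ≠ x) → R x = L x)
    (hR : ∀ x ∈ Set.Ico a b, ∀ᶠ y in 𝓝[>] x, L y = R x)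
    (hL : ∀ x ∈ Set.Ioc a b, ∀ᶠ y in 𝓝[<] x, R y = L x) :
    L b - R a = ∑ j, (R (θ j) - L (θ j)) := by
  classical
  -- At the right end the left value is taken, since the hypotheses say nothing about what follows
  -- b.
  set T : ℝ → ℂ := fun x => (if x = b then L b else R x) -
    ∑ j, if θ j ≤ x then R (θ j) - L (θ j) else 0 with hT
  have hreg' : ∀ x : ℝ, ∀ j, ∀ᶠ y in 𝓝[≠] x, θ j ≠ y := fun x j => by
    by_cases h : θ j = x
    · filter_upwards [self_mem_nhdsWithin] with y hy hy'
      exact hy (hy' ▸ h)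
    · filter_upwards [nhdsWithin_le_nhds (isOpen_compl_singleton.mem_nhds (Ne.symm h))] with y hy hy'
      exact hy hy'.symm
  have hright : ∀ x ∈ Set.Ico a b, ∀ᶠ y in 𝓝[>] x, T y = T x := by
    intro x hx
    have h1 : ∀ᶠ y in 𝓝[>] x, ∀ j, θ j ≠ y :=
      eventually_all.2 fun j => (hreg' x j).filter_mono (nhdsWithin_mono _ fun y hy => ne_of_gt hy)
    have h2 : ∀ᶠ y in 𝓝[>] x, ∀ j, (θ j ≤ y ↔ θ j ≤ x) := eventually_all.2 fun j => by
      rcases le_or_gt (θ j) x with h | h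
      · filter_upwards [self_mem_nhdsWithin] with y hy
        exact ⟨fun _ => h, fun _ => h.trans (le_of_lt hy)⟩
      · filter_upwards [nhdsWithin_le_nhds (gt_mem_nhds h)] with y hy
        exact ⟨fun h' => absurd hy (not_lt.2 h'), fun h' => absurd h (not_lt.2 h')⟩
    filter_upwards [h1, h2, hR x hx, Ioo_mem_nhdsGT hx.2] with y h1 h2 h3 h4
    simp only [hT, if_neg hx.2.ne, if_neg h4.2.ne, h2]
    rw [hreg y ⟨hx.1.trans_lt h4.1, h4.2⟩ h1, h3]
  have hleft : ∀ x ∈ Set.Ioc a b, ∀ᶠ y in 𝓝[<] x, T y = T x := by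
    intro x hx
    have h2 : ∀ᶠ y in 𝓝[<] x, ∀ j, (θ j ≤ y ↔ θ j < x) := eventually_all.2 fun j => by
      rcases lt_or_ge (θ j) x with h | h
      · filter_upwards [nhdsWithin_le_nhds (lt_mem_nhds h)] with y hy
        exact ⟨fun _ => h, fun _ => hy.le⟩
      · filter_upwards [self_mem_nhdsWithin] with y hy
        have hy : y < x := hy
        exact ⟨fun h' => absurd (h'.trans_lt hy) (not_lt.2 h), fun h' => absurd h' (not_lt.2 h)⟩
    have h3 : T x = L x - ∑ j, if θ j < x then R (θ j) - L (θ j) else 0 := by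
      simp only [hT]
      by_cases hb : x = b
      · subst hb
        have : ∀ j, θ j ≤ x ↔ θ j < x := fun j => ⟨fun _ => (hθ j).2, le_of_lt⟩
        simp only [if_true, this]
      · rw [if_neg hb]
        by_cases hj : ∃ i, θ i = x
        · obtain ⟨i, hi⟩ := hj
          have : ∀ j, (if θ j ≤ x then R (θ j) - L (θ j) else 0) =
              (if θ j < x then R (θ j) - L (θ j) else 0) + if j = i then R x - L x else 0 := by
            intro j
            by_cases hji : j = i
            · subst hji
              simp [hi]
            · have : θ j ≠ x := fun h => hji (hinj (h.trans hi.symm))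
              simp [hji, le_iff_lt_or_eq, this]
          simp only [this, Finset.sum_add_distrib, Finset.sum_ite_eq', Finset.mem_univ, if_true]
          ring
        · push Not at hj
          have : ∀ j, θ j ≤ x ↔ θ j < x := fun j => by simp [le_iff_lt_or_eq, hj j]
          simp only [this]
          rw [hreg x ⟨hx.1, lt_of_le_of_ne hx.2 hb⟩ hj]
    filter_upwards [h2, hL x hx, self_mem_nhdsWithin] with y h2 h4 h5
    have h5 : y < x := h5
    rw [h3]
    simp only [hT, if_neg (h5.trans_le hx.2).ne, h2, h4]
  have hconst := constant_of_has_deriv_right_zero (f := T) (a := a) (b := b) (fun x hx => by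
      have h1 : 𝓝[Set.Icc a b] x ≤ 𝓝[Set.Ioc x b ∪ Set.Ico a x ∪ {x}] x := by
        refine nhdsWithin_mono _ fun y hy => ?_
        rcases lt_trichotomy y x with h | h | h
        · exact Or.inl (Or.inr ⟨hy.1, h⟩)
        · exact Or.inr h
        · exact Or.inl (Or.inl ⟨h, hy.2⟩)
      refine Tendsto.mono_left ?_ h1
      rw [nhdsWithin_union, nhdsWithin_union]
      refine Tendsto.sup (Tendsto.sup ?_ ?_) ?_
      · by_cases hxb : x = b
        · simp [hxb]
        · refine tendsto_nhds_of_eventually_eq ?_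
          exact (hright x ⟨hx.1, lt_of_le_of_ne hx.2 hxb⟩).filter_mono
            (nhdsWithin_mono _ fun y hy => hy.1)
      · by_cases hxa : x = a
        · simp [hxa]
        · refine tendsto_nhds_of_eventually_eq ?_
          exact (hleft x ⟨lt_of_le_of_ne hx.1 (Ne.symm hxa), hx.2⟩).filter_mono
            (nhdsWithin_mono _ fun y hy => hy.2)
      · simp only [nhdsWithin_singleton]
        exact tendsto_pure_nhds _ _)
    (fun x hx => by
      refine (hasDerivWithinAt_const x (Set.Ici x) (T x)).congr_of_eventuallyEq ?_ rfl
      rw [← Set.Ioi_insert, nhdsWithin_insert]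
      exact eventually_sup.2 ⟨by simp, hright x hx⟩) b ⟨hab.le, le_rfl⟩
  have e1 : T a = R a := by
    have : ∀ j, ¬ θ j ≤ a := fun j => not_le.2 (hθ j).1
    simp [hT, hab.ne, this]
  have e2 : T b = L b - ∑ j, (R (θ j) - L (θ j)) := by
    have : ∀ j, θ j ≤ b := fun j => (hθ j).2.le
    simp [hT, this]
  rw [e1, e2] at hconst
  linear_combination hconst

namespace RayContour

variable {m : ℕ} (S : RayContour m)

/-- An angle is regular if the open ray in its direction is not a piece of the contour. -/
def Regular (φ : ℝ) : Prop := ∀ p, Complex.exp (φ * Complex.I) ≠ S.rot p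

variable {S}

lemma Regular.exp_notMem {w : ℂ} (h : S.Regular w.im) : Complex.exp w ∉ S.carrier := by
  rintro ⟨p, r, hr, he⟩
  apply h p
  have h1 : Complex.exp w = (Real.exp w.re : ℂ) * Complex.exp (w.im * Complex.I) := by
    rw [Complex.ofReal_exp, ← Complex.exp_add, Complex.re_add_im]
  have h2 : r = Real.exp w.re := by
    have := congrArg norm he
    rw [Complex.norm_exp, S.norm_point p hr] at this
    exact this.symm
  rw [h1, point_eq, h2] at he
  exact mul_left_cancel₀ (by exact_mod_cast (Real.exp_pos _).ne') he

variable (S)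

/-- The map φ ↦ e^{iφ} has a nonvanishing derivative, so it takes each of the finitely many
directions at isolated angles only. -/
lemma eventually_regular (x : ℝ) : ∀ᶠ y in 𝓝[≠] x, S.Regular y := by
  refine eventually_all.2 fun p => ?_
  by_cases h : Complex.exp (x * Complex.I) = S.rot p
  · have h2 : HasDerivAt (fun y : ℝ => Complex.exp (y * Complex.I))
        (Complex.exp (x * Complex.I) * Complex.I) x := by
      have h3 : HasDerivAt (fun y : ℝ => (y : ℂ) * Complex.I) Complex.I x := by
        simpa using (Complex.ofRealCLM.hasDerivAt (x := x)).mul_const Complex.I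
      exact h3.cexp
    rw [← h]
    exact h2.eventually_ne (by simp)
  · have : ContinuousAt (fun y : ℝ => Complex.exp (y * Complex.I)) x := by fun_prop
    exact (this.eventually_ne h).filter_mono nhdsWithin_le_nhds

/-- Half planes bounded by horizontal lines. -/
def halfPlane (θ : ℝ) (s : ℤˣ) : Set ℂ := {w | 0 < ((s : ℤ) : ℝ) * (w.im - θ)}

/-- In the coordinate w = log z rays become horizontal lines and sides become half planes: the
imaginary part of e^{w − iθ} has the sign of sin(Im w − θ), that is of Im w − θ as long as this is
less than π in modulus. -/
lemma tendsto_exp_side {p : Option (Fin m)} {s : ℤˣ} {w : ℂ}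
    (hθ : Complex.exp (w.im * Complex.I) = S.rot p) :
    Tendsto Complex.exp (𝓝[halfPlane w.im s] w) (𝓝[S.side p s] (S.point p (Real.exp w.re))) := by
  obtain ⟨c, hc⟩ := S.exists_goodCone
  have hw : Complex.exp w = S.point p (Real.exp w.re) := by
    rw [point_eq, ← hθ, Complex.ofReal_exp, ← Complex.exp_add, Complex.re_add_im]
  have h0 : Tendsto (fun v : ℂ => Complex.exp (v - w.im * Complex.I)) (𝓝 w)
      (𝓝 ((Real.exp w.re : ℝ) : ℂ)) := by
    refine Continuous.tendsto' (by fun_prop) _ _ ?_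
    rw [Complex.ofReal_exp]
    congr 1
    exact Complex.ext (by simp) (by simp)
  refine tendsto_nhdsWithin_iff.2 ⟨?_, ?_⟩
  · rw [← hw]
    exact (Complex.continuous_exp.tendsto w).mono_left nhdsWithin_le_nhds
  · have h1 : ∀ᶠ v in 𝓝 w, |v.im - w.im| < Real.pi := by
      refine (Continuous.tendsto' (continuous_abs.comp (Complex.continuous_im.sub continuous_const)
        : Continuous fun v : ℂ => |v.im - w.im|) w 0 (by simp)).eventually_lt_const Real.pi_pos
    filter_upwards [self_mem_nhdsWithin, nhdsWithin_le_nhds (h0.eventually ((isOpen_cone c).mem_nhds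
      (ofReal_mem_cone hc.1 (Real.exp_pos _)))), nhdsWithin_le_nhds h1] with v hv hv' hv''
    have e : Complex.exp v = Complex.exp (v - w.im * Complex.I) * S.rot p := by
      rw [← hθ, ← Complex.exp_add]; ring_nf
    rw [e]
    refine hc.mem_side hv' ?_
    have him : (Complex.exp (v - w.im * Complex.I)).im = Real.exp v.re * Real.sin (v.im - w.im) := by
      rw [Complex.exp_im]; simp
    rw [him]
    have hv : 0 < ((s : ℤ) : ℝ) * (v.im - w.im) := hv
    rw [abs_lt] at hv''
    rcases Int.units_eq_one_or s with rfl | rfl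
    · simp only [Units.val_one, Int.cast_one, one_mul] at hv ⊢
      exact mul_pos (Real.exp_pos _) (Real.sin_pos_of_pos_of_lt_pi hv hv''.2)
    · simp only [Units.val_neg, Units.val_one, Int.cast_neg, Int.cast_one, neg_mul, one_mul,
        Left.neg_pos_iff] at hv ⊢
      exact mul_neg_of_pos_of_neg (Real.exp_pos _) (Real.sin_neg_of_neg_of_neg_pi_lt hv hv''.1)

/-- Cauchy's theorem on a polar rectangle between two pieces of the contour, in logarithmic
coordinates. -/
lemma integral_polar_rect {F : ℂ → ℂ} (hd : DifferentiableOn ℂ F S.carrierᶜ) {α β X : ℝ}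
    (hαβ : α < β) (hX : 0 < X) (hreg : ∀ φ ∈ Set.Ioo α β, S.Regular φ) {kα kβ : ℝ → ℂ}
    (hα : ∀ x : ℝ, Tendsto (fun w => Complex.exp w * F (Complex.exp w))
      (𝓝[halfPlane α 1] ((x : ℂ) + α * Complex.I)) (𝓝 (kα x)))
    (hβ : ∀ x : ℝ, Tendsto (fun w => Complex.exp w * F (Complex.exp w))
      (𝓝[halfPlane β (-1)] ((x : ℂ) + β * Complex.I)) (𝓝 (kβ x))) :
    (∫ x in (-X)..X, kβ x) - ∫ x in (-X)..X, kα x =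
      Complex.I * ∫ φ in α..β, (Complex.exp (X + φ * Complex.I) *
          F (Complex.exp (X + φ * Complex.I)) -
        Complex.exp ((-X : ℝ) + φ * Complex.I) * F (Complex.exp ((-X : ℝ) + φ * Complex.I))) := by
  set K : ℂ → ℂ := fun w => Complex.exp w * F (Complex.exp w) with hK
  set A : Set ℂ := Set.Ioo (-X) X ×ℂ Set.Ioo α β with hA
  -- Here e^w F(e^w) dw is F(z) dz. Extended by continuity to the closed rectangle it has the
  -- one-sided limits as values on the horizontal edges, and Cauchy's theorem needs
  -- differentiability in the interior only.
  set G := extendFrom A K with hG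
  have hX' : -X < X := by linarith
  have hKd : ∀ w : ℂ, w.im ∈ Set.Ioo α β → DifferentiableAt ℂ K w := fun w hw =>
    Complex.differentiableAt_exp.mul ((hd.differentiableAt (S.isOpen_compl.mem_nhds
      (hreg _ hw).exp_notMem)).comp w Complex.differentiableAt_exp)
  have hcl : closure A = Set.Icc (-X) X ×ℂ Set.Icc α β := by
    rw [hA, Complex.closure_reProdIm, closure_Ioo hX'.ne, closure_Ioo hαβ.ne]
  have hAopen : IsOpen A := isOpen_Ioo.reProdIm isOpen_Ioo
  have hAα : A ⊆ halfPlane α 1 := fun w hw => by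
    have := hw.2.1
    simp only [halfPlane, Set.mem_ofPred_eq, Units.val_one, Int.cast_one, one_mul]
    linarith
  have hAβ : A ⊆ halfPlane β (-1) := fun w hw => by
    have := hw.2.2
    simp only [halfPlane, Set.mem_ofPred_eq, Units.val_neg, Units.val_one, Int.cast_neg,
      Int.cast_one, neg_mul, one_mul]
    linarith
  have tα : ∀ x : ℝ, Tendsto K (𝓝[A] ((x : ℂ) + α * Complex.I)) (𝓝 (kα x)) := fun x =>
    (hα x).mono_left (nhdsWithin_mono _ hAα)
  have tβ : ∀ x : ℝ, Tendsto K (𝓝[A] ((x : ℂ) + β * Complex.I)) (𝓝 (kβ x)) := fun x =>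
    (hβ x).mono_left (nhdsWithin_mono _ hAβ)
  have ti : ∀ w : ℂ, w.im ∈ Set.Ioo α β → Tendsto K (𝓝[A] w) (𝓝 (K w)) := fun w hw =>
    (hKd w hw).continuousAt.tendsto.mono_left nhdsWithin_le_nhds
  have hGc : ContinuousOn G (Set.Icc (-X) X ×ℂ Set.Icc α β) := by
    refine continuousOn_extendFrom hcl.ge fun w hw => ?_
    rcases eq_or_lt_of_le hw.2.1 with h | h
    · refine ⟨kα w.re, ?_⟩
      have := tα w.re
      rwa [h, Complex.re_add_im] at this
    · rcases eq_or_lt_of_le hw.2.2 with h' | h'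
      · refine ⟨kβ w.re, ?_⟩
        have := tβ w.re
        rwa [← h', Complex.re_add_im] at this
      · exact ⟨_, ti w ⟨h, h'⟩⟩
  have hGK : ∀ w ∈ closure A, w.im ∈ Set.Ioo α β → G w = K w := fun w hw hw' =>
    extendFrom_eq hw (ti w hw')
  have key := Complex.integral_boundary_rect_eq_zero_of_continuousOn_of_differentiableOn G
    ⟨-X, α⟩ ⟨X, β⟩ (by rw [Set.uIcc_of_le hX'.le, Set.uIcc_of_le hαβ.le]; exact hGc) (by
      simp only [min_eq_left hX'.le, max_eq_right hX'.le, min_eq_left hαβ.le, max_eq_right hαβ.le]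
      intro w hw
      refine ((hKd w hw.2).congr_of_eventuallyEq ?_).differentiableWithinAt
      filter_upwards [hAopen.mem_nhds hw] with v hv
      exact hGK v (subset_closure hv) hv.2)
  simp only at key
  have e1 : ∫ x : ℝ in (-X)..X, G (x + α * Complex.I) = ∫ x in (-X)..X, kα x := by
    refine intervalIntegral.integral_congr fun x hx => ?_
    rw [Set.uIcc_of_le hX'.le] at hx
    exact extendFrom_eq (hcl ▸ ⟨by simpa using hx, by simpa using hαβ.le⟩) (tα x)
  have e2 : ∫ x : ℝ in (-X)..X, G (x + β * Complex.I) = ∫ x in (-X)..X, kβ x := by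
    refine intervalIntegral.integral_congr fun x hx => ?_
    rw [Set.uIcc_of_le hX'.le] at hx
    exact extendFrom_eq (hcl ▸ ⟨by simpa using hx, by simpa using hαβ.le⟩) (tβ x)
  have e3 : ∀ x ∈ Set.Icc (-X) X, (∫ y : ℝ in α..β, G (x + y * Complex.I)) =
      ∫ y : ℝ in α..β, K (x + y * Complex.I) := fun x hx => by
    rw [intervalIntegral.integral_of_le hαβ.le, intervalIntegral.integral_of_le hαβ.le,
      MeasureTheory.integral_Ioc_eq_integral_Ioo, MeasureTheory.integral_Ioc_eq_integral_Ioo]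
    refine MeasureTheory.setIntegral_congr_fun measurableSet_Ioo fun y hy => ?_
    exact hGK _ (hcl ▸ ⟨by simpa using hx, by simpa using Set.Ioo_subset_Icc_self hy⟩) (by simpa using hy)
  have hGi : ∀ x ∈ Set.Icc (-X) X, IntervalIntegrable (fun y : ℝ => K (x + y * Complex.I))
      MeasureTheory.volume α β := fun x hx => by
    have h1 : IntervalIntegrable (fun y : ℝ => G (x + y * Complex.I)) MeasureTheory.volume α β := by
      apply ContinuousOn.intervalIntegrable
      rw [Set.uIcc_of_le hαβ.le]
      exact hGc.comp (by fun_prop) fun y hy => ⟨by simpa using hx, by simpa using hy⟩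
    rw [intervalIntegrable_iff_integrableOn_Ioo_of_le hαβ.le] at h1 ⊢
    refine h1.congr_fun (fun y hy => ?_) measurableSet_Ioo
    exact hGK _ (hcl ▸ ⟨by simpa using hx, by simpa using Set.Ioo_subset_Icc_self hy⟩) (by simpa using hy)
  have hXm : X ∈ Set.Icc (-X) X := ⟨hX'.le, le_rfl⟩
  have hXm' : -X ∈ Set.Icc (-X) X := ⟨le_rfl, hX'.le⟩
  rw [e1, e2, e3 X hXm, e3 (-X) hXm'] at key
  rw [intervalIntegral.integral_sub (hGi X hXm) (hGi (-X) hXm')]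
  simp only [smul_eq_mul] at key
  linear_combination -key

end RayContour

end

/-! ### The integral of a jump over the whole contour. -/

section

namespace RayContour

variable {m : ℕ} (S : RayContour m)

/-- Boundary values from a side are continuous along the piece. -/
lemma continuousOn_of_tendsto_side {F : ℂ → ℂ} {p : Option (Fin m)} {s : ℤˣ} {h : ℝ → ℂ}
    (hb : ∀ r, 0 < r → Tendsto F (𝓝[S.side p s] (S.point p r)) (𝓝 (h r))) :
    ContinuousOn h (Set.Ioi 0) := by
  have h1 : ContinuousOn (extendFrom (S.side p s) F) (S.point p '' Set.Ioi 0) := by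
    refine continuousOn_extendFrom ?_ ?_
    · rintro _ ⟨r, hr, rfl⟩
      have := S.nhdsWithin_side_neBot p s hr
      exact mem_closure_iff_nhdsWithin_neBot.2 inferInstance
    · rintro _ ⟨r, hr, rfl⟩
      exact ⟨_, hb r hr⟩
  have h2 : ContinuousOn (fun r => extendFrom (S.side p s) F (S.point p r)) (Set.Ioi 0) := by
    refine h1.comp ?_ fun r hr => ⟨r, hr, rfl⟩
    have : S.point p = fun r : ℝ => (r : ℂ) * S.rot p := funext fun r => S.point_eq p r
    rw [this]
    fun_prop
  refine h2.congr fun r hr => ?_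
  have := S.nhdsWithin_side_neBot p s hr
  exact ((hb r hr).limUnder_eq).symm

lemma countable_irregular : {φ : ℝ | ¬ S.Regular φ}.Countable := by
  have : {φ : ℝ | ¬ S.Regular φ} ⊆ ⋃ p, Set.range fun n : ℤ => S.arg p + n * (2 * Real.pi) := by
    intro φ hφ
    simp only [Regular, Set.mem_ofPred_eq, not_forall, not_not] at hφ
    obtain ⟨p, hp⟩ := hφ
    refine Set.mem_iUnion.2 ⟨p, ?_⟩
    obtain ⟨n, hn⟩ := Complex.exp_eq_exp_iff_exists_int.1 hp
    refine ⟨n, ?_⟩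
    have := congrArg Complex.im hn
    simpa using this.symm
  exact (Set.countable_iUnion fun p => Set.countable_range _).mono this

lemma isOpen_regular : IsOpen {φ : ℝ | S.Regular φ} := by
  have : {φ : ℝ | S.Regular φ} = ⋂ p, {φ : ℝ | Complex.exp (φ * Complex.I) ≠ S.rot p} := by
    ext; simp [Regular]
  rw [this]
  exact isOpen_iInter_of_finite fun p => isOpen_ne_fun (by fun_prop) continuous_const

/-- One-sided limits on all horizontal lines at once. At a regular angle F is continuous and the
sides agree; at the angle of a piece the factor e^w supplies dz/dx. Angles are not reduced modulo
2π, so the negative half line is represented both by π and by −π. -/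
lemma exists_logLimit {F : ℂ → ℂ} (hd : DifferentiableOn ℂ F S.carrierᶜ)
    {h : Option (Fin m) → ℤˣ → ℝ → ℂ}
    (hb : ∀ p s r, 0 < r → Tendsto F (𝓝[S.side p s] (S.point p r)) (𝓝 (h p s r))) :
    ∃ k : ℝ → ℤˣ → ℝ → ℂ,
      (∀ (θ : ℝ) s (x : ℝ), Tendsto (fun w => Complex.exp w * F (Complex.exp w))
        (𝓝[halfPlane θ s] ((x : ℂ) + θ * Complex.I)) (𝓝 (k θ s x))) ∧
      (∀ θ, S.Regular θ → k θ 1 = k θ (-1)) ∧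
      (∀ (θ : ℝ) p s, Complex.exp (θ * Complex.I) = S.rot p →
        ∀ x, k θ s x = Real.exp x * (h p s (Real.exp x) * S.rot p)) := by
  classical
  refine ⟨fun θ s x => if hp : ∃ p, Complex.exp (θ * Complex.I) = S.rot p then
      Real.exp x * (h hp.choose s (Real.exp x) * S.rot hp.choose) else
      Complex.exp ((x : ℂ) + θ * Complex.I) * F (Complex.exp ((x : ℂ) + θ * Complex.I)),
    fun θ s x => ?_, fun θ hθ => ?_, fun θ p s hp x => ?_⟩
  · have him : ((x : ℂ) + θ * Complex.I).im = θ := by simp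
    have hre : ((x : ℂ) + θ * Complex.I).re = x := by simp
    beta_reduce
    split_ifs with hp
    · have h1 := S.tendsto_exp_side (p := hp.choose) (s := s) (w := (x : ℂ) + θ * Complex.I)
        (by rw [him]; exact hp.choose_spec)
      rw [him, hre] at h1
      have h2 := (hb hp.choose s _ (Real.exp_pos x)).comp h1
      have h3 : Tendsto Complex.exp (𝓝[halfPlane θ s] ((x : ℂ) + θ * Complex.I))
          (𝓝 (Real.exp x * S.rot hp.choose)) := by
        have := (Complex.continuous_exp.tendsto ((x : ℂ) + θ * Complex.I)).mono_left
          (nhdsWithin_le_nhds (s := halfPlane θ s))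
        rwa [Complex.exp_add, hp.choose_spec, ← Complex.ofReal_exp] at this
      have := h3.mul h2
      rw [show (Real.exp x : ℂ) * (h hp.choose s (Real.exp x) * S.rot hp.choose) =
        Real.exp x * S.rot hp.choose * h hp.choose s (Real.exp x) by ring]
      exact this
    · have hreg : S.Regular ((x : ℂ) + θ * Complex.I).im := by
        rw [him]; exact fun p hp' => hp ⟨p, hp'⟩
      have : ContinuousAt (fun w => Complex.exp w * F (Complex.exp w))
          ((x : ℂ) + θ * Complex.I) :=
        (Complex.differentiableAt_exp.mul ((hd.differentiableAt (S.isOpen_compl.mem_nhds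
          hreg.exp_notMem)).comp _ Complex.differentiableAt_exp)).continuousAt
      exact this.tendsto.mono_left nhdsWithin_le_nhds
  · have : ¬ ∃ p, Complex.exp (θ * Complex.I) = S.rot p := fun ⟨p, hp⟩ => hθ p hp
    funext x
    simp only [this, dif_neg, not_false_eq_true]
  · have hp' : ∃ p, Complex.exp (θ * Complex.I) = S.rot p := ⟨p, hp⟩
    have : hp'.choose = p := S.rot_injective (hp'.choose_spec.symm.trans hp)
    simp only [dif_pos hp', this]

set_option maxHeartbeats 1000000 in
/-- The contour integral of the jump of a function that is analytic off the contour is determined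
by its behaviour at infinity. -/
theorem sum_integral_jump {F : ℂ → ℂ} (hd : DifferentiableOn ℂ F S.carrierᶜ)
    {h : Option (Fin m) → ℤˣ → ℝ → ℂ}
    (hb : ∀ p s r, 0 < r → Tendsto F (𝓝[S.side p s] (S.point p r)) (𝓝 (h p s r)))
    {κ : ℂ} (hinf : Tendsto (fun z => z * F z) (Bornology.cobounded ℂ ⊓ 𝓟 S.carrierᶜ) (𝓝 κ))
    (hzero : Tendsto (fun z => z * F z) (𝓝[S.carrierᶜ] 0) (𝓝 0))
    (hi : ∀ p, MeasureTheory.IntegrableOn (fun r => h p 1 r - h p (-1) r) (Set.Ioi 0)) :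
    ∑ p, (∫ r in Set.Ioi 0, (h p 1 r - h p (-1) r)) * S.rot p = -(2 * Real.pi * Complex.I * κ) := by
  have hpi := Real.pi_pos
  have hpp : -Real.pi < Real.pi := by linarith
  set K : ℂ → ℂ := fun w => Complex.exp w * F (Complex.exp w) with hK
  obtain ⟨k, hk, hkreg, hkp⟩ := S.exists_logLimit hd hb
  set V : ℝ → ℝ → ℂ := fun X φ => K (X + φ * Complex.I) - K ((-X : ℝ) + φ * Complex.I) with hV
  have hKc : ∀ x : ℝ, ContinuousOn (fun φ : ℝ => K (x + φ * Complex.I)) {φ | S.Regular φ} := by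
    intro x φ hφ
    have hreg : S.Regular ((x : ℂ) + φ * Complex.I).im := by simpa using hφ
    have : ContinuousAt K ((x : ℂ) + φ * Complex.I) :=
        (Complex.differentiableAt_exp.mul ((hd.differentiableAt (S.isOpen_compl.mem_nhds
          hreg.exp_notMem)).comp _ Complex.differentiableAt_exp)).continuousAt
    exact (ContinuousAt.comp (f := fun φ : ℝ => (x : ℂ) + φ * Complex.I) this
      (by fun_prop)).continuousWithinAt
  have hae : ∀ᵐ φ : ℝ, φ ∈ {φ : ℝ | S.Regular φ} := by
    rw [MeasureTheory.ae_iff]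
    exact S.countable_irregular.measure_zero _
  have hVm : ∀ X, MeasureTheory.AEStronglyMeasurable (V X) := by
    intro X
    have h1 : MeasureTheory.AEStronglyMeasurable (V X)
        (MeasureTheory.volume.restrict {φ | S.Regular φ}) :=
      ((hKc X).sub (hKc (-X))).aestronglyMeasurable S.isOpen_regular.measurableSet
    rwa [MeasureTheory.Measure.restrict_eq_self_of_ae_mem hae] at h1
  have l1 : ∀ φ, S.Regular φ → Tendsto (fun X : ℝ => K (X + φ * Complex.I)) atTop (𝓝 κ) := by
    intro φ hφ
    refine hinf.comp (tendsto_inf.2 ⟨?_, tendsto_principal.2 (Eventually.of_forall fun X => ?_)⟩)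
    · rw [← tendsto_norm_atTop_iff_cobounded]
      simpa [Complex.norm_exp] using Real.tendsto_exp_atTop
    · exact Regular.exp_notMem (by simpa using hφ)
  have l2 : ∀ φ, S.Regular φ → Tendsto (fun X : ℝ => K ((-X : ℝ) + φ * Complex.I)) atTop (𝓝 0) := by
    intro φ hφ
    refine hzero.comp (tendsto_nhdsWithin_iff.2 ⟨?_, Eventually.of_forall fun X => ?_⟩)
    · rw [tendsto_zero_iff_norm_tendsto_zero]
      simpa [Complex.norm_exp] using Real.tendsto_exp_neg_atTop_nhds_zero
    · exact Regular.exp_notMem (by simpa using hφ)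
  have b1 : ∀ᶠ X : ℝ in atTop, ∀ φ, S.Regular φ → ‖K (X + φ * Complex.I)‖ ≤ ‖κ‖ + 1 := by
    have := (hinf.norm.eventually_le_const (lt_add_one ‖κ‖))
    rw [eventually_inf_principal] at this
    obtain ⟨R, hR⟩ := (Filter.hasBasis_cobounded_norm).eventually_iff.1 this
    filter_upwards [Real.tendsto_exp_atTop.eventually_ge_atTop R] with X hX φ hφ
    exact hR.2 (by simpa [Complex.norm_exp] using hX) (Regular.exp_notMem (by simpa using hφ))
  have b2 : ∀ᶠ X : ℝ in atTop, ∀ φ, S.Regular φ → ‖K ((-X : ℝ) + φ * Complex.I)‖ ≤ 1 := by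
    have := (hzero.norm.eventually_le_const (by simp : ‖(0 : ℂ)‖ < 1))
    rw [eventually_nhdsWithin_iff, Metric.eventually_nhds_iff] at this
    obtain ⟨ε, hε, hR⟩ := this
    filter_upwards [Real.tendsto_exp_neg_atTop_nhds_zero.eventually_lt_const hε] with X hX φ hφ
    exact hR (by simpa [Complex.norm_exp] using hX) (Regular.exp_notMem (by simpa using hφ))
  have bV : ∀ᶠ X : ℝ in atTop, ∀ φ, S.Regular φ → ‖V X φ‖ ≤ ‖κ‖ + 2 := by
    filter_upwards [b1, b2] with X h1 h2 φ hφ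
    refine (norm_sub_le _ _).trans ?_
    linarith [h1 φ hφ, h2 φ hφ]
  have iV : ∀ᶠ X : ℝ in atTop, ∀ a b, IntervalIntegrable (V X) MeasureTheory.volume a b := by
    filter_upwards [bV] with X hX a b
    refine (intervalIntegrable_const (c := ‖κ‖ + 2)).mono_fun (hVm X).restrict ?_
    refine MeasureTheory.ae_restrict_of_ae ?_
    filter_upwards [hae] with φ hφ
    exact (hX φ hφ).trans (le_abs_self _)
  -- The outer arc contributes κ at each regular angle and the inner arc 0; the irregular angles
  -- form a null set, and z F(z) is bounded near both ends.
  have lV : Tendsto (fun X => ∫ φ in (-Real.pi)..Real.pi, V X φ) atTop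
      (𝓝 (∫ φ in (-Real.pi)..Real.pi, κ)) := by
    refine intervalIntegral.tendsto_integral_filter_of_dominated_convergence (fun _ => ‖κ‖ + 2)
      (Eventually.of_forall fun X => (hVm X).restrict) ?_ intervalIntegrable_const ?_
    · filter_upwards [bV] with X hX
      filter_upwards [hae] with φ hφ _ using hX φ hφ
    · filter_upwards [hae] with φ hφ _
      have := (l1 φ hφ).sub (l2 φ hφ)
      rwa [sub_zero] at this
  have hce : ∀ p s, Continuous fun x : ℝ => (Real.exp x : ℂ) * (h p s (Real.exp x) * S.rot p) := by
    intro p s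
    have : Continuous fun x : ℝ => h p s (Real.exp x) :=
      (S.continuousOn_of_tendsto_side (hb p s)).comp_continuous Real.continuous_exp fun x => Real.exp_pos x
    exact (Complex.continuous_ofReal.comp Real.continuous_exp).mul (this.mul continuous_const)
  have main : ∀ᶠ X : ℝ in atTop, ∑ p, ∫ x in (-X)..X, (Real.exp x : ℂ) *
      ((h p 1 (Real.exp x) - h p (-1) (Real.exp x)) * S.rot p) =
      -(Complex.I * ∫ φ in (-Real.pi)..Real.pi, V X φ) := by
    filter_upwards [iV, eventually_gt_atTop 0] with X hX hX0
    -- Integrals over the truncated ray at angle θ, from above in `R` and from below in `L`, with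
    -- the arcs accumulated since −π subtracted. Cauchy's theorem on a sector without contour
    -- equates `L` at its upper edge with `R` at its lower edge.
    set R : ℝ → ℂ := fun θ => (∫ x in (-X)..X, k θ 1 x) - Complex.I * ∫ φ in (-Real.pi)..θ, V X φ
    set L : ℝ → ℂ := fun θ => (∫ x in (-X)..X, k θ (-1) x) -
      Complex.I * ∫ φ in (-Real.pi)..θ, V X φ
    have step : ∀ α β, α < β → (∀ φ ∈ Set.Ioo α β, S.Regular φ) → L β = R α := by
      intro α β hαβ hreg
      have e := S.integral_polar_rect hd hαβ hX0 hreg (hk α 1) (hk β (-1))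
      have e2 := intervalIntegral.integral_add_adjacent_intervals (hX (-Real.pi) α) (hX α β)
      simp only [L, R]
      rw [← e2]
      linear_combination e
    have hirr : ∀ x ∈ Set.Ioo (-Real.pi) Real.pi, (∀ j, S.angle j ≠ x) → S.Regular x := by
      intro x hx hj p hp
      have h1 : Complex.exp (x * Complex.I) = Complex.exp (S.arg p * Complex.I) := hp
      have h2 : S.arg p ∈ Set.Ioc (-Real.pi) Real.pi := S.arg_mem p
      have h3 : x = S.arg p := by
        have := congrArg Complex.arg h1
        rwa [Complex.arg_exp_mul_I, Complex.arg_exp_mul_I, (toIocMod_eq_self _).2 ?_,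
          (toIocMod_eq_self _).2 ?_] at this
        · rw [show -Real.pi + 2 * Real.pi = Real.pi by ring]; exact h2
        · rw [show -Real.pi + 2 * Real.pi = Real.pi by ring]; exact Set.Ioo_subset_Ioc_self hx
      cases p with
      | none => exact hx.2.ne h3
      | some j => exact hj j h3.symm
    have key := sum_jumps_eq hpp S.angle S.angle_injective S.angle_mem R L
      (fun x hx hj => by simp only [R, L, hkreg x (hirr x hx hj)])
      (fun x hx => by
        have := (S.eventually_regular x).filter_mono (nhdsWithin_mono x fun y (hy : x < y) => hy.ne')
        obtain ⟨u, hu, hu'⟩ := mem_nhdsGT_iff_exists_Ioo_subset.1 this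
        filter_upwards [Ioo_mem_nhdsGT hu] with y hy
        exact step x y hy.1 fun φ hφ => hu' ⟨hφ.1, hφ.2.trans hy.2⟩)
      (fun x hx => by
        have := (S.eventually_regular x).filter_mono (nhdsWithin_mono x fun y (hy : y < x) => hy.ne)
        obtain ⟨u, hu, hu'⟩ := mem_nhdsLT_iff_exists_Ioo_subset.1 this
        filter_upwards [Ioo_mem_nhdsLT hu] with y hy
        exact (step y x hy.2 fun φ hφ => hu' ⟨hy.1.trans hφ.1, hφ.2⟩).symm)
    have hdiff : ∀ p, (∫ x in (-X)..X, (Real.exp x : ℂ) * (h p 1 (Real.exp x) * S.rot p)) -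
        (∫ x in (-X)..X, (Real.exp x : ℂ) * (h p (-1) (Real.exp x) * S.rot p)) =
        ∫ x in (-X)..X, (Real.exp x : ℂ) *
          ((h p 1 (Real.exp x) - h p (-1) (Real.exp x)) * S.rot p) := by
      intro p
      rw [← intervalIntegral.integral_sub ((hce p 1).intervalIntegrable _ _)
        ((hce p (-1)).intervalIntegrable _ _)]
      refine intervalIntegral.integral_congr fun x _ => ?_
      ring
    have kp : ∀ (θ : ℝ) p s, Complex.exp (θ * Complex.I) = S.rot p →
        k θ s = fun x => Real.exp x * (h p s (Real.exp x) * S.rot p) :=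
      fun θ p s hp => funext (hkp θ p s hp)
    rw [Fintype.sum_option, ← hdiff]
    -- The negative half line closes the circle: it is met at the angle π from its side −1 and at
    -- the angle −π from its side 1. The two end terms of the telescoping sum together form its
    -- jump.
    have e1 : Complex.exp ((Real.pi : ℝ) * Complex.I) = S.rot none := by
      rw [rot_none, Complex.exp_pi_mul_I]
    have e2 : Complex.exp ((-Real.pi : ℝ) * Complex.I) = S.rot none := by
      rw [rot_none]; push_cast; rw [neg_mul, Complex.exp_neg, Complex.exp_pi_mul_I]; norm_num
    have e3 : ∀ j, R (S.angle j) - L (S.angle j) = ∫ x in (-X)..X, (Real.exp x : ℂ) *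
          ((h (some j) 1 (Real.exp x) - h (some j) (-1) (Real.exp x)) * S.rot (some j)) := by
      intro j
      rw [← hdiff]
      have hj : Complex.exp (S.angle j * Complex.I) = S.rot (some j) := rfl
      simp only [R, L, kp _ (some j) _ hj]
      ring
    simp only [e3] at key
    rw [← key]
    simp only [R, L, kp _ none _ e1, kp _ none _ e2, intervalIntegral.integral_same]
    ring
  -- The substitution r = e^x carries the truncated integrals to integrals over the half line, which
  -- converge by the assumed integrability of the jumps.
  have himg : Real.exp '' Set.univ = Set.Ioi 0 := by rw [Set.image_univ, Real.range_exp]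
  have lp : ∀ p, Tendsto (fun X : ℝ => ∫ x in (-X)..X, (Real.exp x : ℂ) *
      ((h p 1 (Real.exp x) - h p (-1) (Real.exp x)) * S.rot p)) atTop
      (𝓝 ((∫ r in Set.Ioi 0, (h p 1 r - h p (-1) r)) * S.rot p)) := by
    intro p
    have hi' := hi p
    have e1 : ∀ x : ℝ, |Real.exp x| • (h p 1 (Real.exp x) - h p (-1) (Real.exp x)) =
        (Real.exp x : ℂ) * (h p 1 (Real.exp x) - h p (-1) (Real.exp x)) := fun x => by
      rw [abs_of_pos (Real.exp_pos x), Complex.real_smul]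
    have hder : ∀ x ∈ Set.univ, HasDerivWithinAt Real.exp (Real.exp x) Set.univ x :=
      fun x _ => (Real.hasDerivAt_exp x).hasDerivWithinAt
    rw [← himg, MeasureTheory.integrableOn_image_iff_integrableOn_abs_deriv_smul MeasurableSet.univ
      hder Real.exp_injective.injOn] at hi'
    simp only [e1, MeasureTheory.integrableOn_univ] at hi'
    have e2 := MeasureTheory.integral_image_eq_integral_abs_deriv_smul MeasurableSet.univ
      hder Real.exp_injective.injOn (fun r => h p 1 r - h p (-1) r)
    simp only [e1, MeasureTheory.Measure.restrict_univ, himg] at e2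
    rw [e2]
    have := (MeasureTheory.intervalIntegral_tendsto_integral hi' tendsto_neg_atTop_atBot
      tendsto_id).mul_const (S.rot p)
    simpa only [← intervalIntegral.integral_mul_const, mul_assoc, id] using this
  have := tendsto_nhds_unique ((tendsto_finsetSum Finset.univ fun p _ => lp p).congr' main)
    ((lV.const_mul Complex.I).neg)
  rw [this, intervalIntegral.integral_const, Complex.real_smul]
  push_cast
  ring

end RayContour

end

/-! ### Signed roots and boundary values of the dressing factor. -/

section

section Roots

variable {n₁ n₂ : ℕ}

/-- The points `λ_k` followed by the points `μ_k`. -/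
def pts (lam : Fin n₂ → ℂ) (mu : Fin n₁ → ℂ) : Fin (n₂ + n₁) → ℂ := Fin.append lam mu

/-- The square roots `√λ_k` followed by `-√μ_k`. -/
def roots (lam : Fin n₂ → ℂ) (mu : Fin n₁ → ℂ) : Fin (n₂ + n₁) → ℂ :=
  Fin.append (fun k => csqrt (lam k)) (fun k => -csqrt (mu k))

/-- The sign of a root: `1` at `λ_k` and `-1` at `μ_k`. -/
def rootSign (n₁ n₂ : ℕ) : Fin (n₂ + n₁) → ℂ := Fin.append (fun _ => 1) (fun _ => -1)

/-- The row attached to a point: the second one for `λ_k` and the first one for `μ_k`. -/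
def ptRow (n₁ n₂ : ℕ) : Fin (n₂ + n₁) → Fin 2 := Fin.append (fun _ => 1) (fun _ => 0)

variable (lam : Fin n₂ → ℂ) (mu : Fin n₁ → ℂ)

lemma roots_sq (k : Fin (n₂ + n₁)) : roots lam mu k ^ 2 = pts lam mu k := by
  refine Fin.addCases (fun k => ?_) (fun k => ?_) k <;> simp [roots, pts, csqrt_sq]

lemma csqrt_pts (k : Fin (n₂ + n₁)) :
    csqrt (pts lam mu k) = rootSign n₁ n₂ k * roots lam mu k := by
  refine Fin.addCases (fun k => ?_) (fun k => ?_) k <;> simp [roots, pts, rootSign]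

lemma roots_eq (k : Fin (n₂ + n₁)) :
    roots lam mu k = rootSign n₁ n₂ k * csqrt (pts lam mu k) := by
  refine Fin.addCases (fun k => ?_) (fun k => ?_) k <;> simp [roots, pts, rootSign]

/-- The common form `ε ∏ (x_k + s)` of the diagonal entries of the dressing factor. -/
def dressScalar (s : ℂ) : ℂ := (-1) ^ n₁ * ∏ k, (roots lam mu k + s)

/-- The dressing factor as a function of the square root. -/
def dressRoot (s : ℂ) : Mat := !![dressScalar lam mu s, 0; 0, dressScalar lam mu (-s)]

/-- With the roots of the μ_j taken with a minus sign, both diagonal entries come from one product ∏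
(x_k + s), at s = √z and s = −√z. A change of sign of √z therefore exchanges them. -/
lemma dressD_eq (z : ℂ) : dressD lam mu z = dressRoot lam mu (csqrt z) := by
  have h1 : ∀ s : ℂ, ∏ j, (csqrt (mu j) - s) = (-1) ^ n₁ * ∏ j, (-csqrt (mu j) + s) := fun s => by
    rw [← Fin.prod_const, ← Finset.prod_mul_distrib]
    exact Finset.prod_congr rfl fun j _ => by ring
  have h2 : ∀ s : ℂ, ∏ j, (csqrt (mu j) + s) = (-1) ^ n₁ * ∏ j, (-csqrt (mu j) + -s) := fun s => by
    rw [← h1]; simp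
  simp only [dressD, dressRoot, dressScalar, Fin.prod_univ_add, roots, Fin.append_left,
    Fin.append_right, h1, h2, ← sub_eq_add_neg]
  congr 1
  ext i j
  fin_cases i <;> fin_cases j <;> simp <;> ring

/-- The product is even in s: although the entries of D have a branch cut, det D is a polynomial in
z, with zeros exactly at the points. -/
lemma dressScalar_mul_neg (s : ℂ) :
    dressScalar lam mu s * dressScalar lam mu (-s) = ∏ k, (pts lam mu k - s ^ 2) := by
  have : ((-1 : ℂ) ^ n₁) * (-1) ^ n₁ = 1 := by rw [← mul_pow]; simp
  rw [dressScalar, dressScalar, mul_mul_mul_comm, this, one_mul, ← Finset.prod_mul_distrib]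
  refine Finset.prod_congr rfl fun k _ => ?_
  rw [← roots_sq]; ring

lemma det_dressRoot (s : ℂ) : (dressRoot lam mu s).det = ∏ k, (pts lam mu k - s ^ 2) := by
  rw [← dressScalar_mul_neg, dressRoot, Matrix.det_fin_two]; simp

lemma continuous_dressScalar : Continuous (dressScalar lam mu) := by
  unfold dressScalar; fun_prop

lemma continuous_dressRoot : Continuous (dressRoot lam mu) := by
  have := continuous_dressScalar lam mu
  refine continuous_matrix fun i j => ?_
  fin_cases i <;> fin_cases j <;> simp only [dressRoot] <;> simp <;> fun_prop

lemma differentiable_dressScalar : Differentiable ℂ (dressScalar lam mu) := by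
  unfold dressScalar; fun_prop

end Roots

lemma csqrt_differentiableAt {z : ℂ} (hz : z ∈ Complex.slitPlane) : DifferentiableAt ℂ csqrt z :=
  differentiableAt_id.cpow_const hz

namespace RayContour

variable {m : ℕ} (S : RayContour m)

/-- The boundary values of the principal square root. -/
def rootBV (p : Option (Fin m)) (s : ℤˣ) (r : ℝ) : ℂ :=
  match p with
  -- Seen outwards along the negative half line, the left side s = 1 is the lower half plane, where
  -- the principal root tends to −i√r.
  | none => -((s : ℤ) : ℂ) * Complex.I * (Real.sqrt r : ℝ)
  | some _ => csqrt (S.point p r)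

lemma point_some_mem_slitPlane (j : Fin m) {r : ℝ} (hr : 0 < r) :
    S.point (some j) r ∈ Complex.slitPlane := by
  rw [Complex.mem_slitPlane_iff_arg]
  have h1 : S.point (some j) r = (r : ℂ) * Complex.exp (S.angle j * Complex.I) := rfl
  refine ⟨?_, S.point_ne_zero _ hr⟩
  rw [h1, Complex.arg_real_mul _ hr, Complex.arg_exp_mul_I, (toIocMod_eq_self _).2]
  · exact (S.angle_mem j).2.ne
  · rw [show -Real.pi + 2 * Real.pi = Real.pi by ring]
    exact Set.Ioo_subset_Ioc_self (S.angle_mem j)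

lemma rootBV_sq (p : Option (Fin m)) (s : ℤˣ) {r : ℝ} (hr : 0 < r) :
    S.rootBV p s r ^ 2 = S.point p r := by
  cases p with
  | none =>
    have h1 : (((s : ℤ) : ℂ)) ^ 2 = 1 := by
      rcases Int.units_eq_one_or s with rfl | rfl <;> simp
    have h2 : ((Real.sqrt r : ℝ) : ℂ) ^ 2 = r := by
      rw [← Complex.ofReal_pow, Real.sq_sqrt hr.le]
    rw [rootBV, mul_pow, mul_pow, neg_sq, h1, h2, Complex.I_sq, point_eq, rot_none]; ring
  | some j => exact csqrt_sq _

lemma rootBV_some (j : Fin m) (s : ℤˣ) (r : ℝ) :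
    S.rootBV (some j) s r = csqrt (S.point (some j) r) := rfl

lemma rootBV_none_neg (s : ℤˣ) (r : ℝ) : S.rootBV none (-s) r = -S.rootBV none s r := by
  simp [rootBV]

lemma tendsto_csqrt_side (p : Option (Fin m)) (s : ℤˣ) {r : ℝ} (hr : 0 < r) :
    Tendsto csqrt (𝓝[S.side p s] (S.point p r)) (𝓝 (S.rootBV p s r)) := by
  cases p with
  | some j =>
    exact (csqrt_differentiableAt (S.point_some_mem_slitPlane j hr)).continuousAt.tendsto.mono_left
      nhdsWithin_le_nhds
  | none =>
    have hlog : ∀ z : ℂ, z ≠ 0 → csqrt z = Complex.exp (Complex.log z / 2) := fun z hz => by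
      rw [csqrt, Complex.cpow_def_of_ne_zero hz]; ring_nf
    have hp : S.point none r = ((-r : ℝ) : ℂ) := by rw [point_eq, rot_none]; push_cast; ring
    have hre : (S.point none r).re < 0 := by rw [hp, Complex.ofReal_re]; linarith
    have him : (S.point none r).im = 0 := by rw [hp, Complex.ofReal_im]
    have hnorm : ‖S.point none r‖ = r := S.norm_point none hr.le
    have hexp : Complex.exp (Real.log r / 2 : ℂ) = (Real.sqrt r : ℝ) := by
      rw [Real.sqrt_eq_rpow, Real.rpow_def_of_pos hr]; push_cast; ring_nf
    have hev : ∀ᶠ z in 𝓝[S.side none s] (S.point none r), csqrt z =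
        Complex.exp (Complex.log z / 2) := by
      filter_upwards [self_mem_nhdsWithin] with z hz
      exact hlog z (S.ne_zero_of_notMem (S.side_subset _ _ hz))
    have key : Tendsto Complex.log (𝓝[S.side none s] (S.point none r))
        (𝓝 (Real.log r - ((s : ℤ) : ℂ) * Real.pi * Complex.I)) := by
      rcases Int.units_eq_one_or s with rfl | rfl
      · have := (Complex.tendsto_log_nhdsWithin_im_neg_of_re_neg_of_im_zero hre him)
        rw [hnorm] at this
        simp only [Units.val_one, Int.cast_one, one_mul]
        refine this.mono_left (nhdsWithin_mono _ fun z hz => ?_)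
        have := (S.mem_side.1 hz).2
        rw [rot_none] at this
        simpa [inv_neg] using this
      · have := (Complex.tendsto_log_nhdsWithin_im_nonneg_of_re_neg_of_im_zero hre him)
        rw [hnorm] at this
        simp only [Units.val_neg, Units.val_one, Int.cast_neg, Int.cast_one, neg_mul, one_mul,
          sub_neg_eq_add]
        refine this.mono_left (nhdsWithin_mono _ fun z hz => ?_)
        have := (S.mem_side.1 hz).2
        rw [rot_none] at this
        have h3 : 0 < z.im := by simpa [inv_neg] using this
        exact h3.le
    refine Tendsto.congr' (hev.mono fun z hz => hz.symm) ?_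
    have h2 := (Complex.continuous_exp.tendsto _).comp (key.div_const 2)
    have h3 : Complex.exp ((Real.log r - ((s : ℤ) : ℂ) * Real.pi * Complex.I) / 2) =
        S.rootBV none s r := by
      rw [sub_div, Complex.exp_sub, hexp, rootBV]
      rcases Int.units_eq_one_or s with rfl | rfl
      · have : ((((1 : ℤˣ) : ℤ) : ℂ) * Real.pi * Complex.I) / 2 = Real.pi / 2 * Complex.I := by
          simp; ring
        rw [this, Complex.exp_pi_div_two_mul_I]
        field_simp
        simp [Complex.I_sq]
      · have : ((((-1 : ℤˣ) : ℤ) : ℂ) * Real.pi * Complex.I) / 2 = -(Real.pi / 2 * Complex.I) := by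
          simp; ring
        rw [this, Complex.exp_neg, Complex.exp_pi_div_two_mul_I, Complex.inv_I, div_neg,
          Complex.div_I]
        simp [mul_comm]
    rw [← h3]
    exact h2

variable {n₁ n₂ : ℕ} (lam : Fin n₂ → ℂ) (mu : Fin n₁ → ℂ)

lemma tendsto_dressD_side (p : Option (Fin m)) (s : ℤˣ) {r : ℝ} (hr : 0 < r) :
    Tendsto (dressD lam mu) (𝓝[S.side p s] (S.point p r))
      (𝓝 (dressRoot lam mu (S.rootBV p s r))) := by
  rw [show dressD lam mu = fun z => dressRoot lam mu (csqrt z) from funext (dressD_eq lam mu)]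
  exact ((continuous_dressRoot lam mu).tendsto _).comp (S.tendsto_csqrt_side p s hr)

variable {lam mu}

lemma prod_pts_sub_ne_zero (ha : ∀ k, pts lam mu k ∉ S.carrier) (p : Option (Fin m)) {r : ℝ}
    (hr : 0 ≤ r) : ∏ k, (pts lam mu k - S.point p r) ≠ 0 := by
  refine Finset.prod_ne_zero_iff.2 fun k _ h => ha k ?_
  rw [sub_eq_zero.1 h]
  exact ⟨p, r, hr, rfl⟩

lemma dressScalar_rootBV_ne_zero (ha : ∀ k, pts lam mu k ∉ S.carrier) (p : Option (Fin m)) (s : ℤˣ)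
    {r : ℝ} (hr : 0 < r) : dressScalar lam mu (S.rootBV p s r) ≠ 0 ∧
      dressScalar lam mu (-S.rootBV p s r) ≠ 0 := by
  have := dressScalar_mul_neg lam mu (S.rootBV p s r)
  rw [S.rootBV_sq p s hr] at this
  have h2 := S.prod_pts_sub_ne_zero ha p hr.le
  rw [← this] at h2
  exact ⟨left_ne_zero_of_mul h2, right_ne_zero_of_mul h2⟩

lemma det_dressRoot_rootBV (lam : Fin n₂ → ℂ) (mu : Fin n₁ → ℂ) (p : Option (Fin m)) (s : ℤˣ)
    {r : ℝ} (hr : 0 < r) :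
    (dressRoot lam mu (S.rootBV p s r)).det = ∏ k, (pts lam mu k - S.point p r) := by
  rw [det_dressRoot, S.rootBV_sq p s hr]

variable {d : ℕ}

lemma dressedJump_eq (M : (Fin d → ℂ) → Option (Fin m) → ℝ → Mat) (q : Params d n₁ n₂)
    (p : Option (Fin m)) {r : ℝ} (hr : 0 < r) :
    dressedJump S M q p r = (dressRoot q.2.1 q.2.2 (S.rootBV p (-S.sgn p) r))⁻¹ * M q.1 p r *
      dressRoot q.2.1 q.2.2 (S.rootBV p (S.sgn p) r) := by
  unfold dressedJump plus minus
  rw [S.boundaryValue_eq hr (S.tendsto_dressD_side _ _ _ _ hr),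
    S.boundaryValue_eq hr (S.tendsto_dressD_side _ _ _ _ hr)]

lemma det_dressedJump {M : (Fin d → ℂ) → Option (Fin m) → ℝ → Mat} {q : Params d n₁ n₂}
    (ha : ∀ k, pts q.2.1 q.2.2 k ∉ S.carrier) (hM : ∀ p r, 0 < r → (M q.1 p r).det = 1)
    (p : Option (Fin m)) {r : ℝ} (hr : 0 < r) : (dressedJump S M q p r).det = 1 := by
  rw [S.dressedJump_eq M q p hr, Matrix.det_mul, Matrix.det_mul, hM p r hr, Matrix.det_nonsing_inv,
    S.det_dressRoot_rootBV _ _ _ _ hr, S.det_dressRoot_rootBV _ _ _ _ hr, mul_one,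
    Ring.inverse_mul_cancel _ (isUnit_iff_ne_zero.2 (S.prod_pts_sub_ne_zero ha p hr.le))]

end RayContour

end

/-! ### Weighted growth and the polynomial dressing matrix. -/

section

/-- The entries of `F` grow at most like `‖z‖ ^ (e + α i - β j)` along the filter `l`. -/
def WtO (l : Filter ℂ) (e : ℝ) (α β : Fin 2 → ℝ) (F : ℂ → Mat) : Prop :=
  ∀ i j, (fun z => F z i j) =O[l] fun z => ‖z‖ ^ (e + α i - β j)

lemma isBigO_rpow_mul {l : Filter ℂ} (hl : ∀ᶠ z in l, z ≠ 0) {F G : ℂ → ℂ} {a b c : ℝ}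
    (hF : F =O[l] fun z => ‖z‖ ^ a) (hG : G =O[l] fun z => ‖z‖ ^ b) (hc : a + b = c) :
    (fun z => F z * G z) =O[l] fun z => ‖z‖ ^ c := by
  refine (hF.mul hG).congr' EventuallyEq.rfl ?_
  filter_upwards [hl] with z hz
  rw [← hc, Real.rpow_add (norm_pos_iff.2 hz)]

namespace WtO

variable {l : Filter ℂ} {e e' : ℝ} {α β γ : Fin 2 → ℝ} {F G : ℂ → Mat}

/-- The column weights of the first factor cancel the row weights of the second, so only the overall
exponents add. This keeps the powers z^{±1/4} of the two rows apart throughout. -/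
lemma mul (hl : ∀ᶠ z in l, z ≠ 0) (hF : WtO l e α β F) (hG : WtO l e' β γ G) :
    WtO l (e + e') α γ (fun z => F z * G z) := by
  intro i j
  simp only [Matrix.mul_apply, Fin.sum_univ_two]
  exact (isBigO_rpow_mul hl (hF i 0) (hG 0 j) (by ring)).add
    (isBigO_rpow_mul hl (hF i 1) (hG 1 j) (by ring))

lemma sub (hF : WtO l e α β F) (hG : WtO l e α β G) : WtO l e α β (fun z => F z - G z) :=
  fun i j => (hF i j).sub (hG i j)

/-- For equal row and column weights the diagonal entries all have exponent e and may be exchanged,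
while the off-diagonal entries stay in place up to sign. -/
lemma adjugate (hF : WtO l e α α F) : WtO l e α α (fun z => (F z).adjugate) := by
  intro i j
  simp only [Matrix.adjugate_fin_two]
  fin_cases i <;> fin_cases j <;> simp
  · simpa using hF 1 1
  · exact hF 0 1
  · exact hF 1 0
  · simpa using hF 0 0

lemma trace (hF : WtO l e α α F) : (fun z => (F z).trace) =O[l] fun z => ‖z‖ ^ e := by
  simp only [Matrix.trace_fin_two]
  exact (by simpa using hF 0 0 : (fun z => F z 0 0) =O[l] fun z => ‖z‖ ^ e).add
    (by simpa using hF 1 1)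

lemma congr (hF : WtO l e α β F) (h : ∀ᶠ z in l, F z = G z) : WtO l e α β G :=
  fun i j => (hF i j).congr' (h.mono fun _ hz => congrFun (congrFun hz i) j) EventuallyEq.rfl

end WtO

/-- The values of a matrix of polynomials. -/
def polyMat (P : Matrix (Fin 2) (Fin 2) (Polynomial ℂ)) (z : ℂ) : Mat :=
  Matrix.of fun i j => (P i j).eval z

/-- The entrywise derivative of a matrix of polynomials. -/
def polyDeriv (P : Matrix (Fin 2) (Fin 2) (Polynomial ℂ)) : Matrix (Fin 2) (Fin 2) (Polynomial ℂ) :=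
  Matrix.of fun i j => (P i j).derivative

lemma continuous_polyMat (P : Matrix (Fin 2) (Fin 2) (Polynomial ℂ)) : Continuous (polyMat P) :=
  continuous_matrix fun i j => (P i j).continuous

lemma tendsto_inv_of_det_one {l : Filter ℂ} [l.NeBot] {F : ℂ → Mat} {A : Mat}
    (h : ∀ᶠ z in l, (F z).det = 1) (hF : Tendsto F l (𝓝 A)) :
    A.det = 1 ∧ Tendsto (fun z => (F z)⁻¹) l (𝓝 A⁻¹) := by
  have h1 : A.det = 1 := by
    have h2 : Tendsto (fun z => (F z).det) l (𝓝 A.det) :=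
      ((continuous_id.matrix_det).tendsto A).comp hF
    exact tendsto_nhds_unique h2 (tendsto_const_nhds.congr' (h.mono fun z hz => hz.symm))
  refine ⟨h1, ?_⟩
  rw [inv_eq_adjugate h1]
  have h2 : Tendsto (fun z => (F z).adjugate) l (𝓝 A.adjugate) :=
    ((continuous_id.matrix_adjugate).tendsto A).comp hF
  exact h2.congr' (h.mono fun z hz => (inv_eq_adjugate hz).symm)

namespace RayContour

variable {m : ℕ} (S : RayContour m)

/-- The neighbourhoods of infinity off the contour. -/
def atInf : Filter ℂ := Bornology.cobounded ℂ ⊓ 𝓟 S.carrierᶜ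

/-- The neighbourhoods of the origin off the contour. -/
def atZero : Filter ℂ := 𝓝[S.carrierᶜ] 0

lemma eventually_atInf {p : ℂ → Prop} :
    (∀ᶠ z in S.atInf, p z) ↔ ∃ ρ : ℝ, ∀ z ∉ S.carrier, ρ ≤ ‖z‖ → p z := by
  rw [atInf, eventually_inf_principal, (Filter.hasBasis_cobounded_norm).eventually_iff]
  simp only [true_and, Set.mem_ofPred_eq, Set.mem_compl_iff]
  exact ⟨fun ⟨ρ, h⟩ => ⟨ρ, fun z hz hr => h hr hz⟩, fun ⟨ρ, h⟩ => ⟨ρ, fun z hr hz => h z hz hr⟩⟩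

lemma atInf_notMem : ∀ᶠ z in S.atInf, z ∉ S.carrier := S.eventually_atInf.2 ⟨0, fun _ h _ => h⟩

lemma atInf_ge (ρ : ℝ) : ∀ᶠ z in S.atInf, ρ ≤ ‖z‖ := S.eventually_atInf.2 ⟨ρ, fun _ _ h => h⟩

lemma atInf_ne_zero : ∀ᶠ z in S.atInf, z ≠ 0 :=
  S.atInf_notMem.mono fun _ h => S.ne_zero_of_notMem h

lemma atZero_notMem : ∀ᶠ z in S.atZero, z ∉ S.carrier := self_mem_nhdsWithin

lemma atZero_ne_zero : ∀ᶠ z in S.atZero, z ≠ 0 :=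
  S.atZero_notMem.mono fun _ h => S.ne_zero_of_notMem h

instance : S.atInf.NeBot := by
  refine ⟨fun h => ?_⟩
  have : ∀ᶠ z in S.atInf, False := by rw [h]; exact eventually_bot
  obtain ⟨ρ, hρ⟩ := S.eventually_atInf.1 this
  obtain ⟨z, hz, hz'⟩ := S.exists_notMem_large ρ
  exact hρ z hz hz'

lemma tendsto_norm_atInf : Tendsto (fun z : ℂ => ‖z‖) S.atInf atTop :=
  tendsto_norm_cobounded_atTop.mono_left inf_le_left

lemma isBigO_atInf {F : ℂ → ℂ} {e : ℝ} : (F =O[S.atInf] fun z => ‖z‖ ^ e) ↔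
    ∃ C ρ : ℝ, ∀ z ∉ S.carrier, ρ ≤ ‖z‖ → ‖F z‖ ≤ C * ‖z‖ ^ e := by
  rw [Asymptotics.isBigO_iff]
  refine exists_congr fun C => ?_
  rw [S.eventually_atInf]
  simp only [Real.norm_of_nonneg (Real.rpow_nonneg (norm_nonneg _) _)]

lemma isBigO_rpow_of_le {F : ℂ → ℂ} {a b : ℝ} (hF : F =O[S.atInf] fun z => ‖z‖ ^ a) (h : a ≤ b) :
    F =O[S.atInf] fun z => ‖z‖ ^ b := by
  refine hF.trans (Asymptotics.IsBigO.of_bound 1 ?_)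
  filter_upwards [S.atInf_ge 1] with z hz
  rw [Real.norm_of_nonneg (Real.rpow_nonneg (norm_nonneg _) _),
    Real.norm_of_nonneg (Real.rpow_nonneg (norm_nonneg _) _), one_mul]
  exact Real.rpow_le_rpow_of_exponent_le hz h

lemma isBigO_one_add_rpow {F : ℂ → ℂ} {C e : ℝ}
    (h : ∀ z ∉ S.carrier, ‖F z‖ ≤ C * (1 + ‖z‖) ^ e) : F =O[S.atInf] fun z => ‖z‖ ^ e := by
  have h1 : (fun z : ℂ => (1 + ‖z‖) ^ e) =O[S.atInf] fun z => ‖z‖ ^ e := by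
    refine Asymptotics.IsBigO.of_bound (2 ^ |e|) ?_
    filter_upwards [S.atInf_ge 1] with z hz
    have hz0 : 0 < ‖z‖ := by linarith
    rw [Real.norm_of_nonneg (Real.rpow_nonneg (by positivity) _),
      Real.norm_of_nonneg (Real.rpow_nonneg (norm_nonneg _) _), ← div_le_iff₀ (by positivity),
      ← Real.div_rpow (by positivity) (by positivity)]
    have h2 : 1 ≤ (1 + ‖z‖) / ‖z‖ := by rw [le_div_iff₀ hz0]; linarith
    refine (Real.rpow_le_rpow_of_exponent_le h2 (le_abs_self e)).trans
      (Real.rpow_le_rpow (by positivity) ?_ (abs_nonneg _))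
    rw [div_le_iff₀ hz0]; linarith
  refine (Asymptotics.IsBigO.of_bound C ?_).trans h1
  filter_upwards [S.atInf_notMem] with z hz
  rw [Real.norm_of_nonneg (Real.rpow_nonneg (by positivity) _)]
  exact h z hz

lemma isBigO_csqrt_atInf : csqrt =O[S.atInf] fun z => ‖z‖ ^ (1 / 2 : ℝ) :=
  Asymptotics.IsBigO.of_bound 1 (Eventually.of_forall fun z => by
    rw [norm_csqrt, one_mul, Real.norm_of_nonneg (Real.rpow_nonneg (norm_nonneg _) _)])

lemma isBigO_const_atInf (c : ℂ) : (fun _ => c) =O[S.atInf] fun z : ℂ => ‖z‖ ^ (0 : ℝ) := by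
  simp only [Real.rpow_zero]
  exact Asymptotics.isBigO_const_const c one_ne_zero _

/-- Cauchy's estimate on the circle of radius |z|/2. The bound is first extended from the complement
of the contour to all large z by density. -/
lemma polynomial_derivative_isBigO {p : Polynomial ℂ} {e : ℝ}
    (h : (fun z => p.eval z) =O[S.atInf] fun z => ‖z‖ ^ e) :
    (fun z => p.derivative.eval z) =O[S.atInf] fun z => ‖z‖ ^ (e - 1) := by
  obtain ⟨C, ρ, hC⟩ := S.isBigO_atInf.1 h
  refine S.isBigO_atInf.2 ⟨2 * (|C| * 2 ^ |e|), 2 * (|ρ| + 1), fun z _ hz => ?_⟩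
  have hz0 : 0 < ‖z‖ := by linarith [abs_nonneg ρ]
  have hb : ∀ w ∈ Metric.sphere z (‖z‖ / 2), ‖p.eval w‖ ≤ |C| * 2 ^ |e| * ‖z‖ ^ e := by
    intro w hw
    rw [mem_sphere_iff_norm] at hw
    have h1 : ‖z‖ ≤ 2 * ‖w‖ := by
      have := norm_sub_norm_le z w
      rw [norm_sub_rev, hw] at this; linarith
    have h2 : ‖w‖ ≤ 2 * ‖z‖ := by
      have := norm_sub_norm_le w z
      rw [hw] at this; linarith
    have hw0 : 0 < ‖w‖ := by linarith
    have h3 := S.le_of_forall_notMem p.continuous hC (z := w) (by linarith)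
    have h4 : ‖w‖ ^ e ≤ 2 ^ |e| * ‖z‖ ^ e := by
      rw [← div_le_iff₀ (by positivity), ← Real.div_rpow (by positivity) (by positivity)]
      rcases le_total 0 e with he | he
      · rw [abs_of_nonneg he]
        exact Real.rpow_le_rpow (by positivity) (by rw [div_le_iff₀ hz0]; exact h2) he
      · rw [abs_of_nonpos he, ← inv_div, Real.inv_rpow (by positivity), ← Real.rpow_neg
          (by positivity)]
        exact Real.rpow_le_rpow (by positivity) (by rw [div_le_iff₀ hw0]; exact h1) (by linarith)
    calc ‖p.eval w‖ ≤ C * ‖w‖ ^ e := h3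
      _ ≤ |C| * ‖w‖ ^ e := by gcongr; exact le_abs_self C
      _ ≤ |C| * (2 ^ |e| * ‖z‖ ^ e) := by gcongr
      _ = _ := by ring
  have := Complex.norm_deriv_le_of_forall_mem_sphere_norm_le (f := fun z => p.eval z)
    (by positivity) (p.differentiable.diffContOnCl) hb
  rw [Polynomial.deriv] at this
  refine this.trans (le_of_eq ?_)
  rw [Real.rpow_sub_one hz0.ne']
  field_simp

end RayContour

variable {m n₁ n₂ : ℕ} {S : RayContour m} {lam : Fin n₂ → ℂ} {mu : Fin n₁ → ℂ}

lemma dressScalar_isBigO (lam : Fin n₂ → ℂ) (mu : Fin n₁ → ℂ) {σ : ℂ → ℂ}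
    (hσ : σ =O[S.atInf] fun z => ‖z‖ ^ (1 / 2 : ℝ)) :
    (fun z => dressScalar lam mu (σ z)) =O[S.atInf] fun z => ‖z‖ ^ (((n₂ + n₁ : ℕ) : ℝ) / 2) := by
  unfold dressScalar
  have h1 : (fun z => ∏ k, (roots lam mu k + σ z)) =O[S.atInf]
      fun z => ∏ _k : Fin (n₂ + n₁), ‖z‖ ^ (1 / 2 : ℝ) := by
    refine Asymptotics.IsBigO.finsetProd fun k _ => ?_
    exact (S.isBigO_rpow_of_le (S.isBigO_const_atInf _) (by norm_num)).add hσ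
  refine (h1.const_mul_left _).congr' EventuallyEq.rfl ?_
  filter_upwards [S.atInf_ge 1] with z hz
  rw [Finset.prod_const, Finset.card_univ, Fintype.card_fin, ← Real.rpow_natCast,
    ← Real.rpow_mul (norm_nonneg _)]
  congr 1; ring

lemma wtO_dressD (lam : Fin n₂ → ℂ) (mu : Fin n₁ → ℂ) :
    WtO S.atInf (((n₂ + n₁ : ℕ) : ℝ) / 2) 0 0 (dressD lam mu) := by
  intro i j
  simp only [dressD_eq, dressRoot, Pi.zero_apply, add_zero, sub_zero]
  have h0 := dressScalar_isBigO lam mu S.isBigO_csqrt_atInf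
  have h1 := dressScalar_isBigO lam mu S.isBigO_csqrt_atInf.neg_left
  fin_cases i <;> fin_cases j <;> simp
  · simpa using h0
  · exact Asymptotics.isBigO_zero _ _
  · exact Asymptotics.isBigO_zero _ _
  · simpa using h1

lemma tendsto_csqrt_zero : Tendsto csqrt (𝓝 0) (𝓝 0) := by
  rw [tendsto_zero_iff_norm_tendsto_zero]
  simp only [norm_csqrt]
  have := (continuous_norm.tendsto (0 : ℂ)).rpow_const (p := 1 / 2) (Or.inr (by norm_num))
  simpa using this

lemma tendsto_dressD_zero (lam : Fin n₂ → ℂ) (mu : Fin n₁ → ℂ) :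
    Tendsto (dressD lam mu) (𝓝 0) (𝓝 (dressRoot lam mu 0)) := by
  rw [show dressD lam mu = fun z => dressRoot lam mu (csqrt z) from funext (dressD_eq lam mu)]
  exact ((continuous_dressRoot lam mu).tendsto 0).comp tendsto_csqrt_zero

lemma wtO_of_tendsto {l : Filter ℂ} {F : ℂ → Mat} {A : Mat} (h : Tendsto F l (𝓝 A)) :
    WtO l 0 0 0 F := by
  intro i j
  have : Tendsto (fun z => F z i j) l (𝓝 (A i j)) :=
    ((continuous_id.matrix_elem i j).tendsto A).comp h
  simpa using this.isBigO_one ℝ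

lemma wtO_dressD_atZero (lam : Fin n₂ → ℂ) (mu : Fin n₁ → ℂ) :
    WtO S.atZero 0 0 0 (dressD lam mu) :=
  wtO_of_tendsto ((tendsto_dressD_zero lam mu).mono_left nhdsWithin_le_nhds)

namespace IsRHPSolution

variable {M : Option (Fin m) → ℝ → Mat} {Γ : ℂ → Mat}

lemma wtO (h : IsRHPSolution S M Γ) : WtO S.atInf 0 wt 0 Γ := by
  obtain ⟨C, _, hC⟩ := h.exists_row_bound
  intro i j
  have := S.isBigO_one_add_rpow fun z hz => hC z hz i j
  simpa using this

lemma eventually_det {l : Filter ℂ} (h : IsRHPSolution S M Γ)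
    (hM : ∀ p r, 0 < r → (M p r).det = 1) (hl : ∀ᶠ z in l, z ∉ S.carrier) :
    ∀ᶠ z in l, (Γ z).det = 1 := hl.mono fun _ hz => h.det_eq_one hM hz

/-- As det Γ = 1, the inverse is the adjugate; its exponents fit because the two weights are
opposite numbers. -/
lemma wtO_inv (h : IsRHPSolution S M Γ) (hM : ∀ p r, 0 < r → (M p r).det = 1) :
    WtO S.atInf 0 0 wt (fun z => (Γ z)⁻¹) := by
  have h1 := h.wtO
  have : WtO S.atInf 0 0 wt (fun z => (Γ z).adjugate) := by
    have e : ∀ i : Fin 2, (0 : ℝ) + (0 : Fin 2 → ℝ) i - wt i = -wt i := fun i => by simp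
    have e' : ∀ i j : Fin 2, (0 : ℝ) + wt i - (0 : Fin 2 → ℝ) j = wt i := fun i j => by simp
    have w : -wt 0 = wt 1 ∧ -wt 1 = wt 0 := by rw [wt_zero, wt_one]; norm_num
    intro i j
    simp only [Matrix.adjugate_fin_two]
    have h00 := h1 0 0
    have h01 := h1 0 1
    have h10 := h1 1 0
    have h11 := h1 1 1
    simp only [e'] at h00 h01 h10 h11
    fin_cases i <;> fin_cases j <;> simp [w.1, w.2] <;> assumption
  exact this.congr ((h.eventually_det hM S.atInf_notMem).mono fun z hz => (inv_eq_adjugate hz).symm)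

lemma tendsto_inv (h : IsRHPSolution S M Γ) (hM : ∀ p r, 0 < r → (M p r).det = 1)
    (p : Option (Fin m)) (s : ℤˣ) {r : ℝ} (hr : 0 < r) : (S.boundaryValue Γ p s r).det = 1 ∧
    Tendsto (fun z => (Γ z)⁻¹) (𝓝[S.side p s] (S.point p r)) (𝓝 (S.boundaryValue Γ p s r)⁻¹) := by
  have := S.nhdsWithin_side_neBot p s hr
  refine tendsto_inv_of_det_one (h.eventually_det hM ?_) (h.boundary_tendsto p s r hr)
  filter_upwards [self_mem_nhdsWithin] with z hz using S.side_subset _ _ hz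

lemma wtO_atZero (h : IsRHPSolution S M Γ) : WtO S.atZero 0 0 0 Γ := by
  obtain ⟨C, hC⟩ := h.locally_bounded 0
  exact fun i j => Asymptotics.IsBigO.of_bound C (hC.mono fun _ hz => by simpa using hz i j)

lemma wtO_inv_atZero (h : IsRHPSolution S M Γ) (hM : ∀ p r, 0 < r → (M p r).det = 1) :
    WtO S.atZero 0 0 0 (fun z => (Γ z)⁻¹) :=
  h.wtO_atZero.adjugate.congr
    ((h.eventually_det hM S.atZero_notMem).mono fun _ hz => (inv_eq_adjugate hz).symm)

end IsRHPSolution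

/-- `P = Γ D Γn⁻¹` for a matrix of polynomials `P`, with control of the degrees. -/
structure IsDressing (S : RayContour m) (Γ Γn : ℂ → Mat) (lam : Fin n₂ → ℂ) (mu : Fin n₁ → ℂ)
    (P : Matrix (Fin 2) (Fin 2) (Polynomial ℂ)) : Prop where
  degree_lt : ∀ i j : Fin 2, (P i j).degree < ((n₂ + n₁ + 2 + i - j) / 2 : ℕ)
  eq : ∀ z ∉ S.carrier, polyMat P z = Γ z * dressD lam mu z * (Γn z)⁻¹
  wtO : WtO S.atInf (((n₂ + n₁ : ℕ) : ℝ) / 2) wt wt (polyMat P)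
  det : ∀ z, (polyMat P z).det = ∏ k, (pts lam mu k - z)

/-- The product Γ D has the jump matrix D_-⁻¹ M D_+ of Γn, so the jumps cancel in Γ D Γn⁻¹. All
factors are bounded near the origin, and the weights control the growth at infinity, so Liouville's
theorem applies to each entry. -/
theorem exists_isDressing {M Mn : Option (Fin m) → ℝ → Mat} {Γ Γn : ℂ → Mat}
    (h : IsRHPSolution S M Γ) (hn : IsRHPSolution S Mn Γn) (hM : ∀ p r, 0 < r → (M p r).det = 1)
    (hMn : ∀ p r, 0 < r → (Mn p r).det = 1) (ha : ∀ k, pts lam mu k ∉ S.carrier)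
    (hD : ∀ p r, 0 < r → Mn p r = (dressRoot lam mu (S.rootBV p (-S.sgn p) r))⁻¹ * M p r *
      dressRoot lam mu (S.rootBV p (S.sgn p) r)) :
    ∃ P, IsDressing S Γ Γn lam mu P := by
  set Q : ℂ → Mat := fun z => Γ z * dressD lam mu z * (Γn z)⁻¹ with hQ
  have hQad : ∀ z ∉ S.carrier, Q z = Γ z * dressD lam mu z * (Γn z).adjugate := fun z hz => by
    rw [hQ]; simp only [inv_eq_adjugate (hn.det_eq_one hMn hz)]
  have hQw : WtO S.atInf (((n₂ + n₁ : ℕ) : ℝ) / 2) wt wt Q := by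
    have := (h.wtO.mul S.atInf_ne_zero (wtO_dressD lam mu)).mul S.atInf_ne_zero (hn.wtO_inv hMn)
    simpa using this
  have hDd : ∀ i j, DifferentiableOn ℂ (fun z => dressD lam mu z i j) S.carrierᶜ := by
    have hs : DifferentiableOn ℂ csqrt S.carrierᶜ := fun z hz =>
      (csqrt_differentiableAt (S.compl_carrier_subset_slitPlane hz)).differentiableWithinAt
    intro i j
    simp only [dressD_eq, dressRoot]
    fin_cases i <;> fin_cases j <;> simp
    · exact (differentiable_dressScalar lam mu).comp_differentiableOn hs
    · exact (differentiable_dressScalar lam mu).comp_differentiableOn hs.neg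
  have hQd : ∀ i j, DifferentiableOn ℂ (fun z => Q z i j) S.carrierᶜ := by
    intro i j
    have e : Set.EqOn (fun z => Q z i j)
        (fun z => (Γ z * dressD lam mu z * (Γn z).adjugate) i j) S.carrierᶜ := fun z hz => by
      simp only [hQad z hz]
    refine DifferentiableOn.congr ?_ e
    have hΓ := h.analytic
    have hΓn := hn.analytic
    have hadj : ∀ i j, DifferentiableOn ℂ (fun z => (Γn z).adjugate i j) S.carrierᶜ := by
      intro i j
      simp only [Matrix.adjugate_fin_two]
      fin_cases i <;> fin_cases j <;> simp
      · exact hΓn 1 1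
      · exact hΓn 0 1
      · exact hΓn 1 0
      · exact hΓn 0 0
    simp only [Matrix.mul_apply, Fin.sum_univ_two]
    exact ((((hΓ i 0).mul (hDd 0 0)).add ((hΓ i 1).mul (hDd 1 0))).mul (hadj 0 j)).add
      ((((hΓ i 0).mul (hDd 0 1)).add ((hΓ i 1).mul (hDd 1 1))).mul (hadj 1 j))
  have hQ0 : ∀ i j, ∃ C, ∀ᶠ z in 𝓝[S.carrierᶜ] 0, ‖Q z i j‖ ≤ C := by
    have := (h.wtO_atZero.mul S.atZero_ne_zero (wtO_dressD_atZero lam mu)).mul S.atZero_ne_zero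
      (hn.wtO_inv_atZero hMn)
    intro i j
    obtain ⟨C, hC⟩ := (this i j).bound
    exact ⟨C, hC.mono fun z hz => by simpa using hz⟩
  have hQj : ∀ p r, 0 < r → ∃ Y : Mat, ∀ s, Tendsto Q (𝓝[S.side p s] (S.point p r)) (𝓝 Y) := by
    intro p r hr
    have hlim : ∀ s, Tendsto Q (𝓝[S.side p s] (S.point p r)) (𝓝 (S.boundaryValue Γ p s r *
        dressRoot lam mu (S.rootBV p s r) * (S.boundaryValue Γn p s r)⁻¹)) := fun s =>
      ((h.boundary_tendsto p s r hr).mul (S.tendsto_dressD_side lam mu p s hr)).mul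
        (hn.tendsto_inv hMn p s hr).2
    refine ⟨S.boundaryValue Γ p (-S.sgn p) r * dressRoot lam mu (S.rootBV p (-S.sgn p) r) *
      (S.boundaryValue Γn p (-S.sgn p) r)⁻¹, fun s => ?_⟩
    have hs : s = S.sgn p ∨ s = -S.sgn p := by
      rcases Int.units_eq_one_or s with rfl | rfl <;>
        rcases Int.units_eq_one_or (S.sgn p) with e | e <;> simp [e]
    rcases hs with rfl | rfl
    · have j1 : S.boundaryValue Γ p (S.sgn p) r = S.boundaryValue Γ p (-S.sgn p) r * M p r :=
        h.jump p r hr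
      have j2 : S.boundaryValue Γn p (S.sgn p) r = S.boundaryValue Γn p (-S.sgn p) r * Mn p r :=
        hn.jump p r hr
      have hu : ∀ s, IsUnit (dressRoot lam mu (S.rootBV p s r)).det := fun s => by
        rw [S.det_dressRoot_rootBV _ _ _ _ hr]
        exact isUnit_iff_ne_zero.2 (S.prod_pts_sub_ne_zero ha p hr.le)
      have hMu : IsUnit (M p r).det := by rw [hM p r hr]; exact isUnit_one
      have := hlim (S.sgn p)
      rw [j1, j2, hD p r hr, Matrix.mul_inv_rev, Matrix.mul_inv_rev, Matrix.mul_inv_rev,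
        Matrix.nonsing_inv_nonsing_inv _ (hu _)] at this
      convert this using 2
      simp only [Matrix.mul_assoc]
      rw [Matrix.mul_nonsing_inv_cancel_left _ _ (hu _),
        Matrix.mul_nonsing_inv_cancel_left _ _ hMu]
    · exact hlim _
  have hpoly : ∀ i j : Fin 2, ∃ p : Polynomial ℂ, p.degree < ((n₂ + n₁ + 2 + i - j) / 2 : ℕ) ∧
      ∀ z ∉ S.carrier, Q z i j = p.eval z := by
    intro i j
    obtain ⟨C, ρ, hC⟩ := S.isBigO_atInf.1 (hQw i j)
    refine S.exists_polynomial (hQd i j) (hQ0 i j) (fun p r hr => ?_) ?_ hC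
    · obtain ⟨Y, hY⟩ := hQj p r hr
      exact ⟨Y i j, fun s => ((continuous_id.matrix_elem i j).tendsto Y).comp (hY s)⟩
    · set n := n₂ + n₁
      have e1 : (n : ℝ) / 2 + wt i - wt j = ((n : ℝ) + i - j) / 2 := by
        simp only [wt]; ring
      -- The growth exponent (n + i − j)/2 is strictly below ⌊(n + 2 + i − j)/2⌋ for either parity.
      -- The truncated subtraction is harmless because j ≤ 1.
      rw [e1]
      have hj : (j : ℕ) ≤ 1 := by have := j.2; omega
      have h2 : n + i + 1 ≤ 2 * ((n + 2 + i - j) / 2) + j := by omega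
      have h3 : ((n : ℝ) + i + 1) ≤ 2 * (((n + 2 + i - j) / 2 : ℕ) : ℝ) + j := by exact_mod_cast h2
      linarith
  choose P hPd hPe using hpoly
  have hPQ : ∀ z ∉ S.carrier, polyMat P z = Q z := fun z hz => by
    ext i j; exact (hPe i j z hz).symm
  refine ⟨P, hPd, hPQ, hQw.congr (S.atInf_notMem.mono fun z hz => (hPQ z hz).symm), fun z => ?_⟩
  have hc : Continuous fun z => (polyMat P z).det - ∏ k, (pts lam mu k - z) :=
    ((continuous_polyMat P).matrix_det).sub (by fun_prop)
  have hcl : IsClosed {z | (polyMat P z).det - ∏ k, (pts lam mu k - z) = 0} :=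
    isClosed_eq hc continuous_const
  have hsub : S.carrierᶜ ⊆ {z | (polyMat P z).det - ∏ k, (pts lam mu k - z) = 0} := by
    intro z hz
    rw [Set.mem_ofPred_eq, hPQ z hz, hQad z hz, Matrix.det_mul, Matrix.det_mul, h.det_eq_one hM hz,
      Matrix.det_adjugate, hn.det_eq_one hMn hz, dressD_eq, det_dressRoot, csqrt_sq]
    simp
  have := hcl.closure_subset_iff.2 hsub (S.dense_compl z)
  exact sub_eq_zero.1 this

end

/-! ### Expansions in powers of √λ at infinity. -/

section

namespace RayContour

variable {m : ℕ} (S : RayContour m)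

lemma tendsto_norm_csqrt : Tendsto (fun z => ‖csqrt z‖) S.atInf atTop := by
  simp only [norm_csqrt]
  exact (tendsto_rpow_atTop (by norm_num)).comp S.tendsto_norm_atInf

lemma tendsto_csqrt_inv : Tendsto (fun z => (csqrt z)⁻¹) S.atInf (𝓝 0) := by
  rw [tendsto_zero_iff_norm_tendsto_zero]
  simp only [norm_inv]
  exact tendsto_inv_atTop_zero.comp S.tendsto_norm_csqrt

lemma tendsto_inv_atInf : Tendsto (fun z : ℂ => z⁻¹) S.atInf (𝓝 0) := by
  rw [tendsto_zero_iff_norm_tendsto_zero]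
  simp only [norm_inv]
  exact tendsto_inv_atTop_zero.comp S.tendsto_norm_atInf

lemma tendsto_polynomial_div {q : Polynomial ℂ} {M : ℕ} (hq : q.degree < M) {u : ℂ → ℂ}
    {l : Filter ℂ} (hu : ∀ᶠ z in l, u z ≠ 0) (hu' : Tendsto (fun z => (u z)⁻¹) l (𝓝 0)) :
    Tendsto (fun z => q.eval (u z) / u z ^ M) l (𝓝 0) := by
  have e : ∀ᶠ z in l, ∑ i ∈ Finset.range M, q.coeff i * ((u z)⁻¹) ^ (M - i) =
      q.eval (u z) / u z ^ M := by
    filter_upwards [hu] with z hz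
    by_cases hM : M = 0
    · subst hM
      have : q = 0 := by
        by_contra h0
        rw [Polynomial.degree_eq_natDegree h0] at hq
        exact absurd (Nat.cast_lt.1 hq) (by omega)
      simp [this]
    have hM' : q.natDegree < M := by
      by_cases h0 : q = 0
      · rw [h0, Polynomial.natDegree_zero]; omega
      · exact (Polynomial.natDegree_lt_iff_degree_lt h0).2 hq
    rw [Polynomial.eval_eq_sum_range' hM', Finset.sum_div]
    · refine Finset.sum_congr rfl fun i hi => ?_
      rw [Finset.mem_range] at hi
      rw [inv_pow, mul_div_assoc]
      congr 1
      rw [eq_div_iff (pow_ne_zero _ hz), inv_mul_eq_iff_eq_mul₀ (pow_ne_zero _ hz), ← pow_add]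
      congr 1; omega
  refine Tendsto.congr' e ?_
  rw [← Finset.sum_const_zero (s := Finset.range M)]
  refine tendsto_finsetSum _ fun i hi => ?_
  rw [Finset.mem_range] at hi
  have := (hu'.pow (M - i)).const_mul (q.coeff i)
  rwa [zero_pow (by omega), mul_zero] at this

/-- Functions with an asymptotic expansion in powers of `λ^{-1/2}` at infinity. -/
def SqrtExp (F : ℂ → ℂ) : Prop :=
  -- A Laurent polynomial in √z is written as a polynomial divided by a power, and q and M may
  -- change with K. No coherence between different K is required, which makes sums and
  -- multiplication by powers of √z immediate.
  ∀ K : ℕ, ∃ (q : Polynomial ℂ) (M : ℕ),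
    Tendsto (fun z => csqrt z ^ K * (F z - q.eval (csqrt z) / csqrt z ^ M)) S.atInf (𝓝 0)

namespace SqrtExp

variable {S} {F G : ℂ → ℂ}

lemma congr (h : S.SqrtExp F) (hFG : ∀ᶠ z in S.atInf, F z = G z) : S.SqrtExp G := by
  intro K
  obtain ⟨q, M, hq⟩ := h K
  exact ⟨q, M, hq.congr' (hFG.mono fun z hz => by rw [hz])⟩

lemma add (hF : S.SqrtExp F) (hG : S.SqrtExp G) : S.SqrtExp (fun z => F z + G z) := by
  intro K
  obtain ⟨q, M, hq⟩ := hF K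
  obtain ⟨q', M', hq'⟩ := hG K
  refine ⟨q * Polynomial.X ^ M' + q' * Polynomial.X ^ M, M + M', ?_⟩
  have := hq.add hq'
  rw [add_zero] at this
  refine this.congr' (S.atInf_ne_zero.mono fun z hz => ?_)
  have h0 := csqrt_ne_zero hz
  simp only [Polynomial.eval_add, Polynomial.eval_mul, Polynomial.eval_pow, Polynomial.eval_X]
  field_simp
  ring

lemma const_mul (hF : S.SqrtExp F) (c : ℂ) : S.SqrtExp (fun z => c * F z) := by
  intro K
  obtain ⟨q, M, hq⟩ := hF K
  refine ⟨Polynomial.C c * q, M, ?_⟩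
  have := hq.const_mul c
  rw [mul_zero] at this
  refine this.congr fun z => ?_
  simp only [Polynomial.eval_mul, Polynomial.eval_C]
  ring

lemma csqrt_mul (hF : S.SqrtExp F) : S.SqrtExp (fun z => csqrt z * F z) := by
  intro K
  obtain ⟨q, M, hq⟩ := hF (K + 1)
  refine ⟨Polynomial.X * q, M, hq.congr fun z => ?_⟩
  simp only [Polynomial.eval_mul, Polynomial.eval_X]
  ring

lemma csqrt_inv_mul (hF : S.SqrtExp F) : S.SqrtExp (fun z => (csqrt z)⁻¹ * F z) := by
  intro K
  obtain ⟨q, M, hq⟩ := hF K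
  refine ⟨q, M + 1, ?_⟩
  have := S.tendsto_csqrt_inv.mul hq
  rw [zero_mul] at this
  refine this.congr' (S.atInf_ne_zero.mono fun z hz => ?_)
  have h0 := csqrt_ne_zero hz
  beta_reduce
  rw [pow_succ]
  field_simp

lemma csqrt_pow_mul (hF : S.SqrtExp F) (k : ℕ) : S.SqrtExp (fun z => csqrt z ^ k * F z) := by
  induction k with
  | zero => simpa using hF
  | succ k ih => exact ih.csqrt_mul.congr (Eventually.of_forall fun z => by ring)

lemma csqrt_inv_pow_mul (hF : S.SqrtExp F) (k : ℕ) :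
    S.SqrtExp (fun z => ((csqrt z)⁻¹) ^ k * F z) := by
  induction k with
  | zero => simpa using hF
  | succ k ih => exact ih.csqrt_inv_mul.congr (Eventually.of_forall fun z => by ring)

lemma prod_mul (hF : S.SqrtExp F) {ι : Type*} (s : Finset ι) (x : ι → ℂ) (c : ℂ) :
    S.SqrtExp (fun z => (∏ k ∈ s, (x k + c * csqrt z)) * F z) := by
  classical
  induction s using Finset.induction_on with
  | empty => simpa using hF
  | insert a s ha ih =>
    refine ((ih.const_mul (x a)).add (ih.csqrt_mul.const_mul c)).congr
      (Eventually.of_forall fun z => ?_)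
    rw [Finset.prod_insert ha]
    ring

/-- The polynomial part of an expansion. -/
lemma exists_polynomial (hF : S.SqrtExp F) :
    ∃ q : Polynomial ℂ, Tendsto (fun z => F z - q.eval (csqrt z)) S.atInf (𝓝 0) := by
  obtain ⟨q, M, hq⟩ := hF 0
  have hmon : (Polynomial.X ^ M : Polynomial ℂ).Monic := Polynomial.monic_X_pow M
  refine ⟨q /ₘ Polynomial.X ^ M, ?_⟩
  have h1 : (q %ₘ Polynomial.X ^ M).degree < M := by
    have := Polynomial.degree_modByMonic_lt q hmon
    rwa [Polynomial.degree_X_pow] at this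
  have h2 := hq.add (tendsto_polynomial_div h1 (S.atInf_ne_zero.mono fun z hz => csqrt_ne_zero hz)
    S.tendsto_csqrt_inv)
  rw [add_zero] at h2
  refine h2.congr' (S.atInf_ne_zero.mono fun z hz => ?_)
  have h0 := csqrt_ne_zero hz
  have h3 := congrArg (Polynomial.eval (csqrt z)) (Polynomial.modByMonic_add_div q (Polynomial.X ^ M))
  simp only [Polynomial.eval_add, Polynomial.eval_mul, Polynomial.eval_pow, Polynomial.eval_X] at h3
  rw [← h3]
  field_simp
  ring

end SqrtExp

lemma exists_even_odd (q : Polynomial ℂ) : ∃ A B : Polynomial ℂ,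
    ∀ s, q.eval s = A.eval (s ^ 2) + s * B.eval (s ^ 2) := by
  induction q using Polynomial.induction_on' with
  | add p q hp hq =>
    obtain ⟨A, B, h⟩ := hp
    obtain ⟨A', B', h'⟩ := hq
    refine ⟨A + A', B + B', fun s => ?_⟩
    simp only [Polynomial.eval_add, h, h']
    ring
  | monomial n a =>
    rcases Nat.even_or_odd' n with ⟨k, rfl | rfl⟩
    · exact ⟨Polynomial.monomial k a, 0, fun s => by simp [pow_mul]⟩
    · exact ⟨0, Polynomial.monomial k a, fun s => by simp [pow_succ, pow_mul]; ring⟩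

lemma polynomial_eq_zero_of_tendsto {B : Polynomial ℂ} {ι : Type*} {l : Filter ι} [l.NeBot]
    {u : ι → ℂ} (hu : Tendsto (fun i => ‖u i‖) l atTop)
    (h : Tendsto (fun i => B.eval (u i)) l (𝓝 0)) : B = 0 := by
  by_cases hd : 0 < B.degree
  · have := B.tendsto_norm_atTop hd hu
    exact absurd h.norm (not_tendsto_nhds_of_tendsto_atTop this _)
  · rw [Polynomial.eq_C_of_degree_le_zero (not_lt.1 hd)] at h ⊢
    simp only [Polynomial.eval_C] at h
    rw [tendsto_nhds_unique tendsto_const_nhds h, Polynomial.C_0]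

/-- The limit at infinity is uniform in the direction, so it passes to the boundary values on a
piece. -/
lemma tendsto_boundary {F : ℂ → ℂ} {c : ℂ} (hF : Tendsto F S.atInf (𝓝 c)) {p : Option (Fin m)}
    {s : ℤˣ} {h : ℝ → ℂ}
    (hb : ∀ r, 0 < r → Tendsto F (𝓝[S.side p s] (S.point p r)) (𝓝 (h r))) :
    Tendsto h atTop (𝓝 c) := by
  rw [Metric.tendsto_nhds]
  intro ε hε
  obtain ⟨ρ, hρ⟩ := S.eventually_atInf.1 (Metric.tendsto_nhds.1 hF (ε / 2) (by linarith))
  filter_upwards [eventually_gt_atTop 0, eventually_gt_atTop ρ] with r h0 hr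
  have := S.nhdsWithin_side_neBot p s h0
  refine (le_of_tendsto ((hb r h0).dist tendsto_const_nhds) ?_).trans_lt (by linarith : ε / 2 < ε)
  have h2 : ∀ᶠ z in 𝓝 (S.point p r), ρ < ‖z‖ :=
    (continuous_norm.tendsto _).eventually (lt_mem_nhds (by rwa [S.norm_point p h0.le]))
  filter_upwards [self_mem_nhdsWithin, nhdsWithin_le_nhds h2] with z hz hz'
  exact (hρ z (S.side_subset _ _ hz) hz'.le).le

/-- A function with an expansion in powers of `λ^{-1/2}` that is continuous across the negative half
line has a polynomial part. -/
lemma SqrtExp.exists_polynomial_of_no_jump {F : ℂ → ℂ} (hF : S.SqrtExp F)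
    (hj : ∀ r, 0 < r → ∃ y, ∀ s, Tendsto F (𝓝[S.side none s] (S.point none r)) (𝓝 y)) :
    ∃ p : Polynomial ℂ, Tendsto (fun z => F z - p.eval z) S.atInf (𝓝 0) := by
  obtain ⟨q, hq⟩ := hF.exists_polynomial
  -- The part that does not decay is A(z) + √z B(z). Both sides of the negative half line give the
  -- same boundary value, whereas √z changes sign there; hence √z B tends to 0 along it, and the
  -- polynomial B is zero.
  obtain ⟨A, B, hAB⟩ := exists_even_odd q
  have hq' : ∀ z, q.eval (csqrt z) = A.eval z + csqrt z * B.eval z := fun z => by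
    rw [hAB, csqrt_sq]
  choose! y hy using hj
  have hb : ∀ s, Tendsto (fun r => y r - (A.eval (S.point none r) +
      S.rootBV none s r * B.eval (S.point none r))) atTop (𝓝 0) := by
    intro s
    refine S.tendsto_boundary hq (p := none) (s := s) fun r hr => ?_
    simp only [hq']
    refine (hy r hr s).sub (Tendsto.add ?_ ((S.tendsto_csqrt_side none s hr).mul ?_))
    · exact (A.continuous.tendsto _).mono_left nhdsWithin_le_nhds
    · exact (B.continuous.tendsto _).mono_left nhdsWithin_le_nhds
  have h1 := (hb 1).sub (hb (-1))
  rw [sub_zero] at h1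
  have hB : B = 0 := by
    refine polynomial_eq_zero_of_tendsto (l := atTop) (u := fun r : ℝ => S.point none r) ?_ ?_
    · refine tendsto_id.congr' ?_
      filter_upwards [eventually_ge_atTop 0] with r hr
      rw [S.norm_point none hr]; rfl
    · rw [tendsto_zero_iff_norm_tendsto_zero] at h1 ⊢
      refine squeeze_zero' (Eventually.of_forall fun _ => norm_nonneg _) ?_ h1
      filter_upwards [eventually_ge_atTop 1] with r hr
      rw [S.rootBV_none_neg 1]
      have e : (y r - (A.eval (S.point none r) + S.rootBV none 1 r * B.eval (S.point none r)) -
          (y r - (A.eval (S.point none r) + -S.rootBV none 1 r * B.eval (S.point none r)))) =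
          -2 * S.rootBV none 1 r * B.eval (S.point none r) := by ring
      rw [e, norm_mul, norm_mul]
      have h3 : 1 ≤ ‖S.rootBV none 1 r‖ := by
        simp only [rootBV, norm_mul, norm_neg, Units.val_one, Int.cast_one, norm_one, one_mul,
          Complex.norm_I, Complex.norm_real, Real.norm_eq_abs, abs_of_nonneg (Real.sqrt_nonneg _)]
        rwa [Real.one_le_sqrt]
      have h4 : ‖(-2 : ℂ)‖ = 2 := by simp
      rw [h4]
      nlinarith [norm_nonneg (B.eval (S.point none r))]
  refine ⟨A, hq.congr fun z => ?_⟩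
  rw [hq', hB]; simp

variable {S}

/-- As F is o(√z), the polynomial grows at most like |z|^(j + 1/2), which excludes degree j + 1. -/
lemma degree_lt_of_tendsto {p : Polynomial ℂ} {F : ℂ → ℂ} {j : ℕ}
    (hp : Tendsto (fun z => z ^ j * F z - p.eval z) S.atInf (𝓝 0))
    (hF : Tendsto (fun z => (csqrt z)⁻¹ * F z) S.atInf (𝓝 0)) : p.degree < (j + 1 : ℕ) := by
  have h1 : (fun z => z ^ j * F z) =O[S.atInf] fun z => ‖z‖ ^ ((j : ℝ) + 1 / 2) := by
    have h2 : (fun z => (csqrt z)⁻¹ * F z) =O[S.atInf] fun z => ‖z‖ ^ (0 : ℝ) := by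
      simpa using hF.isBigO_one ℝ
    have h3 : (fun z : ℂ => z ^ j) =O[S.atInf] fun z => ‖z‖ ^ (j : ℝ) :=
      Asymptotics.IsBigO.of_bound 1 (Eventually.of_forall fun z => by
        rw [Real.rpow_natCast]; simp)
    refine (isBigO_rpow_mul S.atInf_ne_zero h3 (isBigO_rpow_mul S.atInf_ne_zero
      S.isBigO_csqrt_atInf h2 (add_zero _)) rfl).congr' ?_ EventuallyEq.rfl
    filter_upwards [S.atInf_ne_zero] with z hz
    rw [mul_inv_cancel_left₀ (csqrt_ne_zero hz)]
  have h4 : (fun z => p.eval z) =O[S.atInf] fun z => ‖z‖ ^ ((j : ℝ) + 1 / 2) := by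
    have h5 : (fun z => z ^ j * F z - p.eval z) =O[S.atInf] fun z => ‖z‖ ^ ((j : ℝ) + 1 / 2) := by
      refine S.isBigO_rpow_of_le (a := 0) ?_ (by positivity)
      simpa using hp.isBigO_one ℝ
    exact (h1.sub h5).congr_left fun z => by ring
  obtain ⟨C, ρ, hC⟩ := S.isBigO_atInf.1 h4
  obtain ⟨p', hp', he⟩ := exists_polynomial_of_growth (f := fun z => p.eval z) (N := j + 1)
    p.differentiable (by push_cast; linarith : (j : ℝ) + 1 / 2 < (j + 1 : ℕ))
    (fun z hz => S.le_of_forall_notMem p.continuous hC hz)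
  rwa [Polynomial.funext he]

/-- Divided by z^j, the polynomial differs from F by a null function, and its lower terms disappear
in the limit. -/
lemma coeff_eq_of_tendsto {p : Polynomial ℂ} {F : ℂ → ℂ} {j : ℕ} {c : ℂ}
    (hp : Tendsto (fun z => z ^ j * F z - p.eval z) S.atInf (𝓝 0))
    (hdeg : p.degree < (j + 1 : ℕ)) (hF : Tendsto F S.atInf (𝓝 c)) : p.coeff j = c := by
  have h1 : Tendsto (fun z : ℂ => ((z : ℂ)⁻¹) ^ j * (z ^ j * F z - p.eval z)) S.atInf (𝓝 0) := by
    refine squeeze_zero_norm' ?_ (tendsto_zero_iff_norm_tendsto_zero.1 hp)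
    filter_upwards [S.atInf_ge 1] with z hz
    rw [norm_mul, norm_pow, norm_inv]
    exact mul_le_of_le_one_left (norm_nonneg _)
      (pow_le_one₀ (by positivity) (inv_le_one_of_one_le₀ hz))
  have h2 : (p - Polynomial.C (p.coeff j) * Polynomial.X ^ j).degree < ((j : ℕ) : WithBot ℕ) := by
    rw [Polynomial.degree_lt_iff_coeff_zero]
    intro i hi
    rw [Polynomial.coeff_sub, Polynomial.coeff_C_mul_X_pow]
    split_ifs with h
    · rw [h, sub_self]
    · rw [sub_zero]
      exact Polynomial.degree_lt_iff_coeff_zero _ _ |>.1 hdeg i (by omega)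
  have h3 := tendsto_polynomial_div h2 (u := id) S.atInf_ne_zero S.tendsto_inv_atInf
  have h4 := (hF.sub h1).sub h3
  rw [sub_zero, sub_zero] at h4
  refine tendsto_nhds_unique (tendsto_const_nhds.congr' ?_) h4
  filter_upwards [S.atInf_ne_zero] with z hz
  simp only [Polynomial.eval_sub, Polynomial.eval_mul, Polynomial.eval_C, Polynomial.eval_pow,
    Polynomial.eval_X, id, inv_pow]
  field_simp
  ring

end RayContour

end

/-! ### The function G_∞: expansion and continuity across the negative half line. -/

section

open RayContour

variable {m n₁ n₂ : ℕ} {S : RayContour m} {M : Option (Fin m) → ℝ → Mat} {Γ : ℂ → Mat}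

lemma tendsto_diag {ι : Type*} {l : Filter ι} {a b : ι → ℂ} {α β : ℂ} (ha : Tendsto a l (𝓝 α))
    (hb : Tendsto b l (𝓝 β)) :
    Tendsto (fun z => (!![a z, 0; 0, b z] : Mat)) l (𝓝 !![α, 0; 0, β]) := by
  refine tendsto_pi_nhds.2 fun i => tendsto_pi_nhds.2 fun j => ?_
  fin_cases i <;> fin_cases j <;> simp <;> first | assumption | exact tendsto_const_nhds

lemma IsRHPSolution.sqrtExp_frameCoord (h : IsRHPSolution S M Γ) (i j : Fin 2) :
    S.SqrtExp (fun z => frameCoord Γ z i j) := by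
  intro K
  obtain ⟨Y, a, -, -, hY⟩ := h.expansion
  -- One order beyond K, so that the remainder multiplied by √z^K still decays, like |z|^(−1/2).
  obtain ⟨C, ρ, hC⟩ := hY (K + 1)
  refine ⟨∑ k ∈ Finset.range (K + 1), Polynomial.C (Y k i j) * Polynomial.X ^ (K + 1 - k), K + 1, ?_⟩
  have h1 : Tendsto (fun z : ℂ => C * ‖z‖ ^ (-(1 / 2) : ℝ)) S.atInf (𝓝 0) := by
    have := ((tendsto_rpow_neg_atTop (by norm_num : (0 : ℝ) < 1 / 2)).comp
      S.tendsto_norm_atInf).const_mul C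
    simpa using this
  refine squeeze_zero_norm' ?_ h1
  filter_upwards [S.atInf_notMem, S.atInf_ge ρ, S.atInf_ne_zero] with z hz hzρ hz0
  have h0 := csqrt_ne_zero hz0
  have h2 := hC z hz hzρ i j
  have e : frameCoord Γ z i j - (∑ k ∈ Finset.range (K + 1), Polynomial.C (Y k i j) *
      Polynomial.X ^ (K + 1 - k)).eval (csqrt z) / csqrt z ^ (K + 1) =
      ((quarterPowNeg z * eMat)⁻¹ * Γ z
        - ∑ k ∈ Finset.range (K + 1), ((csqrt z)⁻¹ ^ k) • Y k) i j := by
    rw [Matrix.sub_apply, Matrix.sum_apply, Polynomial.eval_finsetSum, Finset.sum_div]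
    congr 1
    refine Finset.sum_congr rfl fun k hk => ?_
    have hk : k ≤ K + 1 := (Finset.mem_range.1 hk).le
    simp only [Polynomial.eval_mul, Polynomial.eval_C, Polynomial.eval_pow, Polynomial.eval_X,
      Matrix.smul_apply, smul_eq_mul, inv_pow]
    rw [div_eq_iff (pow_ne_zero _ h0), ← pow_sub_mul_pow _ hk]
    field_simp
  rw [e, norm_mul, norm_pow, norm_csqrt, ← Real.rpow_mul_natCast (norm_nonneg _)]
  have hz1 : 0 < ‖z‖ := norm_pos_iff.2 hz0
  calc ‖z‖ ^ (1 / 2 * (K : ℝ)) * _ ≤ ‖z‖ ^ (1 / 2 * (K : ℝ)) *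
        (C * ‖z‖ ^ (-((K + 1 : ℕ) : ℝ) / 2)) := by gcongr
    _ = C * (‖z‖ ^ (1 / 2 * (K : ℝ)) * ‖z‖ ^ (-((K + 1 : ℕ) : ℝ) / 2)) := by ring
    _ = _ := by rw [← Real.rpow_add hz1]; congr 2; push_cast; ring

lemma IsRHPSolution.tendsto_frameCoord (h : IsRHPSolution S M Γ) :
    Tendsto (frameCoord Γ) S.atInf (𝓝 1) := by
  obtain ⟨C, ρ, -, -, hC⟩ := h.exists_near_one
  have h1 : Tendsto (fun z : ℂ => C * ‖z‖ ^ (-(1 / 2) : ℝ)) S.atInf (𝓝 0) := by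
    have := ((tendsto_rpow_neg_atTop (by norm_num : (0 : ℝ) < 1 / 2)).comp
      S.tendsto_norm_atInf).const_mul C
    simpa using this
  refine tendsto_pi_nhds.2 fun i => tendsto_pi_nhds.2 fun j => ?_
  rw [← tendsto_sub_nhds_zero_iff]
  refine squeeze_zero_norm' ?_ h1
  filter_upwards [S.atInf_notMem, S.atInf_ge ρ] with z hz hzρ using hC z hz hzρ i j

/-- `G_∞` without the scaling by powers of `λ`. -/
def gCore (Γ : ℂ → Mat) (lam : Fin n₂ → ℂ) (mu : Fin n₁ → ℂ) (z : ℂ) : Mat :=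
  eMat * frameCoord Γ z * dressD lam mu z * eMatInv

/-- The powers of `√λ` that relate `gInfty` and `gCore`. -/
def gWeight (n : ℕ) (z : ℂ) : Mat :=
  !![((csqrt z)⁻¹) ^ (2 * ((n + 1) / 2)), (csqrt z)⁻¹ * ((csqrt z)⁻¹) ^ (2 * (n / 2));
    csqrt z * ((csqrt z)⁻¹) ^ (2 * ((n + 1) / 2)), ((csqrt z)⁻¹) ^ (2 * (n / 2))]

/-- The factor z^{−σ₃/4} at the front of Γ and the factor z^{σ₃/4} of G_∞ conjugate the core, so the
quarter powers combine into integer powers of √z. -/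
lemma gInfty_apply (lam : Fin n₂ → ℂ) (mu : Fin n₁ → ℂ) {z : ℂ} (hz : z ≠ 0) (i b : Fin 2) :
    gInfty Γ lam mu z i b = gWeight (n₂ + n₁) z i b * gCore Γ lam mu z i b := by
  have h1 : gInfty Γ lam mu z = quarterPowNeg z * gCore Γ lam mu z * quarterPow z *
      !![(z ^ ((n₂ + n₁ + 1) / 2))⁻¹, 0; 0, (z ^ ((n₂ + n₁) / 2))⁻¹] := by
    rw [gInfty, gCore, ← frame_mul_frameCoord Γ hz]
    simp only [Matrix.mul_assoc]
  have h2 : ∀ k : ℕ, (z ^ k)⁻¹ = ((csqrt z)⁻¹) ^ (2 * k) := fun k => by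
    rw [pow_mul, inv_pow, csqrt_sq, inv_pow]
  have hq := quarter_ne_zero hz
  rw [h1, h2, h2, gWeight, ← quarter_sq]
  generalize gCore Γ lam mu z = A
  generalize ((n₂ + n₁) / 2) = a
  generalize ((n₂ + n₁ + 1) / 2) = b'
  rw [Matrix.eta_fin_two A]
  fin_cases i <;> fin_cases b <;> simp [quarterPowNeg, quarterPow] <;>
    field_simp

lemma sqrtExp_mat_mul_const {F : ℂ → Mat} (hF : ∀ i j, S.SqrtExp fun z => F z i j) (A : Mat)
    (i j : Fin 2) : S.SqrtExp fun z => (F z * A) i j := by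
  simp only [Matrix.mul_apply, Fin.sum_univ_two]
  exact (((hF i 0).const_mul (A 0 j)).add ((hF i 1).const_mul (A 1 j))).congr
    (Eventually.of_forall fun z => by ring)

lemma sqrtExp_const_mul_mat {F : ℂ → Mat} (hF : ∀ i j, S.SqrtExp fun z => F z i j) (A : Mat)
    (i j : Fin 2) : S.SqrtExp fun z => (A * F z) i j := by
  simp only [Matrix.mul_apply, Fin.sum_univ_two]
  exact ((hF 0 j).const_mul (A i 0)).add ((hF 1 j).const_mul (A i 1))

lemma IsRHPSolution.sqrtExp_gInfty (h : IsRHPSolution S M Γ) (lam : Fin n₂ → ℂ) (mu : Fin n₁ → ℂ)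
    (k : ℕ) (i b : Fin 2) : S.SqrtExp fun z => z ^ k * gInfty Γ lam mu z i b := by
  have h1 : ∀ i j, S.SqrtExp fun z => (eMat * frameCoord Γ z) i j :=
    sqrtExp_const_mul_mat h.sqrtExp_frameCoord eMat
  have h2 : ∀ i j, S.SqrtExp fun z => (eMat * frameCoord Γ z * dressD lam mu z) i j := by
    intro i j
    have := (((h1 i j).prod_mul Finset.univ (roots lam mu) (if j = 0 then 1 else -1))).const_mul
      ((-1) ^ n₁)
    refine this.congr (Eventually.of_forall fun z => ?_)
    rw [dressD_eq, dressRoot, Matrix.mul_apply (N := !![_, _; _, _]), Fin.sum_univ_two]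
    fin_cases j <;> simp [dressScalar] <;> ring
  have h3 : ∀ i j, S.SqrtExp fun z => gCore Γ lam mu z i j := sqrtExp_mat_mul_const h2 _
  have h4 : S.SqrtExp fun z => gInfty Γ lam mu z i b := by
    have : S.SqrtExp fun z => gWeight (n₂ + n₁) z i b * gCore Γ lam mu z i b := by
      have := h3 i b
      fin_cases i <;> fin_cases b <;> simp [gWeight]
      · simpa using this.csqrt_inv_pow_mul _
      · exact (((this.csqrt_inv_pow_mul (2 * ((n₂ + n₁) / 2)))).csqrt_inv_mul).congr
          (Eventually.of_forall fun z => by simp; ring)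
      · exact (((this.csqrt_inv_pow_mul (2 * ((n₂ + n₁ + 1) / 2)))).csqrt_mul).congr
          (Eventually.of_forall fun z => by simp; ring)
      · simpa using this.csqrt_inv_pow_mul _
    exact this.congr (S.atInf_ne_zero.mono fun z hz => (gInfty_apply lam mu hz i b).symm)
  refine (h4.csqrt_pow_mul (2 * k)).congr (Eventually.of_forall fun z => ?_)
  rw [pow_mul, csqrt_sq]

lemma cpow_quarter_eq (z : ℂ) (hz : z ≠ 0) : z ^ (1 / 4 : ℂ) = csqrt (csqrt z) := by
  have h1 : Complex.log (csqrt z) = Complex.log z / 2 := by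
    rw [csqrt, Complex.cpow_def_of_ne_zero hz, Complex.log_exp]
    · ring
    · have := Complex.neg_pi_lt_arg z
      simp [Complex.log_im]; linarith [Real.pi_pos]
    · have := Complex.arg_le_pi z
      simp [Complex.log_im]; linarith [Real.pi_pos]
  rw [csqrt, Complex.cpow_def_of_ne_zero (csqrt_ne_zero hz), h1, Complex.cpow_def_of_ne_zero hz]
  ring_nf

/-- From the lower to the upper side of the negative half line z^{1/4} is multiplied by i. -/
lemma csqrt_mul_I {a : ℝ} (ha : 0 < a) :
    csqrt (Complex.I * a) = Complex.I * csqrt (-Complex.I * a) := by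
  have h0 : (a : ℂ) ≠ 0 := by exact_mod_cast ha.ne'
  rw [csqrt, csqrt, Complex.cpow_def_of_ne_zero (mul_ne_zero Complex.I_ne_zero h0),
    Complex.cpow_def_of_ne_zero (mul_ne_zero (neg_ne_zero.2 Complex.I_ne_zero) h0), mul_comm _ (a : ℂ),
    mul_comm _ (a : ℂ), Complex.log_ofReal_mul ha Complex.I_ne_zero,
    Complex.log_ofReal_mul ha (neg_ne_zero.2 Complex.I_ne_zero), Complex.log_I, Complex.log_neg_I]
  nth_rewrite 2 [← Complex.exp_pi_div_two_mul_I]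
  rw [← Complex.exp_add]
  congr 1
  ring

lemma tendsto_quarter_none (s : ℤˣ) {r : ℝ} (hr : 0 < r) :
    Tendsto (fun z : ℂ => z ^ (1 / 4 : ℂ)) (𝓝[S.side none s] (S.point none r))
      (𝓝 (csqrt (S.rootBV none s r))) := by
  have h1 : S.rootBV none s r ∈ Complex.slitPlane := by
    rw [Complex.mem_slitPlane_iff]
    right
    have := Real.sqrt_pos.2 hr
    rcases Int.units_eq_one_or s with rfl | rfl <;> simp [rootBV] <;> exact this.ne'
  refine (((csqrt_differentiableAt h1).continuousAt.tendsto.comp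
    (S.tendsto_csqrt_side none s hr))).congr' ?_
  filter_upwards [self_mem_nhdsWithin] with z hz
  exact (cpow_quarter_eq z (S.ne_zero_of_notMem (S.side_subset _ _ hz))).symm

/-- Across the negative half line Γ is multiplied by (iσ₂)^{±1}, the diagonal entries of D are
exchanged, and z^{1/4} acquires a factor i^{±1}. The matrix (1 − iσ₁)/√2 is chosen so that the three
effects cancel. -/
lemma IsRHPSolution.gInfty_no_jump (h : IsRHPSolution S M Γ)
    (hM : ∀ r, 0 < r → M none r = !![0, 1; -1, 0]) (lam : Fin n₂ → ℂ) (mu : Fin n₁ → ℂ) {r : ℝ}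
    (hr : 0 < r) : ∃ Y : Mat, ∀ s, Tendsto (gInfty Γ lam mu)
      (𝓝[S.side none s] (S.point none r)) (𝓝 Y) := by
  set x := S.point none r with hx
  have hx0 : x ≠ 0 := S.point_ne_zero _ hr
  set B : Mat := !![(x ^ ((n₂ + n₁ + 1) / 2))⁻¹, 0; 0, (x ^ ((n₂ + n₁) / 2))⁻¹] with hB
  set u : ℤˣ → ℂ := fun s => csqrt (S.rootBV none s r) with hu
  have hu0 : ∀ s, u s ≠ 0 := fun s => csqrt_ne_zero fun h0 => by
    have := S.rootBV_sq none s hr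
    rw [h0] at this
    exact hx0 (by rw [hx, ← this]; ring)
  have hlim : ∀ s, Tendsto (gInfty Γ lam mu) (𝓝[S.side none s] x)
      (𝓝 (S.boundaryValue Γ none s r * dressRoot lam mu (S.rootBV none s r) * eMatInv *
        !![u s, 0; 0, (u s)⁻¹] * B)) := by
    intro s
    refine ((((h.boundary_tendsto none s r hr).mul
      (S.tendsto_dressD_side lam mu none s hr)).mul tendsto_const_nhds).mul ?_).mul ?_
    · have h1 := tendsto_quarter_none (S := S) s hr
      exact tendsto_diag h1 (h1.inv₀ (hu0 s))
    · have h1 : ∀ k : ℕ, Tendsto (fun z : ℂ => (z ^ k)⁻¹) (𝓝[S.side none s] x) (𝓝 (x ^ k)⁻¹) :=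
        fun k => (((continuous_pow k).tendsto x).inv₀ (pow_ne_zero _ hx0)).mono_left
          nhdsWithin_le_nhds
      exact tendsto_diag (h1 _) (h1 _)
  refine ⟨_, fun s => (?_ : Tendsto _ _ (𝓝 (S.boundaryValue Γ none 1 r *
    dressRoot lam mu (S.rootBV none 1 r) * eMatInv * !![u 1, 0; 0, (u 1)⁻¹] * B)))⟩
  rcases Int.units_eq_one_or s with rfl | rfl
  · exact hlim 1
  · have j1 : S.boundaryValue Γ none (-1) r = S.boundaryValue Γ none 1 r * M none r := by
      have := h.jump none r hr
      simpa [RayContour.plus, RayContour.minus, RayContour.sgn] using this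
    have j2 : u (-1) = Complex.I * u 1 := by
      have := csqrt_mul_I (Real.sqrt_pos.2 hr)
      simpa [hu, rootBV] using this
    have := hlim (-1)
    rw [j1, hM r hr, S.rootBV_none_neg 1, j2] at this
    convert this using 2
    congr 1
    have hu1 := hu0 1
    simp only [Matrix.mul_assoc]
    congr 1
    simp only [dressRoot, eMatInv, neg_neg, Matrix.smul_mul, Matrix.mul_smul, Matrix.mul_fin_two]
    congr 1
    ext i j
    fin_cases i <;> fin_cases j <;> simp <;> field_simp <;> simp [Complex.I_sq]

end

/-! ### Leading terms of G_∞. -/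

section

open RayContour

variable {m n₁ n₂ : ℕ} {S : RayContour m} {M : Option (Fin m) → ℝ → Mat} {Γ : ℂ → Mat}

/-- The limits of the leading entries of `G_∞`. -/
def gLim (n₁ n₂ : ℕ) (b : Fin 2) : ℂ :=
  (-1) ^ n₁ * if Even (n₂ + n₁) then 1 else if b = 0 then Complex.I else -Complex.I

lemma gLim_ne_zero (n₁ n₂ : ℕ) (b : Fin 2) : gLim n₁ n₂ b ≠ 0 := by
  unfold gLim
  refine mul_ne_zero (pow_ne_zero _ (by norm_num)) ?_
  split_ifs
  · exact one_ne_zero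
  · exact Complex.I_ne_zero
  · exact neg_ne_zero.2 Complex.I_ne_zero

/-- The leading form of `gCore`. -/
def gCoreLim (n₁ n₂ : ℕ) : Mat :=
  (-1) ^ n₁ • if Even (n₂ + n₁) then 1 else !![0, -Complex.I; Complex.I, 0]

/-- Normalized by z^{−n/2}, D tends to ±diag(1, (−1)^n). Conjugated by (1 + iσ₁)/√2 this is ±1 for
even n and ±σ₂ for odd n, so the parity of n decides which row of a column is the leading one. -/
lemma IsRHPSolution.tendsto_gCore (h : IsRHPSolution S M Γ) (lam : Fin n₂ → ℂ) (mu : Fin n₁ → ℂ) :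
    Tendsto (fun z => ((csqrt z)⁻¹) ^ (n₂ + n₁) • gCore Γ lam mu z) S.atInf
      (𝓝 (gCoreLim n₁ n₂)) := by
  have hprod : ∀ c : ℂ, Tendsto (fun z => ((csqrt z)⁻¹) ^ (n₂ + n₁) *
      dressScalar lam mu (c * csqrt z)) S.atInf (𝓝 ((-1) ^ n₁ * c ^ (n₂ + n₁))) := by
    intro c
    have h1 : Tendsto (fun z => (-1) ^ n₁ * ∏ k, (roots lam mu k * (csqrt z)⁻¹ + c)) S.atInf
        (𝓝 ((-1) ^ n₁ * ∏ _k : Fin (n₂ + n₁), c)) := by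
      refine (tendsto_finsetProd _ fun k _ => ?_).const_mul _
      have := (S.tendsto_csqrt_inv.const_mul (roots lam mu k)).add_const c
      rwa [mul_zero, zero_add] at this
    rw [Finset.prod_const, Finset.card_univ, Fintype.card_fin] at h1
    refine h1.congr' (S.atInf_ne_zero.mono fun z hz => ?_)
    have h0 := csqrt_ne_zero hz
    have h2 : ∏ k, (roots lam mu k * (csqrt z)⁻¹ + c) =
        ((csqrt z)⁻¹) ^ (n₂ + n₁) * ∏ k, (roots lam mu k + c * csqrt z) := by
      rw [← Fin.prod_const, ← Finset.prod_mul_distrib]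
      refine Finset.prod_congr rfl fun k _ => ?_
      field_simp
    beta_reduce
    unfold dressScalar
    rw [h2]
    ring
  have hD : Tendsto (fun z => ((csqrt z)⁻¹) ^ (n₂ + n₁) • dressD lam mu z) S.atInf
      (𝓝 !![(-1) ^ n₁, 0; 0, (-1) ^ n₁ * (-1) ^ (n₂ + n₁)]) := by
    have := tendsto_diag (hprod 1) (hprod (-1))
    rw [one_pow, mul_one] at this
    refine this.congr fun z => ?_
    rw [dressD_eq, dressRoot]
    ext i j
    fin_cases i <;> fin_cases j <;> simp
  have h1 := ((tendsto_const_nhds (x := eMat)).mul h.tendsto_frameCoord).mul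
    (hD.mul (tendsto_const_nhds (x := eMatInv)))
  have e : eMat * 1 * (!![(-1) ^ n₁, 0; 0, (-1) ^ n₁ * (-1) ^ (n₂ + n₁)] * eMatInv) =
      gCoreLim n₁ n₂ := by
    have h2 := sqrt_two_inv_sq
    rw [gCoreLim, eMat, eMatInv]
    generalize ((Real.sqrt 2 : ℝ) : ℂ)⁻¹ = t at h2 ⊢
    rw [Matrix.mul_one]
    split_ifs with hn
    · rw [hn.neg_one_pow]
      ext i j
      fin_cases i <;> fin_cases j <;> simp
      · linear_combination (2 * (-1) ^ n₁) * h2 - t ^ 2 * (-1) ^ n₁ * Complex.I_sq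
      · ring
      · ring
      · linear_combination (2 * (-1) ^ n₁) * h2 - t ^ 2 * (-1) ^ n₁ * Complex.I_sq
    · rw [(Nat.not_even_iff_odd.1 hn).neg_one_pow]
      ext i j
      fin_cases i <;> fin_cases j <;> simp
      · linear_combination t ^ 2 * (-1) ^ n₁ * Complex.I_sq
      · linear_combination (-2 * Complex.I * (-1) ^ n₁) * h2
      · linear_combination (2 * Complex.I * (-1) ^ n₁) * h2
      · linear_combination - t ^ 2 * (-1) ^ n₁ * Complex.I_sq
  rw [e] at h1
  refine h1.congr fun z => ?_
  rw [gCore, Matrix.smul_mul, Matrix.mul_smul]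
  simp only [Matrix.mul_assoc]

lemma IsRHPSolution.tendsto_gCore_apply (h : IsRHPSolution S M Γ) (lam : Fin n₂ → ℂ)
    (mu : Fin n₁ → ℂ) (i b : Fin 2) :
    Tendsto (fun z => ((csqrt z)⁻¹) ^ (n₂ + n₁) * gCore Γ lam mu z i b) S.atInf
      (𝓝 (gCoreLim n₁ n₂ i b)) :=
  ((continuous_id.matrix_elem i b).tendsto _).comp (h.tendsto_gCore lam mu)

/-- The row of the leading entry in the column of index `l`. -/
def colRow (n l : ℕ) : Fin 2 := Fin.ofNat 2 (l + n)

lemma colRow_eq_one_iff (n l : ℕ) : colRow n l = 1 ↔ (l + n) % 2 = 1 := by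
  rw [colRow, Fin.ext_iff]; rfl

lemma colRow_eq_zero_iff (n l : ℕ) : colRow n l = 0 ↔ (l + n) % 2 = 0 := by
  rw [colRow, Fin.ext_iff]; rfl

/-- The leading limits give the diagonal of the coefficient matrix, the vanishing limit in the upper
row its triangularity among columns of equal degree, and the bound o(√z) the degrees of the
polynomial parts. -/
lemma IsRHPSolution.tendsto_gInfty (h : IsRHPSolution S M Γ) (lam : Fin n₂ → ℂ)
    (mu : Fin n₁ → ℂ) (b : Fin 2) :
    Tendsto (fun z => gInfty Γ lam mu z (colRow (n₂ + n₁) b) b) S.atInf (𝓝 (gLim n₁ n₂ b)) ∧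
    (colRow (n₂ + n₁) b = 1 → Tendsto (fun z => gInfty Γ lam mu z 0 b) S.atInf (𝓝 0)) ∧
    ∀ i, Tendsto (fun z => (csqrt z)⁻¹ * gInfty Γ lam mu z i b) S.atInf (𝓝 0) := by
  -- The weight of the entry is compared with the normalization z^{−n/2} of `gCore`; the function w
  -- is what remains after this cancellation, and its limit 0 or 1 decides the limit of the entry.
  have key : ∀ i : Fin 2, ∀ w : ℂ → ℂ, ∀ {G : ℂ → ℂ},
      (∀ z, z ≠ 0 → w z * ((csqrt z)⁻¹) ^ (n₂ + n₁) = G z * gWeight (n₂ + n₁) z i b) → ∀ {c : ℂ},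
      Tendsto w S.atInf (𝓝 c) →
      Tendsto (fun z => G z * gInfty Γ lam mu z i b) S.atInf (𝓝 (c * gCoreLim n₁ n₂ i b)) := by
    intro i w G hw c hc
    refine (hc.mul (h.tendsto_gCore_apply lam mu i b)).congr' (S.atInf_ne_zero.mono fun z hz => ?_)
    beta_reduce
    rw [gInfty_apply lam mu hz, ← mul_assoc, hw z hz]
    ring
  have t0 := S.tendsto_csqrt_inv
  have t1 : Tendsto (fun _ : ℂ => (1 : ℂ)) S.atInf (𝓝 1) := tendsto_const_nhds
  have t2 := t0.mul t0
  rw [zero_mul] at t2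
  rcases Nat.even_or_odd' (n₂ + n₁) with ⟨k, hk | hk⟩
  · have hev : Even (n₂ + n₁) := ⟨k, by omega⟩
    have e1 : 2 * ((n₂ + n₁ + 1) / 2) = n₂ + n₁ := by omega
    have e2 : 2 * ((n₂ + n₁) / 2) = n₂ + n₁ := by omega
    have hc : ∀ b' : Fin 2, colRow (n₂ + n₁) b' = b' := fun b' => by
      rw [colRow, Fin.ext_iff, Fin.val_ofNat]
      have := b'.2
      omega
    rw [hc]
    have hG : gCoreLim n₁ n₂ = (-1) ^ n₁ • 1 := by rw [gCoreLim, if_pos hev]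
    have hL : gLim n₁ n₂ b = (-1) ^ n₁ := by rw [gLim, if_pos hev, mul_one]
    rw [hL]
    refine ⟨?_, ?_, ?_⟩
    · have := key b (fun _ => 1) (G := fun _ => 1)
        (fun z hz => by fin_cases b <;> simp [gWeight, e1, e2]) t1
      simpa [hG] using this
    · rintro rfl
      have := key 0 (fun z => (csqrt z)⁻¹) (G := fun _ => 1)
        (fun z hz => by simp [gWeight, e2]) t0
      simpa [hG] using this
    · intro i
      fin_cases i <;> fin_cases b
      · simpa using key 0 (fun z => (csqrt z)⁻¹) (G := fun z => (csqrt z)⁻¹)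
          (fun z hz => by simp [gWeight, e1]) t0
      · simpa using key 0 (fun z => (csqrt z)⁻¹ * (csqrt z)⁻¹) (G := fun z => (csqrt z)⁻¹)
          (fun z hz => by simp [gWeight, e2]; ring) t2
      · have := key 1 (fun _ => 1) (G := fun z => (csqrt z)⁻¹)
          (fun z hz => by
            have := csqrt_ne_zero hz
            simp [gWeight, e1, this]) t1
        simpa [hG] using this
      · simpa using key 1 (fun z => (csqrt z)⁻¹) (G := fun z => (csqrt z)⁻¹)
          (fun z hz => by simp [gWeight, e2]) t0
  · have hev : ¬ Even (n₂ + n₁) := by rw [Nat.not_even_iff_odd]; exact ⟨k, hk⟩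
    have e1 : 2 * ((n₂ + n₁ + 1) / 2) = n₂ + n₁ + 1 := by omega
    have e2 : n₂ + n₁ = 2 * ((n₂ + n₁) / 2) + 1 := by omega
    have w0 : ∀ z, ((csqrt z)⁻¹) ^ (2 * ((n₂ + n₁ + 1) / 2)) =
        ((csqrt z)⁻¹) ^ (n₂ + n₁) * (csqrt z)⁻¹ := fun z => by rw [e1, pow_succ]
    have w1 : ∀ z, ((csqrt z)⁻¹) ^ (n₂ + n₁) =
        ((csqrt z)⁻¹) ^ (2 * ((n₂ + n₁) / 2)) * (csqrt z)⁻¹ := fun z => by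
      nth_rewrite 1 [e2]; rw [pow_succ]
    have hc : ∀ b' : Fin 2, colRow (n₂ + n₁) b' = 1 - b' := fun b' => by
      rw [colRow, Fin.ext_iff, Fin.val_ofNat]
      fin_cases b' <;> simp <;> omega
    rw [hc]
    have hG : gCoreLim n₁ n₂ = (-1) ^ n₁ • !![0, -Complex.I; Complex.I, 0] := by
      rw [gCoreLim, if_neg hev]
    have hL : gLim n₁ n₂ b = (-1) ^ n₁ * if b = 0 then Complex.I else -Complex.I := by
      rw [gLim, if_neg hev]
    rw [hL]
    refine ⟨?_, ?_, ?_⟩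
    · fin_cases b
      · have := key 1 (fun _ => 1) (G := fun _ => 1)
          (fun z hz => by
            have := csqrt_ne_zero hz
            simp only [gWeight, w0]
            simp
            field_simp) t1
        simpa [hG] using this
      · have := key 0 (fun _ => 1) (G := fun _ => 1)
          (fun z hz => by
            simp only [gWeight, w1 z]
            simp
            ring) t1
        simpa [hG] using this
    · intro hb
      have hb : b = 0 := by
        revert hb; fin_cases b <;> simp
      subst hb
      have := key 0 (fun z => (csqrt z)⁻¹) (G := fun _ => 1)
        (fun z hz => by
          simp only [gWeight, w0]
          simp
          ring) t0
      simpa [hG] using this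
    · intro i
      fin_cases i <;> fin_cases b
      · simpa using key 0 (fun z => (csqrt z)⁻¹ * (csqrt z)⁻¹) (G := fun z => (csqrt z)⁻¹)
          (fun z hz => by simp only [gWeight, w0]; simp; ring) t2
      · simpa using key 0 (fun z => (csqrt z)⁻¹) (G := fun z => (csqrt z)⁻¹)
          (fun z hz => by simp only [gWeight, w1 z]; simp [mul_comm]) t0
      · simpa using key 1 (fun z => (csqrt z)⁻¹) (G := fun z => (csqrt z)⁻¹)
          (fun z hz => by
            have := csqrt_ne_zero hz
            simp only [gWeight, w0]
            simp [this]
            field_simp) t0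
      · have := key 1 (fun _ => 1) (G := fun z => (csqrt z)⁻¹)
          (fun z hz => by simp only [gWeight, w1 z]; simp; ring) t1
        simpa [hG] using this

end

/-! ### Residues at infinity and the reduction of det 𝔾. -/

section

open RayContour

variable {m n₁ n₂ : ℕ} {S : RayContour m} {M : Option (Fin m) → ℝ → Mat} {Γ : ℂ → Mat}

/-- The difference of two admissible polynomials tends to 0 at infinity and hence vanishes; then the
two limits coincide. -/
lemma hasResidueAtInfty_unique {g : ℂ → ℂ} {ρ ρ' : ℂ} (h : HasResidueAtInfty S g ρ)
    (h' : HasResidueAtInfty S g ρ') : ρ = ρ' := by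
  obtain ⟨p, hp⟩ := h
  obtain ⟨p', hp'⟩ := h'
  change Tendsto _ S.atInf _ at hp
  change Tendsto _ S.atInf _ at hp'
  have h1 := hp.sub hp'
  have h2 : Tendsto (fun z => (p' - p).eval z) S.atInf (𝓝 0) := by
    have := S.tendsto_inv_atInf.mul h1
    rw [zero_mul] at this
    refine this.congr' (S.atInf_ne_zero.mono fun z hz => ?_)
    simp only [Polynomial.eval_sub]
    field_simp
    ring
  have h3 := polynomial_eq_zero_of_tendsto S.tendsto_norm_atInf h2
  rw [sub_eq_zero] at h3
  subst h3
  simp only [sub_self] at h1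
  have := tendsto_nhds_unique h1 tendsto_const_nhds
  linear_combination -this

lemma residueAtInfty_eq {g : ℂ → ℂ} {ρ : ℂ} (h : HasResidueAtInfty S g ρ) :
    residueAtInfty S g = ρ := by
  have hex : ∃ ρ, HasResidueAtInfty S g ρ := ⟨ρ, h⟩
  rw [residueAtInfty, dif_pos hex]
  exact hasResidueAtInfty_unique hex.choose_spec h

/-- The residue at infinity of a function with a polynomial part, divided by `z - a`. -/
lemma hasResidueAtInfty_div {F : ℂ → ℂ} {p : Polynomial ℂ} (a : ℂ)
    (h : Tendsto (fun z => F z - p.eval z) S.atInf (𝓝 0)) :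
    HasResidueAtInfty S (fun z => F z / (z - a)) (-p.eval a) := by
  obtain ⟨q, hq⟩ := Polynomial.X_sub_C_dvd_sub_C_eval (a := a) (p := p)
  refine ⟨q, ?_⟩
  change Tendsto _ S.atInf _
  have hq' : ∀ z, p.eval z = p.eval a + (z - a) * q.eval z := fun z => by
    have := congrArg (Polynomial.eval z) hq
    simp only [Polynomial.eval_sub, Polynomial.eval_C, Polynomial.eval_mul, Polynomial.eval_X] at this
    linear_combination this
  have h1 : Tendsto (fun z : ℂ => (1 - a * z⁻¹)⁻¹) S.atInf (𝓝 1) := by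
    have := ((S.tendsto_inv_atInf.const_mul a).const_sub 1).inv₀ (by simp)
    simpa using this
  have h2 := h1.mul (h.add_const (p.eval a))
  rw [zero_add, one_mul] at h2
  rw [neg_neg]
  refine h2.congr' ?_
  filter_upwards [S.atInf_ne_zero, S.atInf_ge (‖a‖ + 1)] with z hz hza
  have h3 : z - a ≠ 0 := fun h0 => by
    rw [sub_eq_zero] at h0
    rw [h0] at hza
    linarith
  rw [hq']
  have h4 : 1 - a * z⁻¹ = (z - a) / z := by field_simp
  rw [h4]
  field_simp
  ring

lemma gIntegrand_eq (lam : Fin n₂ → ℂ) (mu : Fin n₁ → ℂ) (k l : Fin (n₂ + n₁)) (z : ℂ) :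
    gIntegrand Γ lam mu k l z = z ^ ((l : ℕ) / 2) *
      ((Γ (pts lam mu k))⁻¹ * gInfty Γ lam mu z) (ptRow n₁ n₂ k) (Fin.ofNat 2 l) /
        (z - pts lam mu k) := by
  refine Fin.addCases (fun k => ?_) (fun k => ?_) k <;> simp [gIntegrand, pts, ptRow]

/-- The rows of `Γ₀⁻¹` at the points, multiplied by powers of the points. -/
def rowMat (Γ : ℂ → Mat) (lam : Fin n₂ → ℂ) (mu : Fin n₁ → ℂ) :
    Matrix (Fin (n₂ + n₁)) (Fin (n₂ + n₁)) ℂ :=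
  Matrix.of fun k l => pts lam mu k ^ ((l : ℕ) / 2) *
    (Γ (pts lam mu k))⁻¹ (ptRow n₁ n₂ k) (colRow (n₂ + n₁) l)

/-- The indices l < n enumerate the monomials z^j with j < ⌊n/2⌋ in component 0 and j < ⌊(n+1)/2⌋ in
component 1. Pairs of polynomials with these degree bounds thus correspond to vectors of length n.
-/
lemma sum_colRow (n : ℕ) (F : Fin 2 → ℕ → ℂ) :
    ∑ l : Fin n, F (colRow n l) ((l : ℕ) / 2) =
      ∑ j ∈ Finset.range (n / 2), F 0 j + ∑ j ∈ Finset.range ((n + 1) / 2), F 1 j := by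
  have key : ∀ (c : ℕ) (k : ℕ), ∑ l ∈ Finset.range (2 * k), F (colRow c l) (l / 2) =
      ∑ j ∈ Finset.range k, F 0 j + ∑ j ∈ Finset.range k, F 1 j := by
    intro c k
    induction k with
    | zero => simp
    | succ k ih =>
      rw [show 2 * (k + 1) = 2 * k + 1 + 1 by ring, Finset.sum_range_succ, Finset.sum_range_succ, ih,
        Finset.sum_range_succ, Finset.sum_range_succ, show 2 * k / 2 = k by omega,
        show (2 * k + 1) / 2 = k by omega]
      rcases Nat.mod_two_eq_zero_or_one c with hc | hc
      · rw [(colRow_eq_zero_iff c (2 * k)).2 (by omega), (colRow_eq_one_iff c (2 * k + 1)).2 (by omega)]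
        ring
      · rw [(colRow_eq_one_iff c (2 * k)).2 (by omega), (colRow_eq_zero_iff c (2 * k + 1)).2 (by omega)]
        ring
  rw [Fin.sum_univ_eq_sum_range (fun l => F (colRow n l) (l / 2)) n]
  rcases Nat.even_or_odd' n with ⟨k, hk | hk⟩
  · nth_rewrite 1 [hk]
    rw [key, show n / 2 = k by omega, show (n + 1) / 2 = k by omega]
  · nth_rewrite 1 [hk]
    rw [Finset.sum_range_succ, key, show n / 2 = k by omega, show (n + 1) / 2 = k + 1 by omega,
      Finset.sum_range_succ, show 2 * k / 2 = k by omega, (colRow_eq_one_iff n (2 * k)).2 (by omega)]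
    ring

/-- Evaluation of two polynomials against a pair of numbers, in terms of all coefficients. -/
lemma sum_colRow_coeff (n : ℕ) {p : Fin 2 → Polynomial ℂ}
    (hp : ∀ i : Fin 2, (p i).degree < ((n + i) / 2 : ℕ)) (y : Fin 2 → ℂ) (a : ℂ) :
    ∑ l : Fin n, a ^ ((l : ℕ) / 2) * y (colRow n l) * (p (colRow n l)).coeff ((l : ℕ) / 2) =
      ∑ i, y i * (p i).eval a := by
  rw [sum_colRow n (fun i j => a ^ j * y i * (p i).coeff j), Fin.sum_univ_two]
  have h : ∀ i : Fin 2, (p i).eval a = ∑ j ∈ Finset.range ((n + i) / 2), (p i).coeff j * a ^ j := by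
    intro i
    by_cases h0 : p i = 0
    · simp [h0]
    · exact Polynomial.eval_eq_sum_range' ((Polynomial.natDegree_lt_iff_degree_lt h0).2 (hp i)) a
  rw [h 0, h 1, Finset.mul_sum, Finset.mul_sum]
  congr 1 <;> refine Finset.sum_congr (by simp) fun j _ => by ring

/-- Triangularity need not refer to the given order of the indices; an injective key supplies
another linear order, and the determinant does not depend on it. -/
lemma det_of_triangular_key {ι : Type*} [Fintype ι] [DecidableEq ι] (A : Matrix ι ι ℂ) (key : ι → ℕ)
    (hinj : Function.Injective key) (h : ∀ i j, key j < key i → A i j = 0) :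
    A.det = ∏ i, A i i := by
  let _ : LinearOrder ι := LinearOrder.lift' key hinj
  exact Matrix.det_of_isUpperTriangular fun i j hij => h i j hij

/-- The constant relating `det 𝔾` and `det (rowMat …)`. -/
def gConst (n₁ n₂ : ℕ) : ℂ :=
  (-1) ^ (n₂ + n₁) * ∏ l : Fin (n₂ + n₁), gLim n₁ n₂ (Fin.ofNat 2 l)

lemma gConst_ne_zero (n₁ n₂ : ℕ) : gConst n₁ n₂ ≠ 0 :=
  mul_ne_zero (pow_ne_zero _ (by norm_num)) (Finset.prod_ne_zero_iff.2 fun _ _ => gLim_ne_zero _ _ _)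

/-- If p_l is the polynomial part of the l-th column z^{⌊l/2⌋} G_∞ e, the residue is minus row e_k
of Γ⁻¹(a_k) applied to p_l(a_k). Expanding p_l in monomials factors 𝔾 as −`rowMat` · C, with C
triangular and its diagonal independent of all parameters. -/
theorem IsRHPSolution.residues (h : IsRHPSolution S M Γ)
    (hM : ∀ r, 0 < r → M none r = !![0, 1; -1, 0]) (lam : Fin n₂ → ℂ) (mu : Fin n₁ → ℂ) :
    (∀ k l, ∃ ρ, HasResidueAtInfty S (gIntegrand Γ lam mu k l) ρ) ∧
      (bigG S Γ lam mu).det = gConst n₁ n₂ * (rowMat Γ lam mu).det := by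
  set n := n₂ + n₁ with hn
  have hp : ∀ (l : ℕ) (i : Fin 2), ∃ p : Polynomial ℂ, Tendsto (fun z => z ^ (l / 2) *
      gInfty Γ lam mu z i (Fin.ofNat 2 l) - p.eval z) S.atInf (𝓝 0) := by
    intro l i
    refine SqrtExp.exists_polynomial_of_no_jump S (h.sqrtExp_gInfty lam mu _ _ _) fun r hr => ?_
    obtain ⟨Y, hY⟩ := h.gInfty_no_jump hM lam mu hr
    refine ⟨S.point none r ^ (l / 2) * Y i (Fin.ofNat 2 l), fun s => Tendsto.mul ?_ ?_⟩
    · exact ((continuous_pow _).tendsto _).mono_left nhdsWithin_le_nhds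
    · exact ((continuous_id.matrix_elem _ _).tendsto Y).comp (hY s)
  choose p hp using hp
  have hlt : ∀ l : ℕ, (Fin.ofNat 2 l : Fin 2).val = l % 2 := fun l => rfl
  have hcol : ∀ l : ℕ, colRow n (Fin.ofNat 2 l : Fin 2) = colRow n l := fun l => by
    rw [colRow, colRow, Fin.ext_iff, hlt, hlt, hlt]; omega
  have hdeg1 : ∀ l i, (p l i).degree < (l / 2 + 1 : ℕ) := fun l i =>
    degree_lt_of_tendsto (hp l i) ((h.tendsto_gInfty lam mu (Fin.ofNat 2 l)).2.2 i)
  have hdiag : ∀ l, (p l (colRow n l)).coeff (l / 2) = gLim n₁ n₂ (Fin.ofNat 2 l) := fun l => by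
    refine coeff_eq_of_tendsto (hp l _) (hdeg1 l _) ?_
    have := (h.tendsto_gInfty lam mu (Fin.ofNat 2 l)).1
    rwa [← hn, hcol] at this
  have hzero : ∀ l, colRow n l = 1 → (p l 0).coeff (l / 2) = 0 := fun l hl => by
    refine coeff_eq_of_tendsto (hp l _) (hdeg1 l _) ?_
    exact (h.tendsto_gInfty lam mu (Fin.ofNat 2 l)).2.1 (by rw [← hn, hcol, hl])
  have hcoef0 : ∀ l i j, l / 2 < j → (p l i).coeff j = 0 := fun l i j hj =>
    Polynomial.degree_lt_iff_coeff_zero _ _ |>.1 (hdeg1 l i) j (by omega)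
  have hdeg : ∀ l, l < n → ∀ i : Fin 2, (p l i).degree < ((n + i) / 2 : ℕ) := by
    intro l hl i
    rw [Polynomial.degree_lt_iff_coeff_zero]
    intro j hj
    rcases lt_or_ge (l / 2) j with h1 | h1
    · exact hcoef0 l i j h1
    -- Only one coefficient could be too high: index l/2 in component 0, for n odd and l = n − 1.
    -- There the leading row is 1, and the coefficient vanishes by `hzero`.
    · have hi2 := i.2
      have hi : i = 0 := by
        rw [Fin.ext_iff]
        have : (i : ℕ) ≠ 1 := fun h1 => by rw [h1] at hj; omega
        simp only [Fin.val_zero]; omega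
      subst hi
      simp only [Fin.val_zero, add_zero] at hj
      have hj' : j = l / 2 := by omega
      rw [hj']
      exact hzero l ((colRow_eq_one_iff n l).2 (by omega))
  have hres : ∀ k l : Fin n, HasResidueAtInfty S (gIntegrand Γ lam mu k l)
      (-∑ i, (Γ (pts lam mu k))⁻¹ (ptRow n₁ n₂ k) i * (p l i).eval (pts lam mu k)) := by
    intro k l
    set y : Fin 2 → ℂ := fun i => (Γ (pts lam mu k))⁻¹ (ptRow n₁ n₂ k) i with hy
    have h1 : Tendsto (fun z => z ^ ((l : ℕ) / 2) *
        ((Γ (pts lam mu k))⁻¹ * gInfty Γ lam mu z) (ptRow n₁ n₂ k) (Fin.ofNat 2 l) -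
        (∑ i, Polynomial.C (y i) * p l i).eval z) S.atInf (𝓝 0) := by
      have := ((hp l 0).const_mul (y 0)).add ((hp l 1).const_mul (y 1))
      rw [mul_zero, mul_zero, add_zero] at this
      refine this.congr fun z => ?_
      simp only [Matrix.mul_apply, Fin.sum_univ_two, Polynomial.eval_add, Polynomial.eval_mul,
        Polynomial.eval_C, hy]
      ring
    have h2 := hasResidueAtInfty_div (pts lam mu k) h1
    have e : (∑ i, Polynomial.C (y i) * p l i).eval (pts lam mu k) =
        ∑ i, y i * (p l i).eval (pts lam mu k) := by
      simp [Fin.sum_univ_two]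
    rw [e] at h2
    rwa [show gIntegrand Γ lam mu k l = fun z => z ^ ((l : ℕ) / 2) *
      ((Γ (pts lam mu k))⁻¹ * gInfty Γ lam mu z) (ptRow n₁ n₂ k) (Fin.ofNat 2 l) /
        (z - pts lam mu k) from funext (gIntegrand_eq lam mu k l)]
  refine ⟨fun k l => ⟨_, hres k l⟩, ?_⟩
  set C : Matrix (Fin n) (Fin n) ℂ :=
    Matrix.of fun l' l => (p l (colRow n l')).coeff ((l' : ℕ) / 2) with hC
  have hG : bigG S Γ lam mu = -(rowMat Γ lam mu * C) := by
    ext k l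
    rw [bigG, Matrix.of_apply, residueAtInfty_eq (hres k l), Matrix.neg_apply, Matrix.mul_apply]
    congr 1
    exact (sum_colRow_coeff n (hdeg l l.2) (fun i => (Γ (pts lam mu k))⁻¹ (ptRow n₁ n₂ k) i)
      (pts lam mu k)).symm
  have hdetC : C.det = ∏ l : Fin n, gLim n₁ n₂ (Fin.ofNat 2 l) := by
    -- The order is by degree, and for equal degree a column leading in row 1 precedes one leading
    -- in row 0.
    rw [det_of_triangular_key C (fun l => 2 * ((l : ℕ) / 2) + 1 - ((l : ℕ) + n) % 2)]
    · exact Finset.prod_congr rfl fun l _ => hdiag l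
    · intro l l' hll
      simp only at hll
      rw [Fin.ext_iff]
      omega
    · intro l' l hll
      change (p l (colRow n l')).coeff ((l' : ℕ) / 2) = 0
      rcases lt_or_ge ((l : ℕ) / 2) ((l' : ℕ) / 2) with h1 | h1
      · exact hcoef0 _ _ _ h1
      · have h2 : (l' : ℕ) / 2 = (l : ℕ) / 2 := by omega
        have h3 : ((l' : ℕ) + n) % 2 = 0 := by omega
        have h4 : ((l : ℕ) + n) % 2 = 1 := by omega
        rw [h2, (colRow_eq_zero_iff n l').2 h3]
        exact hzero l ((colRow_eq_one_iff n l).2 h4)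
  rw [hG, Matrix.det_neg, Matrix.det_mul, hdetC, Fintype.card_fin, gConst]
  ring

end

/-! ### Zeros of the dressing factor. -/

section

open RayContour

variable {m n₁ n₂ : ℕ} {S : RayContour m} {lam : Fin n₂ → ℂ} {mu : Fin n₁ → ℂ}

lemma csqrt_re_pos {z : ℂ} (hz : z ∈ Complex.slitPlane) : 0 < (csqrt z).re := by
  have h0 := Complex.slitPlane_ne_zero hz
  have h1 : csqrt z = Complex.exp (Complex.log z / 2) := by
    rw [csqrt, Complex.cpow_def_of_ne_zero h0]; ring_nf
  rw [h1, Complex.exp_re]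
  refine mul_pos (Real.exp_pos _) (Real.cos_pos_of_mem_Ioo ⟨?_, ?_⟩)
  · have := Complex.neg_pi_lt_arg z
    simp [Complex.log_im]; linarith
  · have := lt_of_le_of_ne (Complex.arg_le_pi z) (Complex.mem_slitPlane_iff_arg.1 hz).1
    simp [Complex.log_im]; linarith

lemma hasDerivAt_csqrt {z : ℂ} (hz : z ∈ Complex.slitPlane) :
    HasDerivAt csqrt (1 / (2 * csqrt z)) z := by
  have h0 := csqrt_ne_zero (Complex.slitPlane_ne_zero hz)
  have h1 := (csqrt_differentiableAt hz).hasDerivAt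
  have h2 := h1.pow 2
  have h3 : HasDerivAt (fun z => csqrt z ^ 2) 1 z := by
    simp only [csqrt_sq]; exact hasDerivAt_id z
  have h4 := h2.unique h3
  have : deriv csqrt z = 1 / (2 * csqrt z) := by
    field_simp
    simp at h4
    linear_combination h4
  rwa [this] at h1

lemma rootSign_sq (k : Fin (n₂ + n₁)) : rootSign n₁ n₂ k * rootSign n₁ n₂ k = 1 := by
  refine Fin.addCases (fun k => ?_) (fun k => ?_) k <;> simp [rootSign]

lemma rootSign_ne_zero (k : Fin (n₂ + n₁)) : rootSign n₁ n₂ k ≠ 0 := fun h => by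
  have := rootSign_sq k
  rw [h] at this; simp at this

lemma roots_ne_zero {k : Fin (n₂ + n₁)} (h : pts lam mu k ≠ 0) : roots lam mu k ≠ 0 := fun h0 =>
  h (by rw [← roots_sq, h0]; ring)

lemma roots_add_ne_zero {k : Fin (n₂ + n₁)} (h : pts lam mu k ∈ Complex.slitPlane) {z : ℂ}
    (hz : z ∈ Complex.slitPlane) : roots lam mu k + rootSign n₁ n₂ k * csqrt z ≠ 0 := by
  rw [roots_eq, ← mul_add]
  refine mul_ne_zero (rootSign_ne_zero k) fun h0 => ?_
  have := congrArg Complex.re h0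
  rw [Complex.add_re, Complex.zero_re] at this
  linarith [csqrt_re_pos h, csqrt_re_pos hz]

lemma dressD_ptRow (lam : Fin n₂ → ℂ) (mu : Fin n₁ → ℂ) (k : Fin (n₂ + n₁)) (z : ℂ) :
    dressD lam mu z (ptRow n₁ n₂ k) (ptRow n₁ n₂ k) =
      dressScalar lam mu (-(rootSign n₁ n₂ k * csqrt z)) := by
  rw [dressD_eq, dressRoot]
  refine Fin.addCases (fun k => ?_) (fun k => ?_) k <;> simp [rootSign, ptRow]

/-- The quotient of the diagonal entry of the dressing factor that vanishes at a point `a_k` by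
`z - a_k`. -/
def dressQuot (lam : Fin n₂ → ℂ) (mu : Fin n₁ → ℂ) (k : Fin (n₂ + n₁)) (z : ℂ) : ℂ :=
  -((-1) ^ n₁ * ∏ l ∈ Finset.univ.erase k, (roots lam mu l - rootSign n₁ n₂ k * csqrt z)) /
    (roots lam mu k + rootSign n₁ n₂ k * csqrt z)

/-- With ε the sign of the root, the factor x_k − ε√z is (a_k − z)/(x_k + ε√z), and the denominator
has no zero because principal roots off the cut have positive real part. So row e_k of D has an
explicit factor z − a_k. -/
lemma dressD_ptRow_eq {k : Fin (n₂ + n₁)} (h : pts lam mu k ∈ Complex.slitPlane) {z : ℂ}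
    (hz : z ∈ Complex.slitPlane) : dressD lam mu z (ptRow n₁ n₂ k) (ptRow n₁ n₂ k) =
      (z - pts lam mu k) * dressQuot lam mu k z := by
  have h0 := roots_add_ne_zero h hz
  rw [dressD_ptRow, dressScalar, dressQuot, ← Finset.mul_prod_erase _ _ (Finset.mem_univ k),
    mul_div_assoc', eq_div_iff h0]
  have h1 : (roots lam mu k + -(rootSign n₁ n₂ k * csqrt z)) *
      (roots lam mu k + rootSign n₁ n₂ k * csqrt z) = pts lam mu k - z := by
    have := rootSign_sq (n₁ := n₁) (n₂ := n₂) k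
    have h2 := csqrt_sq z
    rw [← roots_sq]
    linear_combination - csqrt z ^ 2 * this - h2
  simp only [← sub_eq_add_neg] at h1 ⊢
  linear_combination ((-1) ^ n₁ * ∏ l ∈ Finset.univ.erase k,
    (roots lam mu l - rootSign n₁ n₂ k * csqrt z)) * h1

lemma rootSign_mul_csqrt_pts (k : Fin (n₂ + n₁)) :
    rootSign n₁ n₂ k * csqrt (pts lam mu k) = roots lam mu k := (roots_eq lam mu k).symm

lemma roots_injective (hinj : Function.Injective (pts lam mu)) :
    Function.Injective (roots lam mu) := fun k l h => hinj (by rw [← roots_sq, h, roots_sq])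

lemma dressQuot_ne_zero {k : Fin (n₂ + n₁)} (h : pts lam mu k ∈ Complex.slitPlane)
    (hinj : Function.Injective (pts lam mu)) : dressQuot lam mu k (pts lam mu k) ≠ 0 := by
  rw [dressQuot]
  refine div_ne_zero (neg_ne_zero.2 (mul_ne_zero (pow_ne_zero _ (by norm_num))
    (Finset.prod_ne_zero_iff.2 fun l hl => ?_))) (roots_add_ne_zero h h)
  rw [rootSign_mul_csqrt_pts, sub_ne_zero]
  exact fun h1 => (Finset.ne_of_mem_erase hl) (roots_injective hinj h1)

lemma differentiableAt_dressQuot {k : Fin (n₂ + n₁)} (h : pts lam mu k ∈ Complex.slitPlane) {z : ℂ}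
    (hz : z ∈ Complex.slitPlane) : DifferentiableAt ℂ (dressQuot lam mu k) z := by
  have hs := csqrt_differentiableAt hz
  unfold dressQuot
  refine DifferentiableAt.div ?_ ((hs.const_mul _).const_add _) (roots_add_ne_zero h hz)
  exact ((DifferentiableAt.fun_finsetProd fun l _ => (hs.const_mul _).const_sub _).const_mul _).neg

/-- The logarithmic derivative of `dressQuot` at its point. -/
lemma logDeriv_dressQuot {k : Fin (n₂ + n₁)} (h : pts lam mu k ∈ Complex.slitPlane)
    (hinj : Function.Injective (pts lam mu)) :
    logDeriv (dressQuot lam mu k) (pts lam mu k) = 1 / (2 * roots lam mu k) *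
      (∑ l ∈ Finset.univ.erase k, 1 / (roots lam mu k - roots lam mu l) -
        1 / (2 * roots lam mu k)) := by
  set a := pts lam mu k with ha
  have hs : HasDerivAt (fun z => rootSign n₁ n₂ k * csqrt z) (1 / (2 * roots lam mu k)) a := by
    have := (hasDerivAt_csqrt h).const_mul (rootSign n₁ n₂ k)
    refine this.congr_deriv ?_
    rw [← rootSign_mul_csqrt_pts k, ← ha]
    have h0 := csqrt_ne_zero (Complex.slitPlane_ne_zero h)
    have h1 := rootSign_ne_zero (n₁ := n₁) (n₂ := n₂) k
    field_simp
    rw [pow_two, rootSign_sq]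
  have hy : rootSign n₁ n₂ k * csqrt a = roots lam mu k := rootSign_mul_csqrt_pts k
  have hne : ∀ l ∈ Finset.univ.erase k, roots lam mu l - rootSign n₁ n₂ k * csqrt a ≠ 0 := by
    intro l hl
    rw [hy, sub_ne_zero]
    exact fun h1 => (Finset.ne_of_mem_erase hl) (roots_injective hinj h1)
  have hd : ∀ l, DifferentiableAt ℂ (fun z => roots lam mu l - rootSign n₁ n₂ k * csqrt z) a :=
    fun l => (hs.const_sub _).differentiableAt
  have hx0 := roots_ne_zero (Complex.slitPlane_ne_zero h)
  have e1 : dressQuot lam mu k = fun z => (-(-1) ^ n₁ * ∏ l ∈ Finset.univ.erase k,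
      (roots lam mu l - rootSign n₁ n₂ k * csqrt z)) /
      (roots lam mu k + rootSign n₁ n₂ k * csqrt z) := by
    funext z; rw [dressQuot]; ring
  have hc : (-(-1) ^ n₁ : ℂ) ≠ 0 := neg_ne_zero.2 (pow_ne_zero _ (by norm_num))
  have hp : ∏ l ∈ Finset.univ.erase k, (roots lam mu l - rootSign n₁ n₂ k * csqrt a) ≠ 0 :=
    Finset.prod_ne_zero_iff.2 hne
  rw [e1, logDeriv_div (f := fun z => -(-1) ^ n₁ * ∏ l ∈ Finset.univ.erase k,
      (roots lam mu l - rootSign n₁ n₂ k * csqrt z))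
      (g := fun z => roots lam mu k + rootSign n₁ n₂ k * csqrt z) a (mul_ne_zero hc hp)
      (roots_add_ne_zero h h) ((DifferentiableAt.fun_finsetProd fun l _ => hd l).const_mul _)
      (hs.const_add _).differentiableAt,
    logDeriv_const_mul _ _ hc (f := fun z => ∏ l ∈ Finset.univ.erase k,
      (roots lam mu l - rootSign n₁ n₂ k * csqrt z)),
    logDeriv_prod (f := fun l z => roots lam mu l - rootSign n₁ n₂ k * csqrt z) hne fun l _ => hd l]
  simp only [logDeriv_apply, (hs.const_add (roots lam mu k)).deriv,
    fun l => (hs.const_sub (roots lam mu l)).deriv, hy]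
  rw [mul_sub, Finset.mul_sum]
  congr 1
  · refine Finset.sum_congr rfl fun l hl => ?_
    have h1 := hne l hl
    rw [hy] at h1
    have h2 : roots lam mu k - roots lam mu l ≠ 0 := fun h3 => h1 (by linear_combination -h3)
    field_simp
    ring
  · field_simp
    ring

end

/-! ### Inversion of the coefficient matrix by means of P. -/

section

open RayContour

variable {m n₁ n₂ : ℕ} {S : RayContour m} {lam : Fin n₂ → ℂ} {mu : Fin n₁ → ℂ}
  {P : Matrix (Fin 2) (Fin 2) (Polynomial ℂ)} {Γ Γn : ℂ → Mat}
  {M Mn : Option (Fin m) → ℝ → Mat}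

/-- The polynomials whose coefficients form the columns of the inverse of `rowMat`. -/
def dressVec (P : Matrix (Fin 2) (Fin 2) (Polynomial ℂ)) (Γn : ℂ → Mat) (lam : Fin n₂ → ℂ)
    (mu : Fin n₁ → ℂ) (k : Fin (n₂ + n₁)) (i : Fin 2) : Polynomial ℂ :=
  (∑ j, Polynomial.C ((dressQuot lam mu k (pts lam mu k))⁻¹ *
    Γn (pts lam mu k) j (ptRow n₁ n₂ k)) * P i j) /ₘ (Polynomial.X - Polynomial.C (pts lam mu k))

lemma IsDressing.mul_eq (hP : IsDressing S Γ Γn lam mu P) (hn : IsRHPSolution S Mn Γn)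
    (hMn : ∀ p r, 0 < r → (Mn p r).det = 1) {z : ℂ} (hz : z ∉ S.carrier) :
    polyMat P z * Γn z = Γ z * dressD lam mu z := by
  rw [hP.eq z hz, Matrix.nonsing_inv_mul_cancel_right _ _
    (by rw [hn.det_eq_one hMn hz]; exact isUnit_one)]

lemma mem_slitPlane_of_notMem {z : ℂ} (hz : z ∉ S.carrier) : z ∈ Complex.slitPlane :=
  S.compl_carrier_subset_slitPlane hz

lemma dressD_apply (lam : Fin n₂ → ℂ) (mu : Fin n₁ → ℂ) (A : Mat) (z : ℂ) (i e : Fin 2) :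
    (A * dressD lam mu z) i e = A i e * dressD lam mu z e e := by
  rw [dressD_eq, dressRoot, Matrix.mul_apply, Fin.sum_univ_two]
  fin_cases e <;> simp

lemma dressD_mul_apply (lam : Fin n₂ → ℂ) (mu : Fin n₁ → ℂ) (A : Mat) (z : ℂ) (i e : Fin 2) :
    (dressD lam mu z * A) i e = dressD lam mu z i i * A i e := by
  rw [dressD_eq, dressRoot, Matrix.mul_apply, Fin.sum_univ_two]
  fin_cases i <;> simp

lemma dressD_pts {k : Fin (n₂ + n₁)} (h : pts lam mu k ∉ S.carrier) :
    dressD lam mu (pts lam mu k) (ptRow n₁ n₂ k) (ptRow n₁ n₂ k) = 0 := by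
  rw [dressD_ptRow_eq (mem_slitPlane_of_notMem h) (mem_slitPlane_of_notMem h), sub_self, zero_mul]

section

variable (hP : IsDressing S Γ Γn lam mu P) (h : IsRHPSolution S M Γ) (hn : IsRHPSolution S Mn Γn)
  (hM : ∀ p r, 0 < r → (M p r).det = 1) (hMn : ∀ p r, 0 < r → (Mn p r).det = 1)
  (ha : ∀ k, pts lam mu k ∉ S.carrier) (hinj : Function.Injective (pts lam mu))

include hP hn hMn ha in
-- The division leaves no remainder: P Γn = Γ D, and the column e_k of D vanishes at a_k.
lemma dressVec_poly (k : Fin (n₂ + n₁)) (i : Fin 2) :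
    (Polynomial.X - Polynomial.C (pts lam mu k)) * dressVec P Γn lam mu k i =
      ∑ j, Polynomial.C ((dressQuot lam mu k (pts lam mu k))⁻¹ *
        Γn (pts lam mu k) j (ptRow n₁ n₂ k)) * P i j := by
  rw [dressVec, Polynomial.mul_divByMonic_eq_iff_isRoot, Polynomial.IsRoot.def]
  have h1 := congrFun (congrFun (hP.mul_eq hn hMn (ha k)) i) (ptRow n₁ n₂ k)
  rw [dressD_apply, dressD_pts (ha k), mul_zero, Matrix.mul_apply] at h1
  simp only [polyMat, Matrix.of_apply, Fin.sum_univ_two] at h1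
  simp only [Fin.sum_univ_two, Polynomial.eval_add, Polynomial.eval_mul, Polynomial.eval_C]
  linear_combination (dressQuot lam mu k (pts lam mu k))⁻¹ * h1

include hP hn hMn ha hinj in
lemma dressVec_eval (k : Fin (n₂ + n₁)) (i : Fin 2) (z : ℂ) :
    (dressVec P Γn lam mu k i).eval z * (dressQuot lam mu k (pts lam mu k) * (z - pts lam mu k)) =
      (polyMat P z * Γn (pts lam mu k)) i (ptRow n₁ n₂ k) := by
  have h1 := congrArg (Polynomial.eval z) (dressVec_poly hP hn hMn ha k i)
  have h0 := dressQuot_ne_zero (mem_slitPlane_of_notMem (ha k)) hinj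
  simp only [Polynomial.eval_mul, Polynomial.eval_sub, Polynomial.eval_X, Polynomial.eval_C,
    Fin.sum_univ_two, Polynomial.eval_add] at h1
  rw [Matrix.mul_apply, Fin.sum_univ_two]
  simp only [polyMat, Matrix.of_apply]
  have h2 := congrArg (fun x => x * dressQuot lam mu k (pts lam mu k)) h1
  simp only [add_mul] at h2
  field_simp at h2
  linear_combination h2

include hP hn hMn ha hinj in
-- At the cancelled zero the quotient takes the value of the derivative, which brings P′ into the
-- formulas.
lemma dressVec_eval_self (k : Fin (n₂ + n₁)) (i : Fin 2) :
    (dressVec P Γn lam mu k i).eval (pts lam mu k) * dressQuot lam mu k (pts lam mu k) =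
      (polyMat (polyDeriv P) (pts lam mu k) * Γn (pts lam mu k)) i (ptRow n₁ n₂ k) := by
  have h1 := congrArg (fun p => (Polynomial.derivative p).eval (pts lam mu k))
    (dressVec_poly hP hn hMn ha k i)
  have h0 := dressQuot_ne_zero (mem_slitPlane_of_notMem (ha k)) hinj
  simp only [Polynomial.derivative_mul, Polynomial.derivative_add, Polynomial.eval_add, Polynomial.eval_mul,
    Polynomial.derivative_sub, Polynomial.derivative_X, Polynomial.derivative_C, sub_zero,
    Polynomial.eval_sub, Polynomial.eval_X, Polynomial.eval_C,
    Fin.sum_univ_two, sub_self, zero_mul, add_zero, one_mul, zero_add] at h1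
  rw [Matrix.mul_apply, Fin.sum_univ_two, h1]
  simp only [polyMat, polyDeriv, Matrix.of_apply]
  field_simp

include hP hn hMn ha in
-- Division by z − a_k lowers the degrees of P by one, and the resulting bounds leave exactly n
-- coefficients, as many as `rowMat` has columns.
lemma dressVec_degree (k : Fin (n₂ + n₁)) (i : Fin 2) :
    (dressVec P Γn lam mu k i).degree < ((n₂ + n₁ + i) / 2 : ℕ) := by
  by_cases h0 : dressVec P Γn lam mu k i = 0
  · rw [h0, Polynomial.degree_zero]; exact WithBot.bot_lt_coe _
  have h1 := dressVec_poly hP hn hMn ha k i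
  have h2 : (∑ j, Polynomial.C ((dressQuot lam mu k (pts lam mu k))⁻¹ *
        Γn (pts lam mu k) j (ptRow n₁ n₂ k)) * P i j).degree < ((n₂ + n₁ + 2 + i) / 2 : ℕ) := by
    refine lt_of_le_of_lt (Polynomial.degree_sum_le _ _) ((Finset.sup_lt_iff (WithBot.bot_lt_coe _)).2
      fun j _ => ?_)
    refine lt_of_le_of_lt ((Polynomial.degree_mul_le_of_le Polynomial.degree_C_le le_rfl).trans_eq
      (zero_add _)) ((hP.degree_lt i j).trans_le ?_)
    exact_mod_cast Nat.div_le_div_right (Nat.sub_le _ _)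
  rw [← h1, Polynomial.degree_mul, Polynomial.degree_X_sub_C, Polynomial.degree_eq_natDegree h0] at h2
  rw [Polynomial.degree_eq_natDegree h0]
  have h3 : 1 + (dressVec P Γn lam mu k i).natDegree < (n₂ + n₁ + 2 + i) / 2 := by
    exact_mod_cast h2
  have h4 : (dressVec P Γn lam mu k i).natDegree < (n₂ + n₁ + i) / 2 := by omega
  exact_mod_cast h4

include hP h hn hM hMn ha hinj in
-- By Γ⁻¹ P = D Γn⁻¹ the row e acquires the factor D_ee. At a point a_l other than a_k this factor
-- vanishes in row e_l, which gives the off-diagonal zeros of the product with `rowMat`.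
lemma inv_mul_dressVec (k : Fin (n₂ + n₁)) (e : Fin 2) {z : ℂ} (hz : z ∉ S.carrier) :
    (∑ i, (Γ z)⁻¹ e i * (dressVec P Γn lam mu k i).eval z) *
        (dressQuot lam mu k (pts lam mu k) * (z - pts lam mu k)) =
      dressD lam mu z e e * ((Γn z)⁻¹ * Γn (pts lam mu k)) e (ptRow n₁ n₂ k) := by
  have h1 : (Γ z)⁻¹ * (polyMat P z * Γn (pts lam mu k)) =
      dressD lam mu z * ((Γn z)⁻¹ * Γn (pts lam mu k)) := by
    rw [hP.eq z hz]
    simp only [Matrix.mul_assoc]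
    rw [Matrix.nonsing_inv_mul_cancel_left _ _ (by rw [h.det_eq_one hM hz]; exact isUnit_one)]
  have h2 := congrFun (congrFun h1 e) (ptRow n₁ n₂ k)
  rw [dressD_mul_apply, Matrix.mul_apply, Fin.sum_univ_two,
    ← dressVec_eval hP hn hMn ha hinj, ← dressVec_eval hP hn hMn ha hinj] at h2
  rw [Fin.sum_univ_two, ← h2]
  ring

include hP h hn hM hMn ha hinj in
/-- Near a point `a_k`, the product of `Γ⁻¹` and the polynomials attached to that point. -/
lemma eventually_inv_mul_dressVec (k : Fin (n₂ + n₁)) :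
    ∀ᶠ z in 𝓝 (pts lam mu k), ∑ i, (Γ z)⁻¹ (ptRow n₁ n₂ k) i * (dressVec P Γn lam mu k i).eval z =
      (dressQuot lam mu k (pts lam mu k))⁻¹ * dressQuot lam mu k z *
        ((Γn z)⁻¹ * Γn (pts lam mu k)) (ptRow n₁ n₂ k) (ptRow n₁ n₂ k) := by
  set a := pts lam mu k with ha'
  set e := ptRow n₁ n₂ k with he
  have hC := S.isOpen_compl.mem_nhds (ha k)
  have hq := dressQuot_ne_zero (mem_slitPlane_of_notMem (ha k)) hinj
  have hcont : ∀ {F : ℂ → Mat} {N : Option (Fin m) → ℝ → Mat}, IsRHPSolution S N F →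
      (∀ p r, 0 < r → (N p r).det = 1) → ∀ i j, ContinuousAt (fun z => (F z)⁻¹ i j) a := by
    intro F N hF hN i j
    have h1 : ∀ i j, ContinuousAt (fun z => F z i j) a := fun i j =>
      ((hF.analytic i j).differentiableAt hC).continuousAt
    have h2 : ContinuousAt (fun z => (F z).adjugate i j) a := by
      simp only [Matrix.adjugate_fin_two]
      fin_cases i <;> fin_cases j <;> simp
      · exact h1 1 1
      · exact (h1 0 1).neg
      · exact (h1 1 0).neg
      · exact h1 0 0
    refine h2.congr ?_
    filter_upwards [hC] with z hz
    rw [inv_eq_adjugate (hF.det_eq_one hN hz)]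
  have c1 : ContinuousAt (fun z => ∑ i, (Γ z)⁻¹ e i * (dressVec P Γn lam mu k i).eval z) a := by
    simp only [Fin.sum_univ_two]
    exact ((hcont h hM e 0).mul (Polynomial.continuous _).continuousAt).add
      ((hcont h hM e 1).mul (Polynomial.continuous _).continuousAt)
  have c2 : ContinuousAt (fun z => (dressQuot lam mu k a)⁻¹ * dressQuot lam mu k z *
      ((Γn z)⁻¹ * Γn a) e e) a := by
    simp only [Matrix.mul_apply, Fin.sum_univ_two]
    exact (continuousAt_const.mul (differentiableAt_dressQuot (mem_slitPlane_of_notMem (ha k))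
      (mem_slitPlane_of_notMem (ha k))).continuousAt).mul
      (((hcont hn hMn e 0).mul continuousAt_const).add ((hcont hn hMn e 1).mul continuousAt_const))
  have hne : ∀ z ∉ S.carrier, z ≠ a → ∑ i, (Γ z)⁻¹ e i * (dressVec P Γn lam mu k i).eval z =
      (dressQuot lam mu k a)⁻¹ * dressQuot lam mu k z * ((Γn z)⁻¹ * Γn a) e e := by
    intro z hz hza
    have h1 := inv_mul_dressVec hP h hn hM hMn ha hinj k e hz
    rw [dressD_ptRow_eq (mem_slitPlane_of_notMem (ha k)) (mem_slitPlane_of_notMem hz)] at h1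
    have h2 : z - a ≠ 0 := sub_ne_zero.2 hza
    rw [← he, ← ha'] at h1
    rw [← ha'] at hq
    refine mul_right_cancel₀ (mul_ne_zero hq h2) (h1.trans ?_)
    field_simp
  -- Away from a_k the factor z − a_k cancels; at a_k itself the identity follows by continuity of
  -- both sides.
  have hself : ∑ i, (Γ a)⁻¹ e i * (dressVec P Γn lam mu k i).eval a =
      (dressQuot lam mu k a)⁻¹ * dressQuot lam mu k a * ((Γn a)⁻¹ * Γn a) e e := by
    refine tendsto_nhds_unique (c1.tendsto.mono_left (nhdsWithin_le_nhds (s := {a}ᶜ))) ?_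
    refine (c2.tendsto.mono_left (nhdsWithin_le_nhds (s := {a}ᶜ))).congr' ?_
    filter_upwards [self_mem_nhdsWithin, nhdsWithin_le_nhds hC] with z hz hz'
    exact (hne z hz' hz).symm
  filter_upwards [hC] with z hz
  by_cases hza : z = a
  · rw [hza]; exact hself
  · exact hne z hz hza

/-- The matrix of the coefficients of the polynomials `dressVec`. -/
def dressInv (P : Matrix (Fin 2) (Fin 2) (Polynomial ℂ)) (Γn : ℂ → Mat) (lam : Fin n₂ → ℂ)
    (mu : Fin n₁ → ℂ) : Matrix (Fin (n₂ + n₁)) (Fin (n₂ + n₁)) ℂ :=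
  Matrix.of fun l k => (dressVec P Γn lam mu k (colRow (n₂ + n₁) l)).coeff ((l : ℕ) / 2)

include hP h hn hM hMn ha hinj in
-- An entry of the product is row e_k of Γ⁻¹(a_k) applied to the k'-th polynomial vector at a_k:
-- zero for k ≠ k' because D vanishes, and one for k = k' by the normalization through `dressQuot`.
-- Solvability of the dressed problem thus forces det 𝔾 ≠ 0.
lemma rowMat_mul_dressInv : rowMat Γ lam mu * dressInv P Γn lam mu = 1 := by
  ext k k'
  have h1 : (rowMat Γ lam mu * dressInv P Γn lam mu) k k' =
      ∑ i, (Γ (pts lam mu k))⁻¹ (ptRow n₁ n₂ k) i * (dressVec P Γn lam mu k' i).eval (pts lam mu k) :=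
    sum_colRow_coeff (n₂ + n₁) (dressVec_degree hP hn hMn ha k')
      (fun i => (Γ (pts lam mu k))⁻¹ (ptRow n₁ n₂ k) i) (pts lam mu k)
  rw [h1]
  by_cases hk : k = k'
  · subst hk
    have := (eventually_inv_mul_dressVec hP h hn hM hMn ha hinj k).self_of_nhds
    rw [this, Matrix.one_apply_eq, inv_mul_cancel₀ (dressQuot_ne_zero (mem_slitPlane_of_notMem (ha k))
      hinj), Matrix.nonsing_inv_mul _ (by rw [hn.det_eq_one hMn (ha k)]; exact isUnit_one)]
    simp
  · have h2 := inv_mul_dressVec hP h hn hM hMn ha hinj k' (ptRow n₁ n₂ k) (ha k)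
    rw [dressD_pts (ha k), zero_mul] at h2
    rw [Matrix.one_apply_ne hk]
    exact (mul_eq_zero.1 h2).resolve_right (mul_ne_zero
      (dressQuot_ne_zero (mem_slitPlane_of_notMem (ha k')) hinj) (sub_ne_zero.2 fun h3 => hk (hinj h3)))

end

end

/-! ### The logarithmic derivative of Δ. -/

section

open RayContour

variable {m d n₁ n₂ : ℕ} {S : RayContour m}

lemma pts_line (q v : Params d n₁ n₂) (s : ℂ) (k : Fin (n₂ + n₁)) :
    pts (q + s • v).2.1 (q + s • v).2.2 k = pts q.2.1 q.2.2 k + s * pts v.2.1 v.2.2 k := by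
  refine Fin.addCases (fun k => ?_) (fun k => ?_) k <;> simp [pts]

lemma differentiable_pts (k : Fin (n₂ + n₁)) :
    Differentiable ℂ fun q : Params d n₁ n₂ => pts q.2.1 q.2.2 k := by
  refine Fin.addCases (fun k => ?_) (fun k => ?_) k
  · simp only [pts, Fin.append_left]; fun_prop
  · simp only [pts, Fin.append_right]; fun_prop

/-- The sign in the product formula for the denominator of `bigDelta`. -/
def deltaSign (n₁ : ℕ) : ℂ := ∏ j : Fin n₁, ∏ _k ∈ Finset.Ioi j, (-1)

lemma deltaSign_ne_zero (n₁ : ℕ) : deltaSign n₁ ≠ 0 :=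
  Finset.prod_ne_zero_iff.2 fun _ _ => Finset.prod_ne_zero_iff.2 fun _ _ => by norm_num

/-- In the signed roots the three products of the denominator form a single Vandermonde product,
since √λ + √μ is a difference of signed roots. The constant sign comes from the pairs of μ's. -/
lemma bigDelta_eq (lam : Fin n₂ → ℂ) (mu : Fin n₁ → ℂ) : bigDelta lam mu =
    (∏ k, pts lam mu k ^ (1 / 4 : ℂ)) /
      (deltaSign n₁ * ∏ k, ∏ l ∈ Finset.Ioi k, (roots lam mu k - roots lam mu l)) := by
  have hI : ∀ {N : ℕ} (f : Fin N → ℂ) (k : Fin N), ∏ l ∈ Finset.Ioi k, f l =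
      ∏ l, if k < l then f l else 1 := fun f k => by
    rw [← Finset.prod_filter]
    congr 1
    ext l; simp
  have e1 : ∏ k, pts lam mu k ^ (1 / 4 : ℂ) =
      (∏ j, lam j ^ (1 / 4 : ℂ)) * ∏ j, mu j ^ (1 / 4 : ℂ) := by
    rw [Fin.prod_univ_add]; simp [pts]
  have hlt : ∀ (i : Fin n₂) (j : Fin n₁), Fin.castAdd n₁ i < Fin.natAdd n₂ j := fun i j => by
    rw [Fin.lt_def]; simp; omega
  have hlt' : ∀ (i : Fin n₂) (j : Fin n₁), ¬ Fin.natAdd n₂ j < Fin.castAdd n₁ i := fun i j =>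
    not_lt.2 (hlt i j).le
  have hc : ∀ i j : Fin n₂, Fin.castAdd n₁ i < Fin.castAdd n₁ j ↔ i < j := fun i j => Iff.rfl
  have hn : ∀ i j : Fin n₁, Fin.natAdd n₂ i < Fin.natAdd n₂ j ↔ i < j := fun i j => by simp
  have e2 : deltaSign n₁ * ∏ k, ∏ l ∈ Finset.Ioi k, (roots lam mu k - roots lam mu l) =
      (∏ j, ∏ k ∈ Finset.Ioi j, (csqrt (lam j) - csqrt (lam k)))
      * (∏ j, ∏ k ∈ Finset.Ioi j, (csqrt (mu j) - csqrt (mu k)))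
      * ∏ j, ∏ k, (csqrt (lam j) + csqrt (mu k)) := by
    have e3 : ∏ j, ∏ k ∈ Finset.Ioi j, (csqrt (mu j) - csqrt (mu k)) = deltaSign n₁ *
        ∏ j, ∏ k ∈ Finset.Ioi j, (-csqrt (mu j) - -csqrt (mu k)) := by
      rw [deltaSign, ← Finset.prod_mul_distrib]
      refine Finset.prod_congr rfl fun j _ => ?_
      rw [← Finset.prod_mul_distrib]
      refine Finset.prod_congr rfl fun k _ => by ring
    rw [e3]
    simp only [hI, Fin.prod_univ_add, roots, Fin.append_left, Fin.append_right, hc, hn, hlt, hlt',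
      if_true, if_false, Finset.prod_const_one, Finset.prod_mul_distrib, sub_neg_eq_add]
    ring
  rw [bigDelta, e1, e2]

lemma sum_pairs {N : ℕ} (f : Fin N → Fin N → ℂ) :
    ∑ k, ∑ l ∈ Finset.Ioi k, (f k l + f l k) = ∑ k, ∑ l ∈ Finset.univ.erase k, f k l := by
  have hI : ∀ (g : Fin N → ℂ) (k : Fin N), ∑ l ∈ Finset.Ioi k, g l =
      ∑ l, if k < l then g l else 0 := fun g k => by
    rw [← Finset.sum_filter]
    congr 1
    ext l; simp
  have hE : ∀ (g : Fin N → ℂ) (k : Fin N), ∑ l ∈ Finset.univ.erase k, g l =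
      ∑ l, ((if k < l then g l else 0) + if l < k then g l else 0) := fun g k => by
    rw [show Finset.univ.erase k = Finset.univ.filter (fun l => l ≠ k) by ext l; simp,
      Finset.sum_filter]
    refine Finset.sum_congr rfl fun l _ => ?_
    rcases lt_trichotomy k l with h | h | h
    · simp [h, h.ne', h.le.not_gt]
    · simp [h]
    · simp [h, h.ne, h.le.not_gt]
  have h1 : ∀ k, ∑ l ∈ Finset.Ioi k, (f k l + f l k) =
      ∑ l, (if k < l then f k l else 0) + ∑ l, if k < l then f l k else 0 := fun k => by
    rw [Finset.sum_add_distrib, hI, hI]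
  simp only [h1, hE, Finset.sum_add_distrib]
  rw [Finset.sum_comm (f := fun k l => if k < l then f l k else 0)]

lemma differentiableAt_prod {E ι : Type*} [NormedAddCommGroup E] [NormedSpace ℂ E] {s : Finset ι}
    {f : ι → E → ℂ} {x : E} (h : ∀ i ∈ s, DifferentiableAt ℂ (f i) x) :
    DifferentiableAt ℂ (fun y => ∏ i ∈ s, f i y) x := by
  classical
  exact (HasFDerivAt.finsetProd fun i hi => (h i hi).hasFDerivAt).differentiableAt

section Line

variable (q v : Params d n₁ n₂)

lemma hasDerivAt_pts_line (k : Fin (n₂ + n₁)) :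
    HasDerivAt (fun s : ℂ => pts (q + s • v).2.1 (q + s • v).2.2 k) (pts v.2.1 v.2.2 k) 0 := by
  simp only [pts_line]
  simpa using ((hasDerivAt_id (0 : ℂ)).mul_const (pts v.2.1 v.2.2 k)).const_add (pts q.2.1 q.2.2 k)

lemma hasDerivAt_roots_line {k : Fin (n₂ + n₁)} (h : pts q.2.1 q.2.2 k ∈ Complex.slitPlane) :
    HasDerivAt (fun s : ℂ => roots (q + s • v).2.1 (q + s • v).2.2 k)
      (pts v.2.1 v.2.2 k / (2 * roots q.2.1 q.2.2 k)) 0 := by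
  have h0 : pts (q + (0 : ℂ) • v).2.1 (q + (0 : ℂ) • v).2.2 k = pts q.2.1 q.2.2 k := by
    rw [pts_line]; ring
  have h1 := (HasDerivAt.comp (h₂ := csqrt) (0 : ℂ) (by rw [h0]; exact hasDerivAt_csqrt h)
    (hasDerivAt_pts_line q v k)).const_mul (rootSign n₁ n₂ k)
  simp only [roots_eq _ _ k]
  refine h1.congr_deriv ?_
  have h2 := rootSign_sq (n₁ := n₁) (n₂ := n₂) k
  have h3 := rootSign_ne_zero (n₁ := n₁) (n₂ := n₂) k
  have h4 := csqrt_ne_zero (Complex.slitPlane_ne_zero h)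
  field_simp
  rw [pow_two, h2]
  ring

lemma differentiableAt_bigDelta (h : ∀ k, pts q.2.1 q.2.2 k ∈ Complex.slitPlane)
    (hinj : Function.Injective (pts q.2.1 q.2.2)) : bigDelta q.2.1 q.2.2 ≠ 0 ∧
    DifferentiableAt ℂ (fun q' : Params d n₁ n₂ => bigDelta q'.2.1 q'.2.2) q := by
  have h1 : ∏ k, ∏ l ∈ Finset.Ioi k, (roots q.2.1 q.2.2 k - roots q.2.1 q.2.2 l) ≠ 0 :=
    Finset.prod_ne_zero_iff.2 fun k _ => Finset.prod_ne_zero_iff.2 fun l hl => by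
      rw [sub_ne_zero]
      exact fun h2 => (Finset.mem_Ioi.1 hl).ne (roots_injective hinj h2)
  have hr : ∀ k, DifferentiableAt ℂ (fun q' : Params d n₁ n₂ => roots q'.2.1 q'.2.2 k) q := by
    intro k
    simp only [roots_eq _ _ k]
    exact ((csqrt_differentiableAt (h k)).comp q (differentiable_pts k q)).const_mul _
  simp only [bigDelta_eq]
  refine ⟨div_ne_zero (Finset.prod_ne_zero_iff.2 fun k _ =>
    quarter_ne_zero (Complex.slitPlane_ne_zero (h k))) (mul_ne_zero (deltaSign_ne_zero _) h1), ?_⟩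
  have h2 : DifferentiableAt ℂ (fun q' : Params d n₁ n₂ =>
      ∏ k, pts q'.2.1 q'.2.2 k ^ (1 / 4 : ℂ)) q := differentiableAt_prod fun k _ =>
    (differentiable_pts k q).cpow_const (h k)
  have h3 : DifferentiableAt ℂ (fun q' : Params d n₁ n₂ =>
      ∏ k, ∏ l ∈ Finset.Ioi k, (roots q'.2.1 q'.2.2 k - roots q'.2.1 q'.2.2 l)) q :=
    differentiableAt_prod fun k _ => differentiableAt_prod fun l _ => (hr k).sub (hr l)
  simp only [div_eq_mul_inv]
  exact h2.mul ((h3.const_mul (deltaSign n₁)).inv (mul_ne_zero (deltaSign_ne_zero _) h1))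

/-- The logarithmic derivative of `Δ` along a line. -/
lemma logDeriv_bigDelta_line (h : ∀ k, pts q.2.1 q.2.2 k ∈ Complex.slitPlane)
    (hinj : Function.Injective (pts q.2.1 q.2.2)) :
    logDeriv (fun s : ℂ => bigDelta (q + s • v).2.1 (q + s • v).2.2) 0 =
      -∑ k, pts v.2.1 v.2.2 k *
        logDeriv (dressQuot q.2.1 q.2.2 k) (pts q.2.1 q.2.2 k) := by
  set x := roots q.2.1 q.2.2 with hx
  set b := pts v.2.1 v.2.2 with hb
  have hq0 : q + (0 : ℂ) • v = q := by simp
  have hx0 : ∀ k, x k ≠ 0 := fun k => roots_ne_zero (Complex.slitPlane_ne_zero (h k))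
  have hxx : ∀ k l, k ≠ l → x k - x l ≠ 0 := fun k l hkl h1 =>
    hkl (roots_injective hinj (sub_eq_zero.1 h1))
  have hr := fun k => hasDerivAt_roots_line q v (h k)
  have hne1 : ∀ k, ∀ l ∈ Finset.Ioi k, roots (q + (0 : ℂ) • v).2.1 (q + (0 : ℂ) • v).2.2 k -
      roots (q + (0 : ℂ) • v).2.1 (q + (0 : ℂ) • v).2.2 l ≠ 0 := fun k l hl => by
    rw [hq0]; exact hxx k l (Finset.mem_Ioi.1 hl).ne
  have hne2 : ∀ k, pts (q + (0 : ℂ) • v).2.1 (q + (0 : ℂ) • v).2.2 k ^ (1 / 4 : ℂ) ≠ 0 := fun k => by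
    rw [hq0]; exact quarter_ne_zero (Complex.slitPlane_ne_zero (h k))
  have hd1 : ∀ k l, HasDerivAt (fun s : ℂ => roots (q + s • v).2.1 (q + s • v).2.2 k -
      roots (q + s • v).2.1 (q + s • v).2.2 l) (b k / (2 * x k) - b l / (2 * x l)) 0 :=
    fun k l => (hr k).sub (hr l)
  have hd2 : ∀ k, HasDerivAt (fun s : ℂ => pts (q + s • v).2.1 (q + s • v).2.2 k ^ (1 / 4 : ℂ))
      ((1 / 4 : ℂ) * pts (q + (0 : ℂ) • v).2.1 (q + (0 : ℂ) • v).2.2 k ^ (1 / 4 - 1 : ℂ) * b k) 0 :=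
    fun k => (hasDerivAt_pts_line q v k).cpow_const (by rw [hq0]; exact h k)
  have hP : DifferentiableAt ℂ (fun s : ℂ => ∏ k, ∏ l ∈ Finset.Ioi k,
      (roots (q + s • v).2.1 (q + s • v).2.2 k - roots (q + s • v).2.1 (q + s • v).2.2 l)) 0 :=
    DifferentiableAt.fun_finsetProd fun k _ =>
      DifferentiableAt.fun_finsetProd fun l _ => (hd1 k l).differentiableAt
  simp only [bigDelta_eq]
  rw [logDeriv_div (f := fun s : ℂ => ∏ k, pts (q + s • v).2.1 (q + s • v).2.2 k ^ (1 / 4 : ℂ))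
    (g := fun s : ℂ => deltaSign n₁ * ∏ k, ∏ l ∈ Finset.Ioi k,
      (roots (q + s • v).2.1 (q + s • v).2.2 k - roots (q + s • v).2.1 (q + s • v).2.2 l)) 0
    (Finset.prod_ne_zero_iff.2 fun k _ => hne2 k)
    (mul_ne_zero (deltaSign_ne_zero _) (Finset.prod_ne_zero_iff.2 fun k _ =>
      Finset.prod_ne_zero_iff.2 fun l hl => hne1 k l hl))
    (DifferentiableAt.fun_finsetProd fun k _ => (hd2 k).differentiableAt) (hP.const_mul _),
    logDeriv_const_mul _ _ (deltaSign_ne_zero _) (f := fun s : ℂ => ∏ k, ∏ l ∈ Finset.Ioi k,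
      (roots (q + s • v).2.1 (q + s • v).2.2 k - roots (q + s • v).2.1 (q + s • v).2.2 l)),
    logDeriv_prod (f := fun k (s : ℂ) => pts (q + s • v).2.1 (q + s • v).2.2 k ^ (1 / 4 : ℂ))
      (fun k _ => hne2 k) (fun k _ => (hd2 k).differentiableAt),
    logDeriv_prod (f := fun k (s : ℂ) => ∏ l ∈ Finset.Ioi k,
      (roots (q + s • v).2.1 (q + s • v).2.2 k - roots (q + s • v).2.1 (q + s • v).2.2 l))
      (fun k _ => Finset.prod_ne_zero_iff.2 fun l hl => hne1 k l hl)
      (fun k _ => DifferentiableAt.fun_finsetProd fun l _ => (hd1 k l).differentiableAt)]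
  have e1 : ∀ k, logDeriv (fun s : ℂ => ∏ l ∈ Finset.Ioi k,
      (roots (q + s • v).2.1 (q + s • v).2.2 k - roots (q + s • v).2.1 (q + s • v).2.2 l)) 0 =
      ∑ l ∈ Finset.Ioi k, (b k / (2 * x k) * (1 / (x k - x l)) +
        b l / (2 * x l) * (1 / (x l - x k))) := by
    intro k
    rw [logDeriv_prod (f := fun l (s : ℂ) =>
      roots (q + s • v).2.1 (q + s • v).2.2 k - roots (q + s • v).2.1 (q + s • v).2.2 l)
      (fun l hl => hne1 k l hl) (fun l _ => (hd1 k l).differentiableAt)]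
    refine Finset.sum_congr rfl fun l hl => ?_
    have h1 := hxx k l (Finset.mem_Ioi.1 hl).ne
    have h2 := hxx l k (Finset.mem_Ioi.1 hl).ne'
    rw [logDeriv_apply, (hd1 k l).deriv, hq0, ← hx]
    have h3 : (1 : ℂ) / (x l - x k) = -(1 / (x k - x l)) := by
      rw [← neg_sub, one_div_neg_eq_neg_one_div]
    rw [h3]
    ring
  -- This term matches the summand 1/(2 x_k) · 1/(2 x_k) of `logDeriv_dressQuot`; it is what the
  -- fourth roots in the numerator of Δ are for.
  have e2 : ∀ k, logDeriv (fun s : ℂ => pts (q + s • v).2.1 (q + s • v).2.2 k ^ (1 / 4 : ℂ)) 0 =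
      b k / (4 * x k ^ 2) := by
    intro k
    have h1 := Complex.slitPlane_ne_zero (h k)
    rw [logDeriv_apply, (hd2 k).deriv, hq0, Complex.cpow_sub _ _ h1, Complex.cpow_one, hx,
      roots_sq]
    have h2 := quarter_ne_zero h1
    field_simp
  simp only [e1, e2]
  rw [sum_pairs fun k l => b k / (2 * x k) * (1 / (x k - x l)), ← Finset.sum_neg_distrib,
    ← Finset.sum_sub_distrib]
  refine Finset.sum_congr rfl fun k _ => ?_
  rw [logDeriv_dressQuot (h k) hinj, ← Finset.mul_sum, ← hx]
  have := hx0 k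
  field_simp
  ring

end Line

end

/-! ### The logarithmic derivative of Δ det 𝔾. -/

section

open RayContour

variable {m d n₁ n₂ : ℕ} {S : RayContour m} {T : Set (Fin d → ℂ)}
  {M : (Fin d → ℂ) → Option (Fin m) → ℝ → Mat} {Γ₀ : (Fin d → ℂ) → ℂ → Mat}

lemma hasDerivAt_adjugate {A : ℂ → Mat} {A' : Mat} {x : ℂ}
    (h : ∀ i j, HasDerivAt (fun s => A s i j) (A' i j) x) (i j : Fin 2) :
    HasDerivAt (fun s => (A s).adjugate i j) (A'.adjugate i j) x := by
  simp only [Matrix.adjugate_fin_two]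
  fin_cases i <;> fin_cases j <;> simp
  · exact h 1 1
  · exact (h 0 1).neg
  · exact (h 1 0).neg
  · exact h 0 0

lemma adjugate_add_smul (A B : Mat) (b : ℂ) (i j : Fin 2) :
    (A + b • B).adjugate i j = A.adjugate i j + b * B.adjugate i j := by
  simp only [Matrix.adjugate_fin_two]
  fin_cases i <;> fin_cases j <;> simp
  ring
  ring

/-- The derivative of a family of matrix functions with respect to the parameters, in the
direction `w`. -/
def famDeriv (Γ₀ : (Fin d → ℂ) → ℂ → Mat) (t w : Fin d → ℂ) (z : ℂ) : Mat :=
  Matrix.of fun i j => deriv (fun s : ℂ => Γ₀ (t + s • w) z i j) 0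

lemma IsAnalyticRHPFamily.hasDerivAt_line (h : IsAnalyticRHPFamily S T M Γ₀) (hT : IsOpen T)
    {t : Fin d → ℂ} (ht : t ∈ T) {z : ℂ} (hz : z ∉ S.carrier) (w : Fin d → ℂ) (b : ℂ) (i j : Fin 2) :
    HasDerivAt (fun s : ℂ => Γ₀ (t + s • w) (z + s * b) i j)
      ((famDeriv Γ₀ t w z + b • derivMat (Γ₀ t) z) i j) 0 := by
  have hd : DifferentiableAt ℂ (fun x : (Fin d → ℂ) × ℂ => Γ₀ x.1 x.2 i j) (t, z) :=
    (h.analytic i j).differentiableAt ((hT.prod S.isOpen_compl).mem_nhds ⟨ht, hz⟩)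
  have hl : ∀ (w : Fin d → ℂ) (b : ℂ), HasDerivAt (fun s : ℂ => Γ₀ (t + s • w) (z + s * b) i j)
      (fderiv ℂ (fun x : (Fin d → ℂ) × ℂ => Γ₀ x.1 x.2 i j) (t, z) (w, b)) 0 := by
    intro w b
    have := hd.hasFDerivAt.hasLineDerivAt (w, b)
    simpa [HasLineDerivAt] using this
  have e1 : famDeriv Γ₀ t w z i j =
      fderiv ℂ (fun x : (Fin d → ℂ) × ℂ => Γ₀ x.1 x.2 i j) (t, z) (w, 0) := by
    have := (hl w 0).deriv
    simpa [famDeriv] using this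
  have e2 : derivMat (Γ₀ t) z i j =
      fderiv ℂ (fun x : (Fin d → ℂ) × ℂ => Γ₀ x.1 x.2 i j) (t, z) (0, 1) := by
    have h1 := hl 0 1
    simp only [smul_zero, add_zero, mul_one] at h1
    have h2 : HasDerivAt (fun x : ℂ => Γ₀ t x i j)
        (fderiv ℂ (fun x : (Fin d → ℂ) × ℂ => Γ₀ x.1 x.2 i j) (t, z) (0, 1)) z := by
      have h3 := HasDerivAt.comp_sub_const (f := fun s : ℂ => Γ₀ t (z + s) i j) z z
        (by rwa [sub_self])
      simpa using h3
    exact h2.deriv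
  refine (hl w b).congr_deriv ?_
  rw [Matrix.add_apply, Matrix.smul_apply, e1, e2, smul_eq_mul, ← smul_eq_mul, ← map_smul, ← map_add]
  simp

section

variable (h : IsAnalyticRHPFamily S T M Γ₀) (hT : IsOpen T)
  (hM : ∀ t p r, 0 < r → (M t p r).det = 1) (q v : Params d n₁ n₂) (ht : q.1 ∈ T)
  (ha : ∀ k, pts q.2.1 q.2.2 k ∉ S.carrier)

include h hM hT ht ha in
lemma eventually_rowMat_eq : ∀ᶠ q' in 𝓝 q, q'.1 ∈ T ∧ ∀ k l,
    rowMat (Γ₀ q'.1) q'.2.1 q'.2.2 k l = pts q'.2.1 q'.2.2 k ^ ((l : ℕ) / 2) *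
      (Γ₀ q'.1 (pts q'.2.1 q'.2.2 k)).adjugate (ptRow n₁ n₂ k) (colRow (n₂ + n₁) l) := by
  have h1 : ∀ᶠ q' : Params d n₁ n₂ in 𝓝 q, q'.1 ∈ T := continuous_fst.continuousAt.eventually
    (hT.mem_nhds ht)
  have h2 : ∀ᶠ q' : Params d n₁ n₂ in 𝓝 q, ∀ k, pts q'.2.1 q'.2.2 k ∈ S.carrierᶜ :=
    eventually_all.2 fun k => (differentiable_pts k).continuous.continuousAt.eventually
      (S.isOpen_compl.mem_nhds (ha k))
  filter_upwards [h1, h2] with q' h1 h2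
  refine ⟨h1, fun k l => ?_⟩
  rw [rowMat, Matrix.of_apply, inv_eq_adjugate ((h.solution _ h1).det_eq_one (hM _) (h2 k))]

include h hM hT ht ha in
lemma differentiableAt_rowMat (k l : Fin (n₂ + n₁)) : DifferentiableAt ℂ
    (fun q' : Params d n₁ n₂ => rowMat (Γ₀ q'.1) q'.2.1 q'.2.2 k l) q := by
  have hd : ∀ i j, DifferentiableAt ℂ
      (fun q' : Params d n₁ n₂ => Γ₀ q'.1 (pts q'.2.1 q'.2.2 k) i j) q := fun i j =>
    DifferentiableAt.comp (g := fun x : (Fin d → ℂ) × ℂ => Γ₀ x.1 x.2 i j)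
      (f := fun q' : Params d n₁ n₂ => (q'.1, pts q'.2.1 q'.2.2 k)) q
      ((h.analytic i j).differentiableAt ((hT.prod S.isOpen_compl).mem_nhds ⟨ht, ha k⟩))
      (differentiableAt_fst.prodMk (differentiable_pts k q))
  have hadj : DifferentiableAt ℂ (fun q' : Params d n₁ n₂ =>
      (Γ₀ q'.1 (pts q'.2.1 q'.2.2 k)).adjugate (ptRow n₁ n₂ k) (colRow (n₂ + n₁) l)) q := by
    generalize ptRow n₁ n₂ k = i
    generalize colRow (n₂ + n₁) l = j
    simp only [Matrix.adjugate_fin_two]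
    fin_cases i <;> fin_cases j <;> simp
    · exact hd 1 1
    · exact hd 0 1
    · exact hd 1 0
    · exact hd 0 0
  refine (((differentiable_pts k q).pow ((l : ℕ) / 2)).mul hadj).congr_of_eventuallyEq ?_
  filter_upwards [eventually_rowMat_eq h hT hM q ht ha] with q' h1
  exact h1.2 k l

variable {P : Matrix (Fin 2) (Fin 2) (Polynomial ℂ)} {Γn : ℂ → Mat}
  {Mn : Option (Fin m) → ℝ → Mat}
  (hP : IsDressing S (Γ₀ q.1) Γn q.2.1 q.2.2 P) (hn : IsRHPSolution S Mn Γn)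
  (hMn : ∀ p r, 0 < r → (Mn p r).det = 1) (hinj : Function.Injective (pts q.2.1 q.2.2))

/-- The contribution of the point `a_k` to the logarithmic derivative of `Δ det 𝔾`. -/
def pointTerm (Γ₀ : (Fin d → ℂ) → ℂ → Mat) (Γn : ℂ → Mat)
    (P : Matrix (Fin 2) (Fin 2) (Polynomial ℂ)) (q v : Params d n₁ n₂) (k : Fin (n₂ + n₁)) : ℂ :=
  ∑ i, (famDeriv Γ₀ q.1 v.1 (pts q.2.1 q.2.2 k)).adjugate (ptRow n₁ n₂ k) i *
      (dressVec P Γn q.2.1 q.2.2 k i).eval (pts q.2.1 q.2.2 k) +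
    pts v.2.1 v.2.2 k * ((derivMat Γn (pts q.2.1 q.2.2 k)).adjugate * Γn (pts q.2.1 q.2.2 k))
      (ptRow n₁ n₂ k) (ptRow n₁ n₂ k)

include h hP hn hM hMn ht ha hinj in
-- The derivative with respect to z, at a_k, of the local identity `eventually_inv_mul_dressVec`.
-- Inverses are written as adjugates, which depend linearly on 2 × 2 matrices and are therefore easy
-- to differentiate.
lemma deriv_inv_mul_dressVec (k : Fin (n₂ + n₁)) :
    ∑ i, ((derivMat (Γ₀ q.1) (pts q.2.1 q.2.2 k)).adjugate (ptRow n₁ n₂ k) i *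
        (dressVec P Γn q.2.1 q.2.2 k i).eval (pts q.2.1 q.2.2 k) +
      (Γ₀ q.1 (pts q.2.1 q.2.2 k)).adjugate (ptRow n₁ n₂ k) i *
        (Polynomial.derivative (dressVec P Γn q.2.1 q.2.2 k i)).eval (pts q.2.1 q.2.2 k)) =
    logDeriv (dressQuot q.2.1 q.2.2 k) (pts q.2.1 q.2.2 k) +
      ((derivMat Γn (pts q.2.1 q.2.2 k)).adjugate * Γn (pts q.2.1 q.2.2 k))
      (ptRow n₁ n₂ k) (ptRow n₁ n₂ k) := by
  have hev := eventually_inv_mul_dressVec hP (h.solution _ ht) hn (hM _) hMn ha hinj k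
  set a := pts q.2.1 q.2.2 k with hadef
  set e := ptRow n₁ n₂ k
  have hC := S.isOpen_compl.mem_nhds (ha k)
  have hq := dressQuot_ne_zero (mem_slitPlane_of_notMem (ha k)) hinj
  rw [← hadef] at hq
  have hd0 : ∀ i j, HasDerivAt (fun z => Γ₀ q.1 z i j) (derivMat (Γ₀ q.1) a i j) a := fun i j =>
    (((h.solution _ ht).analytic i j).differentiableAt hC).hasDerivAt
  have hdn : ∀ i j, HasDerivAt (fun z => Γn z i j) (derivMat Γn a i j) a := fun i j =>
    ((hn.analytic i j).differentiableAt hC).hasDerivAt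
  have h1 : HasDerivAt (fun z => ∑ i, (Γ₀ q.1 z).adjugate e i * (dressVec P Γn q.2.1 q.2.2 k i).eval z)
      (∑ i, ((derivMat (Γ₀ q.1) a).adjugate e i * (dressVec P Γn q.2.1 q.2.2 k i).eval a +
      (Γ₀ q.1 a).adjugate e i *
        (Polynomial.derivative (dressVec P Γn q.2.1 q.2.2 k i)).eval a)) a :=
    HasDerivAt.fun_sum fun i _ => (hasDerivAt_adjugate hd0 e i).mul (Polynomial.hasDerivAt _ _)
  have h2 : HasDerivAt (fun z => (dressQuot q.2.1 q.2.2 k a)⁻¹ * dressQuot q.2.1 q.2.2 k z *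
      (∑ i, (Γn z).adjugate e i * Γn a i e))
      ((dressQuot q.2.1 q.2.2 k a)⁻¹ * deriv (dressQuot q.2.1 q.2.2 k) a *
        (∑ i, (Γn a).adjugate e i * Γn a i e) +
      (dressQuot q.2.1 q.2.2 k a)⁻¹ * dressQuot q.2.1 q.2.2 k a *
        (∑ i, (derivMat Γn a).adjugate e i * Γn a i e)) a :=
    (((differentiableAt_dressQuot (mem_slitPlane_of_notMem (ha k))
      (mem_slitPlane_of_notMem (ha k))).hasDerivAt).const_mul _).mul
      (HasDerivAt.fun_sum fun i _ => (hasDerivAt_adjugate hdn e i).mul_const _)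
  have h3 : (fun z => ∑ i, (Γ₀ q.1 z).adjugate e i * (dressVec P Γn q.2.1 q.2.2 k i).eval z)
      =ᶠ[𝓝 a] fun z => (dressQuot q.2.1 q.2.2 k a)⁻¹ * dressQuot q.2.1 q.2.2 k z *
      (∑ i, (Γn z).adjugate e i * Γn a i e) := by
    filter_upwards [hev, hC] with z hz hzC
    rw [inv_eq_adjugate ((h.solution _ ht).det_eq_one (hM _) hzC),
      inv_eq_adjugate (hn.det_eq_one hMn hzC)] at hz
    rw [hz, Matrix.mul_apply]
  have h4 := h1.unique (h2.congr_of_eventuallyEq h3)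
  have h5 : ∑ i, (Γn a).adjugate e i * Γn a i e = 1 := by
    rw [← Matrix.mul_apply, Matrix.adjugate_mul, hn.det_eq_one hMn (ha k)]
    simp
  rw [h4, h5, logDeriv_apply, Matrix.mul_apply]
  field_simp

include h hP hn hM hMn hT ht ha hinj in
-- Jacobi's formula with the inverse `dressInv`. The k-th diagonal entry of A′B is the derivative
-- along the line of row e_k of Γ₀⁻¹ at the moving point applied to the k-th polynomial vector,
-- whose coefficients stay frozen at q.
lemma hasDerivAt_det_rowMat : HasDerivAt
    (fun s : ℂ => (rowMat (Γ₀ (q + s • v).1) (q + s • v).2.1 (q + s • v).2.2).det)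
    ((rowMat (Γ₀ q.1) q.2.1 q.2.2).det * ∑ k, (pointTerm Γ₀ Γn P q v k + pts v.2.1 v.2.2 k *
      logDeriv (dressQuot q.2.1 q.2.2 k) (pts q.2.1 q.2.2 k))) 0 := by
  have hq0 : q + (0 : ℂ) • v = q := by simp
  have hent : ∀ k l, HasDerivAt
      (fun s : ℂ => rowMat (Γ₀ (q + s • v).1) (q + s • v).2.1 (q + s • v).2.2 k l)
      (fderiv ℂ (fun q' : Params d n₁ n₂ => rowMat (Γ₀ q'.1) q'.2.1 q'.2.2 k l) q v) 0 :=
    fun k l => (differentiableAt_rowMat h hT hM q ht ha k l).hasFDerivAt.hasLineDerivAt v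
  set A' : Matrix (Fin (n₂ + n₁)) (Fin (n₂ + n₁)) ℂ := Matrix.of fun k l =>
    fderiv ℂ (fun q' : Params d n₁ n₂ => rowMat (Γ₀ q'.1) q'.2.1 q'.2.2 k l) q v with hA'
  have hB : rowMat (Γ₀ (q + (0 : ℂ) • v).1) (q + (0 : ℂ) • v).2.1 (q + (0 : ℂ) • v).2.2 *
      dressInv P Γn q.2.1 q.2.2 = 1 := by
    rw [hq0]; exact rowMat_mul_dressInv hP (h.solution _ ht) hn (hM _) hMn ha hinj
  have hdet := hasDerivAt_det (A := fun s : ℂ =>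
    rowMat (Γ₀ (q + s • v).1) (q + s • v).2.1 (q + s • v).2.2) (A' := A') hent hB
  refine hdet.congr_deriv ?_
  rw [hq0]
  congr 1
  rw [Matrix.trace]
  refine Finset.sum_congr rfl fun k _ => ?_
  rw [Matrix.diag_apply, Matrix.mul_apply]
  set a := pts q.2.1 q.2.2 k with hadef
  set b := pts v.2.1 v.2.2 k with hbdef
  set e := ptRow n₁ n₂ k with hedef
  -- both sides are the derivative of the same function
  have h1 : HasDerivAt (fun s : ℂ => ∑ l,
      rowMat (Γ₀ (q + s • v).1) (q + s • v).2.1 (q + s • v).2.2 k l * dressInv P Γn q.2.1 q.2.2 l k)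
      (∑ l, A' k l * dressInv P Γn q.2.1 q.2.2 l k) 0 :=
    HasDerivAt.fun_sum fun l _ => (hent k l).mul_const _
  have hD := fun i j => h.hasDerivAt_line hT ht (ha k) v.1 b i j
  rw [← hadef] at hD
  have hb : HasDerivAt (fun s : ℂ => a + s * b) b 0 := by
    simpa using ((hasDerivAt_id (0 : ℂ)).mul_const b).const_add a
  have h2 : HasDerivAt (fun s : ℂ => ∑ i, (Γ₀ (q.1 + s • v.1) (a + s * b)).adjugate e i *
      (dressVec P Γn q.2.1 q.2.2 k i).eval (a + s * b))
      (∑ i, ((famDeriv Γ₀ q.1 v.1 a + b • derivMat (Γ₀ q.1) a).adjugate e i *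
        (dressVec P Γn q.2.1 q.2.2 k i).eval (a + 0 * b) +
        (Γ₀ (q.1 + (0 : ℂ) • v.1) (a + 0 * b)).adjugate e i *
          ((Polynomial.derivative (dressVec P Γn q.2.1 q.2.2 k i)).eval (a + 0 * b) * b))) 0 :=
    HasDerivAt.fun_sum fun i _ => (hasDerivAt_adjugate hD e i).mul
      (HasDerivAt.comp (h₂ := fun z => (dressVec P Γn q.2.1 q.2.2 k i).eval z) (0 : ℂ)
        (Polynomial.hasDerivAt _ _) hb)
  have h3 : (fun s : ℂ => ∑ l,
      rowMat (Γ₀ (q + s • v).1) (q + s • v).2.1 (q + s • v).2.2 k l * dressInv P Γn q.2.1 q.2.2 l k)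
      =ᶠ[𝓝 0] fun s : ℂ => ∑ i, (Γ₀ (q.1 + s • v.1) (a + s * b)).adjugate e i *
      (dressVec P Γn q.2.1 q.2.2 k i).eval (a + s * b) := by
    have hc : ContinuousAt (fun s : ℂ => q + s • v) 0 := by fun_prop
    have hev := eventually_rowMat_eq h hT hM q ht ha
    rw [← hq0] at hev
    filter_upwards [hc.eventually hev] with s hs
    rw [← sum_colRow_coeff (n₂ + n₁) (dressVec_degree hP hn hMn ha k)]
    refine Finset.sum_congr rfl fun l _ => ?_
    rw [hs.2 k l, pts_line]
    rfl
  rw [h1.unique (h2.congr_of_eventuallyEq h3)]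
  have h4 := deriv_inv_mul_dressVec h hM q ht ha hP hn hMn hinj k
  rw [← hadef, ← hedef] at h4
  simp only [zero_mul, add_zero, zero_smul, adjugate_add_smul, Fin.sum_univ_two, pointTerm,
    ← hadef, ← hedef, ← hbdef] at h4 ⊢
  linear_combination b * h4

include h hP hn hM hMn hT ht ha hinj in
/-- `Δ det 𝔾` is nonzero and differentiable, and its logarithmic derivative is a sum over the
points. -/
theorem logDeriv_deltaDetG (hM0 : ∀ t r, 0 < r → M t none r = !![0, 1; -1, 0]) :
    deltaDetG S Γ₀ q ≠ 0 ∧ DifferentiableAt ℂ (deltaDetG (n₁ := n₁) (n₂ := n₂) S Γ₀) q ∧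
    ∀ v, fderiv ℂ (deltaDetG (n₁ := n₁) (n₂ := n₂) S Γ₀) q v / deltaDetG S Γ₀ q =
      ∑ k, pointTerm Γ₀ Γn P q v k := by
  have hsp := fun k => mem_slitPlane_of_notMem (ha k)
  have hR := rowMat_mul_dressInv hP (h.solution _ ht) hn (hM _) hMn ha hinj
  have hR0 : (rowMat (Γ₀ q.1) q.2.1 q.2.2).det ≠ 0 := fun h0 => by
    have := congrArg Matrix.det hR
    rw [Matrix.det_mul, h0, zero_mul, Matrix.det_one] at this
    exact zero_ne_one this
  obtain ⟨hΔ0, hΔ⟩ := differentiableAt_bigDelta q hsp hinj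
  -- Only t ∈ T is needed here, so the formula holds in a neighbourhood of q and may be
  -- differentiated; the constant drops out of the logarithmic derivative.
  have heq : ∀ q' : Params d n₁ n₂, q'.1 ∈ T → deltaDetG S Γ₀ q' = gConst n₁ n₂ *
      (bigDelta q'.2.1 q'.2.2 * (rowMat (Γ₀ q'.1) q'.2.1 q'.2.2).det) := fun q' hq' => by
    rw [deltaDetG, ((h.solution _ hq').residues (hM0 _) q'.2.1 q'.2.2).2]
    ring
  have hev : deltaDetG S Γ₀ =ᶠ[𝓝 q] fun q' => gConst n₁ n₂ *
      (bigDelta q'.2.1 q'.2.2 * (rowMat (Γ₀ q'.1) q'.2.1 q'.2.2).det) := by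
    have h1 : ∀ᶠ q' : Params d n₁ n₂ in 𝓝 q, q'.1 ∈ T := continuous_fst.continuousAt.eventually
      (hT.mem_nhds ht)
    exact h1.mono heq
  have hdet : DifferentiableAt ℂ (fun q' : Params d n₁ n₂ =>
      (rowMat (Γ₀ q'.1) q'.2.1 q'.2.2).det) q := by
    simp only [Matrix.det_apply]
    refine DifferentiableAt.fun_sum fun σ _ => DifferentiableAt.const_smul ?_ _
    exact differentiableAt_prod fun k _ => differentiableAt_rowMat h hT hM q ht ha _ _
  have hdiff : DifferentiableAt ℂ (deltaDetG (n₁ := n₁) (n₂ := n₂) S Γ₀) q :=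
    ((hΔ.mul hdet).const_mul (gConst n₁ n₂)).congr_of_eventuallyEq hev
  have hne : deltaDetG S Γ₀ q ≠ 0 := by
    rw [heq q ht]
    exact mul_ne_zero (gConst_ne_zero _ _) (mul_ne_zero hΔ0 hR0)
  refine ⟨hne, hdiff, fun v => ?_⟩
  have hq0 : q + (0 : ℂ) • v = q := by simp
  have hΔl : HasDerivAt (fun s : ℂ => bigDelta (q + s • v).2.1 (q + s • v).2.2)
      (bigDelta q.2.1 q.2.2 * -∑ k, pts v.2.1 v.2.2 k *
        logDeriv (dressQuot q.2.1 q.2.2 k) (pts q.2.1 q.2.2 k)) 0 := by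
    have h1 : HasDerivAt (fun s : ℂ => bigDelta (q + s • v).2.1 (q + s • v).2.2) _ 0 :=
      hΔ.hasFDerivAt.hasLineDerivAt v
    have h2 := logDeriv_bigDelta_line q v hsp hinj
    refine h1.differentiableAt.hasDerivAt.congr_deriv ?_
    rw [← h2, logDeriv_apply, hq0]
    field_simp
  have h1 := (hΔl.mul (hasDerivAt_det_rowMat h hT hM q v ht ha hP hn hMn hinj)).const_mul
    (gConst n₁ n₂)
  have hc : ContinuousAt (fun s : ℂ => q + s • v) 0 := by fun_prop
  have h2 : HasDerivAt (fun s : ℂ => deltaDetG S Γ₀ (q + s • v)) _ 0 :=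
    hdiff.hasFDerivAt.hasLineDerivAt v
  rw [← hq0] at hev
  have h3 := h2.unique (h1.congr_of_eventuallyEq (hc.eventually hev))
  rw [h3, heq q ht, hq0, Finset.sum_add_distrib]
  have := gConst_ne_zero n₁ n₂
  field_simp
  ring

end

end

/-! ### Extension of the dressed solution through the contour. -/

section

namespace RayContour

variable {m : ℕ} (S : RayContour m)

lemma HasExt.comp_differentiable {S : RayContour m} {p : Option (Fin m)} {s : ℤˣ} {r : ℝ}
    {F G φ : ℂ → ℂ} (h : S.HasExt p s r F G) (hφ : Differentiable ℂ φ) :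
    S.HasExt p s r (fun z => φ (F z)) (fun z => φ (G z)) :=
  ⟨(hφ.analyticAt _).comp h.1, h.2.fun_comp φ⟩

/-- Across the negative half line the root is continued by ∓i√(−z). The squares agree, and
positivity of the real parts of principal roots excludes the wrong sign. -/
lemma exists_hasExt_csqrt (p : Option (Fin m)) (s : ℤˣ) {r : ℝ} (hr : 0 < r) :
    ∃ G, S.HasExt p s r csqrt G := by
  have han : ∀ z ∈ Complex.slitPlane, AnalyticAt ℂ csqrt z := fun z hz =>
    DifferentiableOn.analyticAt (s := Complex.slitPlane)
      (fun w hw => (csqrt_differentiableAt hw).differentiableWithinAt)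
      (Complex.isOpen_slitPlane.mem_nhds hz)
  cases p with
  | some j => exact ⟨csqrt, HasExt.of_analyticAt (han _ (S.point_some_mem_slitPlane j hr))⟩
  | none =>
    refine ⟨fun z => -((s : ℤ) : ℂ) * Complex.I * csqrt (-z), ?_, ?_⟩
    · have h1 : -S.point none r ∈ Complex.slitPlane := by
        rw [point_eq, rot_none, mul_neg_one, neg_neg]
        exact Or.inl (by simpa using hr)
      exact analyticAt_const.mul ((han _ h1).comp (f := fun z => -z) analyticAt_id.neg)
    · filter_upwards [self_mem_nhdsWithin] with z hz
      have h1 := (S.mem_side.1 hz).2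
      rw [rot_none] at h1
      have h2 : 0 < ((s : ℤ) : ℝ) * (-z).im := by simpa [inv_neg] using h1
      have hw : -z ∈ Complex.slitPlane := Or.inr fun h3 => by rw [h3, mul_zero] at h2; exact h2.false
      have hz' : z ∈ Complex.slitPlane := mem_slitPlane_of_notMem (S.side_subset _ _ hz)
      have hs2 : (((s : ℤ) : ℂ)) ^ 2 = 1 := by
        rcases Int.units_eq_one_or s with rfl | rfl <;> simp
      have h3 : csqrt z ^ 2 = (-((s : ℤ) : ℂ) * Complex.I * csqrt (-z)) ^ 2 := by
        rw [csqrt_sq, mul_pow, mul_pow, neg_pow, hs2, Complex.I_sq, csqrt_sq]; ring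
      rcases sq_eq_sq_iff_eq_or_eq_neg.1 h3 with h4 | h4
      · exact h4
      exfalso
      have h5 := csqrt_re_pos hz'
      have h6 := csqrt_re_pos hw
      have h7 : (-z).im = 2 * ((csqrt (-z)).re * (csqrt (-z)).im) := by
        nth_rewrite 1 [← csqrt_sq (-z)]
        rw [pow_two, Complex.mul_im]; ring
      have h8 : (csqrt z).re = -(((s : ℤ) : ℝ) * (csqrt (-z)).im) := by
        rw [h4]
        rcases Int.units_eq_one_or s with rfl | rfl <;> simp
      rw [h7] at h2
      have h9 : 0 < (csqrt (-z)).re * (2 * (((s : ℤ) : ℝ) * (csqrt (-z)).im)) := by linarith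
      have := pos_of_mul_pos_right h9 h6.le
      linarith

lemma exists_matExt_dressD {n₁ n₂ : ℕ} (lam : Fin n₂ → ℂ) (mu : Fin n₁ → ℂ) (p : Option (Fin m))
    (s : ℤˣ) {r : ℝ} (hr : 0 < r) : ∃ G, S.MatExt p s r (dressD lam mu) G := by
  obtain ⟨G, hG⟩ := S.exists_hasExt_csqrt p s hr
  refine ⟨fun z => dressRoot lam mu (G z), ?_⟩
  have h0 : S.HasExt p s r (fun _ => 0) (fun _ => 0) := HasExt.of_analyticAt analyticAt_const
  have h1 := hG.comp_differentiable (differentiable_dressScalar lam mu)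
  have h2 := hG.comp_differentiable (φ := fun x => dressScalar lam mu (-x))
    ((differentiable_dressScalar lam mu).comp differentiable_neg)
  intro i j
  simp only [dressD_eq, dressRoot]
  fin_cases i <;> fin_cases j <;> simp
  exacts [h1, h0, h0, h2]

end RayContour

open RayContour

section DressR

variable {m n₁ n₂ : ℕ} {S : RayContour m} {lam : Fin n₂ → ℂ} {mu : Fin n₁ → ℂ}
  {P : Matrix (Fin 2) (Fin 2) (Polynomial ℂ)} {Γ Γn : ℂ → Mat} {M Mn : Option (Fin m) → ℝ → Mat}

/-- The inverse of the polynomial matrix of a dressing. -/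
def dressR (P : Matrix (Fin 2) (Fin 2) (Polynomial ℂ)) (lam : Fin n₂ → ℂ) (mu : Fin n₁ → ℂ)
    (z : ℂ) : Mat :=
  (∏ k, (pts lam mu k - z))⁻¹ • (polyMat P z).adjugate

lemma IsDressing.dressR_mul (hP : IsDressing S Γ Γn lam mu P) {z : ℂ}
    (hz : ∏ k, (pts lam mu k - z) ≠ 0) : dressR P lam mu z * polyMat P z = 1 := by
  rw [dressR, Matrix.smul_mul, Matrix.adjugate_mul, hP.det z, smul_smul, inv_mul_cancel₀ hz, one_smul]

lemma IsDressing.eq_dressR (hP : IsDressing S Γ Γn lam mu P) (hn : IsRHPSolution S Mn Γn)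
    (hMn : ∀ p r, 0 < r → (Mn p r).det = 1) {z : ℂ} (hz : z ∉ S.carrier)
    (hz' : ∏ k, (pts lam mu k - z) ≠ 0) :
    Γn z = dressR P lam mu z * (Γ z * dressD lam mu z) := by
  rw [← hP.mul_eq hn hMn hz, ← Matrix.mul_assoc, hP.dressR_mul hz', one_mul]

lemma differentiableAt_prod_pts (z : ℂ) :
    DifferentiableAt ℂ (fun z => ∏ k, (pts lam mu k - z)) z :=
  differentiableAt_prod fun _ _ => differentiableAt_id.const_sub _

lemma differentiable_polyMat (P : Matrix (Fin 2) (Fin 2) (Polynomial ℂ)) (i j : Fin 2) :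
    Differentiable ℂ fun z => polyMat P z i j := (P i j).differentiable

lemma differentiable_adjugate_polyMat (P : Matrix (Fin 2) (Fin 2) (Polynomial ℂ)) (i j : Fin 2) :
    Differentiable ℂ fun z => (polyMat P z).adjugate i j := by
  simp only [Matrix.adjugate_fin_two]
  fin_cases i <;> fin_cases j <;> simp
  exacts [differentiable_polyMat P 1 1, differentiable_polyMat P 0 1,
    differentiable_polyMat P 1 0, differentiable_polyMat P 0 0]

lemma continuousAt_dressR {z : ℂ} (hz : ∏ k, (pts lam mu k - z) ≠ 0) :
    ContinuousAt (dressR P lam mu) z :=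
  ContinuousAt.smul ((differentiableAt_prod_pts z).continuousAt.inv₀ hz)
    (continuousAt_pi.2 fun i => continuousAt_pi.2 fun j =>
      (differentiable_adjugate_polyMat P i j z).continuousAt)

/-- The dressed solution extends analytically across the contour where the initial one does. -/
lemma IsDressing.exists_matExt (hP : IsDressing S Γ Γn lam mu P) (hn : IsRHPSolution S Mn Γn)
    (hMn : ∀ p r, 0 < r → (Mn p r).det = 1) (ha : ∀ k, pts lam mu k ∉ S.carrier)
    {p : Option (Fin m)} {s : ℤˣ} {r : ℝ} (hr : 0 < r) {G : ℂ → Mat} (hG : S.MatExt p s r Γ G) :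
    ∃ Gn, S.MatExt p s r Γn Gn := by
  obtain ⟨E, hE⟩ := S.exists_matExt_dressD lam mu p s hr
  have h0 := S.prod_pts_sub_ne_zero ha p hr.le
  have hev : ∀ᶠ z in 𝓝 (S.point p r), ∏ k, (pts lam mu k - z) ≠ 0 :=
    (differentiableAt_prod_pts _).continuousAt.eventually_ne h0
  -- Since Γn = P⁻¹ Γ D, and P⁻¹ is analytic near the contour because the points lie off it, no
  -- continuation of the dressed jump matrices has to be constructed.
  have hR : S.MatExt p s r (dressR P lam mu) (dressR P lam mu) := fun i j => by
    refine HasExt.of_analyticAt ?_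
    refine Complex.analyticAt_iff_eventually_differentiableAt.2 (hev.mono fun z hz => ?_)
    simp only [dressR, Matrix.smul_apply, smul_eq_mul]
    exact ((differentiableAt_prod_pts z).inv hz).mul (differentiable_adjugate_polyMat P i j z)
  have h1 := hR.mul (hG.mul hE)
  refine ⟨_, fun i j => (h1 i j).congr ?_⟩
  filter_upwards [self_mem_nhdsWithin, nhdsWithin_le_nhds hev] with z hz hz'
  rw [hP.eq_dressR hn hMn (S.side_subset _ _ hz) hz']

end DressR

end

/-! ### The derivative of the family with respect to t. -/

section

open RayContour

variable {m d : ℕ} {S : RayContour m} {T : Set (Fin d → ℂ)}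
  {M : (Fin d → ℂ) → Option (Fin m) → ℝ → Mat} {Γ₀ : (Fin d → ℂ) → ℂ → Mat}

lemma eventually_ball_line {t : Fin d → ℂ} (w : Fin d → ℂ) {Q : (Fin d → ℂ) → Prop}
    (hQ : ∀ᶠ t' in 𝓝 t, Q t') : ∃ ρ : ℝ, 0 < ρ ∧ ∀ s ∈ Metric.ball (0 : ℂ) ρ, Q (t + s • w) := by
  have hc : ContinuousAt (fun s : ℂ => t + s • w) 0 := by fun_prop
  have h0 : t + (0 : ℂ) • w = t := by simp
  rw [← h0] at hQ
  exact Metric.eventually_nhds_iff_ball.1 (hc.eventually hQ)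

lemma frameCoord_apply (F : ℂ → Mat) (z : ℂ) (i j : Fin 2) : frameCoord F z i j =
    (quarterPowNeg z * eMat)⁻¹ i 0 * F z 0 j + (quarterPowNeg z * eMat)⁻¹ i 1 * F z 1 j := by
  rw [frameCoord, Matrix.mul_apply, Fin.sum_univ_two]

namespace IsAnalyticRHPFamily

section

variable (h : IsAnalyticRHPFamily S T M Γ₀) (hT : IsOpen T) {t : Fin d → ℂ} (ht : t ∈ T)
  (w : Fin d → ℂ)

include h in
lemma differentiableOn_line {ρ : ℝ} (hρ : ∀ s ∈ Metric.ball (0 : ℂ) ρ, t + s • w ∈ T) {z : ℂ}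
    (hz : z ∉ S.carrier) (i j : Fin 2) :
    DifferentiableOn ℂ (fun s : ℂ => Γ₀ (t + s • w) z i j) (Metric.ball 0 ρ) :=
  (h.analytic i j).comp (f := fun s : ℂ => (t + s • w, z)) (by fun_prop) fun s hs => ⟨hρ s hs, hz⟩

include h hT ht in
lemma exists_line_bound (z₀ : ℂ) : ∃ ρ C : ℝ, 0 < ρ ∧
    (∀ s ∈ Metric.ball (0 : ℂ) ρ, t + s • w ∈ T) ∧
    ∀ᶠ z in 𝓝[S.carrierᶜ] z₀, ∀ s ∈ Metric.ball (0 : ℂ) ρ, ∀ i j, ‖Γ₀ (t + s • w) z i j‖ ≤ C := by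
  obtain ⟨C, hC⟩ := h.locally_bounded t ht z₀
  rw [nhdsWithin_prod_eq, eventually_prod_iff] at hC
  obtain ⟨p₁, h1, p₂, h2, h3⟩ := hC
  rw [hT.nhdsWithin_eq ht] at h1
  obtain ⟨ρ, hρ, hρ'⟩ := eventually_ball_line w (h1.and (hT.mem_nhds ht))
  exact ⟨ρ, C, hρ, fun s hs => (hρ' s hs).2, h2.mono fun z hz s hs => h3 (hρ' s hs).1 hz⟩

include h hT ht in
lemma exists_line_bound_atInf : ∃ ρ C : ℝ, 0 < ρ ∧
    (∀ s ∈ Metric.ball (0 : ℂ) ρ, t + s • w ∈ T) ∧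
    ∀ᶠ z in S.atInf, ∀ s ∈ Metric.ball (0 : ℂ) ρ, ∀ i j,
      ‖(frameCoord (Γ₀ (t + s • w)) z - 1) i j‖ ≤ C * ‖z‖ ^ (-(1 / 2) : ℝ) := by
  obtain ⟨Y, hY⟩ := h.expansion
  obtain ⟨C, ρ', hC⟩ := hY t ht 1
  obtain ⟨ρ, hρ, hb⟩ := eventually_ball_line w (hC.and (hT.mem_nhds ht))
  refine ⟨ρ, C, hρ, fun s hs => (hb s hs).2, S.eventually_atInf.2 ⟨ρ', fun z hz hzρ s hs i j => ?_⟩⟩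
  obtain ⟨Y', a, hY0, -, hY'⟩ := (h.solution _ (hb s hs).2).expansion
  obtain ⟨C', ρ'', h'⟩ := hY' 1
  have h1 : Y (t + s • w) 0 = 1 := by rw [zeroth_coefficient_unique (hb s hs).1 h', hY0]
  rw [← h1]
  exact remainderBound_one (hb s hs).1 hz hzρ i j

include h hT ht in
lemma exists_famDeriv_bound (z₀ : ℂ) : ∃ C : ℝ,
    ∀ᶠ z in 𝓝[S.carrierᶜ] z₀, ∀ i j, ‖famDeriv Γ₀ t w z i j‖ ≤ C := by
  obtain ⟨ρ, C, hρ, hρT, hb⟩ := h.exists_line_bound hT ht w z₀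
  refine ⟨C / (ρ / 2), ?_⟩
  filter_upwards [hb, self_mem_nhdsWithin] with z hz hzC i j
  refine Complex.norm_deriv_le_of_forall_mem_sphere_norm_le (by linarith) ?_ fun s hs => hz s ?_ i j
  · refine DifferentiableOn.diffContOnCl_ball (U := Metric.ball 0 ρ)
      (h.differentiableOn_line w hρT hzC i j) (Metric.closedBall_subset_ball (by linarith))
  · exact Metric.closedBall_subset_ball (by linarith) (Metric.sphere_subset_closedBall hs)

include h hT ht in
lemma wtO_famDeriv_atZero : WtO S.atZero 0 0 0 (famDeriv Γ₀ t w) := fun i j => by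
  obtain ⟨C, hC⟩ := h.exists_famDeriv_bound hT ht w 0
  refine Asymptotics.IsBigO.of_bound C ?_
  filter_upwards [show ∀ᶠ z in S.atZero, _ from hC] with z hz
  simpa using hz i j

include h hT ht in
-- The leading coefficient of the expansion is the identity for every t, so in the frame the
-- derivative only sees the remainder O(|z|^(−1/2)). Cauchy's estimate in the parameter turns its
-- locally uniform bound into one for the derivative.
lemma wtO_famDeriv_atInf : WtO S.atInf (-(1 / 2)) wt 0 (famDeriv Γ₀ t w) := fun i j => by
  obtain ⟨ρ, C, hρ, hρT, hb⟩ := h.exists_line_bound_atInf hT ht w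
  refine Asymptotics.IsBigO.of_bound (2 * (C / (ρ / 2))) ?_
  filter_upwards [hb, S.atInf_notMem, S.atInf_ne_zero] with z hz hzC hz0
  have hn : 0 < ‖z‖ := norm_pos_iff.2 hz0
  have h1 : ∀ k, ‖frameCoord (famDeriv Γ₀ t w) z k j‖ ≤ C * ‖z‖ ^ (-(1 / 2) : ℝ) / (ρ / 2) := by
    intro k
    have hd : ∀ i, DifferentiableOn ℂ (fun s : ℂ => Γ₀ (t + s • w) z i j) (Metric.ball 0 ρ) :=
      fun i => h.differentiableOn_line w hρT hzC i j
    have hd0 : ∀ i, HasDerivAt (fun s : ℂ => Γ₀ (t + s • w) z i j) (famDeriv Γ₀ t w z i j) 0 :=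
      fun i => ((hd i).differentiableAt (Metric.ball_mem_nhds 0 hρ)).hasDerivAt
    have h2 : HasDerivAt (fun s : ℂ => (frameCoord (Γ₀ (t + s • w)) z - 1) k j)
        (frameCoord (famDeriv Γ₀ t w) z k j) 0 := by
      simp only [Matrix.sub_apply, frameCoord_apply]
      exact (((hd0 0).const_mul _).add ((hd0 1).const_mul _)).sub_const _
    rw [← h2.deriv]
    refine Complex.norm_deriv_le_of_forall_mem_sphere_norm_le (by linarith) ?_ fun s hs => hz s ?_ k j
    · refine DifferentiableOn.diffContOnCl_ball (U := Metric.ball 0 ρ) ?_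
        (Metric.closedBall_subset_ball (by linarith))
      simp only [Matrix.sub_apply, frameCoord_apply]
      exact (((hd 0).const_mul _).add ((hd 1).const_mul _)).sub_const _
    · exact Metric.closedBall_subset_ball (by linarith) (Metric.sphere_subset_closedBall hs)
  refine (norm_le_of_frameCoord hz0 h1 i).trans (le_of_eq ?_)
  rw [Real.norm_of_nonneg (by positivity), Pi.zero_apply, sub_zero, Real.rpow_add hn]
  ring

include h hT ht in
/-- The parameter derivative of the family has boundary values. -/
lemma exists_tendsto_famDeriv (p : Option (Fin m)) (s : ℤˣ) {r : ℝ} (hr : 0 < r) :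
    ∃ L, Tendsto (famDeriv Γ₀ t w) (𝓝[S.side p s] (S.point p r)) (𝓝 L) := by
  obtain ⟨ρ, C, hρ, hρT, hb⟩ := h.exists_line_bound hT ht w (S.point p r)
  have hsub : 𝓝[S.side p s] (S.point p r) ≤ 𝓝[S.carrierᶜ] (S.point p r) :=
    nhdsWithin_mono _ (S.side_subset p s)
  refine ⟨Matrix.of fun i j => Complex.cderiv (ρ / 2)
    (fun σ => S.boundaryValue (Γ₀ (t + σ • w)) p s r i j) 0,
    tendsto_pi_nhds.2 fun i => tendsto_pi_nhds.2 fun j => ?_⟩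
  refine tendsto_deriv_of_bounded (g := fun σ z => Γ₀ (t + σ • w) z i j) (C := C) hρ ?_ ?_ ?_
  · filter_upwards [self_mem_nhdsWithin] with z hz
    exact h.differentiableOn_line w hρT (S.side_subset _ _ hz) i j
  · exact (hb.filter_mono hsub).mono fun z hz σ hσ => hz σ hσ i j
  · intro σ hσ
    have := (h.solution _ (hρT σ hσ)).boundary_tendsto p s r hr
    exact tendsto_pi_nhds.1 (tendsto_pi_nhds.1 this i) j

include h hT ht in
/-- The parameter derivative of the jump relation. -/
lemma famDeriv_jump {p : Option (Fin m)} {r : ℝ} (hr : 0 < r) {L₁ L₂ M' : Mat}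
    (h1 : Tendsto (famDeriv Γ₀ t w) (𝓝[S.side p (S.sgn p)] (S.point p r)) (𝓝 L₁))
    (h2 : Tendsto (famDeriv Γ₀ t w) (𝓝[S.side p (-S.sgn p)] (S.point p r)) (𝓝 L₂))
    (hM : ∀ i j, ∀ᶠ s in 𝓝 (0 : ℂ), DifferentiableAt ℂ (fun s : ℂ => M (t + s • w) p r i j) s)
    (hM' : ∀ i j, deriv (fun s : ℂ => M (t + s • w) p r i j) 0 = M' i j) :
    L₁ = L₂ * M t p r + S.minus (Γ₀ t) p r * M' := by
  obtain ⟨ρ₁, C, hρ₁, hρT₁, hb⟩ := h.exists_line_bound hT ht w (S.point p r)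
  have hM1 : ∀ᶠ s in 𝓝 (0 : ℂ), ∀ i j, DifferentiableAt ℂ (fun s : ℂ => M (t + s • w) p r i j) s ∧
      ‖M (t + s • w) p r i j‖ ≤ ‖M t p r i j‖ + 1 := by
    refine eventually_all.2 fun i => eventually_all.2 fun j => (hM i j).and ?_
    have hc := (hM i j).self_of_nhds.continuousAt.norm
    have h3 : ‖M (t + (0 : ℂ) • w) p r i j‖ < ‖M t p r i j‖ + 1 := by simp
    exact (hc.eventually_lt continuousAt_const h3).mono fun s hs => hs.le
  obtain ⟨ρ₂, hρ₂, hM2⟩ := Metric.eventually_nhds_iff_ball.1 hM1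
  set ρ := min ρ₁ ρ₂ with hρdef
  have hρ : 0 < ρ := lt_min hρ₁ hρ₂
  have hs1 : Metric.ball (0 : ℂ) ρ ⊆ Metric.ball 0 ρ₁ := Metric.ball_subset_ball (min_le_left _ _)
  have hs2 : Metric.ball (0 : ℂ) ρ ⊆ Metric.ball 0 ρ₂ := Metric.ball_subset_ball (min_le_right _ _)
  have hρT : ∀ s ∈ Metric.ball (0 : ℂ) ρ, t + s • w ∈ T := fun s hs => hρT₁ s (hs1 hs)
  set l₁ := 𝓝[S.side p (S.sgn p)] (S.point p r)
  set l₂ := 𝓝[S.side p (-S.sgn p)] (S.point p r)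
  have : l₁.NeBot := S.nhdsWithin_side_neBot p _ hr
  have : l₂.NeBot := S.nhdsWithin_side_neBot p _ hr
  have m1 : ∀ᶠ x in l₁ ×ˢ l₂, x.1 ∉ S.carrier ∧ x.2 ∉ S.carrier := by
    have e1 : ∀ᶠ z in l₁, z ∉ S.carrier :=
      (eventually_mem_nhdsWithin (s := S.side p (S.sgn p))).mono (S.side_subset p _)
    have e2 : ∀ᶠ z in l₂, z ∉ S.carrier :=
      (eventually_mem_nhdsWithin (s := S.side p (-S.sgn p))).mono (S.side_subset p _)
    exact (e1.prod_inl l₂).and (e2.prod_inr l₁)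
  have b1 : ∀ᶠ x in l₁ ×ˢ l₂, ∀ s ∈ Metric.ball (0 : ℂ) ρ, ∀ i j,
      ‖Γ₀ (t + s • w) x.1 i j‖ ≤ C ∧ ‖Γ₀ (t + s • w) x.2 i j‖ ≤ C := by
    have e1 := hb.filter_mono (nhdsWithin_mono _ (S.side_subset p (S.sgn p)))
    have e2 := hb.filter_mono (nhdsWithin_mono _ (S.side_subset p (-S.sgn p)))
    filter_upwards [e1.prod_inl l₂, e2.prod_inr l₁] with x h3 h4 s hs i j
    exact ⟨h3 s (hs1 hs) i j, h4 s (hs1 hs) i j⟩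
  -- The jump relation holds for limits only, so it is put on the product of the two one-sided
  -- filters: Γ at a point on the plus side minus Γ M with Γ at a point on the minus side tends to 0
  -- for each s. Uniform boundedness then makes its derivative in s tend to 0 as well.
  have hlim : ∀ s ∈ Metric.ball (0 : ℂ) ρ, ∀ i j,
      Tendsto (fun x : ℂ × ℂ => (Γ₀ (t + s • w) x.1 - Γ₀ (t + s • w) x.2 * M (t + s • w) p r) i j)
        (l₁ ×ˢ l₂) (𝓝 0) := by
    intro s hs i j
    have hsol := h.solution _ (hρT s hs)
    have t1 := (hsol.boundary_tendsto p (S.sgn p) r hr).comp (tendsto_fst (f := l₁) (g := l₂))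
    have t2 := (hsol.boundary_tendsto p (-S.sgn p) r hr).comp (tendsto_snd (f := l₁) (g := l₂))
    have t3 := t1.sub (t2.mul_const (M (t + s • w) p r))
    have e : S.boundaryValue (Γ₀ (t + s • w)) p (S.sgn p) r -
      S.boundaryValue (Γ₀ (t + s • w)) p (-S.sgn p) r * M (t + s • w) p r = 0 :=
      sub_eq_zero.2 (hsol.jump p r hr)
    rw [e] at t3
    exact tendsto_pi_nhds.1 (tendsto_pi_nhds.1 t3 i) j
  ext i j
  have key := tendsto_deriv_of_bounded (l := l₁ ×ˢ l₂) (g₀ := fun _ => 0) (ρ := ρ)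
    (C := C + (C * (‖M t p r 0 j‖ + 1) + C * (‖M t p r 1 j‖ + 1)))
    (g := fun s x => (Γ₀ (t + s • w) x.1 - Γ₀ (t + s • w) x.2 * M (t + s • w) p r) i j) hρ (by
      filter_upwards [m1] with x hx s hs
      have d1 := h.differentiableOn_line w hρT hx.1 i j
      have d2 := fun k => h.differentiableOn_line w hρT hx.2 i k
      have d3 := fun k => (hM2 s (hs2 hs) k j).1.differentiableWithinAt (s := Metric.ball (0 : ℂ) ρ)
      simp only [Matrix.sub_apply, Matrix.mul_apply, Fin.sum_univ_two]
      exact (d1 s hs).sub (((d2 0 s hs).mul (d3 0)).add ((d2 1 s hs).mul (d3 1)))) (by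
      filter_upwards [b1] with x hx s hs
      simp only [Matrix.sub_apply, Matrix.mul_apply, Fin.sum_univ_two]
      have hC0 : 0 ≤ C := (norm_nonneg _).trans (hx s hs i j).1
      have e3 : ∀ k, ‖Γ₀ (t + s • w) x.2 i k * M (t + s • w) p r k j‖ ≤ C * (‖M t p r k j‖ + 1) :=
        fun k => by
          rw [norm_mul]
          exact mul_le_mul (hx s hs i k).2 (hM2 s (hs2 hs) k j).2 (norm_nonneg _) hC0
      exact (norm_sub_le _ _).trans (add_le_add (hx s hs i j).1
        ((norm_add_le _ _).trans (add_le_add (e3 0) (e3 1))))) (fun s hs => hlim s hs i j)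
  have hcd : Complex.cderiv (ρ / 2) (fun _ => (0 : ℂ)) 0 = 0 := by simp [Complex.cderiv, circleIntegral]
  rw [hcd] at key
  have hsol := h.solution t ht
  have t1 := h1.comp (tendsto_fst (f := l₁) (g := l₂))
  have t2 := h2.comp (tendsto_snd (f := l₁) (g := l₂))
  have t3 := (hsol.boundary_tendsto p (-S.sgn p) r hr).comp (tendsto_snd (f := l₁) (g := l₂))
  have t4 := t1.sub ((t2.mul_const (M t p r)).add (t3.mul_const M'))
  have t5 := tendsto_pi_nhds.1 (tendsto_pi_nhds.1 t4 i) j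
  have t6 : Tendsto (fun x : ℂ × ℂ => deriv (fun s : ℂ =>
      (Γ₀ (t + s • w) x.1 - Γ₀ (t + s • w) x.2 * M (t + s • w) p r) i j) 0) (l₁ ×ˢ l₂)
      (𝓝 ((L₁ - (L₂ * M t p r + S.boundaryValue (Γ₀ t) p (-S.sgn p) r * M')) i j)) := by
    refine t5.congr' ?_
    filter_upwards [m1] with x hx
    have h00 : Metric.ball (0 : ℂ) ρ ∈ 𝓝 0 := Metric.ball_mem_nhds 0 hρ
    have d1 : HasDerivAt (fun s : ℂ => Γ₀ (t + s • w) x.1 i j) (famDeriv Γ₀ t w x.1 i j) 0 :=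
      ((h.differentiableOn_line w hρT hx.1 i j).differentiableAt h00).hasDerivAt
    have d2 : ∀ k, HasDerivAt (fun s : ℂ => Γ₀ (t + s • w) x.2 i k) (famDeriv Γ₀ t w x.2 i k) 0 :=
      fun k => ((h.differentiableOn_line w hρT hx.2 i k).differentiableAt h00).hasDerivAt
    have d3 : ∀ k, HasDerivAt (fun s : ℂ => M (t + s • w) p r k j) (M' k j) 0 := fun k => by
      rw [← hM']
      exact (hM k j).self_of_nhds.hasDerivAt
    have d4 := d1.sub (((d2 0).mul (d3 0)).add ((d2 1).mul (d3 1)))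
    simp only [Matrix.sub_apply, Matrix.mul_apply, Fin.sum_univ_two]
    refine Eq.trans ?_ d4.deriv.symm
    simp [Matrix.mul_apply, Fin.sum_univ_two]
    ring
  have := tendsto_nhds_unique t6 key
  rw [Matrix.sub_apply, sub_eq_zero] at this
  exact this

include h hT ht in
lemma differentiableOn_famDeriv (i j : Fin 2) :
    DifferentiableOn ℂ (fun z => famDeriv Γ₀ t w z i j) S.carrierᶜ := by
  have hc : Continuous fun x : ℂ × ℂ => (t + x.1 • w, x.2) := by fun_prop
  refine differentiableOn_deriv_param (g := fun x => Γ₀ (t + x.1 • w) x.2 i j)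
    (V := (fun x : ℂ × ℂ => (t + x.1 • w, x.2)) ⁻¹' (T ×ˢ S.carrierᶜ))
    ((hT.prod S.isOpen_compl).preimage hc) (fun z hz => ⟨by simpa using ht, hz⟩) ?_
  exact (h.analytic i j).comp (f := fun x : ℂ × ℂ => (t + x.1 • w, x.2)) (by fun_prop)
    fun x hx => hx

end

end IsAnalyticRHPFamily

end

/-! ### The function H and its residues. -/

section

open RayContour

/-- `F⁻¹ F'` for a matrix function `F` of determinant one. -/
def logMat (F : ℂ → Mat) (z : ℂ) : Mat := (F z).adjugate * derivMat F z

/-- The derivative of the relation `det A = 1`. -/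
lemma adjugate_mul_add_eq_zero {A : ℂ → Mat} {A' : Mat} {x : ℂ}
    (h : ∀ i j, HasDerivAt (fun s => A s i j) (A' i j) x) (hdet : ∀ᶠ s in 𝓝 x, (A s).det = 1) :
    A'.adjugate * A x + (A x).adjugate * A' = 0 := by
  ext i j
  have h1 : HasDerivAt (fun s => ∑ k, (A s).adjugate i k * A s k j)
      (∑ k, (A'.adjugate i k * A x k j + (A x).adjugate i k * A' k j)) x :=
    HasDerivAt.fun_sum fun k _ => (hasDerivAt_adjugate h i k).mul (h k j)
  have h2 : (fun s => ∑ k, (A s).adjugate i k * A s k j) =ᶠ[𝓝 x] fun _ => (1 : Mat) i j :=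
    hdet.mono fun s hs => by
      simp only [← Matrix.mul_apply, Matrix.adjugate_mul, hs, one_smul]
  have h3 := h1.unique ((hasDerivAt_const x ((1 : Mat) i j)).congr_of_eventuallyEq h2)
  rw [Finset.sum_add_distrib, ← Matrix.mul_apply, ← Matrix.mul_apply] at h3
  exact h3

lemma trace_adjugate_mul_eq_zero {A A' : Mat} (h : A'.adjugate * A + A.adjugate * A' = 0) :
    (A.adjugate * A').trace = 0 := by
  have h1 := congrFun (congrFun h 0) 0
  simp only [Matrix.adjugate_fin_two, Matrix.add_apply, Matrix.mul_apply, Fin.sum_univ_two,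
    Matrix.zero_apply, Matrix.of_apply, Matrix.cons_val', Matrix.cons_val_zero, Matrix.cons_val_one,
    Matrix.cons_val_fin_one, Matrix.trace_fin_two] at h1 ⊢
  linear_combination h1

/-- The derivative of an inverse, in terms of adjugates: for unimodular 2 × 2 matrices the
derivative of A⁻¹ is the adjugate of A′. -/
lemma adjugate_mul_mul_adjugate {A A' : Mat} (hA : A.det = 1)
    (h : A'.adjugate * A + A.adjugate * A' = 0) :
    A.adjugate * A' * A.adjugate = -A'.adjugate := by
  rw [eq_neg_of_add_eq_zero_right h, Matrix.neg_mul, Matrix.mul_assoc, Matrix.mul_adjugate, hA,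
    one_smul, Matrix.mul_one]

lemma differentiableOn_adjugate {A : ℂ → Mat} {U : Set ℂ}
    (h : ∀ i j, DifferentiableOn ℂ (fun z => A z i j) U) (i j : Fin 2) :
    DifferentiableOn ℂ (fun z => (A z).adjugate i j) U := by
  simp only [Matrix.adjugate_fin_two]
  fin_cases i <;> fin_cases j <;> simp
  exacts [h 1 1, h 0 1, h 1 0, h 0 0]

lemma differentiableOn_mul {A B : ℂ → Mat} {U : Set ℂ}
    (hA : ∀ i j, DifferentiableOn ℂ (fun z => A z i j) U)
    (hB : ∀ i j, DifferentiableOn ℂ (fun z => B z i j) U) (i j : Fin 2) :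
    DifferentiableOn ℂ (fun z => (A z * B z) i j) U := by
  simp only [Matrix.mul_apply, Fin.sum_univ_two]
  exact ((hA i 0).mul (hB 0 j)).add ((hA i 1).mul (hB 1 j))

section

variable {m d n₁ n₂ : ℕ} {S : RayContour m} {lam : Fin n₂ → ℂ} {mu : Fin n₁ → ℂ}
  {P : Matrix (Fin 2) (Fin 2) (Polynomial ℂ)} {Γ Γn : ℂ → Mat} {M Mn : Option (Fin m) → ℝ → Mat}

lemma IsRHPSolution.hasDerivAt (h : IsRHPSolution S M Γ) {z : ℂ} (hz : z ∉ S.carrier) (i j : Fin 2) :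
    HasDerivAt (fun z => Γ z i j) (derivMat Γ z i j) z :=
  ((h.analytic i j).differentiableAt (S.isOpen_compl.mem_nhds hz)).hasDerivAt

lemma IsRHPSolution.differentiableOn_derivMat (h : IsRHPSolution S M Γ) (i j : Fin 2) :
    DifferentiableOn ℂ (fun z => derivMat Γ z i j) S.carrierᶜ :=
  (h.analytic i j).deriv S.isOpen_compl

lemma IsRHPSolution.logMat_trace (h : IsRHPSolution S M Γ) (hM : ∀ p r, 0 < r → (M p r).det = 1)
    {z : ℂ} (hz : z ∉ S.carrier) : (derivMat Γ z).adjugate * Γ z + logMat Γ z = 0 ∧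
      (logMat Γ z).trace = 0 := by
  have h1 := adjugate_mul_add_eq_zero (h.hasDerivAt hz) (by
    filter_upwards [S.isOpen_compl.mem_nhds hz] with w hw using h.det_eq_one hM hw)
  exact ⟨h1, trace_adjugate_mul_eq_zero h1⟩

/-- The product of the diagonal entries of the dressing factor, divided by `z - a_k`, at `a_k`. -/
lemma dressD_mul_dressQuot {k : Fin (n₂ + n₁)} (h : pts lam mu k ∈ Complex.slitPlane) :
    (-1) ^ (n₂ + n₁) * (dressD lam mu (pts lam mu k) (1 - ptRow n₁ n₂ k) (1 - ptRow n₁ n₂ k) *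
      dressQuot lam mu k (pts lam mu k)) =
      ∏ l ∈ Finset.univ.erase k, (pts lam mu k - pts lam mu l) := by
  have h1 : dressD lam mu (pts lam mu k) (1 - ptRow n₁ n₂ k) (1 - ptRow n₁ n₂ k) =
      dressScalar lam mu (roots lam mu k) := by
    rw [← rootSign_mul_csqrt_pts k, dressD_eq, dressRoot]
    refine Fin.addCases (fun k => ?_) (fun k => ?_) k <;> simp [rootSign, ptRow]
  have h0 := roots_ne_zero (Complex.slitPlane_ne_zero h)
  have h2 : (∏ l ∈ Finset.univ.erase k, (roots lam mu l + roots lam mu k)) *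
      ∏ l ∈ Finset.univ.erase k, (roots lam mu l - roots lam mu k) =
      (-1) ^ (n₂ + n₁ - 1) * ∏ l ∈ Finset.univ.erase k, (pts lam mu k - pts lam mu l) := by
    have hc : (Finset.univ.erase k).card = n₂ + n₁ - 1 := by simp
    rw [← hc, ← Finset.prod_const, ← Finset.prod_mul_distrib, ← Finset.prod_mul_distrib]
    refine Finset.prod_congr rfl fun l _ => ?_
    rw [← roots_sq, ← roots_sq]; ring
  have hN : n₂ + n₁ = (n₂ + n₁ - 1) + 1 := by have := k.pos; omega
  have h3 : ((-1 : ℂ) ^ n₁) ^ 2 = 1 := by rw [← pow_mul, mul_comm, pow_mul]; simp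
  have h4 : ((-1 : ℂ) ^ (n₂ + n₁ - 1)) ^ 2 = 1 := by rw [← pow_mul, mul_comm, pow_mul]; simp
  rw [h1, dressQuot, rootSign_mul_csqrt_pts, dressScalar,
    ← Finset.mul_prod_erase _ _ (Finset.mem_univ k),
    show (-1 : ℂ) ^ (n₂ + n₁) = (-1) ^ (n₂ + n₁ - 1) * -1 by rw [← pow_succ, ← hN]]
  have h5 : roots lam mu k + roots lam mu k ≠ 0 := by rw [← two_mul]; exact mul_ne_zero two_ne_zero h0
  rw [mul_div_assoc', mul_div_assoc', div_eq_iff h5]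
  linear_combination (roots lam mu k + roots lam mu k) *
    ((-1 : ℂ) ^ (n₂ + n₁ - 1) * ((-1 : ℂ) ^ n₁) ^ 2 * h2 +
    (∏ l ∈ Finset.univ.erase k, (pts lam mu k - pts lam mu l)) * (((-1 : ℂ) ^ n₁) ^ 2 * h4 + h3))

/-- The adjugate of the polynomial matrix at a point `a_k`, where it has rank one. -/
lemma trace_rank_one {e : Fin 2} {P' Pm G Gn D X : Mat} (hD : D e e = 0) (h01 : D 0 1 = 0)
    (h10 : D 1 0 = 0) (hGn : Gn.det = 1) (hP : Pm * Gn = G * D) :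
    (P' * Pm.adjugate * X).trace =
      D (1 - e) (1 - e) * (G.adjugate * X * P' * Gn) e e := by
  have h1 : Pm.adjugate = Gn * D.adjugate * G.adjugate := by
    have h2 : Gn.adjugate * Pm.adjugate = D.adjugate * G.adjugate := by
      rw [← Matrix.adjugate_mul_distrib, ← Matrix.adjugate_mul_distrib, hP]
    rw [Matrix.mul_assoc, ← h2, ← Matrix.mul_assoc, Matrix.mul_adjugate, hGn, one_smul,
      Matrix.one_mul]
  have h3 : (P' * Pm.adjugate * X).trace = (D.adjugate * (G.adjugate * X * P' * Gn)).trace := by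
    rw [h1, Matrix.trace_mul_comm, ← Matrix.trace_mul_comm (G.adjugate * X * P' * Gn)]
    have h4 : X * (P' * (Gn * D.adjugate * G.adjugate)) =
        (X * P' * Gn * D.adjugate) * G.adjugate := by simp only [Matrix.mul_assoc]
    rw [h4, Matrix.trace_mul_comm]
    simp only [Matrix.mul_assoc]
  rw [h3, Matrix.trace_fin_two, Matrix.mul_apply, Matrix.mul_apply, Fin.sum_univ_two,
    Fin.sum_univ_two, Matrix.adjugate_fin_two]
  fin_cases e <;> simp_all

/-- The velocity of the signed square roots of the points. -/
def rootDot (q v : Params d n₁ n₂) (k : Fin (n₂ + n₁)) : ℂ :=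
  pts v.2.1 v.2.2 k / (2 * roots q.2.1 q.2.2 k)

/-- The numerator of `formH` over the common denominator. -/
def formNum (Γ₀ : (Fin d → ℂ) → ℂ → Mat) (Γn : ℂ → Mat) (P : Matrix (Fin 2) (Fin 2) (Polynomial ℂ))
    (q v : Params d n₁ n₂) (z : ℂ) : ℂ :=
  -(-1) ^ (n₂ + n₁) * (polyMat (polyDeriv P) z * (polyMat P z).adjugate *
      (famDeriv Γ₀ q.1 v.1 z * (Γ₀ q.1 z).adjugate)).trace +
    2 * csqrt z * (∑ k, rootDot q v k * ∏ l ∈ Finset.univ.erase k, (z - pts q.2.1 q.2.2 l)) *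
      logMat Γn z 0 0

/-- The function whose jumps are the difference of the two integrands. -/
def formH (Γ₀ : (Fin d → ℂ) → ℂ → Mat) (Γn : ℂ → Mat) (P : Matrix (Fin 2) (Fin 2) (Polynomial ℂ))
    (q v : Params d n₁ n₂) (z : ℂ) : ℂ :=
  -(polyMat (polyDeriv P) z * dressR P q.2.1 q.2.2 z *
      (famDeriv Γ₀ q.1 v.1 z * (Γ₀ q.1 z).adjugate)).trace +
    2 * csqrt z * (∑ k, rootDot q v k / (z - pts q.2.1 q.2.2 k)) * logMat Γn z 0 0

lemma formNum_div (Γ₀ : (Fin d → ℂ) → ℂ → Mat) (q v : Params d n₁ n₂) {z : ℂ}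
    (hz : ∀ k, z ≠ pts q.2.1 q.2.2 k) :
    formNum Γ₀ Γn P q v z / ∏ k, (z - pts q.2.1 q.2.2 k) = formH Γ₀ Γn P q v z := by
  have h0 : ∏ k, (z - pts q.2.1 q.2.2 k) ≠ 0 :=
    Finset.prod_ne_zero_iff.2 fun k _ => sub_ne_zero.2 (hz k)
  have h1 : ∏ k, (pts q.2.1 q.2.2 k - z) = (-1) ^ (n₂ + n₁) * ∏ k, (z - pts q.2.1 q.2.2 k) := by
    have : (-1 : ℂ) ^ (n₂ + n₁) = ∏ _k : Fin (n₂ + n₁), (-1 : ℂ) := by simp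
    rw [this, ← Finset.prod_mul_distrib]
    exact Finset.prod_congr rfl fun k _ => by ring
  have h2 : ∀ k, rootDot q v k / (z - pts q.2.1 q.2.2 k) =
      rootDot q v k * (∏ l ∈ Finset.univ.erase k, (z - pts q.2.1 q.2.2 l)) /
        ∏ k, (z - pts q.2.1 q.2.2 k) := fun k => by
    have h3 : ∏ l ∈ Finset.univ.erase k, (z - pts q.2.1 q.2.2 l) ≠ 0 :=
      Finset.prod_ne_zero_iff.2 fun k _ => sub_ne_zero.2 (hz k)
    have h4 := sub_ne_zero.2 (hz k)
    rw [← Finset.mul_prod_erase _ _ (Finset.mem_univ k)]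
    field_simp
  have h5 : ((-1 : ℂ) ^ (n₂ + n₁))⁻¹ = (-1) ^ (n₂ + n₁) := by
    rw [← inv_pow]; norm_num
  simp only [formNum, formH, h2, ← Finset.sum_div, dressR, h1, Matrix.mul_smul, Matrix.smul_mul,
    Matrix.trace_smul, mul_inv, h5, smul_eq_mul]
  field_simp

end

section

variable {m d n₁ n₂ : ℕ} {S : RayContour m} {T : Set (Fin d → ℂ)}
  {M : (Fin d → ℂ) → Option (Fin m) → ℝ → Mat} {Γ₀ : (Fin d → ℂ) → ℂ → Mat}
  {P : Matrix (Fin 2) (Fin 2) (Polynomial ℂ)} {Γn : ℂ → Mat} {Mn : Option (Fin m) → ℝ → Mat}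
  (h : IsAnalyticRHPFamily S T M Γ₀) (hT : IsOpen T)
  (hM : ∀ t p r, 0 < r → (M t p r).det = 1) (q v : Params d n₁ n₂) (ht : q.1 ∈ T)
  (ha : ∀ k, pts q.2.1 q.2.2 k ∉ S.carrier)
  (hP : IsDressing S (Γ₀ q.1) Γn q.2.1 q.2.2 P) (hn : IsRHPSolution S Mn Γn)
  (hMn : ∀ p r, 0 < r → (Mn p r).det = 1) (hinj : Function.Injective (pts q.2.1 q.2.2))

include h hT ht hn in
lemma differentiableOn_formNum : DifferentiableOn ℂ (formNum Γ₀ Γn P q v) S.carrierᶜ := by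
  have hs : DifferentiableOn ℂ csqrt S.carrierᶜ := fun z hz =>
    (csqrt_differentiableAt (S.compl_carrier_subset_slitPlane hz)).differentiableWithinAt
  have h1 := differentiableOn_mul (differentiableOn_mul
    (fun i j => (differentiable_polyMat (polyDeriv P) i j).differentiableOn (s := S.carrierᶜ))
    (fun i j => (differentiable_adjugate_polyMat P i j).differentiableOn))
    (differentiableOn_mul (h.differentiableOn_famDeriv hT ht v.1)
      (differentiableOn_adjugate (h.solution _ ht).analytic))
  have h2 := differentiableOn_mul (differentiableOn_adjugate hn.analytic) hn.differentiableOn_derivMat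
  have h3 : Differentiable ℂ fun z : ℂ =>
      ∑ k, rootDot q v k * ∏ l ∈ Finset.univ.erase k, (z - pts q.2.1 q.2.2 l) := fun z =>
    DifferentiableAt.fun_sum fun k _ => (differentiableAt_prod fun l _ =>
      differentiableAt_id.sub_const _).const_mul _
  unfold formNum
  simp only [Matrix.trace_fin_two]
  exact (((h1 0 0).add (h1 1 1)).const_mul _).add
    (((hs.const_mul 2).mul h3.differentiableOn).mul (h2 0 0))

include h hT hM ht ha hP hn hMn hinj in
/-- The residues of `formH`. -/
lemma formNum_pts (k : Fin (n₂ + n₁)) : formNum Γ₀ Γn P q v (pts q.2.1 q.2.2 k) /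
    ∏ l ∈ Finset.univ.erase k, (pts q.2.1 q.2.2 k - pts q.2.1 q.2.2 l) =
      pointTerm Γ₀ Γn P q v k := by
  set a := pts q.2.1 q.2.2 k with hadef
  set e := ptRow n₁ n₂ k with hedef
  have hsl := mem_slitPlane_of_notMem (ha k)
  have hsol := h.solution _ ht
  have hX0 : ∏ l ∈ Finset.univ.erase k, (a - pts q.2.1 q.2.2 l) ≠ 0 :=
    Finset.prod_ne_zero_iff.2 fun l hl => sub_ne_zero.2 fun h1 =>
      (Finset.ne_of_mem_erase hl) (hinj h1).symm
  have hX := dressD_mul_dressQuot hsl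
  rw [← hadef, ← hedef] at hX
  -- the trace
  have hDe := dressD_pts (ha k)
  have hdet0 := hsol.det_eq_one (hM _) (ha k)
  have hdetn := hn.det_eq_one hMn (ha k)
  have hoff : ∀ i j, i ≠ j → dressD q.2.1 q.2.2 a i j = 0 := fun i j hij => by
    rw [dressD_eq, dressRoot]; fin_cases i <;> fin_cases j <;> simp_all
  have hΓd : (famDeriv Γ₀ q.1 v.1 a).adjugate * Γ₀ q.1 a + (Γ₀ q.1 a).adjugate *
      famDeriv Γ₀ q.1 v.1 a = 0 := by
    have h1 := fun i j => h.hasDerivAt_line hT ht (ha k) v.1 0 i j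
    simp only [mul_zero, add_zero, zero_smul, ← hadef] at h1
    have h2 := adjugate_mul_add_eq_zero h1 (by
      obtain ⟨ρ, hρ, hb⟩ := eventually_ball_line v.1 (hT.mem_nhds ht)
      filter_upwards [Metric.ball_mem_nhds 0 hρ] with s hs
      exact (h.solution _ (hb s hs)).det_eq_one (hM _) (ha k))
    simpa using h2
  have hmul := hP.mul_eq hn hMn (ha k)
  have hW := fun i => dressVec_eval_self hP hn hMn ha hinj k i
  simp only [← hadef, ← hedef] at hW hdet0 hdetn hDe hmul
  -- At a_k the adjugate of P has rank at most one, so the trace collapses to one diagonal entry. In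
  -- it P′ Γn e is, up to the normalization, the value of the k-th polynomial vector at its own
  -- point.
  have htr := trace_rank_one (e := e) (P' := polyMat (polyDeriv P) a)
    (X := famDeriv Γ₀ q.1 v.1 a * (Γ₀ q.1 a).adjugate) hDe (hoff 0 1 (by simp)) (hoff 1 0 (by simp))
    hdetn hmul
  rw [← Matrix.mul_assoc (Γ₀ q.1 a).adjugate, adjugate_mul_mul_adjugate hdet0 hΓd,
    Matrix.mul_assoc (-(famDeriv Γ₀ q.1 v.1 a).adjugate), Matrix.mul_apply, Fin.sum_univ_two,
    ← hW, ← hW] at htr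
  -- the second term
  obtain ⟨hl1, hl2⟩ := hn.logMat_trace hMn (ha k)
  rw [← hadef] at hl1 hl2
  have hsum : ∑ j, rootDot q v j * ∏ l ∈ Finset.univ.erase j, (a - pts q.2.1 q.2.2 l) =
      rootDot q v k * ∏ l ∈ Finset.univ.erase k, (a - pts q.2.1 q.2.2 l) := by
    refine Finset.sum_eq_single k (fun j _ hj => ?_) (by simp)
    rw [Finset.prod_eq_zero (Finset.mem_erase.2 ⟨hj.symm, Finset.mem_univ k⟩) (by simp [hadef]),
      mul_zero]
  have hroot : 2 * csqrt a * rootDot q v k = rootSign n₁ n₂ k * pts v.2.1 v.2.2 k := by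
    have h0 := roots_ne_zero (Complex.slitPlane_ne_zero hsl)
    rw [rootDot, hadef, csqrt_pts]
    field_simp
  -- The logarithmic derivative is traceless, so its diagonal entries are opposite; the sign of the
  -- root selects the one in row e_k, with the sign of a differentiated inverse.
  have hsgn : rootSign n₁ n₂ k * logMat Γn a 0 0 =
      ((derivMat Γn a).adjugate * Γn a) e e := by
    have h1 := congrFun (congrFun hl1 e) e
    rw [Matrix.trace_fin_two] at hl2
    rw [Matrix.add_apply, Matrix.zero_apply] at h1
    rw [eq_neg_of_add_eq_zero_left h1, hedef]
    clear_value a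
    refine Fin.addCases (fun k => ?_) (fun k => ?_) k <;> simp [rootSign, ptRow]
    linear_combination hl2
  rw [formNum, pointTerm, hsum, Fin.sum_univ_two, div_eq_iff hX0, htr, ← hsgn]
  simp only [← hadef, ← hedef, Matrix.neg_apply]
  rw [← hX]
  linear_combination (((-1) ^ (n₂ + n₁) * (dressD q.2.1 q.2.2 a (1 - e) (1 - e) *
    dressQuot q.2.1 q.2.2 k a))) * logMat Γn a 0 0 * hroot

end

end

/-! ### Behaviour of H at the origin and at infinity. -/

section

open RayContour

section

variable {m d n₁ n₂ : ℕ} {S : RayContour m} {lam : Fin n₂ → ℂ} {mu : Fin n₁ → ℂ}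
  {P : Matrix (Fin 2) (Fin 2) (Polynomial ℂ)} {Γ Γn : ℂ → Mat} {M Mn : Option (Fin m) → ℝ → Mat}

namespace RayContour

lemma isBigO_rpow_atZero_of_le (S : RayContour m) {F : ℂ → ℂ} {a b : ℝ}
    (hF : F =O[S.atZero] fun z => ‖z‖ ^ b) (h : a ≤ b) : F =O[S.atZero] fun z => ‖z‖ ^ a := by
  refine hF.trans (Asymptotics.IsBigO.of_bound 1 ?_)
  have h1 : ∀ᶠ z in S.atZero, ‖z‖ ≤ 1 :=
    nhdsWithin_le_nhds ((continuous_norm.tendsto' (0 : ℂ) 0 norm_zero).eventually_le_const one_pos)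
  filter_upwards [h1, S.atZero_ne_zero] with z hz hz0
  rw [Real.norm_of_nonneg (by positivity), Real.norm_of_nonneg (by positivity), one_mul]
  exact Real.rpow_le_rpow_of_exponent_ge (norm_pos_iff.2 hz0) hz h

lemma isBigO_inv_atInf (S : RayContour m) {F : ℂ → ℂ} {e : ℝ} {c : ℝ} (hc : 0 < c)
    (h : ∀ᶠ z in S.atInf, c * ‖z‖ ^ e ≤ ‖F z‖) :
    (fun z => (F z)⁻¹) =O[S.atInf] fun z => ‖z‖ ^ (-e) := by
  refine Asymptotics.IsBigO.of_bound c⁻¹ ?_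
  filter_upwards [h, S.atInf_ne_zero] with z hz hz0
  have h0 : 0 < ‖z‖ ^ e := Real.rpow_pos_of_pos (norm_pos_iff.2 hz0) _
  rw [norm_inv, Real.norm_of_nonneg (by positivity), Real.rpow_neg (norm_nonneg _), ← mul_inv]
  exact inv_anti₀ (by positivity) hz

lemma isBigO_inv_sub_atInf (S : RayContour m) (a : ℂ) :
    (fun z => (a - z)⁻¹) =O[S.atInf] fun z => ‖z‖ ^ (-1 : ℝ) := by
  refine S.isBigO_inv_atInf (c := 1 / 2) (by norm_num) ?_
  filter_upwards [S.atInf_ge (2 * ‖a‖)] with z hz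
  rw [Real.rpow_one]
  have := norm_sub_norm_le z a
  rw [norm_sub_rev] at this
  linarith

lemma isBigO_inv_add_csqrt_atInf (S : RayContour m) (x : ℂ) :
    (fun z => (x + csqrt z)⁻¹) =O[S.atInf] fun z => ‖z‖ ^ (-(1 / 2) : ℝ) := by
  refine S.isBigO_inv_atInf (c := 1 / 2) (by norm_num) ?_
  have h1 : Tendsto (fun z : ℂ => ‖z‖ ^ (1 / 2 : ℝ)) S.atInf atTop :=
    (tendsto_rpow_atTop (by norm_num)).comp S.tendsto_norm_atInf
  filter_upwards [h1.eventually_ge_atTop (2 * ‖x‖)] with z hz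
  have := norm_sub_norm_le (csqrt z) (-x)
  rw [norm_neg, sub_neg_eq_add, norm_csqrt, add_comm] at this
  linarith

lemma isBigO_of_continuousAt_zero (S : RayContour m) {F : ℂ → ℂ} (hF : ContinuousAt F 0) :
    F =O[S.atZero] fun z => ‖z‖ ^ (0 : ℝ) := by
  simp only [Real.rpow_zero]
  exact (hF.tendsto.mono_left (nhdsWithin_le_nhds (s := S.carrierᶜ))).isBigO_one ℝ

lemma isBigO_csqrt_atZero (S : RayContour m) : csqrt =O[S.atZero] fun z => ‖z‖ ^ (1 / 2 : ℝ) :=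
  Asymptotics.IsBigO.of_bound 1 (Eventually.of_forall fun z => by
    rw [norm_csqrt, one_mul, Real.norm_of_nonneg (Real.rpow_nonneg (norm_nonneg _) _)])

lemma tendsto_mul_atInf (S : RayContour m) {F : ℂ → ℂ}
    (hF : F =O[S.atInf] fun z => ‖z‖ ^ (-(3 / 2) : ℝ)) :
    Tendsto (fun z => z * F z) S.atInf (𝓝 0) := by
  have h1 : (fun z : ℂ => z) =O[S.atInf] fun z => ‖z‖ ^ (1 : ℝ) := by
    simpa using Asymptotics.isBigO_refl (fun z : ℂ => z) S.atInf |>.norm_right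
  have h2 := isBigO_rpow_mul S.atInf_ne_zero h1 hF (c := -(1 / 2)) (by norm_num)
  exact h2.trans_tendsto ((tendsto_rpow_neg_atTop (by norm_num)).comp S.tendsto_norm_atInf)

lemma tendsto_mul_atZero (S : RayContour m) {F : ℂ → ℂ}
    (hF : F =O[S.atZero] fun z => ‖z‖ ^ (-(1 / 2) : ℝ)) :
    Tendsto (fun z => z * F z) S.atZero (𝓝 0) := by
  have h1 : (fun z : ℂ => z) =O[S.atZero] fun z => ‖z‖ ^ (1 : ℝ) := by
    simpa using Asymptotics.isBigO_refl (fun z : ℂ => z) S.atZero |>.norm_right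
  have h2 := isBigO_rpow_mul S.atZero_ne_zero h1 hF (c := 1 / 2) (by norm_num)
  refine h2.trans_tendsto ?_
  have h3 : Tendsto (fun z : ℂ => ‖z‖ ^ (1 / 2 : ℝ)) (𝓝 0) (𝓝 0) := by
    have : Continuous fun z : ℂ => ‖z‖ ^ (1 / 2 : ℝ) :=
      continuous_norm.rpow_const fun _ => Or.inr (by norm_num)
    exact this.tendsto' 0 0 (by simp)
  exact h3.mono_left nhdsWithin_le_nhds

end RayContour

lemma WtO.mono_atZero {F : ℂ → Mat} (hF : WtO S.atZero 0 0 0 F) : WtO S.atZero (-1) 0 0 F :=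
  fun i j => S.isBigO_rpow_atZero_of_le (hF i j) (by simp)

lemma wtO_derivMat_atInf {C : ℝ} (hC : ∀ z ∉ S.carrier, ∀ i j,
    ‖derivMat Γ z i j‖ * ‖z‖ ≤ C * (1 + ‖z‖) ^ wt i) : WtO S.atInf (-1) wt 0 (derivMat Γ) := by
  intro i j
  have h1 : (fun z => derivMat Γ z i j * z) =O[S.atInf] fun z => ‖z‖ ^ wt i :=
    S.isBigO_one_add_rpow fun z hz => by rw [norm_mul]; exact hC z hz i j
  have h2 : (fun z : ℂ => z⁻¹) =O[S.atInf] fun z => ‖z‖ ^ (-1 : ℝ) :=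
    S.isBigO_inv_atInf one_pos (Eventually.of_forall fun z => by simp)
  refine (isBigO_rpow_mul S.atInf_ne_zero h1 h2 (by simp; ring)).congr' ?_ EventuallyEq.rfl
  filter_upwards [S.atInf_ne_zero] with z hz
  field_simp

lemma wtO_derivMat_atZero {C : ℝ} (hC : ∀ z ∉ S.carrier, ∀ i j,
    ‖derivMat Γ z i j‖ * ‖z‖ ≤ C * (1 + ‖z‖) ^ wt i) : WtO S.atZero (-1) 0 0 (derivMat Γ) := by
  intro i j
  refine Asymptotics.IsBigO.of_bound (|C| * 2) ?_
  have h1 : ∀ᶠ z in S.atZero, ‖z‖ ≤ 1 :=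
    nhdsWithin_le_nhds ((continuous_norm.tendsto' (0 : ℂ) 0 norm_zero).eventually_le_const one_pos)
  filter_upwards [h1, S.atZero_ne_zero, S.atZero_notMem] with z hz hz0 hzC
  have hn := norm_pos_iff.2 hz0
  have h2 : (1 + ‖z‖) ^ wt i ≤ 2 := by
    calc (1 + ‖z‖) ^ wt i ≤ (1 + ‖z‖) ^ (1 : ℝ) :=
          Real.rpow_le_rpow_of_exponent_le (by linarith) (by
            fin_cases i
            · rw [Fin.zero_eta, wt_zero]; norm_num
            · rw [Fin.mk_one, wt_one]; norm_num)
      _ ≤ 2 := by rw [Real.rpow_one]; linarith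
  have h3 : ‖derivMat Γ z i j‖ * ‖z‖ ≤ |C| * 2 :=
    (hC z hzC i j).trans (mul_le_mul (le_abs_self C) h2 (by positivity) (abs_nonneg C))
  simp only [Pi.zero_apply, add_zero, sub_zero]
  rw [Real.norm_of_nonneg (by positivity), Real.rpow_neg_one, ← div_eq_mul_inv, le_div_iff₀ hn]
  exact h3

section Log

variable (h : IsRHPSolution S M Γ) (hM : ∀ p r, 0 < r → (M p r).det = 1)

include h hM in
lemma wtO_adjugate_atInf : WtO S.atInf 0 0 wt (fun z => (Γ z).adjugate) :=
  (h.wtO_inv hM).congr ((h.eventually_det hM S.atInf_notMem).mono fun _ hz => inv_eq_adjugate hz)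

include h hM in
lemma wtO_adjugate_atZero : WtO S.atZero 0 0 0 (fun z => (Γ z).adjugate) :=
  (h.wtO_inv_atZero hM).congr
    ((h.eventually_det hM S.atZero_notMem).mono fun _ hz => inv_eq_adjugate hz)

include h hM in
lemma wtO_logMat_atInf {C : ℝ} (hC : ∀ z ∉ S.carrier, ∀ i j,
    ‖derivMat Γ z i j‖ * ‖z‖ ≤ C * (1 + ‖z‖) ^ wt i) : WtO S.atInf (-1) 0 0 (logMat Γ) := by
  have := (wtO_adjugate_atInf h hM).mul S.atInf_ne_zero (wtO_derivMat_atInf hC)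
  rw [zero_add] at this
  exact this

include h hM in
lemma wtO_logMat_atZero {C : ℝ} (hC : ∀ z ∉ S.carrier, ∀ i j,
    ‖derivMat Γ z i j‖ * ‖z‖ ≤ C * (1 + ‖z‖) ^ wt i) : WtO S.atZero (-1) 0 0 (logMat Γ) := by
  have := (wtO_adjugate_atZero h hM).mul S.atZero_ne_zero (wtO_derivMat_atZero hC)
  rw [zero_add] at this
  exact this

/-- The logarithmic derivative of the polynomial matrix of a dressing, conjugated by `Γ`. -/
def dressB (P : Matrix (Fin 2) (Fin 2) (Polynomial ℂ)) (lam : Fin n₂ → ℂ) (mu : Fin n₁ → ℂ)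
    (Γ : ℂ → Mat) (z : ℂ) : Mat :=
  (Γ z).adjugate * (polyMat (polyDeriv P) z * dressR P lam mu z) * Γ z

/-- P grows with exponent n/2 relative to the weights and P′ with one less; P⁻¹ is the adjugate over
a polynomial of degree n, with exponent n/2 − n. The sum is −1. -/
lemma IsDressing.wtO_polyDeriv_mul_dressR (hP : IsDressing S Γ Γn lam mu P) :
    WtO S.atInf (-1) wt wt (fun z => polyMat (polyDeriv P) z * dressR P lam mu z) := by
  have h1 : WtO S.atInf (((n₂ + n₁ : ℕ) : ℝ) / 2 - 1) wt wt (polyMat (polyDeriv P)) := fun i j => by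
    have := S.polynomial_derivative_isBigO (hP.wtO i j)
    refine this.congr_right fun z => ?_
    ring_nf
  have h2 : WtO S.atInf (-(((n₂ + n₁ : ℕ) : ℝ) / 2)) wt wt (dressR P lam mu) := fun i j => by
    have h3 : (fun z => (∏ k, (pts lam mu k - z))⁻¹) =O[S.atInf]
        fun z => ‖z‖ ^ (-((n₂ + n₁ : ℕ) : ℝ)) := by
      have := Asymptotics.IsBigO.finsetProd (s := (Finset.univ : Finset (Fin (n₂ + n₁))))
        (f := fun k z => (pts lam mu k - z)⁻¹) (g := fun _ (z : ℂ) => ‖z‖ ^ (-1 : ℝ)) (l := S.atInf)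
        fun k _ => S.isBigO_inv_sub_atInf _
      simp only [Finset.prod_inv_distrib, Finset.prod_const, Finset.card_univ, Fintype.card_fin] at this
      refine this.congr_right fun z => ?_
      rw [← Real.rpow_natCast, ← Real.rpow_mul (norm_nonneg _)]
      ring_nf
    refine isBigO_rpow_mul S.atInf_ne_zero h3 (hP.wtO.adjugate i j) ?_
    ring
  have := h1.mul S.atInf_ne_zero h2
  convert this using 1
  ring

lemma continuousAt_polyDeriv_mul_dressR {z : ℂ} (hz : ∏ k, (pts lam mu k - z) ≠ 0) :
    ContinuousAt (fun z => polyMat (polyDeriv P) z * dressR P lam mu z) z :=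
  (continuous_polyMat _).continuousAt.mul (continuousAt_dressR hz)

lemma wtO_polyDeriv_mul_dressR_atZero (ha : ∀ k, pts lam mu k ∉ S.carrier) :
    WtO S.atZero 0 0 0 (fun z => polyMat (polyDeriv P) z * dressR P lam mu z) := by
  refine wtO_of_tendsto ((continuousAt_polyDeriv_mul_dressR ?_).tendsto.mono_left nhdsWithin_le_nhds)
  exact Finset.prod_ne_zero_iff.2 fun k _ => sub_ne_zero.2 (S.ne_zero_of_notMem (ha k))

include h hM in
lemma wtO_dressB_atInf (hP : IsDressing S Γ Γn lam mu P) :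
    WtO S.atInf (-1) 0 0 (dressB P lam mu Γ) := by
  have := ((wtO_adjugate_atInf h hM).mul S.atInf_ne_zero hP.wtO_polyDeriv_mul_dressR).mul
    S.atInf_ne_zero h.wtO
  rw [zero_add, add_zero] at this
  exact this

include h hM in
lemma wtO_dressB_atZero (ha : ∀ k, pts lam mu k ∉ S.carrier) :
    WtO S.atZero 0 0 0 (dressB P lam mu Γ) := by
  have := ((wtO_adjugate_atZero h hM).mul S.atZero_ne_zero
    (wtO_polyDeriv_mul_dressR_atZero (P := P) ha)).mul S.atZero_ne_zero h.wtO_atZero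
  rw [zero_add, add_zero] at this
  exact this

end Log

lemma differentiableOn_dressD (lam : Fin n₂ → ℂ) (mu : Fin n₁ → ℂ) (i j : Fin 2) :
    DifferentiableOn ℂ (fun z => dressD lam mu z i j) S.carrierᶜ := by
  have hs : DifferentiableOn ℂ csqrt S.carrierᶜ := fun z hz =>
    (csqrt_differentiableAt (S.compl_carrier_subset_slitPlane hz)).differentiableWithinAt
  simp only [dressD_eq, dressRoot]
  fin_cases i <;> fin_cases j <;> simp
  · exact (differentiable_dressScalar lam mu).comp_differentiableOn hs
  · exact (differentiable_dressScalar lam mu).comp_differentiableOn hs.neg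

/-- The derivative of the dressing relation. -/
lemma IsDressing.logMat_eq (hP : IsDressing S Γ Γn lam mu P) (h : IsRHPSolution S M Γ)
    (hn : IsRHPSolution S Mn Γn) (hM : ∀ p r, 0 < r → (M p r).det = 1)
    (hMn : ∀ p r, 0 < r → (Mn p r).det = 1) {z : ℂ} (hz : z ∉ S.carrier)
    (hz' : ∏ k, (pts lam mu k - z) ≠ 0) :
    dressD lam mu z * logMat Γn z = (logMat Γ z - dressB P lam mu Γ z) * dressD lam mu z +
      derivMat (dressD lam mu) z := by
  have hD : ∀ i j, HasDerivAt (fun z => dressD lam mu z i j) (derivMat (dressD lam mu) z i j) z :=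
    fun i j => ((differentiableOn_dressD lam mu i j).differentiableAt
      (S.isOpen_compl.mem_nhds hz)).hasDerivAt
  have h1 : derivMat Γ z * dressD lam mu z + Γ z * derivMat (dressD lam mu) z =
      polyMat (polyDeriv P) z * Γn z + polyMat P z * derivMat Γn z := by
    ext i j
    have e1 : HasDerivAt (fun z => ∑ k, Γ z i k * dressD lam mu z k j)
        (∑ k, (derivMat Γ z i k * dressD lam mu z k j +
          Γ z i k * derivMat (dressD lam mu) z k j)) z :=
      HasDerivAt.fun_sum fun k _ => (h.hasDerivAt hz i k).mul (hD k j)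
    have e2 : HasDerivAt (fun z => ∑ k, polyMat P z i k * Γn z k j)
        (∑ k, (polyMat (polyDeriv P) z i k * Γn z k j + polyMat P z i k * derivMat Γn z k j)) z :=
      HasDerivAt.fun_sum fun k _ => ((P i k).hasDerivAt z).mul (hn.hasDerivAt hz k j)
    have e3 : (fun z => ∑ k, Γ z i k * dressD lam mu z k j) =ᶠ[𝓝 z]
        fun z => ∑ k, polyMat P z i k * Γn z k j := by
      filter_upwards [S.isOpen_compl.mem_nhds hz] with w hw
      rw [← Matrix.mul_apply, ← Matrix.mul_apply, hP.mul_eq hn hMn hw]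
    have e4 := e1.unique (e2.congr_of_eventuallyEq e3)
    rw [Finset.sum_add_distrib, Finset.sum_add_distrib] at e4
    exact e4
  have hΓ : (Γ z).adjugate * Γ z = 1 := by rw [Matrix.adjugate_mul, h.det_eq_one hM hz, one_smul]
  have h2 : (Γ z).adjugate * polyMat P z = dressD lam mu z * (Γn z).adjugate := by
    rw [hP.eq z hz, ← inv_eq_adjugate (hn.det_eq_one hMn hz), ← Matrix.mul_assoc, ← Matrix.mul_assoc,
      hΓ, Matrix.one_mul]
  have h3 := congrArg (fun X => (Γ z).adjugate * X) h1
  simp only [Matrix.mul_add, ← Matrix.mul_assoc] at h3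
  rw [hΓ, Matrix.one_mul, h2] at h3
  have h4 : (Γ z).adjugate * polyMat (polyDeriv P) z * Γn z = dressB P lam mu Γ z * dressD lam mu z := by
    rw [hP.eq_dressR hn hMn hz hz', dressB]
    simp only [Matrix.mul_assoc]
  rw [h4] at h3
  rw [logMat, logMat, Matrix.sub_mul, ← Matrix.mul_assoc]
  rw [eq_sub_of_add_eq' h3.symm]
  abel

/-- The logarithmic derivative of the first diagonal entry of the dressing factor. -/
def dressLog (lam : Fin n₂ → ℂ) (mu : Fin n₁ → ℂ) (s : ℂ) : ℂ :=
  (∑ k, (roots lam mu k + s)⁻¹) * (1 / 2 * s⁻¹)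

lemma derivMat_dressD_zero {z : ℂ} (hz : z ∉ S.carrier) (hz' : ∏ k, (pts lam mu k - z) ≠ 0) :
    derivMat (dressD lam mu) z 0 0 = dressD lam mu z 0 0 * dressLog lam mu (csqrt z) ∧
      dressD lam mu z 0 0 ≠ 0 := by
  have h1 : (fun z => dressD lam mu z 0 0) = fun z => dressScalar lam mu (csqrt z) := by
    funext z; rw [dressD_eq, dressRoot]; simp
  have hsl := mem_slitPlane_of_notMem hz
  have h0 : ∀ k, roots lam mu k + csqrt z ≠ 0 := fun k hk => by
    have h2 : pts lam mu k - z = 0 := by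
      rw [← roots_sq, ← csqrt_sq z, eq_neg_of_add_eq_zero_left hk]; ring
    exact Finset.prod_ne_zero_iff.1 hz' k (Finset.mem_univ k) h2
  have h3 : HasDerivAt (dressScalar lam mu) (dressScalar lam mu (csqrt z) *
      ∑ k, (roots lam mu k + csqrt z)⁻¹) (csqrt z) := by
    have h4 : logDeriv (fun s => ∏ k, (roots lam mu k + s)) (csqrt z) =
        ∑ k, (roots lam mu k + csqrt z)⁻¹ := by
      rw [logDeriv_prod (f := fun k s => roots lam mu k + s) (fun k _ => h0 k)
        (fun k _ => differentiableAt_id.const_add _)]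
      refine Finset.sum_congr rfl fun k _ => ?_
      rw [logDeriv_apply, ((hasDerivAt_id' (csqrt z)).const_add _).deriv, one_div]
    have h5 : ∏ k, (roots lam mu k + csqrt z) ≠ 0 := Finset.prod_ne_zero_iff.2 fun k _ => h0 k
    have h6 : DifferentiableAt ℂ (fun s => ∏ k, (roots lam mu k + s)) (csqrt z) :=
      differentiableAt_prod fun k _ => differentiableAt_id.const_add _
    refine (h6.hasDerivAt.const_mul ((-1) ^ n₁)).congr_deriv ?_
    rw [← h4, logDeriv_apply, dressScalar]
    field_simp
  constructor
  · rw [derivMat, Matrix.of_apply, h1, show dressD lam mu z 0 0 = dressScalar lam mu (csqrt z) from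
      congrFun h1 z]
    refine (HasDerivAt.comp z h3 (hasDerivAt_csqrt hsl)).deriv.trans ?_
    rw [dressLog]
    ring
  · rw [show dressD lam mu z 0 0 = dressScalar lam mu (csqrt z) from congrFun h1 z, dressScalar]
    exact mul_ne_zero (pow_ne_zero _ (by norm_num)) (Finset.prod_ne_zero_iff.2 fun k _ => h0 k)

lemma isBigO_dressLog_atInf (lam : Fin n₂ → ℂ) (mu : Fin n₁ → ℂ) :
    (fun z => dressLog lam mu (csqrt z)) =O[S.atInf] fun z => ‖z‖ ^ (-1 : ℝ) := by
  have h1 : (fun z => ∑ k, (roots lam mu k + csqrt z)⁻¹) =O[S.atInf]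
      fun z => ‖z‖ ^ (-(1 / 2) : ℝ) :=
    Asymptotics.IsBigO.fun_sum fun k _ => S.isBigO_inv_add_csqrt_atInf _
  have h2 := (S.isBigO_inv_add_csqrt_atInf 0).const_mul_left (1 / 2)
  simp only [zero_add] at h2
  exact isBigO_rpow_mul S.atInf_ne_zero h1 h2 (by norm_num)

lemma isBigO_dressLog_atZero (ha : ∀ k, pts lam mu k ∉ S.carrier) :
    (fun z => dressLog lam mu (csqrt z)) =O[S.atZero] fun z => ‖z‖ ^ (-1 : ℝ) := by
  have hc0 : csqrt 0 = 0 := by simp [csqrt]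
  have h1 : (fun z => ∑ k, (roots lam mu k + csqrt z)⁻¹) =O[S.atZero] fun z => ‖z‖ ^ (0 : ℝ) := by
    refine S.isBigO_of_continuousAt_zero ?_
    have hs : ContinuousAt csqrt 0 := by rw [ContinuousAt, hc0]; exact tendsto_csqrt_zero
    refine tendsto_finsetSum _ fun k _ => ContinuousAt.inv₀ (continuousAt_const.add hs) ?_
    rw [hc0, add_zero]
    exact roots_ne_zero (S.ne_zero_of_notMem (ha k))
  have h2 : (fun z => 1 / 2 * (csqrt z)⁻¹) =O[S.atZero] fun z => ‖z‖ ^ (-(1 / 2) : ℝ) := by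
    refine Asymptotics.IsBigO.const_mul_left (Asymptotics.IsBigO.of_bound 1 ?_) _
    refine Eventually.of_forall fun z => ?_
    rw [norm_inv, norm_csqrt, one_mul, Real.norm_of_nonneg (Real.rpow_nonneg (norm_nonneg _) _),
      Real.rpow_neg (norm_nonneg _)]
  exact S.isBigO_rpow_atZero_of_le (isBigO_rpow_mul S.atZero_ne_zero h1 h2 (c := -(1 / 2)) (by norm_num))
    (by norm_num)

/-- The logarithmic derivative along a line of the quotient of the diagonal entries of the
dressing factor. -/
def rootVel (q v : Params d n₁ n₂) (s : ℂ) : ℂ :=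
  2 * s * ∑ k, rootDot q v k / (s ^ 2 - pts q.2.1 q.2.2 k)

lemma isBigO_rootVel_atInf (q v : Params d n₁ n₂) :
    (fun z => rootVel q v (csqrt z)) =O[S.atInf] fun z => ‖z‖ ^ (-(1 / 2) : ℝ) := by
  have h1 : (fun z => ∑ k, rootDot q v k / (z - pts q.2.1 q.2.2 k)) =O[S.atInf]
      fun z => ‖z‖ ^ (-1 : ℝ) := by
    refine Asymptotics.IsBigO.fun_sum fun k _ => ?_
    have := (S.isBigO_inv_sub_atInf (pts q.2.1 q.2.2 k)).const_mul_left (-rootDot q v k)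
    refine this.congr_left fun z => ?_
    rw [← neg_sub, inv_neg, div_eq_mul_inv]; ring
  simp only [rootVel, csqrt_sq]
  exact isBigO_rpow_mul S.atInf_ne_zero (S.isBigO_csqrt_atInf.const_mul_left 2) h1 (by norm_num)

lemma isBigO_rootVel_atZero (q v : Params d n₁ n₂) (ha : ∀ k, pts q.2.1 q.2.2 k ∉ S.carrier) :
    (fun z => rootVel q v (csqrt z)) =O[S.atZero] fun z => ‖z‖ ^ (1 / 2 : ℝ) := by
  have h1 : (fun z => ∑ k, rootDot q v k / (z - pts q.2.1 q.2.2 k)) =O[S.atZero]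
      fun z => ‖z‖ ^ (0 : ℝ) := by
    refine S.isBigO_of_continuousAt_zero (tendsto_finsetSum _ fun k _ =>
      ContinuousAt.div continuousAt_const (continuousAt_id.sub continuousAt_const) ?_)
    simpa using S.ne_zero_of_notMem (ha k)
  simp only [rootVel, csqrt_sq]
  exact isBigO_rpow_mul S.atZero_ne_zero (S.isBigO_csqrt_atZero.const_mul_left 2) h1 (by norm_num)

end

section

variable {m d n₁ n₂ : ℕ} {S : RayContour m} {T : Set (Fin d → ℂ)}
  {M : (Fin d → ℂ) → Option (Fin m) → ℝ → Mat} {Γ₀ : (Fin d → ℂ) → ℂ → Mat}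
  {P : Matrix (Fin 2) (Fin 2) (Polynomial ℂ)} {Γn : ℂ → Mat} {Mn : Option (Fin m) → ℝ → Mat}
  (h : IsAnalyticRHPFamily S T M Γ₀) (hT : IsOpen T)
  (hM : ∀ t p r, 0 < r → (M t p r).det = 1) (q v : Params d n₁ n₂) (ht : q.1 ∈ T)
  (ha : ∀ k, pts q.2.1 q.2.2 k ∉ S.carrier)
  (hP : IsDressing S (Γ₀ q.1) Γn q.2.1 q.2.2 P) (hn : IsRHPSolution S Mn Γn)
  (hMn : ∀ p r, 0 < r → (Mn p r).det = 1) {C : ℝ} (hC : ∀ z ∉ S.carrier, ∀ i j,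
    ‖derivMat (Γ₀ q.1) z i j‖ * ‖z‖ ≤ C * (1 + ‖z‖) ^ wt i)

lemma formH_eq (Γ₀ : (Fin d → ℂ) → ℂ → Mat) (z : ℂ) : formH Γ₀ Γn P q v z =
    -(polyMat (polyDeriv P) z * dressR P q.2.1 q.2.2 z *
      (famDeriv Γ₀ q.1 v.1 z * (Γ₀ q.1 z).adjugate)).trace +
    rootVel q v (csqrt z) * logMat Γn z 0 0 := by
  rw [formH, rootVel, csqrt_sq]

include h hM ht hP hn hMn in
-- Conjugation by the diagonal matrix D does not change diagonal entries. Hence this entry of Γn⁻¹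
-- Γn′ inherits its bounds from Γ₀, P and D, without any estimate for Γn′.
lemma logMat_zero_eq {z : ℂ} (hz : z ∉ S.carrier) (hz' : ∏ k, (pts q.2.1 q.2.2 k - z) ≠ 0) :
    logMat Γn z 0 0 = (logMat (Γ₀ q.1) z - dressB P q.2.1 q.2.2 (Γ₀ q.1) z) 0 0 +
      dressLog q.2.1 q.2.2 (csqrt z) := by
  have h1 := congrFun (congrFun (hP.logMat_eq (h.solution _ ht) hn (hM _) hMn hz hz') 0) 0
  obtain ⟨h2, h3⟩ := derivMat_dressD_zero hz hz'
  rw [Matrix.add_apply, dressD_apply, dressD_mul_apply, h2] at h1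
  refine mul_left_cancel₀ h3 (h1.trans ?_)
  ring

include h hT hM ht hP hn hMn hC in
-- Both terms are O(|z|^(−3/2)): in the first, P′P⁻¹ has exponent −1 and the parameter derivative
-- −1/2; in the second, the velocity of the roots has −1/2 and the logarithmic derivative −1.
lemma tendsto_mul_formH_atInf : Tendsto (fun z => z * formH Γ₀ Γn P q v z) S.atInf (𝓝 0) := by
  refine S.tendsto_mul_atInf ?_
  rw [show formH Γ₀ Γn P q v = fun z => _ from funext fun z => formH_eq q v Γ₀ z]
  have hsol := h.solution _ ht
  have h1 : WtO S.atInf (-(3 / 2)) wt wt (fun z => polyMat (polyDeriv P) z *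
      dressR P q.2.1 q.2.2 z * (famDeriv Γ₀ q.1 v.1 z * (Γ₀ q.1 z).adjugate)) := by
    have := hP.wtO_polyDeriv_mul_dressR.mul S.atInf_ne_zero
      ((h.wtO_famDeriv_atInf hT ht v.1).mul S.atInf_ne_zero (wtO_adjugate_atInf hsol (hM _)))
    convert this using 1
    norm_num
  have h2 : (fun z => logMat Γn z 0 0) =O[S.atInf] fun z => ‖z‖ ^ (-1 : ℝ) := by
    have h3 : (fun z => (logMat (Γ₀ q.1) z - dressB P q.2.1 q.2.2 (Γ₀ q.1) z) 0 0) =O[S.atInf]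
        fun z => ‖z‖ ^ (-1 : ℝ) :=
      ((wtO_logMat_atInf hsol (hM _) hC).sub (wtO_dressB_atInf hsol (hM _) hP) 0 0).congr_right
        fun z => by simp
    refine (h3.add (isBigO_dressLog_atInf q.2.1 q.2.2)).congr' ?_ EventuallyEq.rfl
    have h4 : ∀ᶠ z in S.atInf, ∀ k, ‖pts q.2.1 q.2.2 k‖ + 1 ≤ ‖z‖ :=
      eventually_all.2 fun k => S.atInf_ge _
    filter_upwards [S.atInf_notMem, h4] with z hz hz4
    refine (logMat_zero_eq h hM q ht hP hn hMn hz (Finset.prod_ne_zero_iff.2 fun k _ h5 => ?_)).symm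
    have := hz4 k
    rw [sub_eq_zero.1 h5] at this
    linarith
  exact h1.trace.neg_left.add (isBigO_rpow_mul S.atInf_ne_zero (isBigO_rootVel_atInf q v) h2
    (by norm_num))

include h hT hM ht ha hP hn hMn hC in
-- The first term is bounded. In the second the logarithmic derivative is O(1/|z|), and the factor
-- √z of `rootVel` improves the product to O(|z|^(−1/2)).
lemma tendsto_mul_formH_atZero : Tendsto (fun z => z * formH Γ₀ Γn P q v z) S.atZero (𝓝 0) := by
  refine S.tendsto_mul_atZero ?_
  rw [show formH Γ₀ Γn P q v = fun z => _ from funext fun z => formH_eq q v Γ₀ z]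
  have hsol := h.solution _ ht
  have h1 : WtO S.atZero 0 0 0 (fun z => polyMat (polyDeriv P) z *
      dressR P q.2.1 q.2.2 z * (famDeriv Γ₀ q.1 v.1 z * (Γ₀ q.1 z).adjugate)) := by
    simpa using (wtO_polyDeriv_mul_dressR_atZero ha).mul S.atZero_ne_zero
      ((h.wtO_famDeriv_atZero hT ht v.1).mul S.atZero_ne_zero (wtO_adjugate_atZero hsol (hM _)))
  have h2 : (fun z => logMat Γn z 0 0) =O[S.atZero] fun z => ‖z‖ ^ (-1 : ℝ) := by
    have h3 : (fun z => (logMat (Γ₀ q.1) z - dressB P q.2.1 q.2.2 (Γ₀ q.1) z) 0 0) =O[S.atZero]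
        fun z => ‖z‖ ^ (-1 : ℝ) :=
      ((wtO_logMat_atZero hsol (hM _) hC).sub
        (wtO_dressB_atZero hsol (hM _) ha).mono_atZero 0 0).congr_right fun z => by simp
    refine (h3.add (isBigO_dressLog_atZero ha)).congr' ?_ EventuallyEq.rfl
    have h4 : ∀ᶠ z in S.atZero, ∏ k, (pts q.2.1 q.2.2 k - z) ≠ 0 :=
      nhdsWithin_le_nhds ((differentiableAt_prod_pts 0).continuousAt.eventually_ne
        (Finset.prod_ne_zero_iff.2 fun k _ => sub_ne_zero.2 (S.ne_zero_of_notMem (ha k))))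
    filter_upwards [S.atZero_notMem, h4] with z hz hz4
    exact (logMat_zero_eq h hM q ht hP hn hMn hz hz4).symm
  exact (S.isBigO_rpow_atZero_of_le h1.trace (by norm_num)).neg_left.add
    (isBigO_rpow_mul S.atZero_ne_zero (isBigO_rootVel_atZero q v ha) h2 (by norm_num))

end

end

/-! ### Algebra of triangular jumps and formulas for the integrands. -/

section

open RayContour

section Algebra

/-- The sign attached to the triangularity of a jump matrix. -/
def offSign (b : Bool) : ℂ := if b then -1 else 1

lemma adjugate_one_add_smul_nilp (x : ℂ) (b : Bool) :
    (1 + x • nilp b : Mat).adjugate = 1 - x • nilp b := by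
  cases b <;> ext i j <;> fin_cases i <;> fin_cases j <;> simp [nilp, Matrix.adjugate_fin_two]

lemma nilp_mul_nilp (b : Bool) : nilp b * nilp b = 0 := by
  cases b <;> ext i j <;> fin_cases i <;> fin_cases j <;> simp [nilp]

lemma nilp_zero_zero (b : Bool) : nilp b 0 0 = 0 := by cases b <;> simp [nilp]

lemma conj_nilp_zero_zero (X : Mat) (h : ℂ) (b : Bool) :
    ((1 - h • nilp b) * X * (1 + h • nilp b)) 0 0 = X 0 0 + offSign b * h * (X * nilp b).trace := by
  cases b <;> simp [nilp, offSign, Matrix.mul_apply, Fin.sum_univ_two, Matrix.trace_fin_two]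
  ring

/-- The first diagonal entry of `G⁻¹ G'` on the two sides of a ray. -/
lemma logMat_jump {G₁ G₂ D₁ D₂ : Mat} {h κ ρ : ℂ} {b : Bool} (hρ : ρ ≠ 0) (h2 : G₂.det = 1)
    (hG : G₁ = G₂ * (1 + h • nilp b))
    (hD : ρ • D₁ = ρ • (D₂ * (1 + h • nilp b)) + G₂ * (κ • nilp b)) :
    (G₁.adjugate * D₁) 0 0 = (G₂.adjugate * D₂) 0 0 +
      offSign b * h * (G₂.adjugate * D₂ * nilp b).trace := by
  have h3 : D₁ = D₂ * (1 + h • nilp b) + (ρ⁻¹ * κ) • (G₂ * nilp b) := by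
    have := congrArg (fun X => ρ⁻¹ • X) hD
    simp only [smul_add, smul_smul, inv_mul_cancel₀ hρ, one_smul, Matrix.mul_smul] at this
    exact this
  have h4 : G₂.adjugate * G₂ = 1 := by rw [Matrix.adjugate_mul, h2, one_smul]
  have h5 : G₁.adjugate * D₁ = (1 - h • nilp b) * (G₂.adjugate * D₂) * (1 + h • nilp b) +
      (ρ⁻¹ * κ) • nilp b := by
    have e1 : G₂.adjugate * (G₂ * nilp b) = nilp b := by rw [← Matrix.mul_assoc, h4, Matrix.one_mul]
    have e2 : (1 - h • nilp b) * nilp b = nilp b := by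
      rw [Matrix.sub_mul, Matrix.smul_mul, nilp_mul_nilp, smul_zero, Matrix.one_mul, sub_zero]
    rw [hG, Matrix.adjugate_mul_distrib, adjugate_one_add_smul_nilp, h3, Matrix.mul_assoc,
      Matrix.mul_add, Matrix.mul_add, Matrix.mul_smul, Matrix.mul_smul, e1, e2]
    simp only [Matrix.mul_assoc]
  -- The derivative of the jump along the ray enters only through a multiple of the nilpotent
  -- matrix, whose diagonal is zero; for this reason κ does not appear in the result.
  rw [h5, Matrix.add_apply, conj_nilp_zero_zero, Matrix.smul_apply, nilp_zero_zero]
  simp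

/-- The jump of `Tr (X Ġ G⁻¹)` across a ray. -/
lemma trace_jump {X G₁ G₂ L₁ L₂ : Mat} {f f' : ℂ} {b : Bool} (hG : G₁ = G₂ * (1 + f • nilp b))
    (hL : L₁ = L₂ * (1 + f • nilp b) + G₂ * (f' • nilp b)) :
    (X * (L₁ * G₁.adjugate)).trace =
      (X * (L₂ * G₂.adjugate)).trace + f' * (G₂.adjugate * X * G₂ * nilp b).trace := by
  have h1 : L₁ * G₁.adjugate = L₂ * G₂.adjugate + f' • (G₂ * nilp b * G₂.adjugate) := by
    have e1 : (1 + f • nilp b) * (1 - f • nilp b) = (1 : Mat) := by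
      rw [← adjugate_one_add_smul_nilp, Matrix.mul_adjugate, det_one_add_smul_nilp, one_smul]
    have e2 : nilp b * (1 - f • nilp b) = nilp b := by
      rw [Matrix.mul_sub, Matrix.mul_smul, nilp_mul_nilp, smul_zero, Matrix.mul_one, sub_zero]
    rw [hL, hG, Matrix.adjugate_mul_distrib, adjugate_one_add_smul_nilp, Matrix.add_mul,
      ← Matrix.mul_assoc, Matrix.mul_assoc L₂, e1, Matrix.mul_one, Matrix.mul_smul, Matrix.smul_mul,
      ← Matrix.mul_assoc, Matrix.mul_assoc G₂, e2]
  have h2 : X * (G₂ * nilp b * G₂.adjugate) = X * G₂ * nilp b * G₂.adjugate := by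
    simp only [Matrix.mul_assoc]
  rw [h1, Matrix.mul_add, Matrix.trace_add, Matrix.mul_smul, Matrix.trace_smul, smul_eq_mul,
    h2, Matrix.trace_mul_comm (X * G₂ * nilp b)]
  simp only [Matrix.mul_assoc]

end Algebra

section DressRatio

variable {n₁ n₂ : ℕ} {lam : Fin n₂ → ℂ} {mu : Fin n₁ → ℂ}

/-- The quotient of the diagonal entries of the dressing factor by which a triangular jump is
multiplied. -/
def dressRatio (b : Bool) (lam : Fin n₂ → ℂ) (mu : Fin n₁ → ℂ) (s : ℂ) : ℂ :=
  if b then dressScalar lam mu (-s) / dressScalar lam mu s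
  else dressScalar lam mu s / dressScalar lam mu (-s)

lemma isUnit_det_dressRoot {s : ℂ} (h1 : dressScalar lam mu s ≠ 0)
    (h2 : dressScalar lam mu (-s) ≠ 0) : IsUnit (dressRoot lam mu s).det := by
  rw [isUnit_iff_ne_zero, dressRoot, Matrix.det_fin_two_of]
  simpa using ⟨h1, h2⟩

/-- On the rays ϖ_j the factor D has no jump, and conjugation by a diagonal matrix rescales a
unipotent triangular one. Dressing therefore multiplies f_j by a ratio of entries of D. -/
lemma dressRoot_conj {s : ℂ} (h1 : dressScalar lam mu s ≠ 0) (h2 : dressScalar lam mu (-s) ≠ 0)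
    (x : ℂ) (b : Bool) : (dressRoot lam mu s)⁻¹ * (1 + x • nilp b) * dressRoot lam mu s =
      1 + (x * dressRatio b lam mu s) • nilp b := by
  have h3 : (1 + x • nilp b) * dressRoot lam mu s =
      dressRoot lam mu s * (1 + (x * dressRatio b lam mu s) • nilp b) := by
    cases b <;> ext i j <;> fin_cases i <;> fin_cases j <;>
      simp [nilp, dressRoot, dressRatio, Matrix.mul_apply, Fin.sum_univ_two]
    all_goals field_simp
  rw [Matrix.mul_assoc, h3, Matrix.nonsing_inv_mul_cancel_left _ _ (isUnit_det_dressRoot h1 h2)]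

/-- On the negative half line the two boundary values of D differ by the exchange of the diagonal
entries, which iσ₂ performs. The dressed jump there is again iσ₂, independent of all parameters, and
contributes nothing to Ω. -/
lemma dressRoot_swap {s : ℂ} (h1 : dressScalar lam mu s ≠ 0) (h2 : dressScalar lam mu (-s) ≠ 0) :
    (dressRoot lam mu s)⁻¹ * !![0, 1; -1, 0] * dressRoot lam mu (-s) = !![0, 1; -1, 0] := by
  have h3 : !![0, 1; -1, 0] * dressRoot lam mu (-s) = dressRoot lam mu s * !![0, 1; -1, 0] := by
    ext i j
    fin_cases i <;> fin_cases j <;> simp [dressRoot, Matrix.mul_apply, Fin.sum_univ_two]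
  rw [Matrix.mul_assoc, h3, Matrix.nonsing_inv_mul_cancel_left _ _ (isUnit_det_dressRoot h1 h2)]

/-- Multiplication by the ratio of the diagonal entries, in terms of conjugation. -/
lemma dressRatio_mul_trace {s : ℂ} (h1 : dressScalar lam mu s ≠ 0) (h2 : dressScalar lam mu (-s) ≠ 0)
    {A X : Mat} {D' : Mat} (h01 : D' 0 1 = 0) (h10 : D' 1 0 = 0)
    (h : dressRoot lam mu s * A = X * dressRoot lam mu s + D') (b : Bool) :
    dressRatio b lam mu s * (A * nilp b).trace = (X * nilp b).trace := by
  have e1 := congrFun (congrFun h 0) 1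
  have e2 := congrFun (congrFun h 1) 0
  cases b <;> simp [nilp, dressRoot, dressRatio, Matrix.mul_apply, Fin.sum_univ_two,
    Matrix.trace_fin_two, h01, h10] at e1 e2 ⊢
  · field_simp
    linear_combination e1
  · field_simp
    linear_combination e2

end DressRatio

section Line

variable {m d n₁ n₂ : ℕ} {S : RayContour m} (q v : Params d n₁ n₂)

lemma eventually_pts_line (ha : ∀ k, pts q.2.1 q.2.2 k ∉ S.carrier) :
    ∀ᶠ s in 𝓝 (0 : ℂ), ∀ k, pts (q + s • v).2.1 (q + s • v).2.2 k ∉ S.carrier := by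
  refine eventually_all.2 fun k => ?_
  refine (hasDerivAt_pts_line q v k).continuousAt.eventually (S.isOpen_compl.mem_nhds ?_)
  simpa using ha k

lemma hasDerivAt_dressScalar_line (ha : ∀ k, pts q.2.1 q.2.2 k ∈ Complex.slitPlane) {s : ℂ}
    (hs : dressScalar q.2.1 q.2.2 s ≠ 0) :
    HasDerivAt (fun σ : ℂ => dressScalar (q + σ • v).2.1 (q + σ • v).2.2 s)
      (dressScalar q.2.1 q.2.2 s * ∑ k, rootDot q v k / (roots q.2.1 q.2.2 k + s)) 0 := by
  have hq0 : q + (0 : ℂ) • v = q := by simp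
  have hr := fun k => (hasDerivAt_roots_line q v (ha k)).add_const s
  have hne : ∏ k, (roots q.2.1 q.2.2 k + s) ≠ 0 := right_ne_zero_of_mul hs
  have hl : logDeriv (fun σ : ℂ => ∏ k, (roots (q + σ • v).2.1 (q + σ • v).2.2 k + s)) 0 =
      ∑ k, rootDot q v k / (roots q.2.1 q.2.2 k + s) := by
    rw [logDeriv_prod (f := fun k σ => roots (q + σ • v).2.1 (q + σ • v).2.2 k + s)
      (fun k _ => by rw [hq0]; exact Finset.prod_ne_zero_iff.1 hne k (Finset.mem_univ k))
      (fun k _ => (hr k).differentiableAt)]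
    refine Finset.sum_congr rfl fun k _ => ?_
    rw [logDeriv_apply, (hr k).deriv, hq0, rootDot]
  have hd : DifferentiableAt ℂ
      (fun σ : ℂ => ∏ k, (roots (q + σ • v).2.1 (q + σ • v).2.2 k + s)) 0 :=
    differentiableAt_prod fun k _ => (hr k).differentiableAt
  refine (hd.hasDerivAt.const_mul ((-1) ^ n₁)).congr_deriv ?_
  rw [← hl, logDeriv_apply, hq0, dressScalar]
  field_simp

lemma hasDerivAt_dressRatio_line (ha : ∀ k, pts q.2.1 q.2.2 k ∈ Complex.slitPlane) {s : ℂ}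
    (hs : dressScalar q.2.1 q.2.2 s ≠ 0) (hs' : dressScalar q.2.1 q.2.2 (-s) ≠ 0) (b : Bool) :
    HasDerivAt (fun σ : ℂ => dressRatio b (q + σ • v).2.1 (q + σ • v).2.2 s)
      (dressRatio b q.2.1 q.2.2 s * (offSign b * rootVel q v s)) 0 := by
  have hq0 : q + (0 : ℂ) • v = q := by simp
  have h1 := hasDerivAt_dressScalar_line q v ha hs
  have h2 := hasDerivAt_dressScalar_line q v ha hs'
  have hv : rootVel q v s = ∑ k, rootDot q v k / (roots q.2.1 q.2.2 k + s) -
      ∑ k, rootDot q v k / (roots q.2.1 q.2.2 k + -s) := by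
    rw [rootVel, Finset.mul_sum, ← Finset.sum_sub_distrib]
    refine Finset.sum_congr rfl fun k _ => ?_
    have e1 : roots q.2.1 q.2.2 k + s ≠ 0 :=
      Finset.prod_ne_zero_iff.1 (right_ne_zero_of_mul hs) k (Finset.mem_univ k)
    have e2 : roots q.2.1 q.2.2 k + -s ≠ 0 :=
      Finset.prod_ne_zero_iff.1 (right_ne_zero_of_mul hs') k (Finset.mem_univ k)
    have e3 : s ^ 2 - roots q.2.1 q.2.2 k ^ 2 ≠ 0 := by
      rw [show s ^ 2 - roots q.2.1 q.2.2 k ^ 2 =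
        -((roots q.2.1 q.2.2 k + s) * (roots q.2.1 q.2.2 k + -s)) by ring]
      exact neg_ne_zero.2 (mul_ne_zero e1 e2)
    rw [← roots_sq, div_sub_div _ _ e1 e2, mul_div_assoc', div_eq_div_iff e3 (mul_ne_zero e1 e2)]
    ring
  cases b
  · simp only [dressRatio, offSign, Bool.false_eq_true, if_false]
    refine (h1.div h2 (by rw [hq0]; exact hs')).congr_deriv ?_
    rw [hq0, hv]
    field_simp
  · simp only [dressRatio, offSign, if_true]
    refine (h2.div h1 (by rw [hq0]; exact hs)).congr_deriv ?_
    rw [hq0, hv]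
    field_simp
    ring

variable (upper : Fin m → Bool) (f : Fin m → (Fin d → ℂ) → ℂ → ℂ)

/-- The derivative of the scalar jump function with respect to the parameters. -/
def jumpDot (f : Fin m → (Fin d → ℂ) → ℂ → ℂ) (j : Fin m) (t w : Fin d → ℂ) (z : ℂ) : ℂ :=
  deriv (fun s : ℂ => f j (t + s • w) z) 0

lemma deriv_jumpMatrix_some (j : Fin m) (t w : Fin d → ℂ) (r : ℝ) (i k : Fin 2) :
    deriv (fun s : ℂ => jumpMatrix S upper f (t + s • w) (some j) r i k) 0 =
      (jumpDot f j t w (S.point (some j) r) • nilp (upper j)) i k := by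
  simp only [jumpMatrix, Matrix.add_apply, Matrix.smul_apply, smul_eq_mul, jumpDot]
  rw [deriv_const_add, deriv_mul_const_field]

lemma deriv_jumpMatrix_none (t w : Fin d → ℂ) (r : ℝ) (i k : Fin 2) :
    deriv (fun s : ℂ => jumpMatrix S upper f (t + s • w) none r i k) 0 = (0 : Mat) i k := by
  simp [jumpMatrix]

variable {q v upper f}

lemma dressedJump_some (ha : ∀ k, pts q.2.1 q.2.2 k ∉ S.carrier) (j : Fin m) {r : ℝ} (hr : 0 < r) :
    dressedJump S (jumpMatrix S upper f) q (some j) r =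
      1 + (f j q.1 (S.point (some j) r) *
        dressRatio (upper j) q.2.1 q.2.2 (csqrt (S.point (some j) r))) • nilp (upper j) := by
  obtain ⟨h1, h2⟩ := S.dressScalar_rootBV_ne_zero ha (some j) 1 hr
  rw [rootBV_some] at h1 h2
  rw [dressedJump_eq _ _ _ _ hr, rootBV_some, rootBV_some, jumpMatrix, dressRoot_conj h1 h2]

lemma dressedJump_none (ha : ∀ k, pts q.2.1 q.2.2 k ∉ S.carrier) {r : ℝ} (hr : 0 < r) :
    dressedJump S (jumpMatrix S upper f) q none r = !![0, 1; -1, 0] := by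
  obtain ⟨h1, h2⟩ := S.dressScalar_rootBV_ne_zero ha none (-S.sgn none) hr
  have h3 : S.rootBV none (S.sgn none) r = -S.rootBV none (-S.sgn none) r := by
    rw [rootBV_none_neg, neg_neg]
  rw [dressedJump_eq _ _ _ _ hr, h3, jumpMatrix, dressRoot_swap h1 h2]

lemma deriv_dressedJump_some (ha : ∀ k, pts q.2.1 q.2.2 k ∉ S.carrier) (j : Fin m) {r : ℝ}
    (hr : 0 < r)
    (hf : DifferentiableAt ℂ (fun s : ℂ => f j (q.1 + s • v.1) (S.point (some j) r)) 0) (i k : Fin 2) :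
    lineDeriv ℂ (fun q' => dressedJump S (jumpMatrix S upper f) q' (some j) r i k) q v =
      ((dressRatio (upper j) q.2.1 q.2.2 (csqrt (S.point (some j) r)) *
        (jumpDot f j q.1 v.1 (S.point (some j) r) + offSign (upper j) *
          f j q.1 (S.point (some j) r) * rootVel q v (csqrt (S.point (some j) r)))) •
        nilp (upper j)) i k := by
  obtain ⟨h1, h2⟩ := S.dressScalar_rootBV_ne_zero ha (some j) 1 hr
  rw [rootBV_some] at h1 h2
  have hsl := fun k => mem_slitPlane_of_notMem (ha k)
  have h3 := (((hf.hasDerivAt.mul (hasDerivAt_dressRatio_line q v hsl h1 h2 (upper j))).mul_const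
    (nilp (upper j) i k)).const_add ((1 : Mat) i k))
  have h4 : (fun s : ℂ => dressedJump S (jumpMatrix S upper f) (q + s • v) (some j) r i k) =ᶠ[𝓝 0]
      fun s : ℂ => (1 : Mat) i k + f j (q.1 + s • v.1) (S.point (some j) r) *
        dressRatio (upper j) (q + s • v).2.1 (q + s • v).2.2 (csqrt (S.point (some j) r)) *
          nilp (upper j) i k := by
    filter_upwards [eventually_pts_line q v ha] with s hs
    rw [dressedJump_some hs j hr]
    rfl
  rw [lineDeriv, h4.deriv_eq]
  refine h3.deriv.trans ?_
  simp only [Matrix.smul_apply, smul_eq_mul, jumpDot, zero_smul, add_zero]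
  ring

lemma deriv_dressedJump_none (ha : ∀ k, pts q.2.1 q.2.2 k ∉ S.carrier) {r : ℝ}
    (hr : 0 < r) (i k : Fin 2) :
    lineDeriv ℂ (fun q' => dressedJump S (jumpMatrix S upper f) q' none r i k) q v = 0 := by
  have h4 : (fun s : ℂ => dressedJump S (jumpMatrix S upper f) (q + s • v) none r i k) =ᶠ[𝓝 0]
      fun _ => (!![0, 1; -1, 0] : Mat) i k := by
    filter_upwards [eventually_pts_line q v ha] with s hs
    rw [dressedJump_none hs hr]
  rw [lineDeriv, h4.deriv_eq, deriv_const]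

lemma lineDeriv_jumpMatrix (p : Option (Fin m)) (r : ℝ) (i k : Fin 2) :
    lineDeriv ℂ (fun q' : Params d n₁ n₂ => jumpMatrix S upper f q'.1 p r i k) q v =
      deriv (fun s : ℂ => jumpMatrix S upper f (q.1 + s • v.1) p r i k) 0 := rfl

/-- The integrand of `Ω` on a piece where the jump matrix is unipotent. -/
lemma omegaIntegrand_eq {E : Type*} [AddCommGroup E] [Module ℂ E] {F G : ℂ → Mat}
    {N : E → Option (Fin m) → ℝ → Mat} {x y : E} {p : Option (Fin m)} {r : ℝ} (hr : 0 < r)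
    (hG : S.MatExt p (-S.sgn p) r F G) (hdet : (G (S.point p r)).det = 1) {h h' : ℂ} {b : Bool}
    (hN : N x p r = 1 + h • nilp b)
    (hN' : ∀ i j, lineDeriv ℂ (fun x' => N x' p r i j) x y = (h' • nilp b) i j) :
    omegaIntegrand S F N x y p r = h' * (logMat G (S.point p r) * nilp b).trace * S.rot p /
      (2 * Real.pi * Complex.I) := by
  have e1 : Matrix.of (fun i j => deriv (fun x : ℝ => S.minus F p x i j) r) =
      S.rot p • derivMat G (S.point p r) := by
    ext i j
    simp only [Matrix.of_apply, Matrix.smul_apply, smul_eq_mul]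
    rw [mul_comm]
    exact (hG.hasDerivAt_boundaryValue hr i j).deriv
  have e2 : Matrix.of (fun i j => lineDeriv ℂ (fun x' => N x' p r i j) x y) = h' • nilp b := by
    ext i j; exact hN' i j
  have e3 : S.minus F p r = G (S.point p r) := hG.boundaryValue_eq hr
  -- The derivative ∂M is a multiple of the nilpotent matrix, whose square is zero, so
  -- multiplication by M⁻¹ leaves it unchanged.
  have e4 : nilp b * (1 - h • nilp b) = nilp b := by
    rw [Matrix.mul_sub, Matrix.mul_smul, nilp_mul_nilp, smul_zero, Matrix.mul_one, sub_zero]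
  rw [omegaIntegrand, e1, e2, e3, hN, inv_eq_adjugate (det_one_add_smul_nilp h b),
    adjugate_one_add_smul_nilp, inv_eq_adjugate hdet, Matrix.mul_assoc _ (h' • nilp b),
    Matrix.smul_mul, e4, logMat]
  simp only [Matrix.mul_smul, Matrix.smul_mul, Matrix.trace_smul, smul_eq_mul]
  ring

lemma omegaIntegrand_eq_zero {E : Type*} [AddCommGroup E] [Module ℂ E] {F : ℂ → Mat}
    {N : E → Option (Fin m) → ℝ → Mat} {x y : E} {p : Option (Fin m)} {r : ℝ}
    (hN' : ∀ i j, lineDeriv ℂ (fun x' => N x' p r i j) x y = 0) :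
    omegaIntegrand S F N x y p r = 0 := by
  have e2 : Matrix.of (fun i j => lineDeriv ℂ (fun x' => N x' p r i j) x y) = 0 := by
    ext i j; exact hN' i j
  rw [omegaIntegrand, e2]
  simp

end Line

end

/-! ### The jump of H across the contour. -/

section

open RayContour

section Boundary

variable {m : ℕ} {S : RayContour m} {p : Option (Fin m)} {s : ℤˣ} {r : ℝ} {F G G₁ G₂ : ℂ → Mat}

lemma RayContour.MatExt.tendsto_logMat (h : S.MatExt p s r F G) :
    Tendsto (logMat F) (𝓝[S.side p s] (S.point p r)) (𝓝 (logMat G (S.point p r))) :=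
  ((continuous_id.matrix_adjugate.tendsto _).comp h.tendsto).mul h.derivMat.tendsto

/-- The jump relation is differentiated along the ray; the derivative of a boundary value is the
complex derivative of the extension times the direction of the ray. -/
lemma RayContour.derivMat_jump (hr : 0 < r) (h1 : S.MatExt p (S.sgn p) r F G₁)
    (h2 : S.MatExt p (-S.sgn p) r F G₂) {N : ℝ → Mat} {N' : Mat}
    (hN : ∀ i j, HasDerivAt (fun x => N x i j) (N' i j) r)
    (hj : ∀ x, 0 < x → S.plus F p x = S.minus F p x * N x) :
    S.rot p • derivMat G₁ (S.point p r) =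
      S.rot p • (derivMat G₂ (S.point p r) * N r) + G₂ (S.point p r) * N' := by
  ext i j
  have e1 := h1.hasDerivAt_boundaryValue hr i j
  have e2 : HasDerivAt (fun x => ∑ k, S.minus F p x i k * N x k j)
      (∑ k, (derivMat G₂ (S.point p r) i k * S.rot p * N r k j +
        S.minus F p r i k * N' k j)) r :=
    HasDerivAt.fun_sum fun k _ => (h2.hasDerivAt_boundaryValue hr i k).mul (hN k j)
  have e3 := e1.unique (e2.congr_of_eventuallyEq (by
    filter_upwards [lt_mem_nhds hr] with x hx
    rw [← Matrix.mul_apply, ← hj x hx]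
    rfl))
  have e4 : S.minus F p r = G₂ (S.point p r) := h2.boundaryValue_eq hr
  rw [e4] at e3
  simp only [Matrix.smul_apply, Matrix.add_apply, Matrix.mul_apply, Fin.sum_univ_two,
    smul_eq_mul] at e3 ⊢
  linear_combination e3

lemma IsRHPSolution.det_ext {M : Option (Fin m) → ℝ → Mat} (h : IsRHPSolution S M F)
    (hM : ∀ p r, 0 < r → (M p r).det = 1) (hr : 0 < r) (hG : S.MatExt p s r F G) :
    (G (S.point p r)).det = 1 := by
  rw [← hG.boundaryValue_eq hr]
  exact (h.tendsto_inv hM p s hr).1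

lemma IsRHPSolution.trace_logMat_ext {M : Option (Fin m) → ℝ → Mat} (h : IsRHPSolution S M F)
    (hM : ∀ p r, 0 < r → (M p r).det = 1) (hr : 0 < r) (hG : S.MatExt p s r F G) :
    (logMat G (S.point p r)).trace = 0 := by
  have := S.nhdsWithin_side_neBot p s hr
  refine tendsto_nhds_unique ((continuous_id.matrix_trace.tendsto _).comp hG.tendsto_logMat)
    (tendsto_const_nhds.congr' ?_)
  filter_upwards [self_mem_nhdsWithin] with z hz
  exact ((h.logMat_trace hM (S.side_subset _ _ hz)).2).symm

lemma IsRHPSolution.ext_jump {M : Option (Fin m) → ℝ → Mat} (h : IsRHPSolution S M F)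
    (hr : 0 < r) (h1 : S.MatExt p (S.sgn p) r F G₁) (h2 : S.MatExt p (-S.sgn p) r F G₂) :
    G₁ (S.point p r) = G₂ (S.point p r) * M p r := by
  rw [← h1.boundaryValue_eq hr, ← h2.boundaryValue_eq hr]
  exact h.jump p r hr

end Boundary

section Admissible

variable {m d : ℕ} {S : RayContour m} {T : Set (Fin d → ℂ)} {f : Fin m → (Fin d → ℂ) → ℂ → ℂ}
  {t : Fin d → ℂ}

lemma IsAdmissible.eventually_differentiableAt_line (hf : IsAdmissible S T f) (ht : t ∈ T)
    (w : Fin d → ℂ) (j : Fin m) {r : ℝ} (hr : 0 < r) : ∀ᶠ s in 𝓝 (0 : ℂ),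
      DifferentiableAt ℂ (fun s : ℂ => f j (t + s • w) (S.point (some j) r)) s := by
  obtain ⟨c, hc, U, hU, htU, hj⟩ := hf.exists_cone ht
  have hl : Continuous fun s : ℂ => t + s • w := by fun_prop
  have h1 : ∀ᶠ s in 𝓝 (0 : ℂ), t + s • w ∈ U :=
    hl.continuousAt.eventually (hU.mem_nhds (by simpa using htU))
  filter_upwards [h1] with s hs
  have h2 := ((hj j).1.differentiableAt ((hU.prod (isOpen_cone c)).mem_nhds
    (Set.mk_mem_prod hs (ofReal_mem_cone hc.1 hr))))
  have h3 : DifferentiableAt ℂ (fun s : ℂ => (t + s • w, (r : ℂ))) s := by fun_prop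
  have h4 := DifferentiableAt.comp s h2 h3
  refine h4.congr_of_eventuallyEq (Eventually.of_forall fun s => ?_)
  simp [point_eq]

lemma IsAdmissible.differentiableAt_ray (hf : IsAdmissible S T f) (ht : t ∈ T) (j : Fin m) {r : ℝ}
    (hr : 0 < r) : DifferentiableAt ℂ (fun u : ℂ => f j t (u * S.rot (some j))) r := by
  obtain ⟨c, hc, U, hU, htU, hj⟩ := hf.exists_cone ht
  have h2 := ((hj j).1.differentiableAt ((hU.prod (isOpen_cone c)).mem_nhds
    (Set.mk_mem_prod htU (ofReal_mem_cone hc.1 hr))))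
  have h3 : DifferentiableAt ℂ (fun u : ℂ => (t, u)) (r : ℂ) := by fun_prop
  exact DifferentiableAt.comp (g := fun w : (Fin d → ℂ) × ℂ => f j w.1 (w.2 * S.rot (some j)))
    (r : ℂ) h2 h3

lemma differentiableAt_dressRatio {n₁ n₂ : ℕ} {lam : Fin n₂ → ℂ} {mu : Fin n₁ → ℂ} {s : ℂ}
    (h1 : dressScalar lam mu s ≠ 0) (h2 : dressScalar lam mu (-s) ≠ 0) (b : Bool) :
    DifferentiableAt ℂ (dressRatio b lam mu) s := by
  have e1 := differentiable_dressScalar lam mu s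
  have e2 : DifferentiableAt ℂ (fun s => dressScalar lam mu (-s)) s :=
    ((differentiable_dressScalar lam mu).comp differentiable_neg) s
  cases b
  · exact e1.div e2 h2
  · exact e2.div e1 h1

end Admissible

section Form

variable {m d n₁ n₂ : ℕ} {S : RayContour m} {T : Set (Fin d → ℂ)} {upper : Fin m → Bool}
  {f : Fin m → (Fin d → ℂ) → ℂ → ℂ} {Γ₀ : (Fin d → ℂ) → ℂ → Mat} {Γn : ℂ → Mat}
  {P : Matrix (Fin 2) (Fin 2) (Polynomial ℂ)} {q : Params d n₁ n₂}
  {p : Option (Fin m)} {s : ℤˣ} {r : ℝ} {G Gn L : Mat}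

lemma continuousAt_rootVel (v : Params d n₁ n₂) (ha : ∀ k, pts q.2.1 q.2.2 k ∉ S.carrier)
    (p : Option (Fin m)) (s : ℤˣ) (hr : 0 < r) : ContinuousAt (rootVel q v) (S.rootBV p s r) := by
  unfold rootVel
  refine (continuousAt_const.mul continuousAt_id).mul (tendsto_finsetSum _ fun k _ =>
    ContinuousAt.div continuousAt_const ((continuousAt_id.pow 2).sub continuousAt_const) ?_)
  have h1 := Finset.prod_ne_zero_iff.1 (S.prod_pts_sub_ne_zero ha p hr.le) k (Finset.mem_univ k)
  simp only [S.rootBV_sq p s hr]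
  exact fun h => h1 (by rw [← neg_sub, h, neg_zero])

lemma rootVel_neg (q v : Params d n₁ n₂) (s : ℂ) : rootVel q v (-s) = -rootVel q v s := by
  simp [rootVel]

lemma tendsto_formH (v : Params d n₁ n₂) (ha : ∀ k, pts q.2.1 q.2.2 k ∉ S.carrier) (hr : 0 < r)
    {G Gn : ℂ → Mat} (hG : S.MatExt p s r (Γ₀ q.1) G) (hGn : S.MatExt p s r Γn Gn)
    (hL : Tendsto (famDeriv Γ₀ q.1 v.1) (𝓝[S.side p s] (S.point p r)) (𝓝 L)) :
    Tendsto (formH Γ₀ Γn P q v) (𝓝[S.side p s] (S.point p r))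
      (𝓝 (-(polyMat (polyDeriv P) (S.point p r) * dressR P q.2.1 q.2.2 (S.point p r) *
        (L * (G (S.point p r)).adjugate)).trace +
          rootVel q v (S.rootBV p s r) * logMat Gn (S.point p r) 0 0)) := by
  rw [show formH Γ₀ Γn P q v = fun z => _ from funext fun z => formH_eq q v Γ₀ z]
  have h1 := (continuousAt_polyDeriv_mul_dressR (P := P)
    (S.prod_pts_sub_ne_zero ha p hr.le)).tendsto.mono_left
      (nhdsWithin_le_nhds (s := S.side p s))
  have h2 := h1.mul (hL.mul ((continuous_id.matrix_adjugate.tendsto _).comp hG.tendsto))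
  have h3 := ((continuousAt_rootVel v ha p s hr).tendsto.comp (S.tendsto_csqrt_side p s hr)).mul
    (tendsto_pi_nhds.1 (tendsto_pi_nhds.1 hGn.tendsto_logMat 0) 0)
  exact ((continuous_id.matrix_trace.tendsto _).comp h2).neg.add h3

lemma tendsto_dressB (ha : ∀ k, pts q.2.1 q.2.2 k ∉ S.carrier) (hr : 0 < r) {Γ G : ℂ → Mat}
    (hG : S.MatExt p s r Γ G) :
    Tendsto (dressB P q.2.1 q.2.2 Γ) (𝓝[S.side p s] (S.point p r))
      (𝓝 (dressB P q.2.1 q.2.2 G (S.point p r))) := by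
  have h1 := (continuousAt_polyDeriv_mul_dressR (P := P)
    (S.prod_pts_sub_ne_zero ha p hr.le)).tendsto.mono_left
      (nhdsWithin_le_nhds (s := S.side p s))
  exact (((continuous_id.matrix_adjugate.tendsto _).comp hG.tendsto).mul h1).mul hG.tendsto

/-- The limit at the contour of the differentiated dressing relation `IsDressing.logMat_eq`. The
trace against the nilpotent matrix picks an off-diagonal entry: there D′ contributes nothing, and D
on the two sides amounts to the ratio of its entries. -/
lemma IsDressing.dressRatio_mul_trace_logMat {Γ G Gn : ℂ → Mat} {M Mn : Option (Fin m) → ℝ → Mat}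
    (hP : IsDressing S Γ Γn q.2.1 q.2.2 P) (h : IsRHPSolution S M Γ) (hn : IsRHPSolution S Mn Γn)
    (hM : ∀ p r, 0 < r → (M p r).det = 1) (hMn : ∀ p r, 0 < r → (Mn p r).det = 1)
    (ha : ∀ k, pts q.2.1 q.2.2 k ∉ S.carrier) (hr : 0 < r)
    (hG : S.MatExt p s r Γ G) (hGn : S.MatExt p s r Γn Gn) (b : Bool) :
    dressRatio b q.2.1 q.2.2 (S.rootBV p s r) * (logMat Gn (S.point p r) * nilp b).trace =
      ((logMat G (S.point p r) - dressB P q.2.1 q.2.2 G (S.point p r)) * nilp b).trace := by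
  have hne := S.nhdsWithin_side_neBot p s hr
  obtain ⟨E, hE⟩ := S.exists_matExt_dressD q.2.1 q.2.2 p s hr
  obtain ⟨h1, h2⟩ := S.dressScalar_rootBV_ne_zero ha p s hr
  have hoff : ∀ i j, i ≠ j → derivMat E (S.point p r) i j = 0 := fun i j hij => by
    refine tendsto_nhds_unique (tendsto_pi_nhds.1 (tendsto_pi_nhds.1 hE.derivMat.tendsto i) j)
      (tendsto_const_nhds.congr fun z => ?_)
    simp only [derivMat, Matrix.of_apply]
    have : (fun z => dressD q.2.1 q.2.2 z i j) = fun _ => 0 := by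
      funext z
      fin_cases i <;> fin_cases j <;> first | exact absurd rfl hij | simp [dressD]
    rw [this, deriv_const]
  refine dressRatio_mul_trace h1 h2 (hoff 0 1 (by decide)) (hoff 1 0 (by decide)) ?_ b
  have hD := S.tendsto_dressD_side q.2.1 q.2.2 p s hr
  refine tendsto_nhds_unique (hD.mul hGn.tendsto_logMat)
    ((((hG.tendsto_logMat.sub (tendsto_dressB ha hr hG)).mul hD).add hE.derivMat.tendsto).congr' ?_)
  have h0 := (differentiableAt_prod_pts (lam := q.2.1) (mu := q.2.2) (S.point p r)).continuousAt.eventually_ne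
    (S.prod_pts_sub_ne_zero ha p hr.le)
  filter_upwards [self_mem_nhdsWithin, nhdsWithin_le_nhds h0] with z hz hz'
  exact (hP.logMat_eq h hn hM hMn (S.side_subset _ _ hz) hz').symm

variable (h : IsAnalyticRHPFamily S T (jumpMatrix S upper f) Γ₀) (hT : IsOpen T)
  (hf : IsAdmissible S T f) (ht : q.1 ∈ T)
  (hn : IsRHPSolution S (dressedJump S (jumpMatrix S upper f) q) Γn)
  (hP : IsDressing S (Γ₀ q.1) Γn q.2.1 q.2.2 P) (ha : ∀ k, pts q.2.1 q.2.2 k ∉ S.carrier)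
  (v : Params d n₁ n₂)

lemma det_dressedJump_jumpMatrix (ha : ∀ k, pts q.2.1 q.2.2 k ∉ S.carrier) (p : Option (Fin m))
    (r : ℝ) (hr : 0 < r) : (dressedJump S (jumpMatrix S upper f) q p r).det = 1 :=
  S.det_dressedJump ha (fun p r _ => det_jumpMatrix upper f q.1 p r) p hr

include h hf ht in
lemma exists_matExt_family (p : Option (Fin m)) (s : ℤˣ) (hr : 0 < r) :
    ∃ G, S.MatExt p s r (Γ₀ q.1) G := by
  obtain ⟨c, K, N, hN⟩ := hf.exists_jumpContinuation upper ht
  exact (h.solution _ ht).exists_matExt hN p s hr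

include h hT hf ht hn hP ha in
lemma exists_tendsto_formH (p : Option (Fin m)) (s : ℤˣ) (hr : 0 < r) :
    ∃ H, Tendsto (formH Γ₀ Γn P q v) (𝓝[S.side p s] (S.point p r)) (𝓝 H) := by
  obtain ⟨G, hG⟩ := exists_matExt_family h hf ht p s hr
  obtain ⟨Gn, hGn⟩ := hP.exists_matExt hn (det_dressedJump_jumpMatrix ha) ha hr hG
  obtain ⟨L, hL⟩ := h.exists_tendsto_famDeriv hT ht v.1 p s hr
  exact ⟨_, tendsto_formH v ha hr hG hGn hL⟩

include h hT hf ht hn hP ha in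
/-- The jump of `formH` is the difference of the two integrands. -/
theorem formH_jump {H₁ H₂ : ℂ} (hr : 0 < r)
    (h1 : Tendsto (formH Γ₀ Γn P q v) (𝓝[S.side p (S.sgn p)] (S.point p r)) (𝓝 H₁))
    (h2 : Tendsto (formH Γ₀ Γn P q v) (𝓝[S.side p (-S.sgn p)] (S.point p r)) (𝓝 H₂)) :
    (H₁ - H₂) * S.rot p = 2 * Real.pi * Complex.I *
      (omegaIntegrand S Γn (dressedJump S (jumpMatrix S upper f)) q v p r -
        omegaIntegrand S (Γ₀ q.1)
          (fun q' : Params d n₁ n₂ => jumpMatrix S upper f q'.1) q v p r) := by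
  have i1 := S.nhdsWithin_side_neBot p (S.sgn p) hr
  have i2 := S.nhdsWithin_side_neBot p (-S.sgn p) hr
  have hM : ∀ p r, 0 < r → (jumpMatrix S upper f q.1 p r).det = 1 :=
    fun p r _ => det_jumpMatrix upper f q.1 p r
  have hMn := det_dressedJump_jumpMatrix (upper := upper) (f := f) ha
  have hsol := h.solution _ ht
  obtain ⟨G₁, hG₁⟩ := exists_matExt_family h hf ht p (S.sgn p) hr
  obtain ⟨G₂, hG₂⟩ := exists_matExt_family h hf ht p (-S.sgn p) hr
  obtain ⟨E₁, hE₁⟩ := hP.exists_matExt hn hMn ha hr hG₁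
  obtain ⟨E₂, hE₂⟩ := hP.exists_matExt hn hMn ha hr hG₂
  obtain ⟨L₁, hL₁⟩ := h.exists_tendsto_famDeriv hT ht v.1 p (S.sgn p) hr
  obtain ⟨L₂, hL₂⟩ := h.exists_tendsto_famDeriv hT ht v.1 p (-S.sgn p) hr
  rw [tendsto_nhds_unique h1 (tendsto_formH v ha hr hG₁ hE₁ hL₁),
    tendsto_nhds_unique h2 (tendsto_formH v ha hr hG₂ hE₂ hL₂)]
  have hGj := hsol.ext_jump hr hG₁ hG₂
  have hEj := hn.ext_jump hr hE₁ hE₂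
  have hmG : S.minus (Γ₀ q.1) p r = G₂ (S.point p r) := hG₂.boundaryValue_eq hr
  set X := polyMat (polyDeriv P) (S.point p r) * dressR P q.2.1 q.2.2 (S.point p r) with hX
  cases p with
  | none =>
    have hLj := h.famDeriv_jump hT ht v.1 hr hL₁ hL₂
      (fun i j => Eventually.of_forall fun s => by simp only [jumpMatrix]; fun_prop)
      (deriv_jumpMatrix_none upper f q.1 v.1 r)
    rw [Matrix.mul_zero, add_zero] at hLj
    rw [dressedJump_none ha hr] at hEj
    have hEd := derivMat_jump hr hE₁ hE₂ (N := fun _ => !![0, 1; -1, 0]) (N' := 0)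
      (fun i j => hasDerivAt_const r _) (fun x hx => by
        rw [hn.jump _ x hx, dressedJump_none ha hx])
    rw [Matrix.mul_zero, add_zero] at hEd
    replace hEd := smul_right_injective _ (S.rot_ne_zero none) hEd
    have e1 : L₁ * (G₁ (S.point none r)).adjugate = L₂ * (G₂ (S.point none r)).adjugate := by
      rw [hLj, hGj, Matrix.adjugate_mul_distrib, Matrix.mul_assoc, ← Matrix.mul_assoc _ _ (Matrix.adjugate _),
        Matrix.mul_adjugate, hM none r hr, one_smul, Matrix.one_mul]
    -- Conjugation by iσ₂ exchanges the diagonal entries, which are opposite because the trace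
    -- vanishes. As √z also changes sign, the second term of H has no jump on the negative half
    -- line.
    have e2 : logMat E₁ (S.point none r) 0 0 = -logMat E₂ (S.point none r) 0 0 := by
      have e3 := hn.trace_logMat_ext hMn hr hE₂
      have e4 : logMat E₁ (S.point none r) = (!![0, 1; -1, 0] : Mat).adjugate *
          logMat E₂ (S.point none r) * !![0, 1; -1, 0] := by
        rw [logMat, hEj, hEd, Matrix.adjugate_mul_distrib, logMat]
        simp only [Matrix.mul_assoc]
      rw [e4]
      rw [Matrix.trace_fin_two] at e3
      simp only [Matrix.adjugate_fin_two_of, Matrix.mul_apply, Fin.sum_univ_two, Matrix.of_apply,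
        Matrix.cons_val', Matrix.cons_val_zero, Matrix.cons_val_one, Matrix.cons_val_fin_one]
      linear_combination e3
    have e5 : S.rootBV none (S.sgn none) r = -S.rootBV none (-S.sgn none) r := by
      rw [rootBV_none_neg, neg_neg]
    rw [omegaIntegrand_eq_zero (fun i k => deriv_dressedJump_none ha hr i k),
      omegaIntegrand_eq_zero (fun i k => (lineDeriv_jumpMatrix none r i k).trans
        (deriv_jumpMatrix_none upper f q.1 v.1 r i k)), e1, e2, e5, rootVel_neg]
    ring
  | some j =>
    have hline := hf.eventually_differentiableAt_line ht v.1 j hr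
    have hLj := h.famDeriv_jump hT ht v.1 hr hL₁ hL₂
      (fun i k => hline.mono fun s hs => by
        simp only [jumpMatrix, Matrix.add_apply, Matrix.smul_apply, smul_eq_mul]
        exact (hs.mul_const _).const_add _)
      (deriv_jumpMatrix_some upper f j q.1 v.1 r)
    rw [hmG] at hLj
    have hfn := hline.self_of_nhds
    obtain ⟨hd1, hd2⟩ := S.dressScalar_rootBV_ne_zero ha (some j) 1 hr
    rw [rootBV_some] at hd1 hd2
    have hN1 : DifferentiableAt ℂ (fun u : ℂ => f j q.1 (u * S.rot (some j)) *
        dressRatio (upper j) q.2.1 q.2.2 (csqrt (u * S.rot (some j)))) r := by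
      refine (hf.differentiableAt_ray ht j hr).mul ?_
      have c1 := csqrt_differentiableAt (S.point_some_mem_slitPlane j hr)
      have c2 := (differentiableAt_dressRatio hd1 hd2 (upper j)).comp _ c1
      rw [point_eq] at c2
      exact DifferentiableAt.comp (g := fun z => dressRatio (upper j) q.2.1 q.2.2 (csqrt z))
        (r : ℂ) c2 (by fun_prop)
    have hN2 := hN1.hasDerivAt.comp_ofReal
    set κ := deriv (fun u : ℂ => f j q.1 (u * S.rot (some j)) *
        dressRatio (upper j) q.2.1 q.2.2 (csqrt (u * S.rot (some j)))) r
    have hEd := derivMat_jump hr hE₁ hE₂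
      (N := fun x => 1 + (f j q.1 (S.point (some j) x) *
        dressRatio (upper j) q.2.1 q.2.2 (csqrt (S.point (some j) x))) • nilp (upper j))
      (N' := κ • nilp (upper j))
      (fun i k => by
        simp only [Matrix.add_apply, Matrix.smul_apply, smul_eq_mul, point_eq]
        exact (hN2.mul_const _).const_add _)
      (fun x hx => by rw [hn.jump _ x hx, dressedJump_some ha j hx])
    rw [dressedJump_some ha j hr] at hEj
    have e1 := trace_jump (X := X) hGj hLj
    have e2 := logMat_jump (S.rot_ne_zero (some j)) (hn.det_ext hMn hr hE₂) hEj hEd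
    -- The terms with the velocity of the roots agree at once. What remains is the coefficient of
    -- ∂f_j: the dressed trace times the ratio minus the undressed trace, which by this relation is
    -- minus the trace with P′P⁻¹ in the jump of H.
    have e3 := hP.dressRatio_mul_trace_logMat hsol hn hM hMn ha hr hG₂ hE₂ (upper j)
    rw [omegaIntegrand_eq hr hE₂ (hn.det_ext hMn hr hE₂) (dressedJump_some ha j hr)
        (deriv_dressedJump_some ha j hr hfn),
      omegaIntegrand_eq hr hG₂ (hsol.det_ext hM hr hG₂)
        (h := f j q.1 (S.point (some j) r)) (b := upper j) rfl
        (fun i k => (lineDeriv_jumpMatrix (some j) r i k).trans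
          (deriv_jumpMatrix_some upper f j q.1 v.1 r i k)), e1]
    change logMat E₁ _ 0 0 = logMat E₂ _ 0 0 + offSign _ * _ * (logMat E₂ _ * _).trace at e2
    rw [e2]
    rw [Matrix.sub_mul, Matrix.trace_sub, dressB, ← hX] at e3
    simp only [rootBV_some] at e3 ⊢
    have hpi : (2 * Real.pi * Complex.I : ℂ) ≠ 0 := by
      simp [Real.pi_ne_zero]
    field_simp
    linear_combination (-jumpDot f j q.1 v.1 (S.point (some j) r) * S.rot (some j)) * e3

end Form

end

/-! ### Absolute convergence of the integrals. -/

section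

open RayContour

section Transfer

variable {m : ℕ} {S : RayContour m} {p : Option (Fin m)} {s : ℤˣ} {F : ℂ → ℂ} {h : ℝ → ℂ} {e : ℝ}

lemma RayContour.norm_le_of_tendsto_side {r C : ℝ} (hr : 0 < r)
    (hb : Tendsto F (𝓝[S.side p s] (S.point p r)) (𝓝 (h r)))
    (hF : ∀ᶠ z in 𝓝[S.carrierᶜ] (S.point p r), ‖F z‖ ≤ C * ‖z‖ ^ e) : ‖h r‖ ≤ C * r ^ e := by
  have := S.nhdsWithin_side_neBot p s hr
  have h1 : ContinuousAt (fun z : ℂ => C * ‖z‖ ^ e) (S.point p r) :=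
    continuousAt_const.mul (continuous_norm.continuousAt.rpow_const
      (Or.inl (by rw [S.norm_point p hr.le]; exact hr.ne')))
  have h2 := h1.tendsto.mono_left (nhdsWithin_le_nhds (s := S.side p s))
  rw [S.norm_point p hr.le] at h2
  exact le_of_tendsto_of_tendsto hb.norm h2 (hF.filter_mono (nhdsWithin_mono _ (S.side_subset p s)))

/-- Bounds at infinity pass to the boundary values. -/
lemma RayContour.isBigO_atTop_of_tendsto_side
    (hb : ∀ r, 0 < r → Tendsto F (𝓝[S.side p s] (S.point p r)) (𝓝 (h r)))
    (hF : F =O[S.atInf] fun z => ‖z‖ ^ e) : h =O[atTop] fun r => r ^ e := by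
  obtain ⟨C, hC⟩ := hF.bound
  obtain ⟨ρ, hρ⟩ := S.eventually_atInf.1 hC
  refine Asymptotics.IsBigO.of_bound C ?_
  filter_upwards [eventually_gt_atTop ρ, eventually_gt_atTop 0] with r hr hr0
  rw [Real.norm_of_nonneg (Real.rpow_nonneg hr0.le _)]
  refine S.norm_le_of_tendsto_side hr0 (hb r hr0) ?_
  have h1 : ∀ᶠ z : ℂ in 𝓝 (S.point p r), ρ < ‖z‖ :=
    continuous_norm.continuousAt.eventually_const_lt (by simpa only [S.norm_point p hr0.le] using hr)
  filter_upwards [self_mem_nhdsWithin, nhdsWithin_le_nhds h1] with z hz hz'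
  have := hρ z hz hz'.le
  rwa [Real.norm_of_nonneg (Real.rpow_nonneg (norm_nonneg _) _)] at this

/-- Bounds at the origin pass to the boundary values. -/
lemma RayContour.isBigO_zero_of_tendsto_side
    (hb : ∀ r, 0 < r → Tendsto F (𝓝[S.side p s] (S.point p r)) (𝓝 (h r)))
    (hF : F =O[S.atZero] fun z => ‖z‖ ^ e) : h =O[𝓝[>] 0] fun r => r ^ e := by
  obtain ⟨C, hC⟩ := hF.bound
  obtain ⟨ρ, hρ, hsub⟩ := Metric.mem_nhdsWithin_iff.1 hC
  refine Asymptotics.IsBigO.of_bound C ?_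
  filter_upwards [Ioo_mem_nhdsGT hρ] with r hr
  rw [Real.norm_of_nonneg (Real.rpow_nonneg hr.1.le _)]
  refine S.norm_le_of_tendsto_side hr.1 (hb r hr.1) ?_
  have h1 : ∀ᶠ z : ℂ in 𝓝 (S.point p r), ‖z‖ < ρ :=
    continuous_norm.continuousAt.eventually_lt_const (by simpa only [S.norm_point p hr.1.le] using hr.2)
  filter_upwards [self_mem_nhdsWithin, nhdsWithin_le_nhds h1] with z hz hz'
  have := hsub ⟨mem_ball_zero_iff.2 hz', hz⟩
  simp only [Set.mem_ofPred_eq] at this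
  rwa [Real.norm_of_nonneg (Real.rpow_nonneg (norm_nonneg _) _)] at this

end Transfer

section Integrable

lemma isBigO_rpow_mul_real {l : Filter ℝ} (hl : ∀ᶠ r in l, 0 < r) {φ ψ : ℝ → ℂ} {a b c : ℝ}
    (hφ : φ =O[l] fun r => r ^ a) (hψ : ψ =O[l] fun r => r ^ b) (hc : a + b = c) :
    (fun r => φ r * ψ r) =O[l] fun r => r ^ c :=
  (hφ.mul hψ).congr' EventuallyEq.rfl (hl.mono fun r hr => by
    simp only [← hc, Real.rpow_add hr])

lemma isBigO_rpow_atTop {a b : ℝ} (h : a ≤ b) :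
    (fun r : ℝ => r ^ a) =O[atTop] fun r : ℝ => r ^ b := by
  refine Asymptotics.IsBigO.of_bound 1 ?_
  filter_upwards [eventually_ge_atTop 1] with r hr
  rw [one_mul, Real.norm_of_nonneg (by positivity), Real.norm_of_nonneg (by positivity)]
  exact Real.rpow_le_rpow_of_exponent_le hr h

lemma isBigO_rpow_zero {a b : ℝ} (h : a ≤ b) :
    (fun r : ℝ => r ^ b) =O[𝓝[>] 0] fun r : ℝ => r ^ a := by
  refine Asymptotics.IsBigO.of_bound 1 ?_
  filter_upwards [Ioo_mem_nhdsGT one_pos] with r hr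
  have := hr.1
  rw [one_mul, Real.norm_of_nonneg (by positivity), Real.norm_of_nonneg (by positivity)]
  exact Real.rpow_le_rpow_of_exponent_ge hr.1 hr.2.le h

/-- The product is O(r^(−1−δ)) at infinity and O(r^(ε−1)) at the origin; integrability over the half
line is convergence of the Mellin integral at s = 1. -/
lemma integrableOn_mul_of_isBigO {φ ψ : ℝ → ℂ} {ε δ : ℝ} (hφ : ContinuousOn φ (Set.Ioi 0))
    (hψ : ContinuousOn ψ (Set.Ioi 0)) (hδ : 0 < δ) (hε : 0 < ε)
    (h1 : φ =O[atTop] fun r => r ^ (-δ)) (h2 : φ =O[𝓝[>] 0] fun r => r ^ ε)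
    (h3 : ψ =O[atTop] fun r => r ^ (-1 : ℝ)) (h4 : ψ =O[𝓝[>] 0] fun r => r ^ (-1 : ℝ)) :
    MeasureTheory.IntegrableOn (fun r => φ r * ψ r) (Set.Ioi 0) := by
  have h5 := mellinConvergent_of_isBigO_rpow (s := 1) (a := 1 + δ) (b := 1 - ε)
    ((hφ.mul hψ).locallyIntegrableOn measurableSet_Ioi)
    (isBigO_rpow_mul_real (eventually_gt_atTop 0) h1 h3 (by ring)) (by simpa using hδ)
    (isBigO_rpow_mul_real self_mem_nhdsWithin h2 h4 (by ring)) (by simpa using hε)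
  simpa [MellinConvergent] using h5

variable {m d : ℕ} {S : RayContour m} {T : Set (Fin d → ℂ)} {f : Fin m → (Fin d → ℂ) → ℂ → ℂ}
  {t : Fin d → ℂ}

lemma IsAdmissible.isBigO_one (hf : IsAdmissible S T f) (ht : t ∈ T) (j : Fin m) :
    (fun r => f j t (S.point (some j) r)) =O[atTop] (fun r => r ^ (0 : ℝ)) ∧
    (fun r => f j t (S.point (some j) r)) =O[𝓝[>] 0] (fun r => r ^ (0 : ℝ)) := by
  obtain ⟨c, hc, U, hU, htU, hj⟩ := hf.exists_cone ht
  obtain ⟨C, hC⟩ := (hj j).2.1 0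
  have h1 : ∀ r : ℝ, 0 < r → ‖f j t (S.point (some j) r)‖ ≤ C * ‖r ^ (0 : ℝ)‖ := fun r hr => by
    have := hC t htU r (ofReal_mem_cone hc.1 hr)
    rw [← point_eq, pow_zero, mul_one] at this
    simpa using this
  exact ⟨Asymptotics.IsBigO.of_bound C ((eventually_gt_atTop 0).mono h1),
    Asymptotics.IsBigO.of_bound C (by filter_upwards [self_mem_nhdsWithin] with r hr using h1 r hr)⟩

/-- Cauchy's estimate in the parameter, for f minus a constant κ. With κ = 0 it transfers the decay
at infinity; with κ the value of f at the origin, which does not depend on t, it transfers the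
Hölder bound. -/
lemma IsAdmissible.jumpDot_bounds (hf : IsAdmissible S T f) (ht : t ∈ T) (w : Fin d → ℂ)
    (j : Fin m) : ContinuousOn (fun r => jumpDot f j t w (S.point (some j) r)) (Set.Ioi 0) ∧
      ((fun r => jumpDot f j t w (S.point (some j) r)) =O[atTop] fun r => r ^ (-1 : ℝ)) ∧
      ∃ α : ℝ, 0 < α ∧
        (fun r => jumpDot f j t w (S.point (some j) r)) =O[𝓝[>] 0] fun r => r ^ α := by
  obtain ⟨c, hc, U, hU, htU, hj⟩ := hf.exists_cone ht
  obtain ⟨hd, hb, c₀, α, C, hα, hh⟩ := hj j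
  obtain ⟨ρ, hρ, hball⟩ := eventually_ball_line w (hU.mem_nhds htU)
  have hg : DifferentiableOn ℂ (fun x : ℂ × ℂ => f j (t + x.1 • w) (x.2 * S.rot (some j)))
      (Metric.ball 0 ρ ×ˢ cone c) :=
    DifferentiableOn.comp (g := fun x : (Fin d → ℂ) × ℂ => f j x.1 (x.2 * S.rot (some j)))
      (f := fun x : ℂ × ℂ => (t + x.1 • w, x.2)) hd
      (by fun_prop : Differentiable ℂ fun x : ℂ × ℂ => (t + x.1 • w, x.2)).differentiableOn
      fun x hx => ⟨hball _ hx.1, hx.2⟩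
  have hkey : ∀ (κ : ℂ) (B r : ℝ), 0 < r →
      (∀ t' ∈ U, ‖f j t' (S.point (some j) r) - κ‖ ≤ B) →
      ‖jumpDot f j t w (S.point (some j) r)‖ ≤ B / (ρ / 2) := fun κ B r hr hB => by
    have h1 : DifferentiableOn ℂ (fun s : ℂ => f j (t + s • w) (S.point (some j) r) - κ)
        (Metric.ball 0 ρ) := by
      refine DifferentiableOn.sub_const ?_ κ
      rw [point_eq]
      exact hg.comp (f := fun s : ℂ => (s, (r : ℂ))) (by fun_prop)
        fun s hs => ⟨hs, ofReal_mem_cone hc.1 hr⟩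
    have h2 := Complex.norm_deriv_le_of_forall_mem_sphere_norm_le (half_pos hρ)
      (h1.diffContOnCl_ball (Metric.closedBall_subset_ball (half_lt_self hρ)))
      (C := B) fun s hs => hB _ (hball _ (Metric.sphere_subset_closedBall.trans
        (Metric.closedBall_subset_ball (half_lt_self hρ)) hs))
    rwa [deriv_sub_const] at h2
  refine ⟨?_, ?_, α, hα, ?_⟩
  · have h1 := differentiableOn_deriv_param (W := cone c) (Metric.isOpen_ball.prod (isOpen_cone c))
      (fun z hz => ⟨Metric.mem_ball_self hρ, hz⟩) hg
    refine ((h1.continuousOn.comp Complex.continuous_ofReal.continuousOn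
      fun r hr => ofReal_mem_cone hc.1 hr)).congr fun r hr => ?_
    simp only [jumpDot, point_eq, Function.comp]
  · obtain ⟨K, hK⟩ := hb 1
    refine Asymptotics.IsBigO.of_bound (K / (ρ / 2)) ?_
    filter_upwards [eventually_gt_atTop 0] with r hr
    refine (hkey 0 (K / r) r hr fun t' ht' => ?_).trans (le_of_eq ?_)
    · have h1 := hK t' ht' r (ofReal_mem_cone hc.1 hr)
      rw [← point_eq, pow_one, Complex.norm_real, Real.norm_of_nonneg hr.le] at h1
      rw [sub_zero, le_div_iff₀ hr]
      nlinarith [norm_nonneg (f j t' (S.point (some j) r))]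
    · rw [Real.norm_of_nonneg (by positivity), Real.rpow_neg_one]
      field_simp
  · refine Asymptotics.IsBigO.of_bound (C / (ρ / 2)) ?_
    filter_upwards [self_mem_nhdsWithin] with r hr
    refine (hkey c₀ (C * r ^ α) r hr fun t' ht' => ?_).trans (le_of_eq ?_)
    · have h1 := hh t' ht' r (ofReal_mem_cone hc.1 hr)
      rwa [← point_eq, Complex.norm_real, Real.norm_of_nonneg (le_of_lt hr)] at h1
    · rw [Real.norm_of_nonneg (Real.rpow_nonneg (le_of_lt hr) _)]
      ring

end Integrable

section Omega

variable {m d n₁ n₂ : ℕ} {S : RayContour m} {T : Set (Fin d → ℂ)} {upper : Fin m → Bool}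
  {f : Fin m → (Fin d → ℂ) → ℂ → ℂ} {Γ₀ : (Fin d → ℂ) → ℂ → Mat} {Γn : ℂ → Mat}
  {P : Matrix (Fin 2) (Fin 2) (Polynomial ℂ)} {q : Params d n₁ n₂}
  (h : IsAnalyticRHPFamily S T (jumpMatrix S upper f) Γ₀)
  (hf : IsAdmissible S T f) (ht : q.1 ∈ T)
  (hn : IsRHPSolution S (dressedJump S (jumpMatrix S upper f) q) Γn)
  (hP : IsDressing S (Γ₀ q.1) Γn q.2.1 q.2.2 P) (ha : ∀ k, pts q.2.1 q.2.2 k ∉ S.carrier)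
  (v : Params d n₁ n₂)

include h hf ht hn hP ha in
/-- The two integrands on a ray, as multiples of boundary values of the undressed solution. -/
lemma exists_omegaIntegrand_some (j : Fin m) {r : ℝ} (hr : 0 < r) : ∃ x y : ℂ,
    Tendsto (fun z => (logMat (Γ₀ q.1) z * nilp (upper j)).trace)
      (𝓝[S.side (some j) (-S.sgn (some j))] (S.point (some j) r)) (𝓝 x) ∧
    Tendsto (fun z => ((logMat (Γ₀ q.1) z - dressB P q.2.1 q.2.2 (Γ₀ q.1) z) *
      nilp (upper j)).trace)
      (𝓝[S.side (some j) (-S.sgn (some j))] (S.point (some j) r)) (𝓝 y) ∧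
    omegaIntegrand S (Γ₀ q.1) (fun q' : Params d n₁ n₂ => jumpMatrix S upper f q'.1) q v (some j) r =
      jumpDot f j q.1 v.1 (S.point (some j) r) * x * (S.rot (some j) / (2 * Real.pi * Complex.I)) ∧
    omegaIntegrand S Γn (dressedJump S (jumpMatrix S upper f)) q v (some j) r =
      (jumpDot f j q.1 v.1 (S.point (some j) r) + offSign (upper j) *
        (f j q.1 (S.point (some j) r) * rootVel q v (csqrt (S.point (some j) r)))) * y *
          (S.rot (some j) / (2 * Real.pi * Complex.I)) := by
  have hM : ∀ p r, 0 < r → (jumpMatrix S upper f q.1 p r).det = 1 :=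
    fun p r _ => det_jumpMatrix upper f q.1 p r
  have hMn := det_dressedJump_jumpMatrix (upper := upper) (f := f) ha
  have hsol := h.solution _ ht
  obtain ⟨G, hG⟩ := exists_matExt_family h hf ht (some j) (-S.sgn (some j)) hr
  obtain ⟨E, hE⟩ := hP.exists_matExt hn hMn ha hr hG
  have e3 := hP.dressRatio_mul_trace_logMat hsol hn hM hMn ha hr hG hE (upper j)
  have hfn := (hf.eventually_differentiableAt_line ht v.1 j hr).self_of_nhds
  refine ⟨_, _, (continuous_id.matrix_trace.tendsto _).comp
    (hG.tendsto_logMat.mul tendsto_const_nhds), (continuous_id.matrix_trace.tendsto _).comp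
    ((hG.tendsto_logMat.sub (tendsto_dressB ha hr hG)).mul tendsto_const_nhds), ?_, ?_⟩
  · rw [omegaIntegrand_eq hr hG (hsol.det_ext hM hr hG)
      (h := f j q.1 (S.point (some j) r)) (b := upper j) rfl
      (fun i k => (lineDeriv_jumpMatrix (some j) r i k).trans
        (deriv_jumpMatrix_some upper f j q.1 v.1 r i k)), mul_div_assoc]
    rfl
  · rw [omegaIntegrand_eq hr hE (hn.det_ext hMn hr hE) (dressedJump_some ha j hr)
      (deriv_dressedJump_some ha j hr hfn)]
    simp only [id]
    rw [← e3, rootBV_some]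
    ring

lemma isBigO_trace_mul_nilp {l : Filter ℂ} {F : ℂ → Mat} (hF : WtO l (-1) 0 0 F) (b : Bool) :
    (fun z => (F z * nilp b).trace) =O[l] fun z => ‖z‖ ^ (-1 : ℝ) := by
  cases b
  · refine (hF 0 1).congr (fun z => ?_) fun z => by simp
    simp [nilp, Matrix.trace_fin_two, Matrix.mul_apply, Fin.sum_univ_two]
  · refine (hF 1 0).congr (fun z => ?_) fun z => by simp
    simp [nilp, Matrix.trace_fin_two, Matrix.mul_apply, Fin.sum_univ_two]

include h hf ht hn hP ha in
/-- Both integrands are integrable. -/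
theorem integrableOn_omegaIntegrand (p : Option (Fin m)) :
    MeasureTheory.IntegrableOn
      (omegaIntegrand S Γn (dressedJump S (jumpMatrix S upper f)) q v p) (Set.Ioi 0) ∧
    MeasureTheory.IntegrableOn (omegaIntegrand S (Γ₀ q.1)
      (fun q' : Params d n₁ n₂ => jumpMatrix S upper f q'.1) q v p) (Set.Ioi 0) := by
  cases p with
  | none =>
    refine ⟨MeasureTheory.integrableOn_zero.congr_fun (fun r hr => ?_) measurableSet_Ioi,
      MeasureTheory.integrableOn_zero.congr_fun (fun r hr => ?_) measurableSet_Ioi⟩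
    · exact (omegaIntegrand_eq_zero fun i k => deriv_dressedJump_none ha hr i k).symm
    · exact (omegaIntegrand_eq_zero fun i k => (lineDeriv_jumpMatrix none r i k).trans
        (deriv_jumpMatrix_none upper f q.1 v.1 r i k)).symm
  | some j =>
    have hM : ∀ p r, 0 < r → (jumpMatrix S upper f q.1 p r).det = 1 :=
      fun p r _ => det_jumpMatrix upper f q.1 p r
    have hsol := h.solution _ ht
    obtain ⟨c, K, N, hN⟩ := hf.exists_jumpContinuation upper ht
    obtain ⟨C, -, hC⟩ := hsol.exists_deriv_bound hN
    -- The boundary traces are chosen as functions on the whole line; the default 0 for r ≤ 0 is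
    -- never used.
    have hex : ∀ r : ℝ, ∃ x y : ℂ, 0 < r → _ := fun r => by
      by_cases hr : 0 < r
      · obtain ⟨x, y, hxy⟩ := exists_omegaIntegrand_some h hf ht hn hP ha v j hr
        exact ⟨x, y, fun _ => hxy⟩
      · exact ⟨0, 0, fun h => absurd h hr⟩
    choose x y hxy using hex
    have w1 := wtO_logMat_atInf hsol hM hC
    have w2 := wtO_logMat_atZero hsol hM hC
    have w3 : WtO S.atInf (-1) 0 0 fun z => logMat (Γ₀ q.1) z - dressB P q.2.1 q.2.2 (Γ₀ q.1) z :=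
      w1.sub (wtO_dressB_atInf hsol hM hP)
    have w4 : WtO S.atZero (-1) 0 0 fun z => logMat (Γ₀ q.1) z - dressB P q.2.1 q.2.2 (Γ₀ q.1) z :=
      w2.sub (wtO_dressB_atZero hsol hM ha).mono_atZero
    have hx := fun r hr => (hxy r hr).1
    have hy := fun r hr => (hxy r hr).2.1
    obtain ⟨d1, d2, α, hα, d3⟩ := hf.jumpDot_bounds ht v.1 j
    obtain ⟨f1, f2⟩ := hf.isBigO_one ht j
    have hrv : ∀ r : ℝ, 0 < r → Tendsto (fun z => rootVel q v (csqrt z))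
        (𝓝[S.side (some j) 1] (S.point (some j) r))
        (𝓝 (rootVel q v (csqrt (S.point (some j) r)))) := fun r hr =>
      (continuousAt_rootVel v ha (some j) 1 hr).tendsto.comp (S.tendsto_csqrt_side (some j) 1 hr)
    have fc : ContinuousOn (fun r => f j q.1 (S.point (some j) r)) (Set.Ioi 0) := fun r hr => by
      have := (hf.differentiableAt_ray ht j hr).hasDerivAt.comp_ofReal.continuousAt
      simp only [← point_eq] at this
      exact this.continuousWithinAt
    -- The f_j are bounded and `rootVel` is O(r^(−1/2)) at infinity and O(r^(1/2)) at the origin,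
    -- which compensates for the bound O(1/r) of the trace. Together with ∂f_j this gives the
    -- exponents 1/2 at infinity and min(α, 1/2) at the origin.
    have g1 := (isBigO_rpow_mul_real (eventually_gt_atTop 0) f1
      (S.isBigO_atTop_of_tendsto_side hrv (isBigO_rootVel_atInf q v)) (zero_add _)).const_mul_left
        (offSign (upper j))
    have g2 := (isBigO_rpow_mul_real self_mem_nhdsWithin f2
      (S.isBigO_zero_of_tendsto_side hrv (isBigO_rootVel_atZero q v ha)) (zero_add _)).const_mul_left
        (offSign (upper j))
    have d2' := d2.trans (isBigO_rpow_atTop (a := -1) (b := -(1 / 2)) (by norm_num))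
    constructor
    · refine MeasureTheory.IntegrableOn.congr_fun ((integrableOn_mul_of_isBigO
        (d1.add (continuousOn_const.mul (fc.mul (S.continuousOn_of_tendsto_side hrv))))
        (S.continuousOn_of_tendsto_side hy) (by norm_num) (lt_min hα (by norm_num))
        (d2'.add g1) ((d3.trans (isBigO_rpow_zero (min_le_left α (1 / 2)))).add
          (g2.trans (isBigO_rpow_zero (min_le_right α (1 / 2)))))
        (S.isBigO_atTop_of_tendsto_side hy (isBigO_trace_mul_nilp w3 _))
        (S.isBigO_zero_of_tendsto_side hy (isBigO_trace_mul_nilp w4 _))).mul_const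
          (S.rot (some j) / (2 * Real.pi * Complex.I)))
        (fun r hr => ((hxy r hr).2.2.2).symm) measurableSet_Ioi
    · refine MeasureTheory.IntegrableOn.congr_fun ((integrableOn_mul_of_isBigO d1
        (S.continuousOn_of_tendsto_side hx) one_pos hα d2 d3
        (S.isBigO_atTop_of_tendsto_side hx (isBigO_trace_mul_nilp w1 _))
        (S.isBigO_zero_of_tendsto_side hx (isBigO_trace_mul_nilp w2 _))).mul_const
          (S.rot (some j) / (2 * Real.pi * Complex.I)))
        (fun r hr => ((hxy r hr).2.2.1).symm) measurableSet_Ioi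

end Omega

end

/-! ### Conclusion: the change of Ω as a sum of residues. -/

section

open RayContour

section Final

variable {m d n₁ n₂ : ℕ} {S : RayContour m} {T : Set (Fin d → ℂ)} {upper : Fin m → Bool}
  {f : Fin m → (Fin d → ℂ) → ℂ → ℂ} {Γ₀ : (Fin d → ℂ) → ℂ → Mat} {Γn : ℂ → Mat}
  {P : Matrix (Fin 2) (Fin 2) (Polynomial ℂ)} {q : Params d n₁ n₂}

lemma tendsto_mul_div_sub_atInf (c a : ℂ) :
    Tendsto (fun z => z * (c / (z - a))) S.atInf (𝓝 c) := by
  have h1 : Tendsto (fun z => (a - z)⁻¹) S.atInf (𝓝 0) :=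
    (S.isBigO_inv_sub_atInf a).trans_tendsto
      ((tendsto_rpow_neg_atTop one_pos).comp S.tendsto_norm_atInf)
  have h2 : Tendsto (fun z => c * (1 - a * (a - z)⁻¹)) S.atInf (𝓝 c) := by
    simpa using (h1.const_mul a).const_sub 1 |>.const_mul c
  refine h2.congr' ?_
  filter_upwards [S.atInf_ge (‖a‖ + 1)] with z hz
  have h3 : a - z ≠ 0 := fun h => by rw [← sub_eq_zero.1 h] at hz; linarith
  have h4 : z - a ≠ 0 := fun h => h3 (by rw [← neg_sub, h, neg_zero])
  field_simp
  ring

lemma tendsto_mul_div_sub_atZero (c : ℂ) {a : ℂ} (ha : a ≠ 0) :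
    Tendsto (fun z => z * (c / (z - a))) S.atZero (𝓝 0) := by
  have h1 : ContinuousAt (fun z => z * (c / (z - a))) 0 :=
    continuousAt_id.mul (continuousAt_const.div (continuousAt_id.sub continuousAt_const) (by simpa))
  have h2 := h1.tendsto
  rw [zero_mul] at h2
  exact h2.mono_left nhdsWithin_le_nhds

lemma sub_eq_sgn_mul (σ : ℤˣ) (L : ℤˣ → ℂ) : L 1 - L (-1) = ((σ : ℤ) : ℂ) * (L σ - L (-σ)) := by
  rcases Int.units_eq_one_or σ with rfl | rfl <;> simp

/-- The change of `Ω` is a sum over the points of the dressing. -/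
theorem Omega_sub_eq_sum_pointTerm (h : IsAnalyticRHPFamily S T (jumpMatrix S upper f) Γ₀)
    (hT : IsOpen T) (hf : IsAdmissible S T f) (ht : q.1 ∈ T)
    (hn : IsRHPSolution S (dressedJump S (jumpMatrix S upper f) q) Γn)
    (hP : IsDressing S (Γ₀ q.1) Γn q.2.1 q.2.2 P) (ha : ∀ k, pts q.2.1 q.2.2 k ∉ S.carrier)
    (hinj : Function.Injective (pts q.2.1 q.2.2)) (v : Params d n₁ n₂) :
    Omega S Γn (dressedJump S (jumpMatrix S upper f)) q v -
      Omega S (Γ₀ q.1) (fun q' : Params d n₁ n₂ => jumpMatrix S upper f q'.1) q v =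
        ∑ k, pointTerm Γ₀ Γn P q v k := by
  have hM : ∀ t p r, 0 < r → (jumpMatrix S upper f t p r).det = 1 :=
    fun t p r _ => det_jumpMatrix upper f t p r
  have hMn := det_dressedJump_jumpMatrix (upper := upper) (f := f) ha
  obtain ⟨c, K, N, hN⟩ := hf.exists_jumpContinuation upper ht
  obtain ⟨C, -, hC⟩ := (h.solution _ ht).exists_deriv_bound hN
  -- F is H with its principal parts at the points removed. It is analytic off the contour and has
  -- the same jumps as H, since the principal parts are continuous across the contour.
  obtain ⟨F, hFd, hF⟩ := exists_partial_fractions S.isOpen_compl Finset.univ (pts q.2.1 q.2.2)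
    (fun k _ => ha k) hinj.injOn (differentiableOn_formNum h hT (P := P) q v ht hn)
  simp only [Finset.mem_univ, true_implies,
    formNum_pts h hT hM q v ht ha hP hn hMn hinj] at hF
  set κ := pointTerm Γ₀ Γn P q v
  have hF' : ∀ z, (∀ k, z ≠ pts q.2.1 q.2.2 k) →
      formH Γ₀ Γn P q v z - ∑ k, κ k / (z - pts q.2.1 q.2.2 k) = F z := fun z hz => by
    rw [← formNum_div Γ₀ q v hz, hF z hz, add_sub_cancel_right]
  have hex : ∀ p s (r : ℝ), ∃ H, 0 < r →
      Tendsto (formH Γ₀ Γn P q v) (𝓝[S.side p s] (S.point p r)) (𝓝 H) := fun p s r => by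
    by_cases hr : 0 < r
    · obtain ⟨H, hH⟩ := exists_tendsto_formH h hT hf ht hn hP ha v p s hr
      exact ⟨H, fun _ => hH⟩
    · exact ⟨0, fun h => absurd h hr⟩
  choose H hH using hex
  have hb : ∀ p s r, 0 < r → Tendsto F (𝓝[S.side p s] (S.point p r))
      (𝓝 (H p s r - ∑ k, κ k / (S.point p r - pts q.2.1 q.2.2 k))) := fun p s r hr => by
    have h0 : ∀ k, S.point p r ≠ pts q.2.1 q.2.2 k := fun k hk =>
      ha k (hk ▸ S.point_mem_carrier p hr.le)
    have h1 : ContinuousAt (fun z => ∑ k, κ k / (z - pts q.2.1 q.2.2 k)) (S.point p r) :=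
      tendsto_finsetSum _ fun k _ => ContinuousAt.div continuousAt_const
        (continuousAt_id.sub continuousAt_const) (sub_ne_zero.2 (h0 k))
    refine ((hH p s r hr).sub (h1.tendsto.mono_left nhdsWithin_le_nhds)).congr' ?_
    have h2 : ∀ᶠ z in 𝓝 (S.point p r), ∀ k, z ≠ pts q.2.1 q.2.2 k :=
      eventually_all.2 fun k => continuousAt_id.eventually_ne (h0 k)
    filter_upwards [nhdsWithin_le_nhds h2] with z hz using hF' z hz
  -- As z H(z) tends to 0, only the subtracted principal parts are seen at infinity, each with its
  -- residue.
  have hinf : Tendsto (fun z => z * F z) S.atInf (𝓝 (-∑ k, κ k)) := by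
    have h1 := (tendsto_mul_formH_atInf h hT hM q v ht hP hn hMn hC).sub
      (tendsto_finsetSum Finset.univ fun k _ => tendsto_mul_div_sub_atInf (S := S) (κ k)
        (pts q.2.1 q.2.2 k))
    rw [zero_sub] at h1
    refine h1.congr' ?_
    have h2 : ∀ᶠ z in S.atInf, ∀ k, z ≠ pts q.2.1 q.2.2 k := eventually_all.2 fun k => by
      filter_upwards [S.atInf_ge (‖pts q.2.1 q.2.2 k‖ + 1)] with z hz h
      rw [h] at hz
      linarith
    filter_upwards [h2] with z hz
    rw [← hF' z hz, mul_sub, Finset.mul_sum]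
  have hzero : Tendsto (fun z => z * F z) S.atZero (𝓝 0) := by
    have h1 := (tendsto_mul_formH_atZero h hT hM q v ht ha hP hn hMn hC).sub
      (tendsto_finsetSum Finset.univ fun k _ => tendsto_mul_div_sub_atZero (S := S) (κ k)
        (S.ne_zero_of_notMem (ha k)))
    rw [Finset.sum_const_zero, sub_zero] at h1
    refine h1.congr' ?_
    have h2 : ∀ᶠ z in S.atZero, ∀ k, z ≠ pts q.2.1 q.2.2 k := eventually_all.2 fun k =>
      nhdsWithin_le_nhds (continuousAt_id.eventually_ne (S.ne_zero_of_notMem (ha k)).symm)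
    filter_upwards [h2] with z hz
    rw [← hF' z hz, mul_sub, Finset.mul_sum]
  set ω := omegaIntegrand S Γn (dressedJump S (jumpMatrix S upper f)) q v
  set ω₀ := omegaIntegrand S (Γ₀ q.1)
    (fun q' : Params d n₁ n₂ => jumpMatrix S upper f q'.1) q v
  have hint := integrableOn_omegaIntegrand h hf ht hn hP ha v
  -- The jump is counted here from the sides of the outward ray, in `formH_jump` from those of the
  -- oriented one. The sign relating the two is the one that weights the piece in `Omega`.
  have hjump : ∀ p r, 0 < r → (H p 1 r - ∑ k, κ k / (S.point p r - pts q.2.1 q.2.2 k)) -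
      (H p (-1) r - ∑ k, κ k / (S.point p r - pts q.2.1 q.2.2 k)) =
        (((S.sgn p : ℤ) : ℂ) * (2 * Real.pi * Complex.I) * (S.rot p)⁻¹) * (ω p r - ω₀ p r) :=
    fun p r hr => by
      have h1 := formH_jump h hT hf ht hn hP ha v hr (hH p _ r hr) (hH p _ r hr)
      have h2 := sub_eq_sgn_mul (S.sgn p) fun s => H p s r
      have h3 := S.rot_ne_zero p
      rw [sub_sub_sub_cancel_right, h2]
      field_simp
      linear_combination h1
  have hsum := S.sum_integral_jump hFd hb hinf hzero fun p =>
    MeasureTheory.IntegrableOn.congr_fun (((hint p).1.sub (hint p).2).const_mul _)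
      (fun r hr => (hjump p r hr).symm) measurableSet_Ioi
  have hterm : ∀ p, (∫ r in Set.Ioi (0 : ℝ),
      ((H p 1 r - ∑ k, κ k / (S.point p r - pts q.2.1 q.2.2 k)) -
        (H p (-1) r - ∑ k, κ k / (S.point p r - pts q.2.1 q.2.2 k)))) * S.rot p =
      (2 * Real.pi * Complex.I) * (((S.sgn p : ℤ) : ℂ) * (∫ r in Set.Ioi (0 : ℝ), ω p r) -
        ((S.sgn p : ℤ) : ℂ) * ∫ r in Set.Ioi (0 : ℝ), ω₀ p r) := fun p => by
    rw [MeasureTheory.setIntegral_congr_fun measurableSet_Ioi (fun r hr => hjump p r hr),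
      MeasureTheory.integral_const_mul, MeasureTheory.integral_sub (hint p).1 (hint p).2]
    have := S.rot_ne_zero p
    field_simp
    rfl
  rw [Finset.sum_congr rfl fun p _ => hterm p, ← Finset.mul_sum, Finset.sum_sub_distrib,
    mul_neg, neg_neg] at hsum
  exact mul_left_cancel₀ Complex.two_pi_I_ne_zero hsum

end Final

lemma pts_injective {n₁ n₂ : ℕ} {lam : Fin n₂ → ℂ} {mu : Fin n₁ → ℂ}
    (h1 : Function.Injective lam) (h2 : Function.Injective mu) (h3 : ∀ j k, lam j ≠ mu k) :
    Function.Injective (pts lam mu) :=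
  Fin.append_injective_iff.2 ⟨h1, h2, h3⟩

end

end Dressing

end

/-- `Γ₀(λ; t)` is an analytic family of solutions of the Riemann-Hilbert problems with jump matrices
`M(λ; t)`, and `Γn` solves the problem with the dressed jump matrices at the parameters
`q = (t, λ⃗, μ⃗)`. Both integrals `Ω` converge, `𝔾` is well defined, `Δ det 𝔾` is nonzero and
differentiable at `q`, and its logarithmic derivative is the change of `Ω`. -/
theorem theorem3p1 {m d n₁ n₂ : ℕ} (S : Dressing.RayContour m)
    (T : Set (Fin d → ℂ)) (hT : IsOpen T)
    (upper : Fin m → Bool) (f : Fin m → (Fin d → ℂ) → ℂ → ℂ)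
    (hf : Dressing.IsAdmissible S T f)
    (Γ₀ : (Fin d → ℂ) → ℂ → Dressing.Mat)
    (hΓ₀ : Dressing.IsAnalyticRHPFamily S T (Dressing.jumpMatrix S upper f) Γ₀)
    (q : Dressing.Params d n₁ n₂) (ht : q.1 ∈ T)
    (hlam : ∀ k, q.2.1 k ∉ S.carrier) (hmu : ∀ k, q.2.2 k ∉ S.carrier)
    (hlam_inj : Function.Injective q.2.1) (hmu_inj : Function.Injective q.2.2)
    (hlam_mu : ∀ j k, q.2.1 j ≠ q.2.2 k)
    (Γn : ℂ → Dressing.Mat)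
    (hΓn : Dressing.IsRHPSolution S
      (Dressing.dressedJump S (Dressing.jumpMatrix S upper f) q) Γn) :
    (∀ k l, ∃ ρ, Dressing.HasResidueAtInfty S
      (Dressing.gIntegrand (Γ₀ q.1) q.2.1 q.2.2 k l) ρ) ∧
    Dressing.deltaDetG S Γ₀ q ≠ 0 ∧
    DifferentiableAt ℂ (Dressing.deltaDetG (n₁ := n₁) (n₂ := n₂) S Γ₀) q ∧
    ∀ v : Dressing.Params d n₁ n₂,
      (∀ p, MeasureTheory.IntegrableOn (Dressing.omegaIntegrand S Γn
        (Dressing.dressedJump S (Dressing.jumpMatrix S upper f)) q v p) (Set.Ioi 0)) ∧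
      (∀ p, MeasureTheory.IntegrableOn (Dressing.omegaIntegrand S (Γ₀ q.1)
        (fun q' : Dressing.Params d n₁ n₂ => Dressing.jumpMatrix S upper f q'.1) q v p)
        (Set.Ioi 0)) ∧
      Dressing.Omega S Γn
          (Dressing.dressedJump S (Dressing.jumpMatrix S upper f)) q v
        - Dressing.Omega S (Γ₀ q.1)
          (fun q' : Dressing.Params d n₁ n₂ => Dressing.jumpMatrix S upper f q'.1) q v
        = fderiv ℂ (Dressing.deltaDetG (n₁ := n₁) (n₂ := n₂) S Γ₀) q v
          / Dressing.deltaDetG S Γ₀ q := by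
  have ha : ∀ k, Dressing.pts q.2.1 q.2.2 k ∉ S.carrier :=
    Fin.addCases (fun k => by simpa [Dressing.pts] using hlam k)
      (fun k => by simpa [Dressing.pts] using hmu k)
  have hinj := Dressing.pts_injective hlam_inj hmu_inj hlam_mu
  have hM : ∀ t p r, 0 < r → (Dressing.jumpMatrix S upper f t p r).det = 1 :=
    fun t p r _ => Dressing.det_jumpMatrix upper f t p r
  have hM0 : ∀ t r, 0 < r → Dressing.jumpMatrix S upper f t none r = !![0, 1; -1, 0] :=
    fun _ _ _ => rfl
  have hMn := Dressing.det_dressedJump_jumpMatrix (upper := upper) (f := f) ha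
  have hsol := hΓ₀.solution _ ht
  -- The existence of Γn supplies P, from which both the inverse of the coefficient matrix and the
  -- residues of H are built; the two computations meet in the sum of `Dressing.pointTerm`.
  obtain ⟨P, hP⟩ := Dressing.exists_isDressing hsol hΓn (hM q.1) hMn ha
    fun p r hr => S.dressedJump_eq _ q p hr
  obtain ⟨h1, h2, h3⟩ :=
    Dressing.logDeriv_deltaDetG hΓ₀ hT hM q ht ha hP hΓn hMn hinj hM0
  refine ⟨(hsol.residues (hM0 q.1) q.2.1 q.2.2).1, h1, h2, fun v => ?_⟩
  have hint := Dressing.integrableOn_omegaIntegrand hΓ₀ hf ht hΓn hP ha v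
  refine ⟨fun p => (hint p).1, fun p => (hint p).2, ?_⟩
  rw [h3 v]
  exact Dressing.Omega_sub_eq_sum_pointTerm hΓ₀ hT hf ht hΓn hP ha hinj v
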